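/- Let $N,k,m\ge 1$ and $l_1,l_2\ge 0$ be integers with $mk+l_1+l_2\le N$, let $V=\mathbb C^N$ with standard bilinear form $(\cdot,\cdot)$ and basis $e_i$, $P=\mathbb Z^N$, $W=\mathcal B_N$ the group of signed permutations of coordinates, $R_+=\{e_i,2e_i\}\cup\{e_i\pm e_j: i<j\}$ the positive roots of $BC_N$, with multiplicities $c_{e_i\pm e_j}=c_1$, $c_{e_i}=c_2$, $c_{2e_i}=c_3$ in $\mathbb C$, and $\rho=\frac12\sum_{\alpha\in R_+}c_\alpha\alpha$. The $BC_N$ trigonometric Cherednik algebra is generated by $W$, the functions $e^{(p,x)}$ ($p\in P$) and the Dunkl operators $$\nabla_i=\partial_{x_i}-\sum_{\alpha\in R_+}\frac{c_\alpha(\alpha,e_i)}{1-e^{-(\alpha,x)}}(1-s_\alpha)+(\rho,e_i),\qquad i=1,\dots,N .$$ Let $\pi^a\subset V$ be the affine plane given by $x_{jk+1}=\dots=x_{jk+k}$ for $0\le j<m$, $x_i=0$ for $N-l_1<i\le N$, and $x_i=\pi\mathrm i$ for $N-l_1-l_2<i\le N-l_1$; let $D^a=\bigcup_{w\in W}w(\pi^a)$,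 and let $x_0\in\pi^a$ be generic, that is, if $e^{(\alpha,x_0)}=1$ for a root $\alpha$, then $e^{(\alpha,x)}=1$ for all $x\in\pi^a$. Let $U\ne0$ be a complex vector space with a right $W$-action $v\cdot w$, and let $P_\alpha$ denote the action of $s_\alpha$ on $U$. Let $\mathcal C^p$ be the space of sums of germs, at the points of $Wx_0$, of $U$-valued analytic functions (elements of $U\otimes$ scalar germs) that are periodic: $f(y+x'-x)=f(y)$ for $y$ near $x$ whenever $x,x'\in Wx_0$ and $x-x'\in2\pi\mathrm i P$. Let $\mathcal I^p\subset\mathcal C^p$ be the subspace of the elements that vanish on $D^a$. The algebra acts on $U$-valued germs through the scalar factor. **Theorem.** (1) The trigonometric Cherednik algebra preserves $\mathcal C^p$, and it preserves $\mathcal I^p$ if and only if all of the following hold: $$c_1=\tfrac1k\ \text{ if }k>1,\qquad 2(c_2+c_3)+2(l_1-1)c_1=1\ \text{ if }l_1>0,\qquad 2c_3+2(l_2-1)c_1=1\ \text{ if }l_2>0.$$ (2) Suppose that these conditions hold. Let $\pi$ be the linear plane parallel to $\pi^a$, with orthonormal coordinates $y$, and let $\pi^a=\pi+\delta$, where $\delta=\pi\mathrm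 i\sum_{N-l_1-l_2<i\le N-l_1}e_i$ and $x_0=y_0+\delta$. For a root $\alpha$ let $\widehat\alpha$ be its orthogonal projection to $\pi$ and $t_\alpha=(\alpha,\delta)$ modulo $2\pi\mathrm i$. For a pair $(\widehat\alpha,t_\alpha)$ put $$\widehat c_{\widehat\alpha,t_\alpha}=\sum_\gamma c_\gamma,\qquad (\widehat\alpha,\widehat\alpha)\,\widehat c_{\widehat\alpha,t_\alpha}\widehat P_{\widehat\alpha,t_\alpha}=(\widehat\alpha,\widehat\alpha)\,\widehat c_{\widehat\alpha,t_\alpha}+\sum_\gamma c_\gamma(\gamma,\gamma)(P_\gamma-1),$$ with sums over the $\gamma\in R_+$ such that $(\widehat\gamma,t_\gamma)=(\widehat\alpha,t_\alpha)$ (an empty sum is $0$). Let $W_0\subset W$ be generated by the reflections in the roots $\alpha$ with $e^{(\alpha,x)}=1$ on $\pi^a$. Let $W$ act diagonally on $\mathcal C^p/\mathcal I^p$ by $(wF)(y)=F(w^{-1}y)\cdot w^{-1}$. Then restriction to $\pi^a$ near $x_0$ identifies the $W$-invariants of $\mathcal C^p/\mathcal I^p$ with the space of germs at $y_0$ of analytic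 functions on $\pi$ with values in $U^{W_0}$. For every $W$-invariant polynomial $p$ the operator $p(\nabla_1,\dots,\nabla_N)$ preserves these invariants, and so defines an operator $H_p$ on this space of germs; the operators $H_p$ commute with each other. Let $$L=\Delta_y-\sum\frac{\widehat c_{\widehat\alpha,t_\alpha}\big(\widehat c_{\widehat\alpha,t_\alpha}+2\widehat c_{2\widehat\alpha,2t_\alpha}+\widehat P_{\widehat\alpha,t_\alpha}\big)(\widehat\alpha,\widehat\alpha)}{4\sinh^2\!\big(\frac{(\widehat\alpha,y)+t_\alpha}2\big)},\qquad f=\prod\Big(\sinh\frac{(\widehat\alpha,y)+t_\alpha}2\Big)^{\widehat c_{\widehat\alpha,t_\alpha}},$$ where the sum and the product are over the distinct pairs $(\widehat\alpha,t_\alpha)\ne(0,0)$, $\alpha\in R_+$, with $t_\alpha$ represented by $0$ or $\pi\mathrm i$. Then $L$ acts on the $U^{W_0}$-valued germs at $y_0$, and for every choice of local branches of the logarithms of the factors of $f$, $$f^{-1}H_{x_1^2+\dots+x_N^2}\,f=L+(\rho,\rho)-(\widehat\rho,\widehat\rho),$$ where $\widehat\rho$ is the orthogonal projection of $\rho$ to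 $\pi$. In particular $L$ is integrable: it commutes with $f^{-1}H_pf$ for every $W$-invariant polynomial $p$. -/

import Mathlib

open Filter Topology TensorProduct

noncomputable section

namespace BCN

/-! ### Germs of analytic functions along a filter -/

/-- The space of germs along `l` of complex functions that are analytic at every point of
some member of `l`. -/
def AnGerm {n : ℕ} (l : Filter (Fin n → ℂ)) : Submodule ℂ (Germ l ℂ) where
  carrier := {F | ∃ f : (Fin n → ℂ) → ℂ, (∀ᶠ y in l, AnalyticAt ℂ f y) ∧ F = (f : Germ l ℂ)}
  add_mem' := by
    rintro _ _ ⟨f, hf, rfl⟩ ⟨g, hg, rfl⟩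
    exact ⟨f + g, by filter_upwards [hf, hg] with y h1 h2 using h1.add h2, rfl⟩
  zero_mem' := ⟨0, Eventually.of_forall fun _ => analyticAt_const, rfl⟩
  smul_mem' := by
    rintro c _ ⟨f, hf, rfl⟩
    exact ⟨c • f, by filter_upwards [hf] with y h1 using analyticAt_const.smul h1, rfl⟩

/-- Multiplication by a function that is analytic at every point of some member of `l`. -/
def mulAn {n : ℕ} {l : Filter (Fin n → ℂ)} (φ : (Fin n → ℂ) → ℂ)
    (hφ : ∀ᶠ y in l, AnalyticAt ℂ φ y) : Module.End ℂ (AnGerm l) where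
  toFun F := ⟨(φ : Germ l ℂ) * F.1, by
    obtain ⟨_, f, hf, rfl⟩ := F
    exact ⟨φ * f, by filter_upwards [hφ, hf] with y h1 h2 using h1.mul h2, rfl⟩⟩
  map_add' F G := Subtype.ext (mul_add _ _ _)
  map_smul' c F := by
    obtain ⟨_, f, hf, rfl⟩ := F
    apply Subtype.ext
    change ((φ * (c • f) : (Fin n → ℂ) → ℂ) : Germ l ℂ) = ((c • (φ * f) : (Fin n → ℂ) → ℂ) : Germ l ℂ)
    rw [mul_smul_comm]

open Classical in
/-- Multiplication by `φ` on germs along `l`. It is only used for functions `φ` that are analytic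
along `l`; for other `φ` it is set to `0`. -/
def mulOp {n : ℕ} (l : Filter (Fin n → ℂ)) (φ : (Fin n → ℂ) → ℂ) : Module.End ℂ (AnGerm l) :=
  if h : ∀ᶠ y in l, AnalyticAt ℂ φ y then mulAn φ h else 0

/-- Filters that are generated by open sets. -/
def OpenBased {n : ℕ} (l : Filter (Fin n → ℂ)) : Prop :=
  ∀ s ∈ l, ∃ t ∈ l, IsOpen t ∧ t ⊆ s

theorem openBased_nhdsSet_inf {n : ℕ} (S R : Set (Fin n → ℂ)) (hR : IsOpen R) :
    OpenBased (𝓝ˢ S ⊓ 𝓟 R) := by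
  intro s hs
  rw [mem_inf_principal, mem_nhdsSet_iff_exists] at hs
  obtain ⟨u, hu, hSu, hus⟩ := hs
  refine ⟨u ∩ R, inter_mem_inf (hu.mem_nhdsSet.2 hSu) (mem_principal_self R), hu.inter hR, ?_⟩
  rintro y ⟨h1, h2⟩
  exact hus h1 h2

theorem openBased_nhds {n : ℕ} (y : Fin n → ℂ) : OpenBased (𝓝 y) := by
  intro s hs
  obtain ⟨t, h1, h2, h3⟩ := mem_nhds_iff.1 hs
  exact ⟨t, h2.mem_nhds h3, h2, h1⟩

/-- The directional derivative `∂_ξ` on germs of analytic functions. -/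
def dirDeriv {n : ℕ} {l : Filter (Fin n → ℂ)} (hl : OpenBased l) (ξ : Fin n → ℂ) :
    Module.End ℂ (AnGerm l) where
  toFun F := ⟨Germ.map' (fun f y => fderiv ℂ f y ξ) (by
      intro f g hfg
      obtain ⟨t, ht, hto, hts⟩ := hl _ hfg
      filter_upwards [ht] with y hy
      have : f =ᶠ[𝓝 y] g := by
        filter_upwards [hto.mem_nhds hy] with z hz using hts hz
      rw [this.fderiv_eq]) F.1, by
    obtain ⟨_, f, hf, rfl⟩ := F
    refine ⟨fun y => fderiv ℂ f y ξ, ?_, rfl⟩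
    filter_upwards [hf] with y hy
    exact ((ContinuousLinearMap.apply ℂ ℂ ξ).analyticAt _).comp hy.fderiv⟩
  map_add' F G := by
    obtain ⟨_, f, hf, rfl⟩ := F
    obtain ⟨_, g, hg, rfl⟩ := G
    apply Subtype.ext
    apply Germ.coe_eq.2
    filter_upwards [hf, hg] with y h1 h2
    change fderiv ℂ (f + g) y ξ = fderiv ℂ f y ξ + fderiv ℂ g y ξ
    rw [fderiv_add h1.differentiableAt h2.differentiableAt]
    rfl
  map_smul' c F := by
    obtain ⟨_, f, hf, rfl⟩ := F
    apply Subtype.ext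
    apply Germ.coe_eq.2
    filter_upwards [hf] with y h1
    change fderiv ℂ (c • f) y ξ = c • fderiv ℂ f y ξ
    rw [fderiv_const_smul h1.differentiableAt]
    rfl

/-! ### The Weyl group and the root system `BC_N` -/

/-- The hyperoctahedral group, i.e. the Weyl group `W` of `BC_N`: the group of signed
permutations of the coordinates of `V = ℂ^N`. -/
def W (N : ℕ) : Subgroup ((Fin N → ℂ) ≃ₗ[ℂ] (Fin N → ℂ)) where
  carrier := {w | ∃ (σ : Equiv.Perm (Fin N)) (ε : Fin N → ℤˣ),
    ∀ x i, w x i = ((ε i : ℤ) : ℂ) * x (σ i)}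
  mul_mem' := by
    rintro v w ⟨σ, ε, h⟩ ⟨τ, η, h'⟩
    refine ⟨σ.trans τ, fun i => ε i * η (σ i), fun x i => ?_⟩
    rw [LinearEquiv.mul_apply, h, h']
    simp [mul_assoc]
  one_mem' := ⟨1, 1, fun x i => by simp⟩
  inv_mem' := by
    rintro w ⟨σ, ε, h⟩
    refine ⟨σ.symm, fun i => ε (σ.symm i), fun x i => ?_⟩
    obtain ⟨y, rfl⟩ := w.surjective x
    have h1 : (w⁻¹ : (Fin N → ℂ) ≃ₗ[ℂ] (Fin N → ℂ)) (w y) = y := w.symm_apply_apply y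
    rw [h1, h, ← mul_assoc]
    rcases Int.units_eq_one_or (ε (σ.symm i)) with h2 | h2 <;> simp [h2]

/-- The positive roots of `BC_N`, with integer coordinates with respect to the standard basis:
`e_i`, `2 e_i`, and `e_i - e_j`, `e_i + e_j` for `i < j`. -/
def posRoots (N : ℕ) : Finset (Fin N → ℤ) :=
  (Finset.univ.image fun i => Pi.single i 1) ∪
  (Finset.univ.image fun i => 2 • Pi.single i 1) ∪
  ((Finset.univ.filter fun p : Fin N × Fin N => p.1 < p.2).image
    fun p => Pi.single p.1 1 - Pi.single p.2 1) ∪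
  ((Finset.univ.filter fun p : Fin N × Fin N => p.1 < p.2).image
    fun p => Pi.single p.1 1 + Pi.single p.2 1)

/-- `(α, α)`. -/
def normSq {N : ℕ} (α : Fin N → ℤ) : ℤ := ∑ i, α i ^ 2

/-- `(α, x)`, for `α` in the weight lattice `ℤ^N` and `x ∈ V`. -/
def pairing {N : ℕ} (α : Fin N → ℤ) (x : Fin N → ℂ) : ℂ := ∑ i, (α i : ℂ) * x i

/-- The multiplicity function: `c₁` on `± e_i ± e_j`, `c₂` on `± e_i`, `c₃` on `± 2 e_i`
(these roots have squared lengths `2`, `1` and `4`). -/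
def mult {N : ℕ} (c₁ c₂ c₃ : ℂ) (α : Fin N → ℤ) : ℂ :=
  if normSq α = 1 then c₂ else if normSq α = 4 then c₃ else c₁

/-- The orthogonal reflection `s_α`. -/
def refl {N : ℕ} (α : Fin N → ℤ) : (Fin N → ℂ) ≃ₗ[ℂ] (Fin N → ℂ) :=
  LinearEquiv.ofInvolutive
    { toFun := fun x i => x i - 2 * pairing α x / (normSq α : ℂ) * (α i : ℂ)
      map_add' := fun x y => by
        have : pairing α (x + y) = pairing α x + pairing α y := by
          simp [pairing, mul_add, Finset.sum_add_distrib]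
        funext i
        simp only [this, Pi.add_apply]
        ring
      map_smul' := fun c x => by
        have : pairing α (c • x) = c * pairing α x := by
          simp only [pairing, Finset.mul_sum, Pi.smul_apply, smul_eq_mul]
          exact Finset.sum_congr rfl fun i _ => by ring
        funext i
        simp only [this, Pi.smul_apply, smul_eq_mul, RingHom.id_apply]
        ring }
    (fun x => by
      by_cases h0 : (normSq α : ℂ) = 0
      · funext i
        simp [h0]
      have h1 : pairing α (fun i => x i - 2 * pairing α x / (normSq α : ℂ) * (α i : ℂ))
          = - pairing α x := by
        have h2 : pairing α (fun i => x i - 2 * pairing α x / (normSq α : ℂ) * (α i : ℂ))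
            = pairing α x - 2 * pairing α x / (normSq α : ℂ) * (normSq α : ℂ) := by
          generalize 2 * pairing α x / (normSq α : ℂ) = t
          simp only [pairing, normSq, Int.cast_sum, Int.cast_pow]
          rw [Finset.mul_sum, ← Finset.sum_sub_distrib]
          exact Finset.sum_congr rfl fun i _ => by ring
        rw [h2]
        field_simp
        ring
      funext i
      simp only [LinearMap.coe_mk, AddHom.coe_mk]
      rw [h1]
      ring)

theorem refl_apply {N : ℕ} (α : Fin N → ℤ) (x : Fin N → ℂ) (i : Fin N) :
    refl α x i = x i - 2 * pairing α x / (normSq α : ℂ) * (α i : ℂ) := rfl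

theorem mem_posRoots {N : ℕ} {α : Fin N → ℤ} : α ∈ posRoots N ↔
    (∃ i, α = Pi.single i 1) ∨ (∃ i, α = 2 • Pi.single i 1) ∨
    (∃ i j, i < j ∧ α = Pi.single i 1 - Pi.single j 1) ∨
    (∃ i j, i < j ∧ α = Pi.single i 1 + Pi.single j 1) := by
  simp only [posRoots, Finset.mem_union, Finset.mem_image, Finset.mem_univ, true_and,
    Finset.mem_filter, Prod.exists, or_assoc, eq_comm (b := α)]

theorem pairing_single {N : ℕ} (i : Fin N) (x : Fin N → ℂ) :
    pairing (Pi.single i 1) x = x i := by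
  rw [pairing, Finset.sum_eq_single i] <;> simp +contextual

theorem pairing_add {N : ℕ} (α β : Fin N → ℤ) (x : Fin N → ℂ) :
    pairing (α + β) x = pairing α x + pairing β x := by
  simp [pairing, add_mul, Finset.sum_add_distrib]

theorem pairing_sub {N : ℕ} (α β : Fin N → ℤ) (x : Fin N → ℂ) :
    pairing (α - β) x = pairing α x - pairing β x := by
  simp [pairing, sub_mul, Finset.sum_sub_distrib]

theorem normSq_single {N : ℕ} (i : Fin N) : normSq (Pi.single i 1 : Fin N → ℤ) = 1 := by
  rw [normSq, Finset.sum_eq_single i] <;> simp +contextual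

theorem normSq_two_single {N : ℕ} (i : Fin N) :
    normSq (2 • Pi.single i 1 : Fin N → ℤ) = 4 := by
  rw [normSq, Finset.sum_eq_single i] <;> simp +contextual

theorem normSq_sub {N : ℕ} {i j : Fin N} (h : i ≠ j) :
    normSq (Pi.single i 1 - Pi.single j 1 : Fin N → ℤ) = 2 := by
  rw [normSq, Finset.sum_eq_add i j h] <;>
    simp +contextual [h, h.symm]

theorem normSq_add {N : ℕ} {i j : Fin N} (h : i ≠ j) :
    normSq (Pi.single i 1 + Pi.single j 1 : Fin N → ℤ) = 2 := by
  rw [normSq, Finset.sum_eq_add i j h] <;>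
    simp +contextual [h, h.symm]

theorem refl_mem {N : ℕ} {α : Fin N → ℤ} (hα : α ∈ posRoots N) : refl α ∈ W N := by
  rcases mem_posRoots.1 hα with ⟨i, rfl⟩ | ⟨i, rfl⟩ | ⟨i, j, hij, rfl⟩ | ⟨i, j, hij, rfl⟩
  · refine ⟨1, fun a => if a = i then -1 else 1, fun x a => ?_⟩
    rw [refl_apply, pairing_single, normSq_single]
    by_cases h : a = i
    · subst h; simp; ring
    · simp [h]
  · refine ⟨1, fun a => if a = i then -1 else 1, fun x a => ?_⟩
    have h2 : pairing (2 • Pi.single i 1) x = 2 * x i := by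
      rw [two_smul, pairing_add, pairing_single, two_mul]
    rw [refl_apply, h2, normSq_two_single]
    by_cases h : a = i
    · subst h; simp; ring
    · simp [h]
  · refine ⟨Equiv.swap i j, 1, fun x a => ?_⟩
    rw [refl_apply, pairing_sub, pairing_single, pairing_single, normSq_sub hij.ne]
    by_cases h : a = i
    · subst h; simp [hij.ne]
    · by_cases h' : a = j
      · subst h'; simp [h]
      · simp [h, h', Equiv.swap_apply_of_ne_of_ne]
  · refine ⟨Equiv.swap i j, fun a => if a = i ∨ a = j then -1 else 1, fun x a => ?_⟩
    rw [refl_apply, pairing_add, pairing_single, pairing_single, normSq_add hij.ne]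
    by_cases h : a = i
    · subst h; simp [hij.ne]
    · by_cases h' : a = j
      · subst h'; simp [h]
      · simp [h, h', Equiv.swap_apply_of_ne_of_ne]

/-- The reflection in a positive root, as an element of `W`. -/
def sRefl {N : ℕ} (α : posRoots N) : W N := ⟨refl α.1, refl_mem α.2⟩

theorem continuous_pairing {N : ℕ} (α : Fin N → ℤ) : Continuous (pairing α) := by
  unfold pairing; fun_prop

theorem analyticAt_pairing {N : ℕ} (α : Fin N → ℤ) (y : Fin N → ℂ) :
    AnalyticAt ℂ (pairing α) y := by
  unfold pairing
  apply Finset.analyticAt_fun_sum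
  intro i _
  exact analyticAt_const.mul ((ContinuousLinearMap.proj (R := ℂ) i).analyticAt y)

/-- The regular set: the points `y` with `e^{(α, y)} ≠ 1` for all roots `α`, i.e. the set where
none of the denominators in the trigonometric Dunkl operators vanishes. -/
def regSet (N : ℕ) : Set (Fin N → ℂ) := {y | ∀ α ∈ posRoots N, Complex.exp (pairing α y) ≠ 1}

theorem isOpen_regSet (N : ℕ) : IsOpen (regSet N) := by
  have : regSet N = ⋂ α ∈ posRoots N, {y | Complex.exp (pairing α y) ≠ 1} := by
    ext y; simp [regSet]
  rw [this]
  refine isOpen_biInter_finset fun α _ => ?_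
  exact isOpen_ne_fun (Complex.continuous_exp.comp (continuous_pairing α)) continuous_const

theorem mem_regSet_iff {N : ℕ} {y : Fin N → ℂ} : y ∈ regSet N ↔
    (∀ i, Complex.exp (2 * y i) ≠ 1) ∧
    ∀ i j, i ≠ j → Complex.exp (y i - y j) ≠ 1 ∧ Complex.exp (y i + y j) ≠ 1 := by
  constructor
  · intro h
    refine ⟨fun i => ?_, fun i j hij => ?_⟩
    · have := h _ (mem_posRoots.2 (Or.inr (Or.inl ⟨i, rfl⟩)))
      rwa [two_smul, pairing_add, pairing_single, ← two_mul] at this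
    · rcases lt_or_gt_of_ne hij with h' | h'
      · have h1 := h _ (mem_posRoots.2 (Or.inr (Or.inr (Or.inl ⟨i, j, h', rfl⟩))))
        have h2 := h _ (mem_posRoots.2 (Or.inr (Or.inr (Or.inr ⟨i, j, h', rfl⟩))))
        rw [pairing_sub, pairing_single, pairing_single] at h1
        rw [pairing_add, pairing_single, pairing_single] at h2
        exact ⟨h1, h2⟩
      · have h1 := h _ (mem_posRoots.2 (Or.inr (Or.inr (Or.inl ⟨j, i, h', rfl⟩))))
        have h2 := h _ (mem_posRoots.2 (Or.inr (Or.inr (Or.inr ⟨j, i, h', rfl⟩))))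
        rw [pairing_sub, pairing_single, pairing_single] at h1
        rw [pairing_add, pairing_single, pairing_single, add_comm] at h2
        refine ⟨fun h3 => h1 ?_, h2⟩
        rw [← neg_sub, Complex.exp_neg, h3, inv_one]
  · rintro ⟨h1, h2⟩ α hα
    rcases mem_posRoots.1 hα with ⟨i, rfl⟩ | ⟨i, rfl⟩ | ⟨i, j, hij, rfl⟩ | ⟨i, j, hij, rfl⟩
    · rw [pairing_single]
      intro h
      apply h1 i
      rw [two_mul, Complex.exp_add, h, one_mul]
    · rw [two_smul, pairing_add, pairing_single, ← two_mul]
      exact h1 i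
    · rw [pairing_sub, pairing_single, pairing_single]
      exact (h2 i j hij.ne).1
    · rw [pairing_add, pairing_single, pairing_single]
      exact (h2 i j hij.ne).2

theorem regSet_mapsTo {N : ℕ} (w : W N) : Set.MapsTo w.1 (regSet N) (regSet N) := by
  obtain ⟨w, σ, ε, h⟩ := w
  intro y hy
  rw [mem_regSet_iff] at hy ⊢
  obtain ⟨h1, h2⟩ := hy
  have key : ∀ z : ℂ, Complex.exp z ≠ 1 → Complex.exp (-z) ≠ 1 := by
    intro z hz h3
    apply hz
    rw [← neg_neg z, Complex.exp_neg, h3, inv_one]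
  refine ⟨fun i => ?_, fun i j hij => ?_⟩
  · rw [h]
    rcases Int.units_eq_one_or (ε i) with h3 | h3
    · simpa [h3] using h1 (σ i)
    · simpa [h3] using key _ (h1 (σ i))
  · rw [h, h]
    have h4 := h2 (σ i) (σ j) (fun h => hij (σ.injective h))
    rcases Int.units_eq_one_or (ε i) with h3 | h3 <;>
      rcases Int.units_eq_one_or (ε j) with h5 | h5
    · simpa [h3, h5] using h4
    · simpa [h3, h5, ← sub_eq_add_neg] using h4.symm
    · have h6 := key _ h4.1
      have h7 := key _ h4.2
      rw [neg_sub] at h6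
      rw [neg_add] at h7
      simp only [h3, h5, Units.val_neg, Units.val_one, Int.cast_neg, Int.cast_one, neg_mul,
        one_mul]
      exact ⟨by rwa [sub_eq_add_neg], by rwa [neg_add_eq_sub]⟩
    · have h6 := key _ h4.1
      have h7 := key _ h4.2
      rw [neg_sub] at h6
      rw [neg_add] at h7
      simp only [h3, h5, Units.val_neg, Units.val_one, Int.cast_neg, Int.cast_one, neg_mul,
        one_mul]
      exact ⟨by rwa [sub_neg_eq_add, neg_add_eq_sub], h7⟩

/-! ### The trigonometric Cherednik algebra -/

/-- The orbit `W x₀`. -/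
def orbit {N : ℕ} (x₀ : Fin N → ℂ) : Set (Fin N → ℂ) := {x | ∃ w ∈ W N, x = w x₀}

/-- The filter of sets that contain all regular points of some neighbourhood of `W x₀`. -/
def nearReg {N : ℕ} (x₀ : Fin N → ℂ) : Filter (Fin N → ℂ) := 𝓝ˢ (orbit x₀) ⊓ 𝓟 (regSet N)

theorem openBased_nearReg {N : ℕ} (x₀ : Fin N → ℂ) : OpenBased (nearReg x₀) :=
  openBased_nhdsSet_inf _ _ (isOpen_regSet N)

theorem continuous_W {N : ℕ} (w : W N) : Continuous (w.1 : (Fin N → ℂ) → (Fin N → ℂ)) :=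
  LinearMap.continuous_of_finiteDimensional w.1.toLinearMap

theorem orbit_mapsTo {N : ℕ} (x₀ : Fin N → ℂ) (w : W N) :
    Set.MapsTo w.1 (orbit x₀) (orbit x₀) := by
  rintro _ ⟨v, hv, rfl⟩
  exact ⟨w.1 * v, (W N).mul_mem w.2 hv, rfl⟩

theorem tendsto_nearReg {N : ℕ} (x₀ : Fin N → ℂ) (w : W N) :
    Tendsto (w.1 : (Fin N → ℂ) → (Fin N → ℂ)) (nearReg x₀) (nearReg x₀) := by
  refine Tendsto.inf ?_ (tendsto_principal_principal.2 (regSet_mapsTo w))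
  exact (continuous_W w).tendsto_nhdsSet (orbit_mapsTo x₀ w)

/-- The action `(w F)(y) = F(w⁻¹ y)` of `W` on germs. -/
def act {N : ℕ} (x₀ : Fin N → ℂ) (w : W N) : Module.End ℂ (AnGerm (nearReg x₀)) where
  toFun F := ⟨F.1.compTendsto (w⁻¹).1 (tendsto_nearReg x₀ w⁻¹), by
    obtain ⟨_, f, hf, rfl⟩ := F
    refine ⟨fun y => f ((w⁻¹).1 y), ?_, rfl⟩
    filter_upwards [(tendsto_nearReg x₀ w⁻¹).eventually hf] with y hy
    exact AnalyticAt.comp (g := f) hy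
      ((LinearMap.toContinuousLinearMap (w⁻¹).1.toLinearMap).analyticAt y)⟩
  map_add' F G := by
    obtain ⟨_, f, hf, rfl⟩ := F
    obtain ⟨_, g, hg, rfl⟩ := G
    rfl
  map_smul' c F := by
    obtain ⟨_, f, hf, rfl⟩ := F
    rfl

/-- The generalised Weyl vector `ρ = ½ ∑_{α > 0} c_α α`. -/
def weylVec (N : ℕ) (c₁ c₂ c₃ : ℂ) : Fin N → ℂ :=
  fun i => (1 / 2) * ∑ α ∈ posRoots N, mult c₁ c₂ c₃ α * (α i : ℂ)

/-- The coefficient `1 / (1 - e^{-(α, y)})`. -/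
def dunklCoef {N : ℕ} (α : Fin N → ℤ) (y : Fin N → ℂ) : ℂ :=
  1 / (1 - Complex.exp (-pairing α y))

theorem analyticAt_dunklCoef {N : ℕ} (x₀ : Fin N → ℂ) {α : Fin N → ℤ} (hα : α ∈ posRoots N) :
    ∀ᶠ y in nearReg x₀, AnalyticAt ℂ (dunklCoef α) y := by
  have : regSet N ∈ nearReg x₀ := mem_inf_of_right (mem_principal_self _)
  filter_upwards [this] with y hy
  refine analyticAt_const.div (analyticAt_const.sub (analyticAt_pairing α y).neg.cexp) ?_
  intro h
  apply hy α hα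
  have h1 : Complex.exp (-pairing α y) = 1 := (sub_eq_zero.1 h).symm
  rw [← neg_neg (pairing α y), Complex.exp_neg, h1, inv_one]

/-- The trigonometric Dunkl operator
`∇_i = ∂_i - ∑_{α > 0} c_α (α, e_i) / (1 - e^{-(α, x)}) (1 - s_α) + (ρ, e_i)`. -/
def dunkl {N : ℕ} (x₀ : Fin N → ℂ) (c₁ c₂ c₃ : ℂ) (i : Fin N) :
    Module.End ℂ (AnGerm (nearReg x₀)) :=
  dirDeriv (openBased_nearReg x₀) (Pi.single i 1)
    - ∑ α : posRoots N, (mult c₁ c₂ c₃ α.1 * (α.1 i : ℂ)) •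
        (mulAn (dunklCoef α.1) (analyticAt_dunklCoef x₀ α.2) * (1 - act x₀ (sRefl α)))
    + weylVec N c₁ c₂ c₃ i • 1

theorem analyticAt_exp_pairing {N : ℕ} (x₀ : Fin N → ℂ) (p : Fin N → ℤ) :
    ∀ᶠ y in nearReg x₀, AnalyticAt ℂ (fun y => Complex.exp (pairing p y)) y :=
  Eventually.of_forall fun y => (analyticAt_pairing p y).cexp

/-- The trigonometric Cherednik algebra of type `BC_N`, generated by `W`, the exponentials
`e^{(p, x)}` with `p` in the weight lattice `ℤ^N`, and the trigonometric Dunkl operators, in its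
action on germs of analytic functions on the regular points near `W x₀`. -/
def cherednik {N : ℕ} (x₀ : Fin N → ℂ) (c₁ c₂ c₃ : ℂ) :
    Subalgebra ℂ (Module.End ℂ (AnGerm (nearReg x₀))) :=
  Algebra.adjoin ℂ
    (Set.range (act x₀) ∪
      Set.range (fun p : Fin N → ℤ =>
        mulAn (fun y => Complex.exp (pairing p y)) (analyticAt_exp_pairing x₀ p)) ∪
      Set.range (dunkl x₀ c₁ c₂ c₃))

/-- The operator `p(∇_1, …, ∇_N)` for a polynomial `p`. -/
def polyDunkl {N : ℕ} (x₀ : Fin N → ℂ) (c₁ c₂ c₃ : ℂ) (p : MvPolynomial (Fin N) ℂ) :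
    Module.End ℂ (AnGerm (nearReg x₀)) :=
  ∑ s ∈ p.support, p.coeff s • (List.ofFn fun i => dunkl x₀ c₁ c₂ c₃ i ^ s i).prod

/-- `W`-invariant polynomials. -/
def IsInvPoly {N : ℕ} (p : MvPolynomial (Fin N) ℂ) : Prop :=
  ∀ w ∈ W N, ∀ x : Fin N → ℂ, MvPolynomial.eval (w x) p = MvPolynomial.eval x p

/-! ### The affine stratum and periodic germs -/

/-- The coordinates that are set to `πi`: the `l₂` coordinates before the last `l₁` ones. -/
def InShift (N l₁ l₂ : ℕ) (i : Fin N) : Prop := N ≤ i.1 + l₁ + l₂ ∧ i.1 + l₁ < N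

instance (N l₁ l₂ : ℕ) (i : Fin N) : Decidable (InShift N l₁ l₂ i) :=
  inferInstanceAs (Decidable (_ ∧ _))

/-- The affine plane `π^a`: the first `m k` coordinates form `m` consecutive blocks of `k` equal
coordinates, the last `l₁` coordinates are `0`, and the `l₂` coordinates before them are `πi`.
(Indices start from `0`.) -/
def plane (N k m l₁ l₂ : ℕ) : Set (Fin N → ℂ) :=
  {x | (∀ i j : Fin N, i.1 < m * k → j.1 < m * k → i.1 / k = j.1 / k → x i = x j) ∧
    (∀ i : Fin N, N ≤ i.1 + l₁ → x i = 0) ∧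
    (∀ i : Fin N, InShift N l₁ l₂ i → x i = Real.pi * Complex.I)}

/-- The affine stratum `D^a = ⋃_{w ∈ W} w(π^a)`. -/
def stratum (N k m l₁ l₂ : ℕ) : Set (Fin N → ℂ) :=
  {x | ∃ w ∈ W N, ∃ z ∈ plane N k m l₁ l₂, x = w z}

/-- Generic points of `π^a`: if `e^{(α, x₀)} = 1` for a root `α`, then `e^{(α, x)} = 1` on all
of `π^a`. -/
def IsGeneric (N k m l₁ l₂ : ℕ) (x₀ : Fin N → ℂ) : Prop :=
  x₀ ∈ plane N k m l₁ l₂ ∧ ∀ α ∈ posRoots N, Complex.exp (pairing α x₀) = 1 →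
    ∀ x ∈ plane N k m l₁ l₂, Complex.exp (pairing α x) = 1

/-- A function near `W x₀` is periodic if `f(y + x' - x) = f(y)` for `y` near `x`, whenever
`x, x' ∈ W x₀` and `x - x' ∈ 2πi ℤ^N`. -/
def IsPeriodicNear {N : ℕ} (x₀ : Fin N → ℂ) (f : (Fin N → ℂ) → ℂ) : Prop :=
  ∀ x ∈ orbit x₀, ∀ x' ∈ orbit x₀,
    (∃ p : Fin N → ℤ, ∀ i, x i - x' i = 2 * Real.pi * Complex.I * (p i : ℂ)) →
    ∀ᶠ y in 𝓝 x, f (y + x' - x) = f y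

/-- The space `𝒞^p_{W x₀}(V, ℂ)` of periodic sums of analytic germs at the points of `W x₀`.
As the orbit is finite, a sum of germs at its points is the same as a germ along the filter
of neighbourhoods of the orbit. -/
def PerGerm {N : ℕ} (x₀ : Fin N → ℂ) : Submodule ℂ (Germ (𝓝ˢ (orbit x₀)) ℂ) where
  carrier := {F | ∃ f : (Fin N → ℂ) → ℂ, (∀ᶠ y in 𝓝ˢ (orbit x₀), AnalyticAt ℂ f y) ∧
    IsPeriodicNear x₀ f ∧ F = (f : Germ (𝓝ˢ (orbit x₀)) ℂ)}
  add_mem' := by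
    rintro _ _ ⟨f, hf, hf', rfl⟩ ⟨g, hg, hg', rfl⟩
    refine ⟨f + g, by filter_upwards [hf, hg] with y h1 h2 using h1.add h2, ?_, rfl⟩
    intro x hx x' hx' h
    filter_upwards [hf' x hx x' hx' h, hg' x hx x' hx' h] with y h1 h2
    simp [h1, h2]
  zero_mem' := ⟨0, Eventually.of_forall fun _ => analyticAt_const,
    fun _ _ _ _ _ => Eventually.of_forall fun _ => rfl, rfl⟩
  smul_mem' := by
    rintro c _ ⟨f, hf, hf', rfl⟩
    refine ⟨c • f, by filter_upwards [hf] with y h1 using analyticAt_const.smul h1, ?_, rfl⟩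
    intro x hx x' hx' h
    filter_upwards [hf' x hx x' hx' h] with y h1
    simp [h1]

/-- Restriction of periodic germs to the regular points; it is injective, since the regular
points are dense, and it is how the Dunkl operators, whose coefficients have poles on the mirrors,
are applied to periodic germs. -/
def toReg {N : ℕ} (x₀ : Fin N → ℂ) : PerGerm x₀ →ₗ[ℂ] AnGerm (nearReg x₀) where
  toFun F := ⟨F.1.compTendsto id (tendsto_id'.2 inf_le_left), by
    obtain ⟨_, f, hf, _, rfl⟩ := F
    exact ⟨f, hf.filter_mono inf_le_left, rfl⟩⟩
  map_add' F G := by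
    obtain ⟨_, f, hf, _, rfl⟩ := F
    obtain ⟨_, g, hg, _, rfl⟩ := G
    rfl
  map_smul' c F := by
    obtain ⟨_, f, hf, _, rfl⟩ := F
    rfl

/-- Restriction of periodic germs to the stratum `D^a`. -/
def resStratum {N : ℕ} (k m l₁ l₂ : ℕ) (x₀ : Fin N → ℂ) :
    PerGerm x₀ →ₗ[ℂ] Germ (𝓝ˢ (orbit x₀) ⊓ 𝓟 (stratum N k m l₁ l₂)) ℂ where
  toFun F := F.1.compTendsto id (tendsto_id'.2 inf_le_left)
  map_add' F G := by
    obtain ⟨_, f, hf, _, rfl⟩ := F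
    obtain ⟨_, g, hg, _, rfl⟩ := G
    rfl
  map_smul' c F := by
    obtain ⟨_, f, hf, _, rfl⟩ := F
    rfl

/-! ### Vector-valued germs

`U`-valued germs are elements of the tensor product of `U` with the space of scalar germs, and
an operator `h` on scalar germs acts on them as `id ⊗ h`. -/

/-- The restriction of `U`-valued periodic germs to the regular points. -/
def toRegU {N : ℕ} (x₀ : Fin N → ℂ) (U : Type*) [AddCommGroup U] [Module ℂ U] :
    U ⊗[ℂ] PerGerm x₀ →ₗ[ℂ] U ⊗[ℂ] AnGerm (nearReg x₀) :=
  (toReg x₀).lTensor U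

/-- The space `𝒞^p_{W x₀}(V, U)`, inside the `U`-valued germs on the regular points. -/
def CpU {N : ℕ} (x₀ : Fin N → ℂ) (U : Type*) [AddCommGroup U] [Module ℂ U] :
    Submodule ℂ (U ⊗[ℂ] AnGerm (nearReg x₀)) :=
  LinearMap.range (toRegU x₀ U)

/-- The space `𝓘^p`: the elements of `𝒞^p_{W x₀}(V, U)` that vanish when restricted to `D^a`. -/
def IpU {N : ℕ} (k m l₁ l₂ : ℕ) (x₀ : Fin N → ℂ) (U : Type*) [AddCommGroup U] [Module ℂ U] :
    Submodule ℂ (U ⊗[ℂ] AnGerm (nearReg x₀)) :=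
  (LinearMap.ker ((resStratum k m l₁ l₂ x₀).lTensor U)).map (toRegU x₀ U)

/-- A space of `U`-valued germs is invariant under the trigonometric Cherednik algebra. -/
def IsInvariant {N : ℕ} {x₀ : Fin N → ℂ} (c₁ c₂ c₃ : ℂ) {U : Type*} [AddCommGroup U] [Module ℂ U]
    (S : Submodule ℂ (U ⊗[ℂ] AnGerm (nearReg x₀))) : Prop :=
  ∀ h ∈ cherednik x₀ c₁ c₂ c₃, ∀ F ∈ S, LinearMap.lTensor U h F ∈ S

/-- The conditions on the multiplicities. -/
def ParamCond (k l₁ l₂ : ℕ) (c₁ c₂ c₃ : ℂ) : Prop :=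
  (1 < k → c₁ = 1 / (k : ℂ)) ∧
  (0 < l₁ → 2 * (c₂ + c₃) + 2 * ((l₁ : ℂ) - 1) * c₁ = 1) ∧
  (0 < l₂ → 2 * c₃ + 2 * ((l₂ : ℂ) - 1) * c₁ = 1)

/-- The diagonal action `w (v ⊗ F) = (v · w⁻¹) ⊗ (w F)` of `W`, where the right `W`-module
structure `v · w` on `U` is given by a representation `ρ` of the opposite group. -/
def diagAct {N : ℕ} (x₀ : Fin N → ℂ) {U : Type*} [AddCommGroup U] [Module ℂ U]
    (ρ : Representation ℂ (W N)ᵐᵒᵖ U) (w : W N) :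
    Module.End ℂ (U ⊗[ℂ] AnGerm (nearReg x₀)) :=
  TensorProduct.map (ρ (MulOpposite.op w⁻¹)) (act x₀ w)

/-- Periodic germs whose classes modulo `𝓘^p` are invariant under the diagonal action. -/
def IsInvMod {N : ℕ} (k m l₁ l₂ : ℕ) (x₀ : Fin N → ℂ) {U : Type*} [AddCommGroup U] [Module ℂ U]
    (ρ : Representation ℂ (W N)ᵐᵒᵖ U) (T : U ⊗[ℂ] PerGerm x₀) : Prop :=
  ∀ w : W N, diagAct x₀ ρ w (toRegU x₀ U T) - toRegU x₀ U T ∈ IpU k m l₁ l₂ x₀ U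

/-- The space `U^{W₀}`, where `W₀` is generated by the reflections `s_α` in those roots `α` for
which `e^{(α, x)} = 1` on `π^a`. -/
def fixedU {N : ℕ} (k m l₁ l₂ : ℕ) {U : Type*} [AddCommGroup U] [Module ℂ U]
    (ρ : Representation ℂ (W N)ᵐᵒᵖ U) : Submodule ℂ U where
  carrier := {v | ∀ α : posRoots N,
    (∀ x ∈ plane N k m l₁ l₂, Complex.exp (pairing α.1 x) = 1) →
      ρ (MulOpposite.op (sRefl α)) v = v}
  add_mem' := fun {a b} ha hb α hα => by rw [map_add, ha α hα, hb α hα]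
  zero_mem' := fun α _ => map_zero _
  smul_mem' := fun c a ha α hα => by rw [map_smul, ha α hα]

/-! ### Coordinates on the plane and the restricted operator -/

/-- The dimension of `π^a`. -/
def dimPlane (N k m l₁ l₂ : ℕ) : ℕ := m + (N - m * k - l₁ - l₂)

/-- The orthonormal basis `ẽ_j` of the linear plane `π` parallel to `π^a`: the first `m` vectors
are `(e_{jk+1} + ⋯ + e_{jk+k}) / √k`, the other ones are the `e_i` of the free coordinates. -/
def basisVec (N k m l₁ l₂ : ℕ) (j : Fin (dimPlane N k m l₁ l₂)) : Fin N → ℂ :=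
  fun i => if j.1 < m then (if i.1 / k = j.1 then ((Real.sqrt k : ℝ) : ℂ)⁻¹ else 0)
    else (if i.1 = m * k + (j.1 - m) then 1 else 0)

/-- The coordinates `y` on `π^a`: the map `y ↦ δ + ∑_j y_j ẽ_j`, where `δ` is the sum of the
vectors `πi e_i` over the coordinates that are set to `πi`. -/
def chart (N k m l₁ l₂ : ℕ) (y : Fin (dimPlane N k m l₁ l₂) → ℂ) : Fin N → ℂ :=
  fun i => (∑ j, y j * basisVec N k m l₁ l₂ j i) +
    (if InShift N l₁ l₂ i then Real.pi * Complex.I else 0)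

theorem continuous_chart (N k m l₁ l₂ : ℕ) : Continuous (chart N k m l₁ l₂) := by
  unfold chart; fun_prop

theorem analyticAt_chart (N k m l₁ l₂ : ℕ) (y : Fin (dimPlane N k m l₁ l₂) → ℂ) :
    AnalyticAt ℂ (chart N k m l₁ l₂) y := by
  rw [analyticAt_pi_iff]
  intro i
  refine AnalyticAt.add ?_ analyticAt_const
  apply Finset.analyticAt_fun_sum
  intro j _
  exact ((ContinuousLinearMap.proj (R := ℂ) j).analyticAt y).mul analyticAt_const

/-- The coordinates cover `π^a`. -/
theorem exists_chart_eq {N k m l₁ l₂ : ℕ} (hk : 1 ≤ k) (hN : m * k + l₁ + l₂ ≤ N)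
    {x : Fin N → ℂ} (hx : x ∈ plane N k m l₁ l₂) : ∃ y, chart N k m l₁ l₂ y = x := by
  obtain ⟨h1, h2, h3⟩ := hx
  have hs : ((Real.sqrt k : ℝ) : ℂ) ≠ 0 := by
    rw [Complex.ofReal_ne_zero]
    exact (Real.sqrt_pos.2 (by exact_mod_cast hk)).ne'
  let y : Fin (dimPlane N k m l₁ l₂) → ℂ := fun j =>
    if j.1 < m then (Real.sqrt k : ℝ) * (if h : j.1 * k < N then x ⟨j.1 * k, h⟩ else 0)
    else (if h : m * k + (j.1 - m) < N then x ⟨m * k + (j.1 - m), h⟩ else 0)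
  refine ⟨y, funext fun i => ?_⟩
  unfold chart
  by_cases hi : i.1 < m * k
  · have hj : i.1 / k < m := Nat.div_lt_of_lt_mul (by rwa [mul_comm] at hi)
    have hj' : i.1 / k < dimPlane N k m l₁ l₂ := hj.trans_le (Nat.le_add_right _ _)
    rw [Finset.sum_eq_single ⟨i.1 / k, hj'⟩]
    · have hle : i.1 / k * k ≤ i.1 := Nat.div_mul_le_self _ _
      have hlt : i.1 / k * k < N := hle.trans_lt i.2
      have hsh : ¬ InShift N l₁ l₂ i := fun h => by
        have := h.1; omega
      simp only [y, basisVec, hj, if_true, hlt, dif_pos, hsh, if_false, add_zero]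
      rw [mul_right_comm, mul_inv_cancel₀ hs, one_mul]
      apply h1 _ _ (hle.trans_lt hi) hi
      simp [Nat.mul_div_cancel _ hk]
    · intro j _ hne
      simp only [basisVec]
      split_ifs with h4 h5 h5
      · exact absurd (Fin.ext h5.symm) hne
      · simp
      · omega
      · simp
    · simp
  · by_cases hi' : i.1 + l₁ + l₂ < N
    · have hj' : m + (i.1 - m * k) < dimPlane N k m l₁ l₂ := by unfold dimPlane; omega
      have hsh : ¬ InShift N l₁ l₂ i := fun h => by
        have := h.1; omega
      rw [Finset.sum_eq_single ⟨m + (i.1 - m * k), hj'⟩]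
      · have e2 : m * k + (i.1 - m * k) = i.1 := by omega
        simp [y, basisVec, e2, hsh]
      · intro j _ hne
        simp only [basisVec]
        split_ifs with h4 h5 h5
        · exfalso
          rw [← h5, Nat.div_lt_iff_lt_mul hk] at h4
          omega
        · simp
        · exact absurd (Fin.ext (by change j.1 = m + (i.1 - m * k); omega)) hne
        · simp
      · simp
    · rw [Finset.sum_eq_zero, zero_add]
      · split_ifs with hsh
        · exact (h3 i hsh).symm
        · refine (h2 i ?_).symm
          by_contra h
          exact hsh ⟨by omega, by omega⟩
      · intro j _
        have := j.2
        unfold dimPlane at this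
        simp only [basisVec]
        split_ifs with h4 h5 h5
        · exfalso
          rw [← h5, Nat.div_lt_iff_lt_mul hk] at h4
          omega
        · simp
        · omega
        · simp

theorem tendsto_chart {N k m l₁ l₂ : ℕ} {x₀ : Fin N → ℂ}
    {y₀ : Fin (dimPlane N k m l₁ l₂) → ℂ} (hy : chart N k m l₁ l₂ y₀ = x₀) :
    Tendsto (chart N k m l₁ l₂) (𝓝 y₀) (𝓝ˢ (orbit x₀)) := by
  refine ((continuous_chart N k m l₁ l₂).tendsto y₀).mono_right ?_
  rw [hy]
  exact nhds_le_nhdsSet ⟨1, (W N).one_mem, rfl⟩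

/-- Restriction of periodic germs to `π^a` near `x₀`, in the coordinates `y`. -/
def resPlane {N k m l₁ l₂ : ℕ} {x₀ : Fin N → ℂ} {y₀ : Fin (dimPlane N k m l₁ l₂) → ℂ}
    (hy : chart N k m l₁ l₂ y₀ = x₀) : PerGerm x₀ →ₗ[ℂ] AnGerm (𝓝 y₀) where
  toFun F := ⟨F.1.compTendsto (chart N k m l₁ l₂) (tendsto_chart hy), by
    obtain ⟨_, f, hf, _, rfl⟩ := F
    refine ⟨fun y => f (chart N k m l₁ l₂ y), ?_, rfl⟩
    filter_upwards [(tendsto_chart hy).eventually hf] with y h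
    exact AnalyticAt.comp (g := f) h (analyticAt_chart N k m l₁ l₂ y)⟩
  map_add' F G := by
    obtain ⟨_, f, hf, _, rfl⟩ := F
    obtain ⟨_, g, hg, _, rfl⟩ := G
    rfl
  map_smul' c F := by
    obtain ⟨_, f, hf, _, rfl⟩ := F
    rfl

/-- The pair `(α̂, t_α)`: the coordinates `(α, ẽ_j)` of the orthogonal projection `α̂` of `α`
onto `π`, and the shift `t_α = (α, δ)` modulo `2πi`. As `(α, δ)` is `πi` times the sum of the
coordinates of `α` on which `δ` is nonzero, the shift is recorded as the class of that integer
modulo `2`. -/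
def hatPair (N k m l₁ l₂ : ℕ) (α : Fin N → ℤ) : (Fin (dimPlane N k m l₁ l₂) → ℂ) × ZMod 2 :=
  (fun j => ∑ i, (α i : ℂ) * basisVec N k m l₁ l₂ j i,
    ((∑ i, if InShift N l₁ l₂ i then α i else 0 : ℤ) : ZMod 2))

/-- `((α̂, y) + t_α) / 2`. -/
def halfArg {d : ℕ} (q : (Fin d → ℂ) × ZMod 2) (y : Fin d → ℂ) : ℂ :=
  ((∑ j, q.1 j * y j) + Real.pi * Complex.I * (q.2.val : ℂ)) / 2

/-- `(α̂, α̂)`. -/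
def hatNormSq {d : ℕ} (q : (Fin d → ℂ) × ZMod 2) : ℂ := ∑ j, q.1 j ^ 2

open Classical in
/-- The pairs `(α̂, t_α) ≠ (0, 0)` for positive roots `α`. -/
def hatPairs (N k m l₁ l₂ : ℕ) : Finset ((Fin (dimPlane N k m l₁ l₂) → ℂ) × ZMod 2) :=
  ((posRoots N).image (hatPair N k m l₁ l₂)).erase 0

open Classical in
/-- The generalised multiplicity `ĉ`: the sum of `c_γ` over the positive roots `γ` with
`(γ̂, t_γ)` equal to the given pair. -/
def cHat (N k m l₁ l₂ : ℕ) (c₁ c₂ c₃ : ℂ) (q : (Fin (dimPlane N k m l₁ l₂) → ℂ) × ZMod 2) : ℂ :=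
  ∑ γ ∈ (posRoots N).filter (fun γ => hatPair N k m l₁ l₂ γ = q), mult c₁ c₂ c₃ γ

open Classical in
/-- The matrix `(α̂, α̂) ĉ P̂ = (α̂, α̂) ĉ + ∑_γ c_γ (γ, γ) (P_γ - 1)`, the sum being over the
positive roots `γ` with `(γ̂, t_γ) = (α̂, t_α)`, where `P_γ` is the action of `s_γ` on `U`. It is
defined as a product, since `P̂` alone has the denominator `(α̂, α̂) ĉ`. -/
def cHatPHat {N : ℕ} (k m l₁ l₂ : ℕ) (c₁ c₂ c₃ : ℂ) {U : Type*} [AddCommGroup U] [Module ℂ U]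
    (ρ : Representation ℂ (W N)ᵐᵒᵖ U) (q : (Fin (dimPlane N k m l₁ l₂) → ℂ) × ZMod 2) :
    Module.End ℂ U :=
  (hatNormSq q * cHat N k m l₁ l₂ c₁ c₂ c₃ q) • 1 +
    ∑ γ ∈ Finset.univ.filter (fun γ : posRoots N => hatPair N k m l₁ l₂ γ.1 = q),
      (mult c₁ c₂ c₃ γ.1 * (normSq γ.1 : ℂ)) • (ρ (MulOpposite.op (sRefl γ)) - 1)

/-- The Laplacian in the coordinates `y`. -/
def laplacian {d : ℕ} (y₀ : Fin d → ℂ) : Module.End ℂ (AnGerm (𝓝 y₀)) :=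
  ∑ j, dirDeriv (openBased_nhds y₀) (Pi.single j 1) * dirDeriv (openBased_nhds y₀) (Pi.single j 1)

/-- The matrix Calogero--Moser operator
`L = Δ_y - ∑ ĉ (ĉ + 2 ĉ_{2α̂, 2t} + P̂) (α̂, α̂) / (4 sinh² (((α̂, y) + t) / 2))`,
summed over the pairs `(α̂, t) ≠ (0, 0)`, on germs at `y₀` of `U`-valued analytic functions. -/
def opL {N k m l₁ l₂ : ℕ} (c₁ c₂ c₃ : ℂ) {U : Type*} [AddCommGroup U] [Module ℂ U]
    (ρ : Representation ℂ (W N)ᵐᵒᵖ U) (y₀ : Fin (dimPlane N k m l₁ l₂) → ℂ) :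
    Module.End ℂ (U ⊗[ℂ] AnGerm (𝓝 y₀)) :=
  LinearMap.lTensor U (laplacian y₀) -
    ∑ q ∈ hatPairs N k m l₁ l₂,
      TensorProduct.map
        ((cHat N k m l₁ l₂ c₁ c₂ c₃ q *
            (cHat N k m l₁ l₂ c₁ c₂ c₃ q + 2 * cHat N k m l₁ l₂ c₁ c₂ c₃ (q + q)) *
            hatNormSq q) • 1 + cHatPHat k m l₁ l₂ c₁ c₂ c₃ ρ q)
        (mulOp (𝓝 y₀) (fun y => 1 / (4 * Complex.sinh (halfArg q y) ^ 2)))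

/-- The additive constant `(ρ, ρ) - (ρ̂, ρ̂)`, where `ρ̂` is the projection of `ρ` onto `π`. -/
def gaugeConst (N k m l₁ l₂ : ℕ) (c₁ c₂ c₃ : ℂ) : ℂ :=
  (∑ i, weylVec N c₁ c₂ c₃ i ^ 2) -
    ∑ j : Fin (dimPlane N k m l₁ l₂),
      (∑ i, weylVec N c₁ c₂ c₃ i * basisVec N k m l₁ l₂ j i) ^ 2

/-- A choice, near `y₀`, of analytic branches of the logarithms of the functions
`sinh(((α̂, y) + t) / 2)`. -/
def IsLogBranch {N k m l₁ l₂ : ℕ} (y₀ : Fin (dimPlane N k m l₁ l₂) → ℂ)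
    (ℓ : (Fin (dimPlane N k m l₁ l₂) → ℂ) × ZMod 2 → (Fin (dimPlane N k m l₁ l₂) → ℂ) → ℂ) :
    Prop :=
  ∀ q ∈ hatPairs N k m l₁ l₂, AnalyticAt ℂ (ℓ q) y₀ ∧
    ∀ᶠ y in 𝓝 y₀, Complex.exp (ℓ q y) = Complex.sinh (halfArg q y)

/-- The logarithm of the gauge function `f = ∏ sinh(((α̂, y) + t) / 2) ^ ĉ`, for the given branches
of the logarithms. -/
def logGauge {N k m l₁ l₂ : ℕ} (c₁ c₂ c₃ : ℂ)
    (ℓ : (Fin (dimPlane N k m l₁ l₂) → ℂ) × ZMod 2 → (Fin (dimPlane N k m l₁ l₂) → ℂ) → ℂ)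
    (y : Fin (dimPlane N k m l₁ l₂) → ℂ) : ℂ :=
  ∑ q ∈ hatPairs N k m l₁ l₂, cHat N k m l₁ l₂ c₁ c₂ c₃ q * ℓ q y

/-- The operators `A ↦ f⁻¹ A f` on germs of functions with values in a vector space `U₀`, where
`f = e^g`. -/
def gaugeConj {d : ℕ} {y₀ : Fin d → ℂ} {U₀ : Type*} [AddCommGroup U₀] [Module ℂ U₀]
    (g : (Fin d → ℂ) → ℂ) (A : Module.End ℂ (U₀ ⊗[ℂ] AnGerm (𝓝 y₀))) :
    Module.End ℂ (U₀ ⊗[ℂ] AnGerm (𝓝 y₀)) :=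
  LinearMap.lTensor U₀ (mulOp (𝓝 y₀) fun y => Complex.exp (-g y)) * A *
    LinearMap.lTensor U₀ (mulOp (𝓝 y₀) fun y => Complex.exp (g y))

/-- The family `H` of operators on germs at `y₀` of analytic `U^{W₀}`-valued functions on `π^a` is
the restriction of the action of the operators `p(∇)`, `p` a `W`-invariant polynomial, on the
`W`-invariants of `𝒞^p_{W x₀}(V, U) / 𝓘^p`: restriction to `π^a` near `x₀` is an isomorphism from
these invariants onto the `U^{W₀}`-valued germs, the operator `p(∇)` preserves the invariants,
and `H p` is the operator that corresponds to `p(∇)`. -/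
def IsRestriction {N k m l₁ l₂ : ℕ} {x₀ : Fin N → ℂ} {y₀ : Fin (dimPlane N k m l₁ l₂) → ℂ}
    (hy : chart N k m l₁ l₂ y₀ = x₀) (c₁ c₂ c₃ : ℂ) {U : Type*} [AddCommGroup U] [Module ℂ U]
    (ρ : Representation ℂ (W N)ᵐᵒᵖ U)
    (H : MvPolynomial (Fin N) ℂ → Module.End ℂ (fixedU k m l₁ l₂ ρ ⊗[ℂ] AnGerm (𝓝 y₀))) : Prop :=
  (∀ T, IsInvMod k m l₁ l₂ x₀ ρ T →
    ∃ g, LinearMap.lTensor U (resPlane hy) T =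
      LinearMap.rTensor (AnGerm (𝓝 y₀)) (fixedU k m l₁ l₂ ρ).subtype g) ∧
  (∀ g, ∃ T, IsInvMod k m l₁ l₂ x₀ ρ T ∧ LinearMap.lTensor U (resPlane hy) T =
      LinearMap.rTensor (AnGerm (𝓝 y₀)) (fixedU k m l₁ l₂ ρ).subtype g) ∧
  (∀ T, IsInvMod k m l₁ l₂ x₀ ρ T → LinearMap.lTensor U (resPlane hy) T = 0 →
    toRegU x₀ U T ∈ IpU k m l₁ l₂ x₀ U) ∧
  ∀ p, IsInvPoly p → ∀ T T', IsInvMod k m l₁ l₂ x₀ ρ T →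
    toRegU x₀ U T' = LinearMap.lTensor U (polyDunkl x₀ c₁ c₂ c₃ p) (toRegU x₀ U T) →
    IsInvMod k m l₁ l₂ x₀ ρ T' ∧
    ∀ g, LinearMap.lTensor U (resPlane hy) T =
        LinearMap.rTensor (AnGerm (𝓝 y₀)) (fixedU k m l₁ l₂ ρ).subtype g →
      LinearMap.lTensor U (resPlane hy) T' =
        LinearMap.rTensor (AnGerm (𝓝 y₀)) (fixedU k m l₁ l₂ ρ).subtype (H p g)

end BCN

end

noncomputable section

namespace BCN

open Complex
open Finset hiding sum_apply mem_map
open LinearMap (lTensor rTensor)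

section Division

variable {E : Type*} [NormedAddCommGroup E] [NormedSpace ℂ E]

/-- The quotient series: `∑_j p_{n+1}(P, …, P, v, id, …, id)` with `v` in position `j`. -/
def quotSeries (p : FormalMultilinearSeries ℂ E ℂ) (P : E →L[ℂ] E) (v : E) :
    FormalMultilinearSeries ℂ E ℂ := fun n =>
  ∑ j : Fin (n + 1), ContinuousMultilinearMap.curryMid j
    ((p (n + 1)).compContinuousLinearMap
      (fun i => if i < j then P else ContinuousLinearMap.id ℂ E)) v

theorem quotSeries_apply (p : FormalMultilinearSeries ℂ E ℂ) (P : E →L[ℂ] E) (v : E)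
    (ℓ : E →L[ℂ] ℂ) (hP : ∀ z, z = P z + ℓ z • v) (n : ℕ) (z : E) :
    p (n + 1) (fun _ => z) - p (n + 1) (fun _ => P z) =
      ℓ z * quotSeries p P v n (fun _ => z) := by
  set A : ℕ → ℂ := fun j => p (n + 1) (fun i : Fin (n + 1) => if i.1 < j then P z else z) with hA
  have h0 : p (n + 1) (fun _ => z) = A 0 := by simp [hA]
  have h1 : p (n + 1) (fun _ => P z) = A (n + 1) := by
    simp only [hA]; congr 1; funext i; rw [if_pos i.2]
  have key : ∀ j : Fin (n + 1), A j.1 - A (j.1 + 1) =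
      ℓ z * ContinuousMultilinearMap.curryMid j ((p (n + 1)).compContinuousLinearMap
        (fun i => if i < j then P else ContinuousLinearMap.id ℂ E)) v (fun _ => z) := by
    intro j
    set m : Fin (n + 1) → E := fun i => if i.1 < j.1 then P z else z
    have e1 : (fun i : Fin (n + 1) => if i.1 < j.1 then P z else z) = Function.update m j z := by
      funext i
      by_cases h : i = j
      · subst h; simp
      · simp [h, m]
    have e2 : (fun i : Fin (n + 1) => if i.1 < j.1 + 1 then P z else z) =
        Function.update m j (P z) := by
      funext i
      by_cases h : i = j
      · subst h; simp
      · have : i.1 ≠ j.1 := fun h' => h (Fin.ext h')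
        have h3 : i.1 < j.1 + 1 ↔ i.1 < j.1 := by omega
        simp [h, m, h3]
    have e3 : (fun i : Fin (n + 1) => (if i < j then P else ContinuousLinearMap.id ℂ E)
        (j.insertNth (α := fun _ => E) v (fun _ => z) i)) = Function.update m j v := by
      funext i
      by_cases h : i = j
      · subst h; simp
      · obtain ⟨i', rfl⟩ := Fin.exists_succAbove_eq h
        simp only [Fin.insertNth_apply_succAbove, Function.update_of_ne h, m, Fin.lt_def]
        split_ifs <;> simp
    rw [ContinuousMultilinearMap.curryMid_apply,
      ContinuousMultilinearMap.compContinuousLinearMap_apply, e3]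
    simp only [hA]
    rw [e1, e2, ← smul_eq_mul, ← ContinuousMultilinearMap.map_update_smul,
      ← ContinuousMultilinearMap.map_update_sub]
    congr 2
    rw [sub_eq_iff_eq_add', ← hP]
  rw [h0, h1, quotSeries, sum_apply, mul_sum,
    ← sum_congr rfl fun j _ => key j,
    Fin.sum_univ_eq_sum_range (fun j => A j - A (j + 1)), sum_range_sub']

theorem norm_quotSeries_le (p : FormalMultilinearSeries ℂ E ℂ) (P : E →L[ℂ] E) (v : E) (n : ℕ) :
    ‖quotSeries p P v n‖ ≤ (n + 1) * (‖p (n + 1)‖ * max ‖P‖ 1 ^ (n + 1) * ‖v‖) := by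
  have : ∀ j ∈ (univ : Finset (Fin (n + 1))), ‖ContinuousMultilinearMap.curryMid j
      ((p (n + 1)).compContinuousLinearMap
        (fun i => if i < j then P else ContinuousLinearMap.id ℂ E)) v‖ ≤
        ‖p (n + 1)‖ * max ‖P‖ 1 ^ (n + 1) * ‖v‖ := by
    intro j _
    refine (ContinuousLinearMap.le_opNorm _ _).trans ?_
    gcongr
    rw [ContinuousMultilinearMap.norm_curryMid]
    refine (ContinuousMultilinearMap.norm_compContinuousLinearMap_le _ _).trans ?_
    gcongr
    calc _ ≤ ∏ _i : Fin (n + 1), max ‖P‖ 1 := by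
          apply prod_le_prod (fun _ _ => norm_nonneg _)
          intro i _
          split_ifs
          · exact le_max_left _ _
          · exact ContinuousLinearMap.norm_id_le.trans (le_max_right _ _)
      _ = _ := by simp
  refine (norm_sum_le_of_le _ this).trans (le_of_eq ?_)
  simp

theorem quotSeries_radius_pos (p : FormalMultilinearSeries ℂ E ℂ) (hp : 0 < p.radius)
    (P : E →L[ℂ] E) (v : E) : 0 < (quotSeries p P v).radius := by
  obtain ⟨C, r, hC, hr, h⟩ := p.le_mul_pow_of_radius_pos hp
  set D : ℝ := max ‖P‖ 1
  have hD : 0 < D := lt_of_lt_of_le one_pos (le_max_right _ _)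
  have hpos : 0 < (2 * (r * D))⁻¹ := by positivity
  refine lt_of_lt_of_le ?_ ((quotSeries p P v).le_radius_of_bound (C * (r * D) * ‖v‖)
    (r := ⟨(2 * (r * D))⁻¹, hpos.le⟩) fun n => ?_)
  · exact ENNReal.coe_pos.2 hpos
  · have h1 : ((n : ℝ) + 1) ≤ 2 ^ n := by
      have : n + 1 ≤ 2 ^ n := Nat.lt_two_pow_self
      exact_mod_cast this
    change _ * (2 * (r * D))⁻¹ ^ n ≤ _
    calc _ ≤ ((n : ℝ) + 1) * (C * r ^ (n + 1) * D ^ (n + 1) * ‖v‖) * (2 * (r * D))⁻¹ ^ n := by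
          gcongr
          refine (norm_quotSeries_le p P v n).trans ?_
          gcongr
          exact h _
      _ ≤ (2 ^ n : ℝ) * (C * r ^ (n + 1) * D ^ (n + 1) * ‖v‖) * (2 * (r * D))⁻¹ ^ n := by
          gcongr
      _ = C * (r * D) * ‖v‖ := by
          rw [inv_pow, mul_pow, mul_pow]
          field_simp
          ring

/-- An analytic function that vanishes on a hyperplane is divisible by its equation. -/
theorem exists_eq_mul_of_eq_zero_on_hyperplane {f : E → ℂ} {x : E}
    (hf : AnalyticAt ℂ f x)
    (ℓ : E →L[ℂ] ℂ) (hℓ : ℓ ≠ 0) (h0 : ∀ᶠ y in 𝓝 x, ℓ y = ℓ x → f y = 0) :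
    ∃ h : E → ℂ, AnalyticAt ℂ h x ∧ ∀ᶠ y in 𝓝 x, f y = (ℓ y - ℓ x) * h y := by
  obtain ⟨p, hp⟩ := hf
  obtain ⟨w, hw⟩ : ∃ w, ℓ w ≠ 0 := by
    by_contra! h
    exact hℓ (ContinuousLinearMap.ext h)
  set v : E := (ℓ w)⁻¹ • w
  have hv : ℓ v = 1 := by simp [v, hw]
  set P : E →L[ℂ] E := ContinuousLinearMap.id ℂ E - ℓ.smulRight v
  have hP : ∀ z, z = P z + ℓ z • v := fun z => by simp [P]
  have hℓP : ∀ z, ℓ (P z) = 0 := fun z => by simp [P, hv]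
  set q := quotSeries p P v
  have hq : HasFPowerSeriesOnBall q.sum q 0 q.radius :=
    q.hasFPowerSeriesOnBall (quotSeries_radius_pos p hp.radius_pos P v)
  refine ⟨fun y => q.sum (y - x), ?_, ?_⟩
  · have h1 : AnalyticAt ℂ q.sum (x - x) := by rw [sub_self]; exact hq.analyticAt
    exact AnalyticAt.comp (g := q.sum) h1 (analyticAt_id.sub analyticAt_const)
  · have t1 : Tendsto (fun y => y - x) (𝓝 x) (𝓝 0) := by
      have : Continuous (fun y : E => y - x) := by fun_prop
      simpa using this.tendsto x
    have t2 : Tendsto (fun y => P (y - x)) (𝓝 x) (𝓝 0) := by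
      have := (P.continuous.tendsto 0).comp t1
      rw [map_zero] at this
      exact this
    have t3 : Tendsto (fun y => x + P (y - x)) (𝓝 x) (𝓝 x) := by
      simpa using tendsto_const_nhds.add t2
    filter_upwards [t1.eventually hp.eventually_hasSum, t2.eventually hp.eventually_hasSum,
      t3.eventually h0, t1.eventually (hq.hasFPowerSeriesAt.eventually_hasSum)] with y h1 h2 h3 h4
    have h5 : f (x + P (y - x)) = 0 := h3 (by rw [map_add, hℓP, add_zero])
    rw [h5] at h2
    rw [add_sub_cancel] at h1
    rw [zero_add] at h4
    have h6 := (hasSum_nat_add_iff' 1).2 (h1.sub h2)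
    have h7 := h4.mul_left (ℓ (y - x))
    have e : (fun n => p (n + 1) (fun _ => y - x) - p (n + 1) (fun _ => P (y - x))) =
        fun n => ℓ (y - x) * q n (fun _ => y - x) :=
      funext fun n => quotSeries_apply p P v ℓ hP n _
    rw [e] at h6
    have h8 := h6.unique h7
    rw [← map_sub, ← h8]
    have h9 : p 0 (fun _ => y - x) = p 0 (fun _ => P (y - x)) := by
      congr 1; funext i; exact i.elim0
    simp [h9]

end Division

/-! ### Germs represented by functions -/

/-- The germ of a function that is analytic along `l`. -/
def AnGerm.mk {n : ℕ} {l : Filter (Fin n → ℂ)} (f : (Fin n → ℂ) → ℂ)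
    (hf : ∀ᶠ y in l, AnalyticAt ℂ f y) : AnGerm l := ⟨f, f, hf, rfl⟩

section AnGermLemmas

variable {n : ℕ} {l : Filter (Fin n → ℂ)} {f g : (Fin n → ℂ) → ℂ}

theorem AnGerm.exists_mk (F : AnGerm l) : ∃ f hf, F = AnGerm.mk f hf := by
  obtain ⟨_, f, hf, rfl⟩ := F
  exact ⟨f, hf, rfl⟩

theorem AnGerm.mk_eq_mk {hf : ∀ᶠ y in l, AnalyticAt ℂ f y} {hg : ∀ᶠ y in l, AnalyticAt ℂ g y} :
    AnGerm.mk f hf = AnGerm.mk g hg ↔ f =ᶠ[l] g :=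
  ⟨fun h => Germ.coe_eq.1 (congrArg Subtype.val h), fun h => Subtype.ext (Germ.coe_eq.2 h)⟩

theorem ev_add (hf : ∀ᶠ y in l, AnalyticAt ℂ f y) (hg : ∀ᶠ y in l, AnalyticAt ℂ g y) :
    ∀ᶠ y in l, AnalyticAt ℂ (fun y => f y + g y) y :=
  (hf.and hg).mono fun _ h => h.1.add h.2

theorem ev_sub (hf : ∀ᶠ y in l, AnalyticAt ℂ f y) (hg : ∀ᶠ y in l, AnalyticAt ℂ g y) :
    ∀ᶠ y in l, AnalyticAt ℂ (fun y => f y - g y) y :=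
  (hf.and hg).mono fun _ h => h.1.sub h.2

theorem ev_mul (hf : ∀ᶠ y in l, AnalyticAt ℂ f y) (hg : ∀ᶠ y in l, AnalyticAt ℂ g y) :
    ∀ᶠ y in l, AnalyticAt ℂ (fun y => f y * g y) y :=
  (hf.and hg).mono fun _ h => h.1.mul h.2

theorem ev_const_mul (c : ℂ) (hf : ∀ᶠ y in l, AnalyticAt ℂ f y) :
    ∀ᶠ y in l, AnalyticAt ℂ (fun y => c * f y) y :=
  hf.mono fun _ h => analyticAt_const.mul h

theorem AnalyticAt.dirDeriv {f : (Fin n → ℂ) → ℂ} {y : Fin n → ℂ} (h : AnalyticAt ℂ f y)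
    (ξ : Fin n → ℂ) : AnalyticAt ℂ (fun y => fderiv ℂ f y ξ) y :=
  ((ContinuousLinearMap.apply ℂ ℂ ξ).analyticAt _).comp h.fderiv

theorem ev_dirDeriv (ξ : Fin n → ℂ) (hf : ∀ᶠ y in l, AnalyticAt ℂ f y) :
    ∀ᶠ y in l, AnalyticAt ℂ (fun y => fderiv ℂ f y ξ) y :=
  hf.mono fun _ h => AnalyticAt.dirDeriv h ξ

theorem AnGerm.mk_add (hf : ∀ᶠ y in l, AnalyticAt ℂ f y) (hg : ∀ᶠ y in l, AnalyticAt ℂ g y) :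
    AnGerm.mk f hf + AnGerm.mk g hg =
      AnGerm.mk (fun y => f y + g y) (ev_add hf hg) :=
  rfl

theorem AnGerm.mk_sub (hf : ∀ᶠ y in l, AnalyticAt ℂ f y) (hg : ∀ᶠ y in l, AnalyticAt ℂ g y) :
    AnGerm.mk f hf - AnGerm.mk g hg =
      AnGerm.mk (fun y => f y - g y) (ev_sub hf hg) :=
  rfl

theorem AnGerm.mk_smul (c : ℂ) (hf : ∀ᶠ y in l, AnalyticAt ℂ f y) :
    c • AnGerm.mk f hf = AnGerm.mk (fun y => c * f y)
      (ev_const_mul c hf) :=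
  rfl

theorem analyticAt_sum_eventually {ι : Type*} (s : Finset ι) (F : ι → (Fin n → ℂ) → ℂ)
    (hF : ∀ i, ∀ᶠ y in l, AnalyticAt ℂ (F i) y) :
    ∀ᶠ y in l, AnalyticAt ℂ (fun y => ∑ i ∈ s, F i y) y :=
  ((s.eventually_all (l := l)).2 fun i _ => hF i).mono fun _ h => Finset.analyticAt_fun_sum s h

theorem AnGerm.mk_sum {ι : Type*} (s : Finset ι) (F : ι → (Fin n → ℂ) → ℂ)
    (hF : ∀ i, ∀ᶠ y in l, AnalyticAt ℂ (F i) y) :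
    ∑ i ∈ s, AnGerm.mk (F i) (hF i) = AnGerm.mk (fun y => ∑ i ∈ s, F i y)
      (analyticAt_sum_eventually s F hF) := by
  classical
  induction s using Finset.induction_on with
  | empty => exact Subtype.ext rfl
  | insert i s his ih =>
    rw [sum_insert his, ih, AnGerm.mk_add]
    exact AnGerm.mk_eq_mk.2 (Eventually.of_forall fun y => by
      simp only [sum_insert his])

theorem mulAn_mk {φ : (Fin n → ℂ) → ℂ} (hφ : ∀ᶠ y in l, AnalyticAt ℂ φ y)
    (hf : ∀ᶠ y in l, AnalyticAt ℂ f y) :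
    mulAn φ hφ (AnGerm.mk f hf) = AnGerm.mk (fun y => φ y * f y)
      (ev_mul hφ hf) :=
  rfl

theorem dirDeriv_mk (hl : OpenBased l) (ξ : Fin n → ℂ) (hf : ∀ᶠ y in l, AnalyticAt ℂ f y) :
    dirDeriv hl ξ (AnGerm.mk f hf) = AnGerm.mk (fun y => fderiv ℂ f y ξ)
      (ev_dirDeriv ξ hf) :=
  rfl

end AnGermLemmas

theorem ev_comp_W {N : ℕ} {x₀ : Fin N → ℂ} (w : W N) {f : (Fin N → ℂ) → ℂ}
    (hf : ∀ᶠ y in nearReg x₀, AnalyticAt ℂ f y) :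
    ∀ᶠ y in nearReg x₀, AnalyticAt ℂ (fun y => f (w.1 y)) y :=
  ((tendsto_nearReg x₀ w).eventually hf).mono fun y hy => AnalyticAt.comp (g := f) hy
    ((LinearMap.toContinuousLinearMap w.1.toLinearMap).analyticAt y)

theorem act_mk {N : ℕ} {x₀ : Fin N → ℂ} (w : W N) {f : (Fin N → ℂ) → ℂ}
    (hf : ∀ᶠ y in nearReg x₀, AnalyticAt ℂ f y) :
    act x₀ w (AnGerm.mk f hf) = AnGerm.mk (fun y => f ((w⁻¹).1 y)) (ev_comp_W w⁻¹ hf) :=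
  rfl

/-! ### Periodic germs represented by functions -/

/-- The germ along `W x₀` of a periodic function that is analytic at the points of `W x₀`. -/
def PerGerm.mk {N : ℕ} {x₀ : Fin N → ℂ} (f : (Fin N → ℂ) → ℂ)
    (hf : ∀ x ∈ orbit x₀, AnalyticAt ℂ f x) (hp : IsPeriodicNear x₀ f) : PerGerm x₀ :=
  ⟨f, f, eventually_nhdsSet_iff_forall.2 fun x hx => (hf x hx).eventually_analyticAt, hp, rfl⟩

theorem PerGerm.exists_mk {N : ℕ} {x₀ : Fin N → ℂ} (F : PerGerm x₀) :
    ∃ f hf hp, F = PerGerm.mk f hf hp := by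
  obtain ⟨_, f, hf, hp, rfl⟩ := F
  exact ⟨f, fun x hx => (eventually_nhdsSet_iff_forall.1 hf x hx).self_of_nhds, hp, rfl⟩

theorem eventually_nearReg {N : ℕ} {x₀ : Fin N → ℂ} {f : (Fin N → ℂ) → ℂ}
    (hf : ∀ x ∈ orbit x₀, AnalyticAt ℂ f x) : ∀ᶠ y in nearReg x₀, AnalyticAt ℂ f y :=
  (eventually_nhdsSet_iff_forall.2 fun x hx => (hf x hx).eventually_analyticAt).filter_mono
    inf_le_left

theorem toReg_mk {N : ℕ} {x₀ : Fin N → ℂ} {f : (Fin N → ℂ) → ℂ}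
    (hf : ∀ x ∈ orbit x₀, AnalyticAt ℂ f x) (hp : IsPeriodicNear x₀ f) :
    toReg x₀ (PerGerm.mk f hf hp) = AnGerm.mk f (eventually_nearReg hf) := rfl

theorem regSet_mem_nearReg {N : ℕ} (x₀ : Fin N → ℂ) : regSet N ∈ nearReg x₀ :=
  mem_inf_of_right (mem_principal_self _)

/-! ### Density of the regular set -/

theorem normSq_pos {N : ℕ} {α : Fin N → ℤ} (hα : α ∈ posRoots N) : 0 < normSq α := by
  rcases mem_posRoots.1 hα with ⟨i, rfl⟩ | ⟨i, rfl⟩ | ⟨i, j, hij, rfl⟩ | ⟨i, j, hij, rfl⟩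
  · rw [normSq_single]; norm_num
  · rw [normSq_two_single]; norm_num
  · rw [normSq_sub hij.ne]; norm_num
  · rw [normSq_add hij.ne]; norm_num

theorem normSq_ne_zero {N : ℕ} {α : Fin N → ℤ} (hα : α ∈ posRoots N) : (normSq α : ℂ) ≠ 0 :=
  Int.cast_ne_zero.2 (normSq_pos hα).ne'

/-- An integral vector as an element of `V`. -/
def toV {N : ℕ} (α : Fin N → ℤ) : Fin N → ℂ := fun i => (α i : ℂ)

theorem pairing_toV {N : ℕ} (α : Fin N → ℤ) : pairing α (toV α) = normSq α := by
  simp [pairing, toV, normSq, sq]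

theorem pairing_vadd {N : ℕ} (α : Fin N → ℤ) (x y : Fin N → ℂ) :
    pairing α (x + y) = pairing α x + pairing α y := by
  simp [pairing, mul_add, sum_add_distrib]

theorem pairing_vsmul {N : ℕ} (α : Fin N → ℤ) (c : ℂ) (x : Fin N → ℂ) :
    pairing α (c • x) = c * pairing α x := by
  simp only [pairing, mul_sum, Pi.smul_apply, smul_eq_mul]
  exact sum_congr rfl fun i _ => by ring

/-- `(α, ·)` as a continuous linear form. -/
def pairingL {N : ℕ} (α : Fin N → ℤ) : (Fin N → ℂ) →L[ℂ] ℂ :=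
  LinearMap.toContinuousLinearMap
    { toFun := pairing α, map_add' := pairing_vadd α, map_smul' := pairing_vsmul α }

@[simp] theorem pairingL_apply {N : ℕ} (α : Fin N → ℤ) (x : Fin N → ℂ) :
    pairingL α x = pairing α x := rfl

theorem pairing_vsub {N : ℕ} (α : Fin N → ℤ) (x y : Fin N → ℂ) :
    pairing α (x - y) = pairing α x - pairing α y := map_sub (pairingL α) x y

theorem dense_exp_ne_one {N : ℕ} {α : Fin N → ℤ} (hα : α ∈ posRoots N) :
    Dense {y : Fin N → ℂ | exp (pairing α y) ≠ 1} := by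
  intro y
  by_cases hy : exp (pairing α y) = 1
  · refine mem_closure_of_tendsto (f := fun n : ℕ => y + ((1 / ((n : ℝ) + 1) : ℝ) : ℂ) • toV α)
      (b := atTop) ?_ (Eventually.of_forall fun n => ?_)
    · have h1 : Tendsto (fun n : ℕ => ((1 / ((n : ℝ) + 1) : ℝ) : ℂ)) atTop (𝓝 0) := by
        have := (Complex.continuous_ofReal.tendsto 0).comp tendsto_one_div_add_atTop_nhds_zero_nat
        simpa [Function.comp_def] using this
      simpa using (tendsto_const_nhds (x := y)).add (h1.smul_const (toV α))
    · change exp _ ≠ 1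
      rw [pairing_vadd, Complex.exp_add, hy, one_mul, pairing_vsmul, pairing_toV]
      intro h
      have h2 := congrArg norm h
      rw [Complex.norm_exp, norm_one, Real.exp_eq_one_iff] at h2
      have h3 : (0 : ℝ) < 1 / ((n : ℝ) + 1) * (normSq α : ℝ) := by
        have : (0 : ℝ) < (normSq α : ℝ) := Int.cast_pos.2 (normSq_pos hα)
        positivity
      have h4 : ((1 / ((n : ℝ) + 1) : ℝ) : ℂ) * (normSq α : ℂ) =
          ((1 / ((n : ℝ) + 1) * (normSq α : ℝ) : ℝ) : ℂ) := by push_cast; rfl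
      rw [h4, Complex.ofReal_re] at h2
      exact h3.ne' h2
  · exact subset_closure hy

theorem dense_regSet (N : ℕ) : Dense (regSet N) := by
  have : regSet N = ⋂ α ∈ (posRoots N : Set (Fin N → ℤ)),
      {y | exp (pairing α y) ≠ 1} := by
    ext y; simp [regSet]
  rw [this]
  refine dense_biInter_of_isOpen (fun α _ => ?_) (countable_toSet _)
    fun α hα => dense_exp_ne_one hα
  exact isOpen_ne_fun (Complex.continuous_exp.comp (continuous_pairing α)) continuous_const

/-- Analytic functions that agree at the regular points near `x` agree near `x`. -/
theorem eventuallyEq_of_eventuallyEq_reg {N : ℕ} {x : Fin N → ℂ} {f g : (Fin N → ℂ) → ℂ}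
    (hf : AnalyticAt ℂ f x) (hg : AnalyticAt ℂ g x) (h : f =ᶠ[𝓝 x ⊓ 𝓟 (regSet N)] g) :
    f =ᶠ[𝓝 x] g := by
  have h' : ∀ᶠ y in 𝓝 x, y ∈ regSet N → f y = g y := eventually_inf_principal.1 h
  filter_upwards [hf.eventually_analyticAt, hg.eventually_analyticAt,
    h'.eventually_nhds] with y h1 h2 h3
  by_contra hne
  have h4 : ∀ᶠ z in 𝓝 y, f z ≠ g z :=
    (h1.continuousAt.sub h2.continuousAt).eventually_ne (sub_ne_zero.2 hne) |>.mono
      fun z hz => sub_ne_zero.1 hz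
  have h5 : ∃ᶠ z in 𝓝 y, z ∈ regSet N := mem_closure_iff_frequently.1 (dense_regSet N y)
  obtain ⟨z, hz, hz1, hz2⟩ := (h5.and_eventually (h3.and h4)).exists
  exact hz2 (hz1 hz)

theorem nhds_inf_le_nearReg {N : ℕ} {x₀ x : Fin N → ℂ} (hx : x ∈ orbit x₀) :
    𝓝 x ⊓ 𝓟 (regSet N) ≤ nearReg x₀ :=
  inf_le_inf_right _ (nhds_le_nhdsSet hx)

theorem toReg_injective {N : ℕ} (x₀ : Fin N → ℂ) : Function.Injective (toReg x₀) := by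
  intro F G h
  obtain ⟨f, hf, hfp, rfl⟩ := PerGerm.exists_mk F
  obtain ⟨g, hg, hgp, rfl⟩ := PerGerm.exists_mk G
  rw [toReg_mk, toReg_mk, AnGerm.mk_eq_mk] at h
  refine Subtype.ext (Germ.coe_eq.2 ?_)
  exact eventually_nhdsSet_iff_forall.2 fun x hx =>
    eventuallyEq_of_eventuallyEq_reg (hf x hx) (hg x hx) (h.filter_mono (nhds_inf_le_nearReg hx))

/-! ### Division by `1 - e^{-(α, y)}` -/

open Classical in
/-- The quotient `n(y) / (1 - e^{-(α, y)})`, continued to the points where the denominator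
vanishes. -/
def divFun {N : ℕ} (α : Fin N → ℤ) (n : (Fin N → ℂ) → ℂ) (y : Fin N → ℂ) : ℂ :=
  if exp (pairing α y) = 1 then fderiv ℂ n y (toV α) / (normSq α : ℂ)
  else dunklCoef α y * n y

/-- The function `(1 - e^{-t}) / t`. -/
def expQuot : ℂ → ℂ := dslope (fun t => 1 - exp (-t)) 0

theorem expQuot_zero : expQuot 0 = 1 := by
  rw [expQuot, dslope_same]
  have : HasDerivAt (fun t : ℂ => 1 - exp (-t)) (-(exp (-0) * -1)) 0 :=
    ((hasDerivAt_neg (0 : ℂ)).cexp.const_sub 1)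
  rw [this.deriv]
  simp

theorem mul_expQuot (t : ℂ) : t * expQuot t = 1 - exp (-t) := by
  have := sub_smul_dslope (fun t : ℂ => 1 - exp (-t)) 0 t
  simpa [expQuot] using this

theorem analyticAt_expQuot : AnalyticAt ℂ expQuot 0 := by
  have : AnalyticAt ℂ (fun t : ℂ => 1 - exp (-t)) 0 :=
    analyticAt_const.sub analyticAt_id.neg.cexp
  obtain ⟨p, hp⟩ := this
  exact ⟨_, hp.has_fpower_series_dslope_fslope⟩

theorem exp_neg_eq_one_iff {z : ℂ} : exp (-z) = 1 ↔ exp z = 1 := by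
  rw [Complex.exp_neg, inv_eq_one]

theorem divFun_analyticAt {N : ℕ} {α : Fin N → ℤ} (hα : α ∈ posRoots N) {n : (Fin N → ℂ) → ℂ}
    {x : Fin N → ℂ} (hn : AnalyticAt ℂ n x)
    (h0 : exp (pairing α x) = 1 → ∀ᶠ y in 𝓝 x, pairing α y = pairing α x → n y = 0) :
    AnalyticAt ℂ (divFun α n) x := by
  by_cases hx : exp (pairing α x) = 1
  · have hℓ : pairingL α ≠ 0 := fun h => by
      have := congrArg (fun L : (Fin N → ℂ) →L[ℂ] ℂ => L (toV α)) h
      simp only [pairingL_apply, pairing_toV] at this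
      exact normSq_ne_zero hα this
    obtain ⟨h, hh, hnh⟩ := exists_eq_mul_of_eq_zero_on_hyperplane hn (pairingL α) hℓ (h0 hx)
    simp only [pairingL_apply] at hnh
    set D : (Fin N → ℂ) → ℂ := fun y => pairing α y - pairing α x
    have hD : AnalyticAt ℂ D x := (analyticAt_pairing α x).sub analyticAt_const
    have hD0 : D x = 0 := sub_self _
    have hu : AnalyticAt ℂ (fun y => expQuot (D y)) x := by
      have : AnalyticAt ℂ expQuot (D x) := by rw [hD0]; exact analyticAt_expQuot
      exact AnalyticAt.comp (g := expQuot) this hD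
    have hu1 : expQuot (D x) ≠ 0 := by rw [hD0, expQuot_zero]; exact one_ne_zero
    have hq : AnalyticAt ℂ (fun y => h y / expQuot (D y)) x := hh.div hu hu1
    refine hq.congr ?_
    have hne : ∀ᶠ y in 𝓝 x, expQuot (D y) ≠ 0 := hu.continuousAt.eventually_ne hu1
    filter_upwards [hne, hnh, hnh.eventually_nhds, hh.eventually_analyticAt] with y h1 h2 h3 h4
    have hexp : exp (-D y) = exp (-pairing α y) := by
      simp only [D]
      rw [neg_sub, sub_eq_add_neg, Complex.exp_add, hx, one_mul]
    have hmul : D y * expQuot (D y) = 1 - exp (-pairing α y) := by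
      rw [mul_expQuot, hexp]
    unfold divFun
    split_ifs with hy
    · have hDy : D y = 0 := by
        rw [exp_neg_eq_one_iff.2 hy, sub_self] at hmul
        exact (mul_eq_zero.1 hmul).resolve_right h1
      have e1 : n =ᶠ[𝓝 y] fun z => D z * h z := h3
      have d1 : HasFDerivAt D (pairingL α) y := by
        have := (pairingL α).hasFDerivAt (x := y)
        exact this.sub_const (pairing α x)
      have d2 := d1.mul h4.differentiableAt.hasFDerivAt
      have d3 : fderiv ℂ (fun z => D z * h z) y = _ := d2.fderiv
      rw [e1.fderiv_eq, d3]
      simp only [hDy, add_apply, smul_apply, pairingL_apply, pairing_toV, smul_eq_mul, zero_mul,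
        zero_add, expQuot_zero, div_one]
      field_simp [normSq_ne_zero hα]
    · have h5 : (1 - exp (-pairing α y)) ≠ 0 := by
        rw [sub_ne_zero]
        exact fun h => hy (exp_neg_eq_one_iff.1 h.symm)
      rw [dunklCoef, ← hmul, h2]
      rw [← hmul] at h5
      have h6 : D y ≠ 0 := left_ne_zero_of_mul h5
      change h y / expQuot (D y) = 1 / (D y * expQuot (D y)) * (D y * h y)
      field_simp
  · have hc : AnalyticAt ℂ (fun y => dunklCoef α y * n y) x := by
      refine AnalyticAt.mul ?_ hn
      refine analyticAt_const.div (analyticAt_const.sub (analyticAt_pairing α x).neg.cexp) ?_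
      rw [sub_ne_zero]
      exact fun h => hx (exp_neg_eq_one_iff.1 h.symm)
    refine hc.congr ?_
    have : ∀ᶠ y in 𝓝 x, exp (pairing α y) ≠ 1 :=
      ((Complex.continuous_exp.comp (continuous_pairing α)).continuousAt).eventually_ne
        hx
    filter_upwards [this] with y hy
    rw [divFun, if_neg hy]

/-! ### Dunkl operators on periodic germs -/

theorem refl_refl {N : ℕ} (α : Fin N → ℤ) (x : Fin N → ℂ) : refl α (refl α x) = x :=
  (refl α).left_inv x

theorem sRefl_mul_self {N : ℕ} (α : posRoots N) : sRefl α * sRefl α = 1 :=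
  Subtype.ext (LinearEquiv.ext fun x => refl_refl α.1 x)

theorem sRefl_inv {N : ℕ} (α : posRoots N) : (sRefl α)⁻¹ = sRefl α :=
  inv_eq_of_mul_eq_one_left (sRefl_mul_self α)

/-- Congruence of points modulo `2πi ℤ^N`. -/
def LatEq {N : ℕ} (x x' : Fin N → ℂ) : Prop :=
  ∃ p : Fin N → ℤ, ∀ i, x i - x' i = 2 * Real.pi * Complex.I * (p i : ℂ)

theorem LatEq.refl {N : ℕ} (x : Fin N → ℂ) : LatEq x x := ⟨0, fun i => by simp⟩

theorem LatEq.symm {N : ℕ} {x x' : Fin N → ℂ} (h : LatEq x x') : LatEq x' x := by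
  obtain ⟨p, hp⟩ := h
  refine ⟨-p, fun i => ?_⟩
  rw [← neg_sub, hp]
  simp

theorem LatEq.trans {N : ℕ} {x y z : Fin N → ℂ} (h : LatEq x y) (h' : LatEq y z) :
    LatEq x z := by
  obtain ⟨p, hp⟩ := h
  obtain ⟨q, hq⟩ := h'
  refine ⟨p + q, fun i => ?_⟩
  rw [← sub_add_sub_cancel, hp, hq, Pi.add_apply, Int.cast_add, mul_add]

theorem LatEq.map {N : ℕ} {x x' : Fin N → ℂ} (h : LatEq x x') (w : W N) :
    LatEq (w.1 x) (w.1 x') := by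
  obtain ⟨p, hp⟩ := h
  obtain ⟨w, σ, ε, hw⟩ := w
  refine ⟨fun i => (ε i : ℤ) * p (σ i), fun i => ?_⟩
  simp only [hw]
  rw [← mul_sub, hp]
  push_cast
  ring

theorem exp_pairing_sub_of_latEq {N : ℕ} {x x' : Fin N → ℂ} (h : LatEq x x') (α : Fin N → ℤ) :
    exp (pairing α (x' - x)) = 1 := by
  obtain ⟨p, hp⟩ := h.symm
  rw [Complex.exp_eq_one_iff]
  refine ⟨∑ i, α i * p i, ?_⟩
  simp only [pairing, Pi.sub_apply, hp]
  push_cast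
  rw [sum_mul]
  exact sum_congr rfl fun i _ => by ring

theorem exists_coroot {N : ℕ} {α : Fin N → ℤ} (hα : α ∈ posRoots N) :
    ∃ β : Fin N → ℤ, ∀ i, 2 * (α i : ℂ) / (normSq α : ℂ) = (β i : ℂ) := by
  rcases mem_posRoots.1 hα with ⟨i, rfl⟩ | ⟨i, rfl⟩ | ⟨i, j, hij, rfl⟩ | ⟨i, j, hij, rfl⟩
  · exact ⟨2 • Pi.single i 1, fun a => by rw [normSq_single]; simp⟩
  · refine ⟨Pi.single i 1, fun a => ?_⟩
    rw [normSq_two_single]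
    simp only [Pi.smul_apply, nsmul_eq_mul]
    push_cast
    ring
  · exact ⟨_, fun a => by rw [normSq_sub hij.ne]; push_cast; ring_nf; rfl⟩
  · exact ⟨_, fun a => by rw [normSq_add hij.ne]; push_cast; ring_nf; rfl⟩

theorem latEq_refl {N : ℕ} {α : Fin N → ℤ} (hα : α ∈ posRoots N) {x : Fin N → ℂ}
    (hx : exp (pairing α x) = 1) : LatEq x (refl α x) := by
  obtain ⟨n, hn⟩ := Complex.exp_eq_one_iff.1 hx
  obtain ⟨β, hβ⟩ := exists_coroot hα
  refine ⟨fun i => n * β i, fun i => ?_⟩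
  rw [refl_apply, hn]
  push_cast
  rw [← hβ i]
  ring

theorem refl_mem_orbit {N : ℕ} {x₀ x : Fin N → ℂ} {α : Fin N → ℤ} (hα : α ∈ posRoots N)
    (hx : x ∈ orbit x₀) : refl α x ∈ orbit x₀ :=
  orbit_mapsTo x₀ ⟨refl α, refl_mem hα⟩ hx

theorem analyticAt_W {N : ℕ} (w : W N) (y : Fin N → ℂ) :
    AnalyticAt ℂ (w.1 : (Fin N → ℂ) → (Fin N → ℂ)) y :=
  (LinearMap.toContinuousLinearMap w.1.toLinearMap).analyticAt y

theorem analyticAt_comp_W {N : ℕ} (w : W N) {f : (Fin N → ℂ) → ℂ} {y : Fin N → ℂ}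
    (h : AnalyticAt ℂ f (w.1 y)) : AnalyticAt ℂ (fun z => f (w.1 z)) y :=
  AnalyticAt.comp (g := f) h (analyticAt_W w y)

theorem IsPeriodicNear.comp_W {N : ℕ} {x₀ : Fin N → ℂ} {f : (Fin N → ℂ) → ℂ}
    (hp : IsPeriodicNear x₀ f) (w : W N) : IsPeriodicNear x₀ (fun y => f (w.1 y)) := by
  intro x hx x' hx' h
  have := hp _ (orbit_mapsTo x₀ w hx) _ (orbit_mapsTo x₀ w hx') (LatEq.map h w)
  filter_upwards [(continuous_W w).continuousAt.eventually this] with y hy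
  rw [map_sub, map_add, hy]

/-- The numerator `f - f ∘ s_α`. -/
def reflDiff {N : ℕ} (α : Fin N → ℤ) (f : (Fin N → ℂ) → ℂ) : (Fin N → ℂ) → ℂ :=
  fun y => f y - f (refl α y)

theorem reflDiff_analyticAt {N : ℕ} {x₀ : Fin N → ℂ} {α : Fin N → ℤ} (hα : α ∈ posRoots N)
    {f : (Fin N → ℂ) → ℂ} (hf : ∀ x ∈ orbit x₀, AnalyticAt ℂ f x) {x : Fin N → ℂ}
    (hx : x ∈ orbit x₀) : AnalyticAt ℂ (reflDiff α f) x :=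
  (hf x hx).sub (analyticAt_comp_W ⟨refl α, refl_mem hα⟩ (hf _ (refl_mem_orbit hα hx)))

theorem refl_eq_add {N : ℕ} {α : Fin N → ℤ} {x y : Fin N → ℂ}
    (h : pairing α y = pairing α x) : refl α y = y + refl α x - x := by
  funext i
  simp only [refl_apply, Pi.sub_apply, Pi.add_apply, h]
  ring

theorem reflDiff_eq_zero {N : ℕ} {x₀ : Fin N → ℂ} {α : Fin N → ℤ} (hα : α ∈ posRoots N)
    {f : (Fin N → ℂ) → ℂ} (hp : IsPeriodicNear x₀ f) {x : Fin N → ℂ} (hx : x ∈ orbit x₀)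
    (h1 : exp (pairing α x) = 1) :
    ∀ᶠ y in 𝓝 x, pairing α y = pairing α x → reflDiff α f y = 0 := by
  filter_upwards [hp x hx _ (refl_mem_orbit hα hx) (latEq_refl hα h1)] with y hy h2
  rw [reflDiff, refl_eq_add h2, hy, sub_self]

theorem reflDiff_periodic {N : ℕ} {x₀ : Fin N → ℂ} {α : Fin N → ℤ} (hα : α ∈ posRoots N)
    {f : (Fin N → ℂ) → ℂ} (hp : IsPeriodicNear x₀ f) : IsPeriodicNear x₀ (reflDiff α f) := by
  intro x hx x' hx' h
  filter_upwards [hp x hx x' hx' h, hp.comp_W ⟨refl α, refl_mem hα⟩ x hx x' hx' h] with y h1 h2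
  exact congrArg₂ (· - ·) h1 h2

theorem fderiv_periodic {N : ℕ} {x₀ : Fin N → ℂ} {f : (Fin N → ℂ) → ℂ}
    (hp : IsPeriodicNear x₀ f) (ξ : Fin N → ℂ) :
    IsPeriodicNear x₀ (fun y => fderiv ℂ f y ξ) := by
  intro x hx x' hx' h
  filter_upwards [(hp x hx x' hx' h).eventually_nhds] with y hy
  have e : (fun z => f (z + (x' - x))) =ᶠ[𝓝 y] f := by
    filter_upwards [hy] with z hz
    rw [← hz, add_sub_assoc]
  rw [← e.fderiv_eq, fderiv_comp_add_right, add_sub_assoc]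

theorem divFun_periodic {N : ℕ} {x₀ : Fin N → ℂ} (α : Fin N → ℤ) {f : (Fin N → ℂ) → ℂ}
    (hp : IsPeriodicNear x₀ f) : IsPeriodicNear x₀ (divFun α f) := by
  intro x hx x' hx' h
  filter_upwards [hp x hx x' hx' h, fderiv_periodic hp (toV α) x hx x' hx' h] with y h1 h2
  have h3 : exp (pairing α (y + x' - x)) = exp (pairing α y) := by
    rw [add_sub_assoc, pairing_vadd, Complex.exp_add, exp_pairing_sub_of_latEq h, mul_one]
  rw [divFun, divFun, h1, h2, h3, dunklCoef, dunklCoef, Complex.exp_neg, h3, ← Complex.exp_neg]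

/-- The Dunkl operator `∇_i` on functions, continued to the mirrors. -/
def perDunkl {N : ℕ} (c₁ c₂ c₃ : ℂ) (i : Fin N) (f : (Fin N → ℂ) → ℂ) (y : Fin N → ℂ) : ℂ :=
  fderiv ℂ f y (Pi.single i 1)
    - ∑ α : posRoots N, (mult c₁ c₂ c₃ α.1 * (α.1 i : ℂ)) * divFun α.1 (reflDiff α.1 f) y
    + weylVec N c₁ c₂ c₃ i * f y

section PerDunkl

variable {N : ℕ} {x₀ : Fin N → ℂ} (c₁ c₂ c₃ : ℂ) (i : Fin N) {f : (Fin N → ℂ) → ℂ}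

theorem divFun_reflDiff_analyticAt (hf : ∀ x ∈ orbit x₀, AnalyticAt ℂ f x)
    (hp : IsPeriodicNear x₀ f) (α : posRoots N) {x : Fin N → ℂ} (hx : x ∈ orbit x₀) :
    AnalyticAt ℂ (divFun α.1 (reflDiff α.1 f)) x :=
  divFun_analyticAt α.2 (reflDiff_analyticAt α.2 hf hx) (reflDiff_eq_zero α.2 hp hx)

theorem perDunkl_analyticAt (hf : ∀ x ∈ orbit x₀, AnalyticAt ℂ f x)
    (hp : IsPeriodicNear x₀ f) {x : Fin N → ℂ} (hx : x ∈ orbit x₀) :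
    AnalyticAt ℂ (perDunkl c₁ c₂ c₃ i f) x := by
  refine ((AnalyticAt.dirDeriv (hf x hx) _).sub ?_).add (analyticAt_const.mul (hf x hx))
  apply Finset.analyticAt_fun_sum
  intro α _
  exact analyticAt_const.mul (divFun_reflDiff_analyticAt hf hp α hx)

theorem perDunkl_periodic (hp : IsPeriodicNear x₀ f) :
    IsPeriodicNear x₀ (perDunkl c₁ c₂ c₃ i f) := by
  intro x hx x' hx' h
  have h1 : ∀ᶠ y in 𝓝 x, ∀ α : posRoots N, divFun α.1 (reflDiff α.1 f) (y + x' - x) =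
      divFun α.1 (reflDiff α.1 f) y :=
    eventually_all.2 fun α => divFun_periodic α.1 (reflDiff_periodic α.2 hp) x hx x' hx' h
  filter_upwards [hp x hx x' hx' h, fderiv_periodic hp (Pi.single i 1) x hx x' hx' h, h1]
    with y e1 e2 e3
  simp only [perDunkl, e1, e2, e3]

theorem dunkl_toReg (hf : ∀ x ∈ orbit x₀, AnalyticAt ℂ f x) (hp : IsPeriodicNear x₀ f) :
    dunkl x₀ c₁ c₂ c₃ i (toReg x₀ (PerGerm.mk f hf hp)) =
      toReg x₀ (PerGerm.mk (perDunkl c₁ c₂ c₃ i f)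
        (fun _ hx => perDunkl_analyticAt c₁ c₂ c₃ i hf hp hx)
        (perDunkl_periodic c₁ c₂ c₃ i hp)) := by
  rw [toReg_mk, toReg_mk, dunkl]
  simp only [LinearMap.add_apply, LinearMap.sub_apply, LinearMap.sum_apply, LinearMap.smul_apply,
    Module.End.mul_apply, Module.End.one_apply, act_mk, AnGerm.mk_sub, mulAn_mk, AnGerm.mk_smul,
    dirDeriv_mk]
  rw [AnGerm.mk_sum, AnGerm.mk_sub, AnGerm.mk_add, AnGerm.mk_eq_mk]
  filter_upwards [regSet_mem_nearReg x₀] with y hy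
  simp only [perDunkl]
  congr 2
  refine sum_congr rfl fun α _ => ?_
  rw [divFun, if_neg (hy α.1 α.2), sRefl_inv]
  rfl

end PerDunkl

/-- Operators on germs at the regular points that preserve the periodic germs. -/
def PreservesPer {N : ℕ} {x₀ : Fin N → ℂ} (h : Module.End ℂ (AnGerm (nearReg x₀))) : Prop :=
  ∀ F, ∃ G, toReg x₀ G = h (toReg x₀ F)

theorem preservesPer_cherednik {N : ℕ} {x₀ : Fin N → ℂ} {c₁ c₂ c₃ : ℂ}
    {h : Module.End ℂ (AnGerm (nearReg x₀))} (hh : h ∈ cherednik x₀ c₁ c₂ c₃) :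
    PreservesPer h := by
  induction hh using Algebra.adjoin_induction with
  | mem h hh =>
    intro F
    obtain ⟨f, hf, hp, rfl⟩ := PerGerm.exists_mk F
    rcases hh with (⟨w, rfl⟩ | ⟨p, rfl⟩) | ⟨i, rfl⟩
    · exact ⟨PerGerm.mk (fun y => f ((w⁻¹).1 y))
        (fun x hx => analyticAt_comp_W w⁻¹ (hf _ (orbit_mapsTo x₀ w⁻¹ hx))) (hp.comp_W w⁻¹), rfl⟩
    · refine ⟨PerGerm.mk (fun y => exp (pairing p y) * f y)
        (fun x hx => (analyticAt_pairing p x).cexp.mul (hf x hx)) ?_, rfl⟩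
      intro x hx x' hx' h
      filter_upwards [hp x hx x' hx' h] with y hy
      rw [hy, add_sub_assoc, pairing_vadd, Complex.exp_add, exp_pairing_sub_of_latEq h, mul_one]
    · exact ⟨_, (dunkl_toReg c₁ c₂ c₃ i hf hp).symm⟩
  | algebraMap r => exact fun F => ⟨r • F, by rw [map_smul]; rfl⟩
  | add h h' _ _ ih ih' =>
    intro F
    obtain ⟨G, hG⟩ := ih F
    obtain ⟨G', hG'⟩ := ih' F
    exact ⟨G + G', by rw [map_add, hG, hG']; rfl⟩
  | mul h h' _ _ ih ih' =>
    intro F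
    obtain ⟨G, hG⟩ := ih' F
    obtain ⟨G', hG'⟩ := ih G
    exact ⟨G', by rw [hG', hG]; rfl⟩

/-- The operator induced on periodic germs. -/
def liftPer {N : ℕ} {x₀ : Fin N → ℂ} (h : Module.End ℂ (AnGerm (nearReg x₀)))
    (hh : PreservesPer h) : Module.End ℂ (PerGerm x₀) :=
  (LinearEquiv.ofInjective (toReg x₀) (toReg_injective x₀)).symm.toLinearMap ∘ₗ
    (h ∘ₗ toReg x₀).codRestrict (LinearMap.range (toReg x₀)) (fun F => hh F)

theorem toReg_liftPer {N : ℕ} {x₀ : Fin N → ℂ} (h : Module.End ℂ (AnGerm (nearReg x₀)))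
    (hh : PreservesPer h) (F : PerGerm x₀) : toReg x₀ (liftPer h hh F) = h (toReg x₀ F) := by
  have := LinearEquiv.apply_symm_apply (LinearEquiv.ofInjective (toReg x₀) (toReg_injective x₀))
    ((h ∘ₗ toReg x₀).codRestrict (LinearMap.range (toReg x₀)) (fun F => hh F) F)
  exact congrArg Subtype.val this

section Tensor

variable {N : ℕ} {x₀ : Fin N → ℂ} {U : Type*} [AddCommGroup U] [Module ℂ U]

theorem toRegU_lTensor_liftPer (h : Module.End ℂ (AnGerm (nearReg x₀))) (hh : PreservesPer h)
    (T : U ⊗[ℂ] PerGerm x₀) :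
    toRegU x₀ U (lTensor U (liftPer h hh) T) = lTensor U h (toRegU x₀ U T) := by
  rw [toRegU, ← LinearMap.comp_apply, ← LinearMap.comp_apply, ← LinearMap.lTensor_comp,
    ← LinearMap.lTensor_comp]
  congr 2
  exact LinearMap.ext fun F => toReg_liftPer h hh F

theorem toRegU_injective (x₀ : Fin N → ℂ) (U : Type*) [AddCommGroup U] [Module ℂ U] :
    Function.Injective (toRegU x₀ U) :=
  Module.Flat.lTensor_preserves_injective_linearMap _ (toReg_injective x₀)

theorem isInvariant_CpU (c₁ c₂ c₃ : ℂ) : IsInvariant c₁ c₂ c₃ (CpU x₀ U) := by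
  rintro h hh _ ⟨T, rfl⟩
  exact ⟨_, toRegU_lTensor_liftPer h (preservesPer_cherednik hh) T⟩

theorem toRegU_mem_IpU {k m l₁ l₂ : ℕ} {T : U ⊗[ℂ] PerGerm x₀} :
    toRegU x₀ U T ∈ IpU k m l₁ l₂ x₀ U ↔
      lTensor U (resStratum k m l₁ l₂ x₀) T = 0 := by
  constructor
  · rintro ⟨T', hT', h⟩
    rw [← toRegU_injective x₀ U h]
    exact hT'
  · intro h
    exact ⟨T, h, rfl⟩

theorem tmul_eq_zero_of_left_ne_zero {M : Type*} [AddCommGroup M] [Module ℂ M] {u : U} (hu : u ≠ 0)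
    {F : M} (h : u ⊗ₜ[ℂ] F = 0) : F = 0 := by
  obtain ⟨φ, hφ⟩ := Module.Projective.exists_dual_eq_one ℂ hu
  have := congrArg (fun t => TensorProduct.lid ℂ M (rTensor M φ t)) h
  simpa [hφ] using this

/-- Invariance of the `U`-valued space `𝓘^p` reduces to the scalar case. -/
theorem isInvariant_IpU_iff [Nontrivial U] (k m l₁ l₂ : ℕ) (c₁ c₂ c₃ : ℂ) :
    IsInvariant c₁ c₂ c₃ (IpU k m l₁ l₂ x₀ U) ↔
      ∀ h ∈ cherednik x₀ c₁ c₂ c₃, ∀ F G : PerGerm x₀, resStratum k m l₁ l₂ x₀ F = 0 →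
        toReg x₀ G = h (toReg x₀ F) → resStratum k m l₁ l₂ x₀ G = 0 := by
  constructor
  · intro H h hh F G hF hG
    obtain ⟨u, hu⟩ := exists_ne (0 : U)
    have h1 : toRegU x₀ U (u ⊗ₜ F) ∈ IpU k m l₁ l₂ x₀ U := by
      rw [toRegU_mem_IpU, LinearMap.lTensor_tmul, hF, tmul_zero]
    have h2 := H h hh _ h1
    rw [toRegU, LinearMap.lTensor_tmul, LinearMap.lTensor_tmul, ← hG, ← LinearMap.lTensor_tmul,
      ← toRegU, toRegU_mem_IpU, LinearMap.lTensor_tmul] at h2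
    exact tmul_eq_zero_of_left_ne_zero hu h2
  · rintro H h hh _ ⟨T, hT, rfl⟩
    rw [← toRegU_lTensor_liftPer h (preservesPer_cherednik hh), toRegU_mem_IpU]
    set R := resStratum k m l₁ l₂ x₀
    have h1 : (lTensor U R).ker = (lTensor U R.ker.subtype).range :=
      Module.Flat.ker_lTensor_eq ℂ U R
    have h2 : T ∈ (lTensor U R.ker.subtype).range := h1 ▸ hT
    obtain ⟨T', rfl⟩ := h2
    rw [← LinearMap.comp_apply, ← LinearMap.comp_apply, ← LinearMap.lTensor_comp,
      ← LinearMap.lTensor_comp]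
    have h3 : R ∘ₗ liftPer h (preservesPer_cherednik hh) ∘ₗ R.ker.subtype = 0 :=
      LinearMap.ext fun F => H h hh F.1 _ F.2 (toReg_liftPer _ _ _)
    rw [LinearMap.comp_assoc, h3, LinearMap.lTensor_zero]
    rfl

end Tensor

/-! ### Sums over the positive roots -/

section RootSums

variable {N : ℕ}

/-- The vector `e_i`. -/
abbrev eV (i : Fin N) : Fin N → ℤ := Pi.single i 1

theorem single_ne_two_single (i j : Fin N) : eV i ≠ 2 • eV j := fun h => by
  have := congrArg normSq h
  rw [normSq_single, normSq_two_single] at this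
  omega

theorem sum_posRoots {M : Type*} [AddCommGroup M] (K : (Fin N → ℤ) → M) :
    ∑ α ∈ posRoots N, K α = ∑ i, K (eV i) + ∑ i, K (2 • eV i) +
      ∑ i, ∑ j, if i < j then K (eV i - eV j) + K (eV i + eV j) else 0 := by
  have inj1 : Function.Injective (fun i : Fin N => eV i) := fun i j h => by
    by_contra hij
    have := congrFun h i
    simp [hij] at this
  have inj2 : Function.Injective (fun i : Fin N => 2 • eV i) := fun i j h => inj1 (by
    funext a
    have := congrFun h a
    simp only [Pi.smul_apply, nsmul_eq_mul] at this
    exact mul_left_cancel₀ two_ne_zero this)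
  have inj3 : Set.InjOn (fun p : Fin N × Fin N => eV p.1 - eV p.2)
      (univ.filter fun p : Fin N × Fin N => p.1 < p.2) := by
    rintro ⟨i, j⟩ hij ⟨k, l⟩ hkl h
    simp only [Finset.coe_filter, mem_univ, true_and] at hij hkl
    change i < j at hij
    change k < l at hkl
    have h1 := congrFun h i
    have h2 := congrFun h j
    simp only [Pi.sub_apply, Pi.single_apply, hij.ne, hij.ne', if_true, if_false] at h1 h2
    have e1 : i = k := by
      by_contra hik
      rw [if_neg hik] at h1
      split_ifs at h1 <;> omega
    have e2 : j = l := by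
      by_contra hjl
      rw [if_neg hjl] at h2
      split_ifs at h2 <;> omega
    rw [e1, e2]
  have inj4 : Set.InjOn (fun p : Fin N × Fin N => eV p.1 + eV p.2)
      (univ.filter fun p : Fin N × Fin N => p.1 < p.2) := by
    rintro ⟨i, j⟩ hij ⟨k, l⟩ hkl h
    simp only [Finset.coe_filter, mem_univ, true_and] at hij hkl
    change i < j at hij
    change k < l at hkl
    have h1 := congrFun h i
    have h2 := congrFun h j
    simp only [Pi.add_apply, Pi.single_apply, hij.ne, hij.ne', if_true, if_false] at h1 h2
    have e1 : i = k ∨ i = l := by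
      by_contra hik
      rw [not_or] at hik
      rw [if_neg hik.1, if_neg hik.2] at h1
      omega
    have e2 : j = k ∨ j = l := by
      by_contra hjl
      rw [not_or] at hjl
      rw [if_neg hjl.1, if_neg hjl.2] at h2
      omega
    rcases e1 with rfl | rfl <;> rcases e2 with rfl | rfl
    · exact absurd hij (lt_irrefl _)
    · rfl
    · exact absurd (hij.trans hkl) (lt_irrefl _)
    · exact absurd hij (lt_irrefl _)
  have sumNe : ∀ {i j : Fin N}, i < j → ∑ a, (eV i + eV j) a = 2 := fun {i j} _ => by
    simp [sum_add_distrib]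
  have sumNe' : ∀ {i j : Fin N}, i < j → ∑ a, (eV i - eV j) a = 0 := fun {i j} _ => by
    simp [sum_sub_distrib]
  have d1 : Disjoint (univ.image fun i : Fin N => eV i)
      (univ.image fun i : Fin N => 2 • eV i) := by
    rw [disjoint_left]
    rintro _ h h'
    obtain ⟨i, -, rfl⟩ := mem_image.1 h
    obtain ⟨j, -, h2⟩ := mem_image.1 h'
    exact single_ne_two_single _ _ h2.symm
  have d2 : Disjoint ((univ.image fun i : Fin N => eV i) ∪
      (univ.image fun i : Fin N => 2 • eV i))
      ((univ.filter fun p : Fin N × Fin N => p.1 < p.2).image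
        fun p => eV p.1 - eV p.2) := by
    rw [disjoint_left]
    rintro _ h h'
    obtain ⟨p, hp, rfl⟩ := mem_image.1 h'
    have hkl' : p.1 < p.2 := (mem_filter.1 hp).2
    have e := normSq_sub hkl'.ne
    rcases mem_union.1 h with h | h
    · obtain ⟨i, -, h2⟩ := mem_image.1 h
      rw [← h2, normSq_single] at e
      omega
    · obtain ⟨i, -, h2⟩ := mem_image.1 h
      rw [← h2, normSq_two_single] at e
      omega
  have d3 : Disjoint ((univ.image fun i : Fin N => eV i) ∪
      (univ.image fun i : Fin N => 2 • eV i) ∪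
      ((univ.filter fun p : Fin N × Fin N => p.1 < p.2).image
        fun p => eV p.1 - eV p.2))
      ((univ.filter fun p : Fin N × Fin N => p.1 < p.2).image
        fun p => eV p.1 + eV p.2) := by
    rw [disjoint_left]
    rintro _ h h'
    obtain ⟨p, hp, rfl⟩ := mem_image.1 h'
    have hkl' : p.1 < p.2 := (mem_filter.1 hp).2
    have e := normSq_add hkl'.ne
    rcases mem_union.1 h with h | h
    · rcases mem_union.1 h with h | h
      · obtain ⟨i, -, h2⟩ := mem_image.1 h
        rw [← h2, normSq_single] at e
        omega
      · obtain ⟨i, -, h2⟩ := mem_image.1 h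
        rw [← h2, normSq_two_single] at e
        omega
    · obtain ⟨q, hq, h2⟩ := mem_image.1 h
      have hij' : q.1 < q.2 := (mem_filter.1 hq).2
      have e1 := sumNe hkl'
      have e2 := sumNe' hij'
      rw [h2] at e2
      omega
  rw [posRoots, sum_union d3, sum_union d2, sum_union d1,
    sum_image inj1.injOn, sum_image inj2.injOn, sum_image inj3,
    sum_image inj4, add_assoc (_ + _)]
  congr 1
  rw [← sum_add_distrib, sum_filter, ← univ_product_univ, sum_product]

/-- The root `e_i - e_k` or `e_k - e_i`, whichever is positive. -/
def eM (i k : Fin N) : Fin N → ℤ := if i < k then eV i - eV k else eV k - eV i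

/-- The root `e_i + e_k`. -/
def eP (i k : Fin N) : Fin N → ℤ := eV i + eV k

/-- The sign of `e_i - e_k`. -/
def sgn (i k : Fin N) : ℂ := if i < k then 1 else -1

theorem eP_comm (i k : Fin N) : eP i k = eP k i := add_comm _ _

theorem eV_mem (i : Fin N) : eV i ∈ posRoots N := mem_posRoots.2 (Or.inl ⟨i, rfl⟩)

theorem two_eV_mem (i : Fin N) : 2 • eV i ∈ posRoots N :=
  mem_posRoots.2 (Or.inr (Or.inl ⟨i, rfl⟩))

theorem eM_mem {i k : Fin N} (h : i ≠ k) : eM i k ∈ posRoots N := by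
  unfold eM
  split_ifs with h'
  · exact mem_posRoots.2 (Or.inr (Or.inr (Or.inl ⟨i, k, h', rfl⟩)))
  · exact mem_posRoots.2 (Or.inr (Or.inr (Or.inl ⟨k, i, lt_of_le_of_ne (not_lt.1 h') h.symm, rfl⟩)))

theorem eP_mem {i k : Fin N} (h : i ≠ k) : eP i k ∈ posRoots N := by
  rcases lt_or_gt_of_ne h with h' | h'
  · exact mem_posRoots.2 (Or.inr (Or.inr (Or.inr ⟨i, k, h', rfl⟩)))
  · exact mem_posRoots.2 (Or.inr (Or.inr (Or.inr ⟨k, i, h', add_comm _ _⟩)))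

theorem mult_eV (c₁ c₂ c₃ : ℂ) (i : Fin N) : mult c₁ c₂ c₃ (eV i) = c₂ := by
  rw [mult, normSq_single, if_pos rfl]

theorem mult_two_eV (c₁ c₂ c₃ : ℂ) (i : Fin N) : mult c₁ c₂ c₃ (2 • eV i) = c₃ := by
  rw [mult, normSq_two_single, if_neg (by norm_num), if_pos rfl]

theorem normSq_eM {i k : Fin N} (h : i ≠ k) : normSq (eM i k) = 2 := by
  unfold eM
  split_ifs
  · exact normSq_sub h
  · exact normSq_sub h.symm

theorem normSq_eP {i k : Fin N} (h : i ≠ k) : normSq (eP i k) = 2 := normSq_add h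

theorem mult_eM (c₁ c₂ c₃ : ℂ) {i k : Fin N} (h : i ≠ k) : mult c₁ c₂ c₃ (eM i k) = c₁ := by
  rw [mult, normSq_eM h, if_neg (by norm_num), if_neg (by norm_num)]

theorem mult_eP (c₁ c₂ c₃ : ℂ) {i k : Fin N} (h : i ≠ k) : mult c₁ c₂ c₃ (eP i k) = c₁ := by
  rw [mult, normSq_eP h, if_neg (by norm_num), if_neg (by norm_num)]

/-- Sums over the positive roots, weighted by a coordinate of the root. -/
theorem sum_posRoots_coord {M : Type*} [AddCommGroup M] [Module ℂ M] (i : Fin N)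
    (K : (Fin N → ℤ) → M) :
    ∑ α ∈ posRoots N, (α i : ℂ) • K α = K (eV i) + (2 : ℂ) • K (2 • eV i) +
      ∑ k ∈ univ.erase i, (sgn i k • K (eM i k) + K (eP i k)) := by
  rw [sum_posRoots]
  congr 1
  · congr 1
    · rw [sum_eq_single i]
      · simp
      · intro j _ hj
        simp [hj.symm]
      · simp
    · rw [sum_eq_single i]
      · simp
      · intro j _ hj
        simp [hj.symm]
      · simp
  · have e1 : ∀ a b : Fin N, (if a < b then ((eV a - eV b) i : ℂ) • K (eV a - eV b) +
        ((eV a + eV b) i : ℂ) • K (eV a + eV b) else 0) =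
        (if a = i then (if i < b then K (eV i - eV b) + K (eV i + eV b) else 0) else 0) +
        (if b = i then (if a < i then -K (eV a - eV i) + K (eV a + eV i) else 0) else 0) := by
      intro a b
      by_cases hab : a < b
      · by_cases ha : a = i
        · subst ha
          simp [hab, hab.ne', hab.ne]
        · by_cases hb : b = i
          · subst hb
            simp [hab, hab.ne]
          · simp [hab, ha, hb, Ne.symm ha, Ne.symm hb]
      · by_cases ha : a = i
        · subst ha
          by_cases hb : b = a
          · subst hb; simp
          · simp [hab, hb]
        · by_cases hb : b = i
          · subst hb
            simp [hab, ha]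
          · simp [hab, ha, hb]
    rw [sum_congr rfl fun a _ => sum_congr rfl fun b _ => e1 a b]
    simp only [sum_add_distrib]
    have e2 : ∑ a, ∑ b : Fin N, (if a = i then
        (if i < b then K (eV i - eV b) + K (eV i + eV b) else 0) else 0) =
        ∑ b, (if i < b then K (eV i - eV b) + K (eV i + eV b) else 0) := by
      rw [sum_comm]
      exact sum_congr rfl fun b _ => by simp
    have e3 : ∑ a, ∑ b : Fin N, (if b = i then
        (if a < i then -K (eV a - eV i) + K (eV a + eV i) else 0) else 0) =
        ∑ a, (if a < i then -K (eV a - eV i) + K (eV a + eV i) else 0) :=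
      sum_congr rfl fun b _ => by simp
    rw [e2, e3, ← sum_add_distrib, ← sum_add_distrib,
      ← add_sum_erase _ _ (mem_univ i)]
    simp only [lt_irrefl, if_false, add_zero, zero_add]
    refine sum_congr rfl fun k hk => ?_
    have hki : k ≠ i := ne_of_mem_erase hk
    rcases lt_or_gt_of_ne hki with h | h
    · simp [h, h.not_gt, sgn, eM, eP, add_comm]
    · simp [h, h.not_gt, sgn, eM, eP]

end RootSums

/-! ### The operators `(1 - e^{-α})⁻¹ (1 - s_α)` -/

section ROp

variable {N : ℕ} {x₀ : Fin N → ℂ}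

/-- The operator `(1 - e^{-α})⁻¹ (1 - s_α)`. -/
def rOp (x₀ : Fin N → ℂ) (α : Fin N → ℤ) : Module.End ℂ (AnGerm (nearReg x₀)) :=
  if h : α ∈ posRoots N then
    mulAn (dunklCoef α) (analyticAt_dunklCoef x₀ h) * (1 - act x₀ (sRefl ⟨α, h⟩)) else 0

/-- The function `1 / (1 - e^{-t})`. -/
def aF (t : ℂ) : ℂ := 1 / (1 - exp (-t))

/-- `rOp` on functions. -/
def rFun (α : Fin N → ℤ) (f : (Fin N → ℂ) → ℂ) (y : Fin N → ℂ) : ℂ :=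
  aF (pairing α y) * (f y - f (refl α y))

theorem ev_rFun {α : Fin N → ℤ} (hα : α ∈ posRoots N) {f : (Fin N → ℂ) → ℂ}
    (hf : ∀ᶠ y in nearReg x₀, AnalyticAt ℂ f y) :
    ∀ᶠ y in nearReg x₀, AnalyticAt ℂ (rFun α f) y :=
  ev_mul (analyticAt_dunklCoef x₀ hα) (ev_sub hf (ev_comp_W (sRefl ⟨α, hα⟩) hf))

theorem rOp_mk {α : Fin N → ℤ} (hα : α ∈ posRoots N) {f : (Fin N → ℂ) → ℂ}
    (hf : ∀ᶠ y in nearReg x₀, AnalyticAt ℂ f y) :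
    rOp x₀ α (AnGerm.mk f hf) = AnGerm.mk (rFun α f) (ev_rFun hα hf) := by
  rw [rOp, dif_pos hα]
  rfl

end ROp

/-! ### Relations between the zero-order operators -/

theorem aF_neg {t : ℂ} (h : exp t ≠ 1) : aF (-t) = 1 - aF t := by
  have h1 : 1 - exp t ≠ 0 := sub_ne_zero.2 (Ne.symm h)
  have h2 : exp t - 1 ≠ 0 := sub_ne_zero.2 h
  have h3 := Complex.exp_ne_zero t
  have h4 : aF t = exp t / (exp t - 1) := by
    rw [aF, Complex.exp_neg, inv_eq_one_div, one_sub_div h3, one_div_div]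
  rw [h4, aF, neg_neg]
  field_simp
  ring

theorem aF_mul {s t : ℂ} (hs : exp s ≠ 1) (ht : exp t ≠ 1)
    (hst : exp (s + t) ≠ 1) : aF s * aF t = aF (s + t) * (aF s + aF t - 1) := by
  have h0 : ∀ {z : ℂ}, exp z ≠ 1 → aF z = exp z / (exp z - 1) := by
    intro z hz
    have h1 : exp z - 1 ≠ 0 := sub_ne_zero.2 hz
    have h2 := Complex.exp_ne_zero z
    rw [aF, Complex.exp_neg, inv_eq_one_div, one_sub_div h2, one_div_div]
  rw [h0 hs, h0 ht, h0 hst]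
  have h1 : exp s - 1 ≠ 0 := sub_ne_zero.2 hs
  have h2 : exp t - 1 ≠ 0 := sub_ne_zero.2 ht
  have h3 : exp (s + t) - 1 ≠ 0 := sub_ne_zero.2 hst
  rw [Complex.exp_add] at h3 ⊢
  field_simp
  ring

section Points

variable {N : ℕ}

theorem pairing_eV (i : Fin N) (y : Fin N → ℂ) : pairing (eV i) y = y i := pairing_single i y

theorem pairing_two_eV (i : Fin N) (y : Fin N → ℂ) : pairing (2 • eV i) y = 2 * y i := by
  rw [two_smul, pairing_add, pairing_single, two_mul]

theorem pairing_eV_sub (i k : Fin N) (y : Fin N → ℂ) : pairing (eV i - eV k) y = y i - y k := by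
  rw [pairing_sub, pairing_single, pairing_single]

theorem pairing_eP (i k : Fin N) (y : Fin N → ℂ) : pairing (eP i k) y = y i + y k := by
  rw [eP, pairing_add, pairing_single, pairing_single]

theorem refl_eV_apply (i : Fin N) (y : Fin N → ℂ) (a : Fin N) :
    refl (eV i) y a = if a = i then - y i else y a := by
  rw [refl_apply, pairing_single, normSq_single]
  by_cases h : a = i
  · subst h; simp; ring
  · simp [h]

theorem refl_two_eV (i : Fin N) : refl (2 • eV i) = refl (eV i) := by
  refine LinearEquiv.ext fun y => funext fun a => ?_
  rw [refl_eV_apply, refl_apply, pairing_two_eV, normSq_two_single]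
  by_cases h : a = i
  · subst h; simp; ring
  · simp [h]

theorem refl_eV_sub_apply {i k : Fin N} (hik : i ≠ k) (y : Fin N → ℂ) (a : Fin N) :
    refl (eV i - eV k) y a = if a = i then y k else if a = k then y i else y a := by
  rw [refl_apply, pairing_eV_sub, normSq_sub hik]
  by_cases h : a = i
  · subst h; simp [hik]
  · by_cases h' : a = k
    · subst h'; simp [h]
    · simp [h, h']

theorem refl_eP_apply {i k : Fin N} (hik : i ≠ k) (y : Fin N → ℂ) (a : Fin N) :
    refl (eP i k) y a = if a = i then -y k else if a = k then -y i else y a := by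
  rw [refl_apply, pairing_eP, normSq_eP hik]
  by_cases h : a = i
  · subst h; simp [hik, eP]
  · by_cases h' : a = k
    · subst h'; simp [h, eP]
    · simp [h, h', eP]

/-- The point `y` with the coordinates `i, j, k` replaced by `p, q, r`. -/
def pt (i j k : Fin N) (y : Fin N → ℂ) (p q r : ℂ) : Fin N → ℂ := fun a =>
  if a = i then p else if a = j then q else if a = k then r else y a

theorem pt_self (i j k : Fin N) (y : Fin N → ℂ) : pt i j k y (y i) (y j) (y k) = y := by
  funext a
  simp only [pt]
  split_ifs with h1 h2 h3
  · rw [h1]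
  · rw [h2]
  · rw [h3]
  · rfl

variable {i j k : Fin N} (y : Fin N → ℂ) (p q r : ℂ) (f : (Fin N → ℂ) → ℂ)

theorem rFun_sub12 (hij : i ≠ j) : rFun (eV i - eV j) f (pt i j k y p q r) =
    aF (p - q) * (f (pt i j k y p q r) - f (pt i j k y q p r)) := by
  have : refl (eV i - eV j) (pt i j k y p q r) = pt i j k y q p r := by
    funext a
    rw [refl_eV_sub_apply hij]
    simp only [pt]
    split_ifs <;> simp_all
  rw [rFun, this, pairing_eV_sub]
  simp [pt, hij.symm]

theorem rFun_sub13 (hij : i ≠ j) (hik : i ≠ k) (hjk : j ≠ k) :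
    rFun (eV i - eV k) f (pt i j k y p q r) =
    aF (p - r) * (f (pt i j k y p q r) - f (pt i j k y r q p)) := by
  have : refl (eV i - eV k) (pt i j k y p q r) = pt i j k y r q p := by
    funext a
    rw [refl_eV_sub_apply hik]
    simp only [pt]
    split_ifs <;> simp_all
  rw [rFun, this, pairing_eV_sub]
  simp [pt, hik.symm, hjk.symm]

theorem rFun_sub23 (hij : i ≠ j) (hik : i ≠ k) (hjk : j ≠ k) :
    rFun (eV j - eV k) f (pt i j k y p q r) =
    aF (q - r) * (f (pt i j k y p q r) - f (pt i j k y p r q)) := by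
  have : refl (eV j - eV k) (pt i j k y p q r) = pt i j k y p r q := by
    funext a
    rw [refl_eV_sub_apply hjk]
    simp only [pt]
    split_ifs <;> simp_all
  rw [rFun, this, pairing_eV_sub]
  simp [pt, hik.symm, hjk.symm, hij.symm]

theorem rFun_add12 (hij : i ≠ j) : rFun (eP i j) f (pt i j k y p q r) =
    aF (p + q) * (f (pt i j k y p q r) - f (pt i j k y (-q) (-p) r)) := by
  have : refl (eP i j) (pt i j k y p q r) = pt i j k y (-q) (-p) r := by
    funext a
    rw [refl_eP_apply hij]
    simp only [pt]
    split_ifs <;> simp_all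
  rw [rFun, this, pairing_eP]
  simp [pt, hij.symm]

theorem rFun_add13 (hij : i ≠ j) (hik : i ≠ k) (hjk : j ≠ k) :
    rFun (eP i k) f (pt i j k y p q r) =
    aF (p + r) * (f (pt i j k y p q r) - f (pt i j k y (-r) q (-p))) := by
  have : refl (eP i k) (pt i j k y p q r) = pt i j k y (-r) q (-p) := by
    funext a
    rw [refl_eP_apply hik]
    simp only [pt]
    split_ifs <;> simp_all
  rw [rFun, this, pairing_eP]
  simp [pt, hik.symm, hjk.symm]

theorem rFun_add23 (hij : i ≠ j) (hik : i ≠ k) (hjk : j ≠ k) :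
    rFun (eP j k) f (pt i j k y p q r) =
    aF (q + r) * (f (pt i j k y p q r) - f (pt i j k y p (-r) (-q))) := by
  have : refl (eP j k) (pt i j k y p q r) = pt i j k y p (-r) (-q) := by
    funext a
    rw [refl_eP_apply hjk]
    simp only [pt]
    split_ifs <;> simp_all
  rw [rFun, this, pairing_eP]
  simp [pt, hik.symm, hjk.symm, hij.symm]

theorem rFun_one : rFun (eV i) f (pt i j k y p q r) =
    aF p * (f (pt i j k y p q r) - f (pt i j k y (-p) q r)) := by
  have : refl (eV i) (pt i j k y p q r) = pt i j k y (-p) q r := by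
    funext a
    rw [refl_eV_apply]
    simp only [pt]
    split_ifs <;> simp_all
  rw [rFun, this, pairing_eV]
  simp [pt]

theorem rFun_two (hij : i ≠ j) : rFun (eV j) f (pt i j k y p q r) =
    aF q * (f (pt i j k y p q r) - f (pt i j k y p (-q) r)) := by
  have : refl (eV j) (pt i j k y p q r) = pt i j k y p (-q) r := by
    funext a
    rw [refl_eV_apply]
    simp only [pt]
    split_ifs <;> simp_all
  rw [rFun, this, pairing_eV]
  simp [pt, hij.symm]

theorem rFun_dbl_one : rFun (2 • eV i) f (pt i j k y p q r) =
    aF (2 * p) * (f (pt i j k y p q r) - f (pt i j k y (-p) q r)) := by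
  have : refl (eV i) (pt i j k y p q r) = pt i j k y (-p) q r := by
    funext a
    rw [refl_eV_apply]
    simp only [pt]
    split_ifs <;> simp_all
  rw [rFun, refl_two_eV, this, pairing_two_eV]
  simp [pt]

theorem rFun_dbl_two (hij : i ≠ j) : rFun (2 • eV j) f (pt i j k y p q r) =
    aF (2 * q) * (f (pt i j k y p q r) - f (pt i j k y p (-q) r)) := by
  have : refl (eV j) (pt i j k y p q r) = pt i j k y p (-q) r := by
    funext a
    rw [refl_eV_apply]
    simp only [pt]
    split_ifs <;> simp_all
  rw [rFun, refl_two_eV, this, pairing_two_eV]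
  simp [pt, hij.symm]

end Points

section ZeroOrder

variable {N : ℕ}

theorem AnGerm.hom_ext {n : ℕ} {l : Filter (Fin n → ℂ)} {A B : Module.End ℂ (AnGerm l)}
    (h : ∀ f hf, A (AnGerm.mk f hf) = B (AnGerm.mk f hf)) : A = B :=
  LinearMap.ext fun F => by
    obtain ⟨f, hf, rfl⟩ := AnGerm.exists_mk F
    exact h f hf

theorem aF_mul' {s t u : ℂ} (hs : exp s ≠ 1) (ht : exp t ≠ 1)
    (hu : exp u ≠ 1) (h : s + t = u) : aF s * aF t - aF u * (aF s + aF t - 1) = 0 := by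
  subst h
  rw [aF_mul hs ht hu, sub_self]

theorem rOp_mul_of_refl_eq (x₀ : Fin N → ℂ) {α β : Fin N → ℤ} (hα : α ∈ posRoots N)
    (hβ : β ∈ posRoots N) (h : refl α = refl β)
    (h' : ∀ y, pairing β (refl α y) = - pairing β y) : rOp x₀ α * rOp x₀ β = rOp x₀ α := by
  refine AnGerm.hom_ext fun f hf => ?_
  rw [Module.End.mul_apply, rOp_mk hβ, rOp_mk hα, rOp_mk hα, AnGerm.mk_eq_mk]
  filter_upwards [regSet_mem_nearReg x₀] with y hy
  have h1 := aF_neg (hy β hβ)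
  simp only [rFun]
  rw [h', h1, ← h, refl_refl]
  ring

theorem pairing_refl (α : Fin N → ℤ) (hα : α ∈ posRoots N) (y : Fin N → ℂ) :
    pairing α (refl α y) = - pairing α y := by
  have : refl α y = y - (2 * pairing α y / (normSq α : ℂ)) • toV α := rfl
  rw [this, pairing_vsub, pairing_vsmul, pairing_toV, div_mul_cancel₀ _ (normSq_ne_zero hα)]
  ring

theorem rOp_mul_self (x₀ : Fin N → ℂ) {α : Fin N → ℤ} (hα : α ∈ posRoots N) :
    rOp x₀ α * rOp x₀ α = rOp x₀ α :=
  rOp_mul_of_refl_eq x₀ hα hα rfl (pairing_refl α hα)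

theorem rOp_eV_mul_two (x₀ : Fin N → ℂ) (i : Fin N) :
    rOp x₀ (eV i) * rOp x₀ (2 • eV i) = rOp x₀ (eV i) :=
  rOp_mul_of_refl_eq x₀ (eV_mem i) (two_eV_mem i) (refl_two_eV i).symm fun y => by
    rw [← refl_two_eV, pairing_refl _ (two_eV_mem i)]

theorem rOp_two_mul_eV (x₀ : Fin N → ℂ) (i : Fin N) :
    rOp x₀ (2 • eV i) * rOp x₀ (eV i) = rOp x₀ (2 • eV i) :=
  rOp_mul_of_refl_eq x₀ (two_eV_mem i) (eV_mem i) (refl_two_eV i) fun y => by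
    rw [refl_two_eV, pairing_refl _ (eV_mem i)]

theorem pairing_refl_of_orthogonal {α β : Fin N → ℤ} (h : pairing α (toV β) = 0)
    (y : Fin N → ℂ) : pairing α (refl β y) = pairing α y := by
  have : refl β y = y - (2 * pairing β y / (normSq β : ℂ)) • toV β := rfl
  rw [this, pairing_vsub, pairing_vsmul, h, mul_zero, sub_zero]

theorem pairing_toV_comm (α β : Fin N → ℤ) : pairing α (toV β) = pairing β (toV α) := by
  simp only [pairing, toV, mul_comm]

theorem commute_rOp_of_orthogonal (x₀ : Fin N → ℂ) {α β : Fin N → ℤ} (hα : α ∈ posRoots N)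
    (hβ : β ∈ posRoots N) (h : pairing α (toV β) = 0) : Commute (rOp x₀ α) (rOp x₀ β) := by
  refine AnGerm.hom_ext fun f hf => ?_
  simp only [Module.End.mul_apply, rOp_mk hβ, rOp_mk hα]
  rw [AnGerm.mk_eq_mk]
  refine Eventually.of_forall fun y => ?_
  have h1 : refl α (refl β y) = refl β (refl α y) := by
    funext i
    simp only [refl_apply]
    rw [pairing_refl_of_orthogonal h, pairing_refl_of_orthogonal (pairing_toV_comm α β ▸ h)]
    ring
  simp only [rFun]
  rw [pairing_refl_of_orthogonal h, pairing_refl_of_orthogonal (pairing_toV_comm α β ▸ h), h1]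
  ring

/-- `rOp` for `± (e_i - e_k)` and `e_i + e_k` together. -/
def eOp (x₀ : Fin N → ℂ) (i k : Fin N) : Module.End ℂ (AnGerm (nearReg x₀)) :=
  sgn i k • rOp x₀ (eM i k) + rOp x₀ (eP i k)

theorem eOp_of_lt (x₀ : Fin N → ℂ) {i k : Fin N} (h : i < k) :
    eOp x₀ i k = rOp x₀ (eV i - eV k) + rOp x₀ (eP i k) := by
  rw [eOp, sgn, eM, if_pos h, if_pos h, one_smul]

theorem eOp_of_gt (x₀ : Fin N → ℂ) {i k : Fin N} (h : k < i) :
    eOp x₀ i k = rOp x₀ (eP k i) - rOp x₀ (eV k - eV i) := by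
  have h1 : (-1 : ℂ) • rOp x₀ (eV k - eV i) = -rOp x₀ (eV k - eV i) :=
    LinearMap.ext fun F => neg_one_smul ℂ (rOp x₀ (eV k - eV i) F)
  rw [eOp, sgn, eM, if_neg h.not_gt, if_neg h.not_gt, h1, eP_comm i k]
  exact neg_add_eq_sub (rOp x₀ (eV k - eV i)) (rOp x₀ (eP k i))

variable {i j k : Fin N}

theorem eM_mem_of_lt (h : i < k) : eV i - eV k ∈ posRoots N :=
  mem_posRoots.2 (Or.inr (Or.inr (Or.inl ⟨i, k, h, rfl⟩)))

structure TripleRel (p q r : ℂ) : Prop where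
  n1 : aF (q - p) = 1 - aF (p - q)
  n2 : aF (r - p) = 1 - aF (p - r)
  n3 : aF (r - q) = 1 - aF (q - r)
  m1 : aF (-q - p) = 1 - aF (p + q)
  m2 : aF (-r - p) = 1 - aF (p + r)
  m3 : aF (-r - q) = 1 - aF (q + r)
  m1' : aF (-p - q) = 1 - aF (p + q)
  m2' : aF (-p - r) = 1 - aF (p + r)
  m3' : aF (-q - r) = 1 - aF (q + r)
  R1 : aF (p - q) * aF (q - r) - aF (p - r) * (aF (p - q) + aF (q - r) - 1) = 0
  R2 : aF (p - q) * aF (q + r) - aF (p + r) * (aF (p - q) + aF (q + r) - 1) = 0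
  R3 : aF (p - r) * aF (q + r) - aF (p + q) * (aF (p - r) + aF (q + r) - 1) = 0
  R4 : aF (q - r) * aF (p + r) - aF (p + q) * (aF (q - r) + aF (p + r) - 1) = 0

theorem tripleRel_of_reg (hij : i ≠ j) (hik : i ≠ k) (hjk : j ≠ k) {z : Fin N → ℂ} {p q r : ℂ}
    (hy : pt i j k z p q r ∈ regSet N) : TripleRel p q r := by
  rw [mem_regSet_iff] at hy
  have h1 := hy.2 i j hij
  have h2 := hy.2 i k hik
  have h3 := hy.2 j k hjk
  simp only [pt, if_true, hij.symm, hik.symm, hjk.symm, if_false] at h1 h2 h3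
  refine ⟨?_, ?_, ?_, ?_, ?_, ?_, ?_, ?_, ?_, ?_, ?_, ?_, ?_⟩
  · rw [← aF_neg h1.1, neg_sub]
  · rw [← aF_neg h2.1, neg_sub]
  · rw [← aF_neg h3.1, neg_sub]
  · rw [← aF_neg h1.2]; congr 1; ring
  · rw [← aF_neg h2.2]; congr 1; ring
  · rw [← aF_neg h3.2]; congr 1; ring
  · rw [← aF_neg h1.2]; congr 1; ring
  · rw [← aF_neg h2.2]; congr 1; ring
  · rw [← aF_neg h3.2]; congr 1; ring
  · exact aF_mul' h1.1 h3.1 h2.1 (by ring)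
  · exact aF_mul' h1.1 h3.2 h2.2 (by ring)
  · exact aF_mul' h2.1 h3.2 h1.2 (by ring)
  · exact aF_mul' h3.1 h2.2 h1.2 (by ring)

/-- The relations between the operators for three indices `i < j < k`. -/
theorem eOp_triple (x₀ : Fin N → ℂ) (hij : i < j) (hjk : j < k) :
    eOp x₀ i j * eOp x₀ j k - eOp x₀ j k * eOp x₀ i j +
      (eOp x₀ i k * eOp x₀ j i - eOp x₀ j i * eOp x₀ i k) +
      (eOp x₀ i k * eOp x₀ j k - eOp x₀ j k * eOp x₀ i k) = 0 ∧
    eOp x₀ i k * eOp x₀ k j - eOp x₀ k j * eOp x₀ i k +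
      (eOp x₀ i j * eOp x₀ k i - eOp x₀ k i * eOp x₀ i j) +
      (eOp x₀ i j * eOp x₀ k j - eOp x₀ k j * eOp x₀ i j) = 0 ∧
    eOp x₀ j k * eOp x₀ k i - eOp x₀ k i * eOp x₀ j k +
      (eOp x₀ j i * eOp x₀ k j - eOp x₀ k j * eOp x₀ j i) +
      (eOp x₀ j i * eOp x₀ k i - eOp x₀ k i * eOp x₀ j i) = 0 ∧
    eOp x₀ i j * eOp x₀ i k + eOp x₀ i k * eOp x₀ i j +
      (eOp x₀ j i * eOp x₀ j k + eOp x₀ j k * eOp x₀ j i) +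
      (eOp x₀ k i * eOp x₀ k j + eOp x₀ k j * eOp x₀ k i) -
      (2 : ℂ) • (eOp x₀ i j + eOp x₀ i k + eOp x₀ j i) = 0 := by
  have hik := hij.trans hjk
  refine ⟨?_, ?_, ?_, ?_⟩
  all_goals
    refine AnGerm.hom_ext fun f hf => ?_
    simp only [eOp_of_lt x₀ hij, eOp_of_lt x₀ hjk, eOp_of_lt x₀ hik, eOp_of_gt x₀ hij,
      eOp_of_gt x₀ hik, eOp_of_gt x₀ hjk, LinearMap.smul_apply,
      LinearMap.add_apply, LinearMap.sub_apply, Module.End.mul_apply,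
      rOp_mk (eM_mem_of_lt hij), rOp_mk (eM_mem_of_lt hik), rOp_mk (eM_mem_of_lt hjk),
      rOp_mk (eP_mem hij.ne), rOp_mk (eP_mem hik.ne), rOp_mk (eP_mem hjk.ne),
      AnGerm.mk_add, AnGerm.mk_sub, AnGerm.mk_smul, LinearMap.zero_apply]
    refine (AnGerm.mk_eq_mk (hg := Eventually.of_forall fun y => analyticAt_const)).2 ?_
    filter_upwards [regSet_mem_nearReg x₀] with y hy
    obtain ⟨z, p, q, r, rfl⟩ : ∃ z p q r, y = pt i j k z p q r :=
      ⟨y, _, _, _, (pt_self i j k y).symm⟩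
    obtain ⟨n1, n2, n3, m1, m2, m3, m1', m2', m3', R1, R2, R3, R4⟩ :=
      tripleRel_of_reg hij.ne hik.ne hjk.ne hy
    obtain ⟨φ, hφ⟩ : ∃ φ : ℂ → ℂ → ℂ → ℂ, ∀ p q r, f (pt i j k z p q r) = φ p q r :=
      ⟨_, fun _ _ _ => rfl⟩
    simp only [rFun_sub12 _ _ _ _ _ hij.ne, rFun_sub13 _ _ _ _ _ hij.ne hik.ne hjk.ne,
      rFun_sub23 _ _ _ _ _ hij.ne hik.ne hjk.ne, rFun_add12 _ _ _ _ _ hij.ne,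
      rFun_add13 _ _ _ _ _ hij.ne hik.ne hjk.ne, rFun_add23 _ _ _ _ _ hij.ne hik.ne hjk.ne, hφ,
      neg_neg, sub_neg_eq_add, neg_add_eq_sub, ← sub_eq_add_neg, add_comm q p,
      add_comm r q, n1, n2, n3, m3, m2', m3']
  · linear_combination (- φ q r p + φ r p q) * R1 +
      (- φ q (-r) (-p) + φ (-r) p (-q)) * R2 + (φ (-q) r (-p) - φ (-r) (-p) q) * R4 +
      (φ (-q) (-r) p - φ r (-p) (-q)) * R3
  · linear_combination (- φ r p q + φ q r p) * R1 +
      (- φ r (-p) (-q) + φ (-q) (-r) p) * R3 + (φ (-r) (-p) q - φ (-q) r (-p)) * R4 +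
      (φ (-r) p (-q) - φ q (-r) (-p)) * R2
  · linear_combination (- φ q r p + φ r p q) * R1 +
      (- φ (-q) r (-p) + φ (-r) (-p) q) * R4 + (φ (-q) (-r) p - φ r (-p) (-q)) * R3 +
      (φ q (-r) (-p) - φ (-r) p (-q)) * R2
  · linear_combination (- 2 * φ p q r + φ r p q + φ q r p) * R1 +
      (- 2 * φ p q r + φ (-r) p (-q) + φ q (-r) (-p)) * R2 +
      (- 2 * φ p q r + φ r (-p) (-q) + φ (-q) (-r) p) * R3 +
      (- 2 * φ p q r + φ (-r) (-p) q + φ (-q) r (-p)) * R4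

/-- The relations between the operators for two indices `i < j`. -/
theorem eOp_pair (x₀ : Fin N → ℂ) (hij : i < j) :
    (eOp x₀ i j * rOp x₀ (eV j) - rOp x₀ (eV j) * eOp x₀ i j +
      (rOp x₀ (eV i) * eOp x₀ j i - eOp x₀ j i * rOp x₀ (eV i)) = 0 ∧
    eOp x₀ i j * rOp x₀ (eV i) + rOp x₀ (eV i) * eOp x₀ i j +
      (eOp x₀ j i * rOp x₀ (eV j) + rOp x₀ (eV j) * eOp x₀ j i) -
      (2 : ℂ) • (rOp x₀ (eV i) + rOp x₀ (eP i j)) = 0) ∧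
    (eOp x₀ i j * rOp x₀ (2 • eV j) - rOp x₀ (2 • eV j) * eOp x₀ i j +
      (rOp x₀ (2 • eV i) * eOp x₀ j i - eOp x₀ j i * rOp x₀ (2 • eV i)) = 0 ∧
    eOp x₀ i j * rOp x₀ (2 • eV i) + rOp x₀ (2 • eV i) * eOp x₀ i j +
      (eOp x₀ j i * rOp x₀ (2 • eV j) + rOp x₀ (2 • eV j) * eOp x₀ j i) -
      (2 : ℂ) • (rOp x₀ (2 • eV i) + rOp x₀ (eP i j)) = 0) := by
  refine ⟨⟨?_, ?_⟩, ⟨?_, ?_⟩⟩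
  all_goals
    refine AnGerm.hom_ext fun f hf => ?_
    simp only [eOp_of_lt x₀ hij, eOp_of_gt x₀ hij, LinearMap.smul_apply,
      LinearMap.add_apply, LinearMap.sub_apply, Module.End.mul_apply,
      rOp_mk (eM_mem_of_lt hij), rOp_mk (eP_mem hij.ne), rOp_mk (eV_mem i), rOp_mk (eV_mem j),
      rOp_mk (two_eV_mem i), rOp_mk (two_eV_mem j),
      AnGerm.mk_add, AnGerm.mk_sub, AnGerm.mk_smul, LinearMap.zero_apply]
    refine (AnGerm.mk_eq_mk (hg := Eventually.of_forall fun y => analyticAt_const)).2 ?_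
    filter_upwards [regSet_mem_nearReg x₀] with y hy
    obtain ⟨z, p, q, r, rfl⟩ : ∃ z p q r, y = pt i j j z p q r :=
      ⟨y, _, _, _, (pt_self i j j y).symm⟩
    rw [mem_regSet_iff] at hy
    have h1 := hy.2 i j hij.ne
    have e1 := hy.1 i
    have e2 := hy.1 j
    simp only [pt, if_true, hij.ne', if_false] at h1 e1 e2
    have d1 : exp p ≠ 1 := fun h => e1 (by rw [two_mul, Complex.exp_add, h, one_mul])
    have d2 : exp q ≠ 1 := fun h => e2 (by rw [two_mul, Complex.exp_add, h, one_mul])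
    have n1 : aF (q - p) = 1 - aF (p - q) := by rw [← aF_neg h1.1, neg_sub]
    have m1 : aF (-q - p) = 1 - aF (p + q) := by rw [← aF_neg h1.2]; congr 1; ring
    have m1' : aF (-p - q) = 1 - aF (p + q) := by rw [← aF_neg h1.2]; congr 1; ring
    have u1 := aF_neg d1
    have u2 := aF_neg d2
    have v1 := aF_neg e1
    have v2 := aF_neg e2
    obtain ⟨φ, hφ⟩ : ∃ φ : ℂ → ℂ → ℂ, ∀ p q, f (pt i j j z p q r) = φ p q :=
      ⟨_, fun _ _ => rfl⟩
    simp only [rFun_sub12 _ _ _ _ _ hij.ne, rFun_add12 _ _ _ _ _ hij.ne, rFun_one,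
      rFun_two _ _ _ _ _ hij.ne, rFun_dbl_one, rFun_dbl_two _ _ _ _ _ hij.ne, hφ,
      neg_neg, sub_neg_eq_add, neg_add_eq_sub, ← sub_eq_add_neg,
      mul_neg, n1, m1', u1, u2, v1, v2]
  · linear_combination (- φ q (-p) + φ (-q) p) * aF_mul' d2 h1.1 d1 (by ring) +
      (- φ q (-p) + φ (-q) p) * aF_mul' d1 d2 h1.2 (by ring)
  · linear_combination (- 2 * φ p q + φ (-q) p + φ q (-p)) * aF_mul' d2 h1.1 d1 (by ring) +
      (- 2 * φ p q + φ (-q) p + φ q (-p)) * aF_mul' d1 d2 h1.2 (by ring)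
  · linear_combination (- φ q (-p) + φ (-q) p) * aF_mul' h1.1 h1.2 e1 (by ring) +
      (- φ q (-p) + φ (-q) p) * aF_mul' e2 h1.1 h1.2 (by ring)
  · linear_combination (- 2 * φ p q + φ (-q) p + φ q (-p)) * aF_mul' h1.1 h1.2 e1 (by ring) +
      (- 2 * φ p q + φ (-q) p + φ q (-p)) * aF_mul' e2 h1.1 h1.2 (by ring)

end ZeroOrder

section Commutators

variable {N : ℕ} (x₀ : Fin N → ℂ)

/-- The directional derivative on germs at the regular points near `W x₀`. -/
abbrev dOp (ξ : Fin N → ℂ) : Module.End ℂ (AnGerm (nearReg x₀)) :=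
  dirDeriv (openBased_nearReg x₀) ξ

section Abstract

variable {A ι : Type*} [Ring A]

theorem ring_add_lie (a b c : A) : ⁅a + b, c⁆ = ⁅a, c⁆ + ⁅b, c⁆ := by
  simp only [Ring.lie_def]; noncomm_ring

theorem ring_lie_add (a b c : A) : ⁅a, b + c⁆ = ⁅a, b⁆ + ⁅a, c⁆ := by
  simp only [Ring.lie_def]; noncomm_ring

theorem ring_sub_lie (a b c : A) : ⁅a - b, c⁆ = ⁅a, c⁆ - ⁅b, c⁆ := by
  simp only [Ring.lie_def]; noncomm_ring

theorem ring_lie_sub (a b c : A) : ⁅a, b - c⁆ = ⁅a, b⁆ - ⁅a, c⁆ := by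
  simp only [Ring.lie_def]; noncomm_ring

theorem ring_sum_lie (S : Finset ι) (X : ι → A) (a : A) :
    ⁅∑ k ∈ S, X k, a⁆ = ∑ k ∈ S, ⁅X k, a⁆ := by
  simp only [Ring.lie_def, sum_mul, mul_sum, sum_sub_distrib]

theorem ring_lie_sum (S : Finset ι) (X : ι → A) (a : A) :
    ⁅a, ∑ k ∈ S, X k⁆ = ∑ k ∈ S, ⁅a, X k⁆ := by
  simp only [Ring.lie_def, sum_mul, mul_sum, sum_sub_distrib]

theorem commute_iff_ring_lie {a b : A} : Commute a b ↔ ⁅a, b⁆ = 0 := by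
  rw [Ring.lie_def, sub_eq_zero]; rfl

theorem commute_add_sub {P Q : A} (h : Commute P Q) : Commute (P + Q) (Q - P) := by
  exact Commute.add_left (Commute.sub_right h (Commute.refl _))
    (Commute.sub_right (Commute.refl _) h.symm)

theorem lie_eq_of_commute {D D' P Q : A} (h1 : Commute (D + D') Q) (h2 : Commute (D - D') P) :
    ⁅D, P - Q⁆ = ⁅D', Q + P⁆ := by
  have h1' := commute_iff_ring_lie.1 h1
  have h2' := commute_iff_ring_lie.1 h2
  simp only [ring_add_lie, ring_sub_lie] at h1' h2'
  simp only [ring_lie_add, ring_lie_sub]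
  linear_combination (norm := abel) h2' - h1'

variable [Algebra ℂ A]

theorem ring_smul_lie (z : ℂ) (a b : A) : ⁅z • a, b⁆ = z • ⁅a, b⁆ := by
  simp only [Ring.lie_def, smul_mul_assoc, mul_smul_comm, smul_sub]

theorem ring_lie_smul (z : ℂ) (a b : A) : ⁅a, z • b⁆ = z • ⁅a, b⁆ := by
  simp only [Ring.lie_def, smul_mul_assoc, mul_smul_comm, smul_sub]

theorem lie_two_terms {r r' e s s' e' : A} (c d : ℂ)
    (h1 : e * s - s * e + (r * e' - e' * r) = 0) (h2 : e * s' - s' * e + (r' * e' - e' * r') = 0) :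
    ⁅c • r + d • r', e'⁆ + ⁅e, c • s + d • s'⁆ = 0 := by
  rw [← Ring.lie_def, ← Ring.lie_def] at h1 h2
  simp only [ring_add_lie, ring_lie_add, ring_smul_lie, ring_lie_smul]
  linear_combination (norm := module) c • h1 + d • h2

theorem commute_of_relations {S : Finset ι} {Fi Fj Eij Eji : A} {X Y : ι → A} (c : ℂ)
    (z1 : Commute Fi Fj) (z2 : ⁅Fi, Eji⁆ + ⁅Eij, Fj⁆ = 0) (z3 : ∀ k ∈ S, Commute Fi (Y k))
    (z4 : ∀ k ∈ S, Commute (X k) Fj) (z5 : Commute Eij Eji)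
    (z6 : ∀ k ∈ S, Eij * Y k - Y k * Eij + (X k * Eji - Eji * X k) + (X k * Y k - Y k * X k) = 0)
    (z7 : ∀ k ∈ S, ∀ l ∈ S, l ≠ k → Commute (X k) (Y l)) :
    Commute (Fi + c • (Eij + ∑ k ∈ S, X k)) (Fj + c • (Eji + ∑ k ∈ S, Y k)) := by
  have y1 : ⁅Fi, Fj⁆ = 0 := commute_iff_ring_lie.1 z1
  have y3 : ⁅Fi, ∑ k ∈ S, Y k⁆ = 0 := by
    rw [ring_lie_sum]
    exact sum_eq_zero fun k hk => commute_iff_ring_lie.1 (z3 k hk)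
  have y4 : ⁅∑ k ∈ S, X k, Fj⁆ = 0 := by
    rw [ring_sum_lie]
    exact sum_eq_zero fun k hk => commute_iff_ring_lie.1 (z4 k hk)
  have y5 : ⁅Eij, Eji⁆ = 0 := commute_iff_ring_lie.1 z5
  have y6 : ⁅Eij, ∑ k ∈ S, Y k⁆ + ⁅∑ k ∈ S, X k, Eji⁆ + ⁅∑ k ∈ S, X k, ∑ k ∈ S, Y k⁆ = 0 := by
    have : ⁅∑ k ∈ S, X k, ∑ k ∈ S, Y k⁆ = ∑ k ∈ S, ⁅X k, Y k⁆ := by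
      rw [ring_sum_lie]
      refine sum_congr rfl fun k hk => ?_
      rw [ring_lie_sum]
      exact sum_eq_single k (fun l hl hlk => commute_iff_ring_lie.1 (z7 k hk l hl hlk))
        (fun h => absurd hk h)
    rw [this, ring_lie_sum, ring_sum_lie, ← sum_add_distrib, ← sum_add_distrib]
    exact sum_eq_zero fun k hk => by simpa only [Ring.lie_def] using z6 k hk
  rw [commute_iff_ring_lie]
  simp only [ring_add_lie, ring_lie_add, ring_smul_lie, ring_lie_smul, y1, y3, y4, y5, zero_add, add_zero]
  linear_combination (norm := module) c • z2 + (c * c) • y6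

theorem lie_smul_sum {i : ι} {S : Finset ι} (hi : i ∈ S) {D F : A} {E : ι → A} (c : ℂ)
    (h1 : Commute D F) (h2 : ∀ k ∈ S, k ≠ i → Commute D (E k)) :
    ⁅D, F + c • ∑ k ∈ S, E k⁆ = c • ⁅D, E i⁆ := by
  rw [ring_lie_add, ring_lie_smul, commute_iff_ring_lie.1 h1, zero_add, ring_lie_sum, sum_eq_single i]
  · exact fun k hk hki => commute_iff_ring_lie.1 (h2 k hk hki)
  · exact fun h => absurd hi h

theorem commute_sub_sub_add_smul {D D' G G' : A} (c c' : ℂ) (h1 : Commute D D')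
    (h2 : Commute G G') (h3 : ⁅D, G'⁆ = ⁅D', G⁆) :
    Commute (D - G + c • (1 : A)) (D' - G' + c' • (1 : A)) := by
  have hs : ∀ (c : ℂ) (X : A), Commute X (c • (1 : A)) :=
    fun c X => (Commute.one_right X).smul_right c
  refine Commute.add_right (Commute.add_left ?_ (hs _ _).symm) (hs _ _)
  rw [commute_iff_ring_lie] at h1 h2 ⊢
  simp only [ring_sub_lie, ring_lie_sub, h1, h2, h3]
  simp only [Ring.lie_def]
  abel

end Abstract

theorem dirDeriv_add {n : ℕ} {l : Filter (Fin n → ℂ)} (hl : OpenBased l) (ξ η : Fin n → ℂ) :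
    dirDeriv hl (ξ + η) = dirDeriv hl ξ + dirDeriv hl η :=
  AnGerm.hom_ext fun f _ => Subtype.ext (Germ.coe_eq.2 (Eventually.of_forall fun y =>
    map_add (fderiv ℂ f y) _ _))

theorem dirDeriv_smul {n : ℕ} {l : Filter (Fin n → ℂ)} (hl : OpenBased l) (c : ℂ)
    (ξ : Fin n → ℂ) : dirDeriv hl (c • ξ) = c • dirDeriv hl ξ :=
  AnGerm.hom_ext fun f _ => Subtype.ext (Germ.coe_eq.2 (Eventually.of_forall fun y =>
    map_smul (fderiv ℂ f y) _ _))

theorem dirDeriv_sub {n : ℕ} {l : Filter (Fin n → ℂ)} (hl : OpenBased l) (ξ η : Fin n → ℂ) :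
    dirDeriv hl (ξ - η) = dirDeriv hl ξ - dirDeriv hl η :=
  AnGerm.hom_ext fun f _ => Subtype.ext (Germ.coe_eq.2 (Eventually.of_forall fun y =>
    map_sub (fderiv ℂ f y) _ _))

theorem dirDeriv_sum {n : ℕ} {l : Filter (Fin n → ℂ)} (hl : OpenBased l) {ι : Type*}
    (s : Finset ι) (ξ : ι → Fin n → ℂ) :
    dirDeriv hl (∑ i ∈ s, ξ i) = ∑ i ∈ s, dirDeriv hl (ξ i) :=
  map_sum (G := (Fin n → ℂ) →+ Module.End ℂ (AnGerm l))
    ⟨⟨dirDeriv hl, by simpa using dirDeriv_smul hl 0 0⟩, dirDeriv_add hl⟩ ξ s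

theorem commute_dirDeriv {n : ℕ} {l : Filter (Fin n → ℂ)} (hl : OpenBased l) (ξ η : Fin n → ℂ) :
    Commute (dirDeriv hl ξ) (dirDeriv hl η) := by
  refine AnGerm.hom_ext fun f hf => ?_
  simp only [Module.End.mul_apply, dirDeriv_mk]
  rw [AnGerm.mk_eq_mk]
  filter_upwards [hf] with y hy
  have key : ∀ a b : Fin n → ℂ, fderiv ℂ (fun z => fderiv ℂ f z a) y b =
      fderiv ℂ (fderiv ℂ f) y b a := fun a b => by
    rw [fderiv_clm_apply hy.fderiv.differentiableAt (differentiableAt_const _)]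
    simp
  rw [key, key]
  exact (ContDiffAt.isSymmSndFDerivAt_of_omega hy.contDiffAt).eq ξ η

theorem hasDerivAt_aF {t : ℂ} (h : exp t ≠ 1) : HasDerivAt aF (aF t - aF t ^ 2) t := by
  have h2 : 1 - exp (-t) ≠ 0 := sub_ne_zero.2 fun h' => h (exp_neg_eq_one_iff.1 h'.symm)
  have h3 : HasDerivAt (fun t : ℂ => 1 - exp (-t)) (-(exp (-t) * -1)) t :=
    (hasDerivAt_neg t).cexp.const_sub 1
  have h4 := h3.inv h2
  have e : (fun t : ℂ => 1 - exp (-t))⁻¹ = aF := by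
    funext t
    simp [aF]
  rw [e] at h4
  have e2 : aF t - aF t ^ 2 = -(-(exp (-t) * -1)) / (1 - exp (-t)) ^ 2 := by
    unfold aF
    field_simp
    ring
  rwa [e2]

theorem hasFDerivAt_pairing {N : ℕ} (α : Fin N → ℤ) (y : Fin N → ℂ) :
    HasFDerivAt (pairing α) (pairingL α) y := (pairingL α).hasFDerivAt

theorem fderiv_comp_refl {N : ℕ} {α : Fin N → ℤ} {f : (Fin N → ℂ) → ℂ} {y : Fin N → ℂ}
    (hf : AnalyticAt ℂ f (refl α y)) (ξ : Fin N → ℂ) :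
    fderiv ℂ (fun z => f (refl α z)) y ξ = fderiv ℂ f (refl α y) (refl α ξ) := by
  set L : (Fin N → ℂ) →L[ℂ] (Fin N → ℂ) :=
    LinearMap.toContinuousLinearMap (refl α).toLinearMap
  have h : HasFDerivAt (fun z => f (L z)) ((fderiv ℂ f (L y)).comp L) y :=
    HasFDerivAt.comp y (g := f) hf.differentiableAt.hasFDerivAt L.hasFDerivAt
  have h' : fderiv ℂ (fun z => f (refl α z)) y = (fderiv ℂ f (L y)).comp L := h.fderiv
  rw [h']
  rfl

theorem fderiv_rFun {N : ℕ} {α : Fin N → ℤ} {f : (Fin N → ℂ) → ℂ} {y : Fin N → ℂ}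
    (hy : exp (pairing α y) ≠ 1) (hf : AnalyticAt ℂ f y)
    (hf' : AnalyticAt ℂ f (refl α y)) (ξ : Fin N → ℂ) :
    fderiv ℂ (rFun α f) y ξ =
      pairing α ξ * (aF (pairing α y) - aF (pairing α y) ^ 2) * (f y - f (refl α y)) +
      aF (pairing α y) * (fderiv ℂ f y ξ - fderiv ℂ f (refl α y) (refl α ξ)) := by
  have d1 : HasFDerivAt (fun z => aF (pairing α z))
      ((aF (pairing α y) - aF (pairing α y) ^ 2) • pairingL α) y :=
    (hasDerivAt_aF hy).comp_hasFDerivAt y (hasFDerivAt_pairing α y)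
  have a2 : AnalyticAt ℂ (fun z => f (refl α z)) y :=
    AnalyticAt.comp (g := f) hf'
      ((LinearMap.toContinuousLinearMap (refl α).toLinearMap).analyticAt y)
  have d2 := hf.differentiableAt.hasFDerivAt.sub a2.differentiableAt.hasFDerivAt
  have d3 := d1.mul d2
  have e : fderiv ℂ (rFun α f) y = _ := d3.fderiv
  rw [e]
  simp only [add_apply, smul_apply, sub_apply, pairingL_apply, smul_eq_mul, fderiv_comp_refl hf',
    Pi.sub_apply]
  ring

theorem ev_refl {α : Fin N → ℤ} (hα : α ∈ posRoots N) {f : (Fin N → ℂ) → ℂ}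
    (hf : ∀ᶠ y in nearReg x₀, AnalyticAt ℂ f y) :
    ∀ᶠ y in nearReg x₀, AnalyticAt ℂ f (refl α y) :=
  (tendsto_nearReg x₀ (sRefl ⟨α, hα⟩)).eventually hf

theorem refl_eq_self {N : ℕ} {α : Fin N → ℤ} {ξ : Fin N → ℂ} (h : pairing α ξ = 0) :
    refl α ξ = ξ := by
  funext i
  rw [refl_apply, h]
  ring

theorem commute_dOp_rOp {α : Fin N → ℤ} (hα : α ∈ posRoots N) {ξ : Fin N → ℂ}
    (h : pairing α ξ = 0) : Commute (dOp x₀ ξ) (rOp x₀ α) := by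
  refine AnGerm.hom_ext fun f hf => ?_
  simp only [Module.End.mul_apply, rOp_mk hα, dirDeriv_mk]
  rw [AnGerm.mk_eq_mk]
  filter_upwards [hf, ev_refl x₀ hα hf, regSet_mem_nearReg x₀] with y h1 h2 h3
  rw [fderiv_rFun (h3 α hα) h1 h2, h, refl_eq_self h, rFun]
  ring

/-- The first-order vector `e_i`, as an element of `V`. -/
abbrev bV (i : Fin N) : Fin N → ℂ := Pi.single i 1

/-- The part of the Dunkl operator that involves the short and long roots. -/
def fOp (c₂ c₃ : ℂ) (i : Fin N) : Module.End ℂ (AnGerm (nearReg x₀)) :=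
  c₂ • rOp x₀ (eV i) + (2 * c₃) • rOp x₀ (2 • eV i)

/-- The zero-order part `∑_α c_α (α, e_i) (1 - e^{-α})⁻¹ (1 - s_α)` of the Dunkl operator. -/
def gOp (c₁ c₂ c₃ : ℂ) (i : Fin N) : Module.End ℂ (AnGerm (nearReg x₀)) :=
  ∑ α ∈ posRoots N, (α i : ℂ) • mult c₁ c₂ c₃ α • rOp x₀ α

theorem gOp_eq (c₁ c₂ c₃ : ℂ) (i : Fin N) :
    gOp x₀ c₁ c₂ c₃ i = fOp x₀ c₂ c₃ i + c₁ • ∑ k ∈ univ.erase i, eOp x₀ i k := by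
  refine (sum_posRoots_coord i fun α => mult c₁ c₂ c₃ α • rOp x₀ α).trans ?_
  rw [mult_eV, mult_two_eV, smul_smul, smul_sum, fOp]
  congr 1
  refine sum_congr rfl fun k hk => ?_
  have hk' : i ≠ k := (ne_of_mem_erase hk).symm
  rw [mult_eM _ _ _ hk', mult_eP _ _ _ hk', eOp, smul_add, smul_comm]

theorem dunkl_eq (c₁ c₂ c₃ : ℂ) (i : Fin N) :
    dunkl x₀ c₁ c₂ c₃ i = dOp x₀ (bV i) - gOp x₀ c₁ c₂ c₃ i + weylVec N c₁ c₂ c₃ i • 1 := by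
  rw [dunkl, gOp, ← sum_coe_sort (posRoots N)]
  congr 2
  refine sum_congr rfl fun α _ => ?_
  rw [rOp, dif_pos α.2, smul_smul, mul_comm (mult _ _ _ _)]

theorem pairing_eV_bV (i j : Fin N) : pairing (eV i) (bV j) = if i = j then 1 else 0 := by
  simp only [pairing_eV, bV, Pi.single_apply]

theorem pairing_eP_bV {i k j : Fin N} (h1 : j ≠ i) (h2 : j ≠ k) : pairing (eP i k) (bV j) = 0 := by
  rw [pairing_eP]; simp [h1.symm, h2.symm]

theorem pairing_eM_bV {i k j : Fin N} (h1 : j ≠ i) (h2 : j ≠ k) : pairing (eM i k) (bV j) = 0 := by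
  unfold eM
  split_ifs <;> rw [pairing_eV_sub] <;> simp [h1.symm, h2.symm]

theorem toV_eV (i : Fin N) : toV (eV i) = bV i := by
  funext a; simp [toV, Pi.single_apply]

variable {x₀} {i j k l : Fin N}

theorem commute_dOp_eOp (h1 : j ≠ i) (h2 : j ≠ k) (h : i ≠ k) :
    Commute (dOp x₀ (bV j)) (eOp x₀ i k) :=
  ((commute_dOp_rOp x₀ (eM_mem h) (pairing_eM_bV h1 h2)).smul_right _).add_right
    (commute_dOp_rOp x₀ (eP_mem h) (pairing_eP_bV h1 h2))

theorem commute_dOp_fOp (h : j ≠ i) (c₂ c₃ : ℂ) : Commute (dOp x₀ (bV j)) (fOp x₀ c₂ c₃ i) := by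
  refine ((commute_dOp_rOp x₀ (eV_mem i) ?_).smul_right _).add_right
    ((commute_dOp_rOp x₀ (two_eV_mem i) ?_).smul_right _)
  · rw [pairing_eV_bV, if_neg h.symm]
  · rw [two_smul, pairing_add, pairing_eV_bV, if_neg h.symm, add_zero]

theorem commute_rOp_eOp {α : Fin N → ℤ} (hα : α ∈ posRoots N) (h : i ≠ k)
    (hi : pairing α (bV i) = 0) (hk : pairing α (bV k) = 0) :
    Commute (rOp x₀ α) (eOp x₀ i k) := by
  have e1 : toV (eP i k) = bV i + bV k := by
    funext a; simp [toV, eP, Pi.single_apply]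
  have e2 : toV (eM i k) = bV i - bV k ∨ toV (eM i k) = bV k - bV i := by
    unfold eM
    split_ifs
    · left; funext a; simp [toV, Pi.single_apply]
    · right; funext a; simp [toV, Pi.single_apply]
  refine ((commute_rOp_of_orthogonal x₀ hα (eM_mem h) ?_).smul_right _).add_right
    (commute_rOp_of_orthogonal x₀ hα (eP_mem h) ?_)
  · rcases e2 with e | e <;> rw [e, pairing_vsub, hi, hk, sub_zero]
  · rw [e1, pairing_vadd, hi, hk, add_zero]

theorem commute_eOp_eOp (h : i ≠ k) (h' : j ≠ l) (h1 : i ≠ j) (h2 : i ≠ l) (h3 : k ≠ j)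
    (h4 : k ≠ l) : Commute (eOp x₀ i k) (eOp x₀ j l) :=
  ((commute_rOp_eOp (eM_mem h) h' (pairing_eM_bV h1.symm h3.symm)
      (pairing_eM_bV h2.symm h4.symm)).smul_left _).add_left
    (commute_rOp_eOp (eP_mem h) h' (pairing_eP_bV h1.symm h3.symm)
      (pairing_eP_bV h2.symm h4.symm))

theorem commute_fOp_eOp (h : j ≠ k) (h1 : i ≠ j) (h2 : i ≠ k) (c₂ c₃ : ℂ) :
    Commute (fOp x₀ c₂ c₃ i) (eOp x₀ j k) := by
  refine ((commute_rOp_eOp (eV_mem i) h ?_ ?_).smul_left _).add_left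
    ((commute_rOp_eOp (two_eV_mem i) h ?_ ?_).smul_left _)
  · rw [pairing_eV_bV, if_neg h1]
  · rw [pairing_eV_bV, if_neg h2]
  · rw [two_smul, pairing_add, pairing_eV_bV, if_neg h1, add_zero]
  · rw [two_smul, pairing_add, pairing_eV_bV, if_neg h2, add_zero]

theorem commute_fOp_fOp (h : i ≠ j) (c₂ c₃ : ℂ) :
    Commute (fOp x₀ c₂ c₃ i) (fOp x₀ c₂ c₃ j) := by
  have e : ∀ a : Fin N, toV (2 • eV a) = (2 : ℂ) • bV a := fun a => by
    funext b; simp [toV, Pi.single_apply]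
  refine Commute.add_left (Commute.add_right ?_ ?_) (Commute.add_right ?_ ?_)
  · refine (Commute.smul_left ?_ _).smul_right _
    exact commute_rOp_of_orthogonal x₀ (eV_mem i) (eV_mem j)
      (by rw [toV_eV, pairing_eV_bV, if_neg h])
  · refine (Commute.smul_left ?_ _).smul_right _
    exact commute_rOp_of_orthogonal x₀ (eV_mem i) (two_eV_mem j)
      (by rw [e, pairing_vsmul, pairing_eV_bV, if_neg h, mul_zero])
  · refine (Commute.smul_left ?_ _).smul_right _
    exact commute_rOp_of_orthogonal x₀ (two_eV_mem i) (eV_mem j)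
      (by rw [toV_eV, two_smul, pairing_add, pairing_eV_bV, if_neg h, add_zero])
  · refine (Commute.smul_left ?_ _).smul_right _
    exact commute_rOp_of_orthogonal x₀ (two_eV_mem i) (two_eV_mem j)
      (by rw [e, pairing_vsmul, two_smul, pairing_add, pairing_eV_bV, if_neg h, add_zero, mul_zero])

theorem commute_rOp_sub_add (h : i ≠ j) :
    Commute (rOp x₀ (eV i - eV j)) (rOp x₀ (eP i j)) := by
  have h1 : eV i - eV j ∈ posRoots N ∨ eV i - eV j ∉ posRoots N := em _
  rcases h1 with h1 | h1
  · refine commute_rOp_of_orthogonal x₀ h1 (eP_mem h) ?_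
    have : toV (eP i j) = bV i + bV j := by funext a; simp [toV, eP, Pi.single_apply]
    rw [this, pairing_eV_sub]
    simp [h, h.symm]
  · rw [rOp, dif_neg h1]
    exact Commute.zero_left _

/-- The triple relation for two indices `i < j` and a third index in any position. -/
theorem eOp_lie_triple (hij : i < j) (hki : k ≠ i) (hkj : k ≠ j) :
    eOp x₀ i j * eOp x₀ j k - eOp x₀ j k * eOp x₀ i j +
      (eOp x₀ i k * eOp x₀ j i - eOp x₀ j i * eOp x₀ i k) +
      (eOp x₀ i k * eOp x₀ j k - eOp x₀ j k * eOp x₀ i k) = 0 := by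
  rcases lt_or_gt_of_ne hki with h | h
  · exact (eOp_triple x₀ h hij).2.2.1
  · rcases lt_or_gt_of_ne hkj with h' | h'
    · exact (eOp_triple x₀ h h').2.1
    · exact (eOp_triple x₀ hij h').1

theorem commute_eOp_swap (hij : i < j) : Commute (eOp x₀ i j) (eOp x₀ j i) := by
  rw [eOp_of_lt x₀ hij, eOp_of_gt x₀ hij]
  have hc := commute_rOp_sub_add (x₀ := x₀) hij.ne
  exact commute_add_sub (A := Module.End ℂ (AnGerm (nearReg x₀))) hc

theorem commute_gOp_of_lt (c₁ c₂ c₃ : ℂ) (hij : i < j) :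
    Commute (gOp x₀ c₁ c₂ c₃ i) (gOp x₀ c₁ c₂ c₃ j) := by
  set S := (univ.erase i).erase j
  have hS : ∀ k ∈ S, k ≠ i ∧ k ≠ j := fun k hk =>
    ⟨ne_of_mem_erase (mem_of_mem_erase hk), ne_of_mem_erase hk⟩
  have e1 : ∑ k ∈ univ.erase i, eOp x₀ i k = eOp x₀ i j + ∑ k ∈ S, eOp x₀ i k :=
    (add_sum_erase _ _ (by simp [hij.ne'])).symm
  have e2 : ∑ k ∈ univ.erase j, eOp x₀ j k = eOp x₀ j i + ∑ k ∈ S, eOp x₀ j k := by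
    rw [show S = (univ.erase j).erase i from erase_right_comm]
    exact (add_sum_erase _ _ (by simp [hij.ne])).symm
  obtain ⟨⟨h1, -⟩, ⟨h2, -⟩⟩ := eOp_pair x₀ hij
  have z3 : ∀ k ∈ S, Commute (fOp x₀ c₂ c₃ i) (eOp x₀ j k) := fun k hk =>
    commute_fOp_eOp (hS k hk).2.symm hij.ne (hS k hk).1.symm _ _
  have z4 : ∀ k ∈ S, Commute (eOp x₀ i k) (fOp x₀ c₂ c₃ j) := fun k hk =>
    (commute_fOp_eOp (hS k hk).1.symm hij.ne' (hS k hk).2.symm _ _).symm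
  have z6 := fun k (hk : k ∈ S) => eOp_lie_triple (x₀ := x₀) hij (hS k hk).1 (hS k hk).2
  have z7 : ∀ k ∈ S, ∀ l ∈ S, l ≠ k → Commute (eOp x₀ i k) (eOp x₀ j l) :=
    fun k hk l hl hlk => commute_eOp_eOp (hS k hk).1.symm (hS l hl).2.symm hij.ne
        (hS l hl).1.symm (hS k hk).2 hlk.symm
  have z2 := lie_two_terms (A := Module.End ℂ (AnGerm (nearReg x₀))) c₂ (2 * c₃) h1 h2
  have := commute_of_relations (A := Module.End ℂ (AnGerm (nearReg x₀))) c₁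
    (commute_fOp_fOp hij.ne c₂ c₃) z2 z3 z4 (commute_eOp_swap hij) z6 z7
  rw [gOp_eq, gOp_eq, e1, e2]
  exact this

theorem commute_gOp (c₁ c₂ c₃ : ℂ) (i j : Fin N) :
    Commute (gOp x₀ c₁ c₂ c₃ i) (gOp x₀ c₁ c₂ c₃ j) := by
  rcases lt_trichotomy i j with h | rfl | h
  · exact commute_gOp_of_lt _ _ _ h
  · exact Commute.refl _
  · exact (commute_gOp_of_lt _ _ _ h).symm

theorem dOp_lie_gOp_of_ne (c₁ c₂ c₃ : ℂ) (hij : i ≠ j) :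
    ⁅dOp x₀ (bV i), gOp x₀ c₁ c₂ c₃ j⁆ = c₁ • ⁅dOp x₀ (bV i), eOp x₀ j i⁆ := by
  rw [gOp_eq]
  exact lie_smul_sum (A := Module.End ℂ (AnGerm (nearReg x₀))) (mem_erase.2 ⟨hij, mem_univ _⟩) c₁ (commute_dOp_fOp hij _ _)
    fun k hk hki => commute_dOp_eOp hij hki.symm (ne_of_mem_erase hk).symm

theorem dOp_lie_gOp_of_lt (c₁ c₂ c₃ : ℂ) (hij : i < j) :
    ⁅dOp x₀ (bV i), gOp x₀ c₁ c₂ c₃ j⁆ = ⁅dOp x₀ (bV j), gOp x₀ c₁ c₂ c₃ i⁆ := by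
  have h1 : Commute (dOp x₀ (bV i + bV j)) (rOp x₀ (eV i - eV j)) :=
    commute_dOp_rOp x₀ (eM_mem_of_lt hij) (by rw [pairing_eV_sub]; simp [hij.ne, hij.ne'])
  have h2 : Commute (dOp x₀ (bV i - bV j)) (rOp x₀ (eP i j)) :=
    commute_dOp_rOp x₀ (eP_mem hij.ne) (by rw [pairing_eP]; simp [hij.ne, hij.ne'])
  rw [dOp, dirDeriv_add] at h1
  rw [dOp, dirDeriv_sub] at h2
  rw [dOp_lie_gOp_of_ne _ _ _ hij.ne, dOp_lie_gOp_of_ne _ _ _ hij.ne', eOp_of_lt x₀ hij,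
    eOp_of_gt x₀ hij]
  exact congrArg (c₁ • ·) (lie_eq_of_commute (A := Module.End ℂ (AnGerm (nearReg x₀))) h1 h2)

theorem dOp_lie_gOp (c₁ c₂ c₃ : ℂ) (i j : Fin N) :
    ⁅dOp x₀ (bV i), gOp x₀ c₁ c₂ c₃ j⁆ = ⁅dOp x₀ (bV j), gOp x₀ c₁ c₂ c₃ i⁆ := by
  rcases lt_trichotomy i j with h | rfl | h
  · exact dOp_lie_gOp_of_lt _ _ _ h
  · rfl
  · exact (dOp_lie_gOp_of_lt _ _ _ h).symm

/-- The trigonometric Dunkl operators commute. -/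
theorem commute_dunkl (c₁ c₂ c₃ : ℂ) (i j : Fin N) :
    Commute (dunkl x₀ c₁ c₂ c₃ i) (dunkl x₀ c₁ c₂ c₃ j) := by
  rw [dunkl_eq, dunkl_eq]
  exact commute_sub_sub_add_smul (A := Module.End ℂ (AnGerm (nearReg x₀))) _ _ (commute_dirDeriv (openBased_nearReg x₀) (bV i) (bV j))
    (commute_gOp c₁ c₂ c₃ i j) (dOp_lie_gOp c₁ c₂ c₃ i j)

end Commutators

section SumOfSquares

variable {A ι : Type*} [Fintype ι]

theorem sum_eq_zero_of_antisymm [AddCommGroup A] [Module ℂ A] (v : ι → ι → A)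
    (h : ∀ i k, v i k + v k i = 0) : ∑ i, ∑ k, v i k = 0 := by
  have h1 : ∑ i, ∑ k, v i k + ∑ i, ∑ k, v i k = 0 := by
    have e : ∑ i, ∑ k, v i k = ∑ i, ∑ k, v k i := sum_comm
    nth_rewrite 2 [e]
    rw [← sum_add_distrib]
    refine sum_eq_zero fun i _ => ?_
    rw [← sum_add_distrib]
    exact sum_eq_zero fun k _ => h i k
  rw [← two_smul ℂ] at h1
  exact (smul_eq_zero.1 h1).resolve_left two_ne_zero

theorem sum_eq_zero_of_cyclic [AddCommGroup A] [Module ℂ A] (u : ι → ι → ι → A)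
    (h : ∀ i j k, u i j k + u j k i + u k i j = 0) : ∑ i, ∑ j, ∑ k, u i j k = 0 := by
  have h2 : ∑ i, ∑ j, ∑ k, u j k i = ∑ i, ∑ j, ∑ k, u i j k := by
    rw [sum_comm]
    exact sum_congr rfl fun i _ => sum_comm
  have h3 : ∑ i, ∑ j, ∑ k, u k i j = ∑ i, ∑ j, ∑ k, u i j k := by
    rw [← h2]
    rw [sum_comm]
    exact sum_congr rfl fun i _ => sum_comm
  have h4 : ∑ i, ∑ j, ∑ k, (u i j k + u j k i + u k i j) = 0 :=
    sum_eq_zero fun i _ => sum_eq_zero fun j _ => sum_eq_zero fun k _ =>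
      h i j k
  simp only [sum_add_distrib, h2, h3] at h4
  have h5 : (3 : ℂ) • ∑ i, ∑ j, ∑ k, u i j k = 0 := by
    rw [← h4]; module
  exact (smul_eq_zero.1 h5).resolve_left three_ne_zero

variable [Ring A] [Algebra ℂ A]

theorem sum_sq_expand (D G : ι → A) (r : ι → ℂ) (h : ∑ i, G i * G i = ∑ i, (2 * r i) • G i) :
    ∑ i, (D i - G i + r i • (1 : A)) ^ 2 = ∑ i, D i * D i - ∑ i, (D i * G i + G i * D i) +
      ∑ i, (2 * r i) • D i + (∑ i, r i ^ 2) • (1 : A) := by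
  have : ∀ i, (D i - G i + r i • (1 : A)) ^ 2 = D i * D i - (D i * G i + G i * D i) +
      (2 * r i) • D i + r i ^ 2 • (1 : A) + G i * G i - (2 * r i) • G i := fun i => by
    simp only [sq, add_mul, mul_add, sub_mul, mul_sub, smul_mul_assoc, mul_smul_comm, mul_one,
      one_mul]
    module
  simp only [this, sum_add_distrib, sum_sub_distrib, h, sum_smul]
  abel

theorem sum_anticomm_expand {κ : Type*} (S : Finset κ) (D : ι → A) (R DS : κ → A)
    (c : κ → ℂ) (a : κ → ι → ℂ) (r : ι → ℂ) (hD : ∀ α, DS α = ∑ i, a α i • D i)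
    (hr : ∀ i, 2 * r i = ∑ α ∈ S, c α * a α i) :
    ∑ i, (D i * (∑ α ∈ S, a α i • c α • R α) + (∑ α ∈ S, a α i • c α • R α) * D i) -
      ∑ i, (2 * r i) • D i = ∑ α ∈ S, c α • (DS α * R α + R α * DS α - DS α) := by
  simp only [hr, sum_smul, mul_sum, sum_mul, ← sum_add_distrib,
    ← sum_sub_distrib, hD, smul_sum]
  rw [sum_comm]
  refine sum_congr rfl fun α _ => sum_congr rfl fun i _ => ?_
  simp only [mul_smul_comm, smul_mul_assoc]
  module

variable [LinearOrder ι]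

theorem sum_sq_of_triple (E : ι → ι → A) (n : ι → ℂ)
    (hn : ∀ i, n i = ∑ k, if i < k then 1 else 0) (hE0 : ∀ i, E i i = 0)
    (hsq : ∀ i j, i < j → E i j * E i j + E j i * E j i = (2 : ℂ) • E i j)
    (htri : ∀ i j k, i < j → j < k → E i j * E i k + E i k * E i j +
      (E j i * E j k + E j k * E j i) + (E k i * E k j + E k j * E k i) -
      (2 : ℂ) • (E i j + E i k + E j i) = 0) :
    ∑ i, (∑ k, E i k) * (∑ k, E i k) = (2 : ℂ) • ∑ i, n i • ∑ k, E i k := by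
  classical
  let δ : ι → ι → ℂ := fun i k => if i < k then 1 else 0
  let u : ι → ι → ι → A := fun i j k =>
    E i j * E i k + E i k * E i j - (2 * δ i k) • E i j - (2 * δ i j) • E i k
  have h1 : ∑ i, ∑ j, ((E i j * E i j) - (2 * δ i j) • E i j) = 0 := by
    refine sum_eq_zero_of_antisymm _ fun i j => ?_
    rcases lt_trichotomy i j with h | rfl | h
    · simp only [δ, h, h.not_gt, if_true, if_false]
      linear_combination (norm := module) hsq i j h
    · simp [hE0]
    · simp only [δ, h, h.not_gt, if_true, if_false]
      linear_combination (norm := module) hsq j i h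
  have h2 : ∑ i, ∑ j, ∑ k, (if j = k then 0 else u i j k) = 0 := by
    have hs : ∀ i j k, u i j k = u i k j := fun i j k => by
      simp only [u]; abel
    have hlt : ∀ i j k, i < j → j < k → u i j k + u j k i + u k i j = 0 := fun i j k hij hjk => by
      have hik := hij.trans hjk
      simp only [u, δ, hij, hjk, hik, hij.not_gt, hjk.not_gt, hik.not_gt, if_true, if_false]
      linear_combination (norm := module) htri i j k hij hjk
    have hδ : ∀ i, δ i i = 0 := fun i => if_neg (lt_irrefl i)
    refine sum_eq_zero_of_cyclic _ fun i j k => ?_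
    by_cases hij : i = j
    · subst hij
      by_cases hik : i = k
      · simp [hik]
      · simp [hik, u, hE0, hδ, Ne.symm hik]
    by_cases hjk : j = k
    · subst hjk
      simp [hij, u, hE0, hδ, Ne.symm hij]
    by_cases hik : i = k
    · subst hik
      simp [hij, u, hE0, hδ, Ne.symm hij]
    simp only [hij, hjk, Ne.symm hik, if_false]
    rcases lt_or_gt_of_ne hij with h | h <;> rcases lt_or_gt_of_ne hjk with h' | h' <;>
      rcases lt_or_gt_of_ne hik with h'' | h''
    · exact hlt _ _ _ h h'
    · exact absurd (h.trans h') h''.not_gt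
    · rw [← hlt i k j h'' h', hs i j k, hs j k i, hs k i j]; abel
    · rw [← hlt k i j h'' h]; abel
    · rw [← hlt j i k h h'', hs i j k, hs j k i, hs k i j]; abel
    · rw [← hlt j k i h' h'']; abel
    · exact absurd (h'.trans h) h''.not_gt
    · rw [← hlt k j i h' h, hs i j k, hs j k i, hs k i j]; abel
  have h3 : ∀ i j, ∑ k, (if j = k then 0 else u i j k) = (∑ k, u i j k) - u i j j := fun i j => by
    rw [← sum_erase_eq_sub (mem_univ j), sum_ite, sum_const_zero,
      zero_add]
    refine sum_congr ?_ fun _ _ => rfl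
    ext k; simp [eq_comm]
  have h4 : ∀ i j, ∑ k, u i j k = E i j * (∑ k, E i k) + (∑ k, E i k) * E i j -
      (2 * n i) • E i j - (2 * δ i j) • ∑ k, E i k := fun i j => by
    simp only [u, sum_sub_distrib, sum_add_distrib, mul_sum, sum_mul,
      smul_sum, hn, ← sum_smul, δ]
  have h5 : ∀ i, ∑ j, ∑ k, u i j k = (2 : ℂ) • ((∑ k, E i k) * (∑ k, E i k)) -
      (4 * n i) • ∑ k, E i k := fun i => by
    simp only [h4, sum_sub_distrib, sum_add_distrib, ← mul_sum,
      ← sum_mul, ← smul_sum, ← sum_smul]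
    have : ∑ j, δ i j = n i := (hn i).symm
    rw [this]
    module
  simp only [h3, sum_sub_distrib, h5] at h2
  simp only [sum_sub_distrib] at h1
  have h6 : ∑ i, ∑ j, u i j j = (2 : ℂ) • (∑ i, ∑ j, E i j * E i j - ∑ i, ∑ j, (2 * δ i j) • E i j) := by
    simp only [u, smul_sum, smul_sub, ← sum_sub_distrib]
    refine sum_congr rfl fun i _ => sum_congr rfl fun j _ => ?_
    module
  rw [h6, h1, smul_zero, sub_zero, sub_eq_zero, ← smul_sum] at h2
  have h7 : (2 : ℂ) • (∑ i, (∑ k, E i k) * (∑ k, E i k)) =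
      (2 : ℂ) • (2 : ℂ) • ∑ i, n i • ∑ k, E i k := by
    rw [h2]
    simp only [smul_sum]
    refine sum_congr rfl fun i _ => sum_congr rfl fun j _ => ?_
    module
  exact smul_right_injective A (two_ne_zero (α := ℂ)) h7

theorem sum_sq_zero_order (F : ι → A) (E : ι → ι → A) (n : ι → ℂ) (c κ : ℂ)
    (hn : ∀ i, n i = ∑ k, if i < k then 1 else 0) (hE0 : ∀ i, E i i = 0)
    (hF : ∀ i, F i * F i = κ • F i)
    (hpair : ∀ i j, i < j → E i j * F i + F i * E i j + (E j i * F j + F j * E j i) =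
      (2 : ℂ) • F i + κ • (E i j + E j i))
    (hsq : ∀ i j, i < j → E i j * E i j + E j i * E j i = (2 : ℂ) • E i j)
    (htri : ∀ i j k, i < j → j < k → E i j * E i k + E i k * E i j +
      (E j i * E j k + E j k * E j i) + (E k i * E k j + E k j * E k i) -
      (2 : ℂ) • (E i j + E i k + E j i) = 0) :
    ∑ i, (F i + c • ∑ k, E i k) * (F i + c • ∑ k, E i k) =
      ∑ i, (κ + 2 * c * n i) • (F i + c • ∑ k, E i k) := by
  classical
  have h1 := sum_sq_of_triple E n hn hE0 hsq htri
  have h2 : ∑ i, ∑ k, (E i k * F i + F i * E i k - (2 * if i < k then 1 else 0 : ℂ) • F i -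
      κ • E i k) = 0 := by
    refine sum_eq_zero_of_antisymm _ fun i j => ?_
    rcases lt_trichotomy i j with h | rfl | h
    · simp only [h, h.not_gt, if_true, if_false]
      linear_combination (norm := module) hpair i j h
    · simp [hE0]
    · simp only [h, h.not_gt, if_true, if_false]
      linear_combination (norm := module) hpair j i h
  have h3 : ∀ i, ∑ k, (E i k * F i + F i * E i k - (2 * if i < k then 1 else 0 : ℂ) • F i -
      κ • E i k) = (∑ k, E i k) * F i + F i * (∑ k, E i k) - (2 * n i) • F i -
      κ • ∑ k, E i k := fun i => by
    simp only [sum_sub_distrib, sum_add_distrib, ← mul_sum,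
      ← sum_mul, ← smul_sum, ← sum_smul, hn]
  simp only [h3] at h2
  have h4 : ∀ i, (F i + c • ∑ k, E i k) * (F i + c • ∑ k, E i k) =
      (κ + 2 * c * n i) • (F i + c • ∑ k, E i k) +
      c • ((∑ k, E i k) * F i + F i * (∑ k, E i k) - (2 * n i) • F i - κ • ∑ k, E i k) +
      (c * c) • ((∑ k, E i k) * (∑ k, E i k) - (2 : ℂ) • n i • ∑ k, E i k) := fun i => by
    simp only [add_mul, mul_add, smul_mul_assoc, mul_smul_comm, hF]
    module
  simp only [h4, sum_add_distrib, ← smul_sum, h2]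
  rw [sum_sub_distrib, h1, ← smul_sum]
  simp

end SumOfSquares

section DunklSquares

variable {N : ℕ} (x₀ : Fin N → ℂ) (c₁ c₂ c₃ : ℂ)

theorem two_mul_weylVec (i : Fin N) : 2 * weylVec N c₁ c₂ c₃ i =
    ∑ α ∈ posRoots N, mult c₁ c₂ c₃ α * (α i : ℂ) := by
  rw [weylVec]; ring

theorem two_mul_weylVec_eq (i : Fin N) : 2 * weylVec N c₁ c₂ c₃ i =
    c₂ + 2 * c₃ + 2 * c₁ * ∑ k, if i < k then 1 else 0 := by
  have h := sum_posRoots_coord i fun α => mult c₁ c₂ c₃ α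
  simp only [smul_eq_mul] at h
  rw [two_mul_weylVec, sum_congr rfl fun α _ => mul_comm _ _, h, mult_eV, mult_two_eV,
    mul_sum, ← add_sum_erase _ _ (mem_univ i), if_neg (lt_irrefl i), mul_zero,
    zero_add]
  congr 1
  refine sum_congr rfl fun k hk => ?_
  have hk' : i ≠ k := (ne_of_mem_erase hk).symm
  rw [mult_eM _ _ _ hk', mult_eP _ _ _ hk', sgn]
  split_ifs <;> ring

theorem two_terms_sq {A : Type*} [Ring A] [Algebra ℂ A] {P Q : A} (c d : ℂ) (hP : P * P = P)
    (hQ : Q * Q = Q) (hPQ : P * Q = P) (hQP : Q * P = Q) :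
    (c • P + (2 * d) • Q) * (c • P + (2 * d) • Q) = (c + 2 * d) • (c • P + (2 * d) • Q) := by
  simp only [add_mul, mul_add, smul_mul_assoc, mul_smul_comm, hP, hQ, hPQ, hQP]
  module

theorem pair_relation {A : Type*} [Ring A] [Algebra ℂ A] {e e' r r' s s' p : A} (c d : ℂ)
    (hp : e + e' = (2 : ℂ) • p)
    (h1 : e * r + r * e + (e' * s + s * e') - (2 : ℂ) • (r + p) = 0)
    (h2 : e * r' + r' * e + (e' * s' + s' * e') - (2 : ℂ) • (r' + p) = 0) :
    e * (c • r + (2 * d) • r') + (c • r + (2 * d) • r') * e +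
      (e' * (c • s + (2 * d) • s') + (c • s + (2 * d) • s') * e') =
      (2 : ℂ) • (c • r + (2 * d) • r') + (c + 2 * d) • (e + e') := by
  rw [hp]
  simp only [add_mul, mul_add, smul_mul_assoc, mul_smul_comm]
  linear_combination (norm := module) c • h1 + (2 * d) • h2

theorem sq_relation {A : Type*} [Ring A] [Algebra ℂ A] {m p : A} (hm : m * m = m) (hp : p * p = p)
    : (m + p) * (m + p) + (p - m) * (p - m) = (2 : ℂ) • (m + p) := by
  simp only [add_mul, mul_add, sub_mul, mul_sub, hm, hp]
  module

theorem add_add_sub_eq {A : Type*} [Ring A] [Algebra ℂ A] (m p : A) :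
    m + p + (p - m) = (2 : ℂ) • p := by module

theorem gOp_sum_sq : ∑ i, gOp x₀ c₁ c₂ c₃ i * gOp x₀ c₁ c₂ c₃ i =
    ∑ i, (2 * weylVec N c₁ c₂ c₃ i) • gOp x₀ c₁ c₂ c₃ i := by
  let E : Fin N → Fin N → Module.End ℂ (AnGerm (nearReg x₀)) :=
    fun i k => if i = k then 0 else eOp x₀ i k
  have hE : ∀ i k, i ≠ k → E i k = eOp x₀ i k := fun i k h => if_neg h
  have hg : ∀ i, gOp x₀ c₁ c₂ c₃ i = fOp x₀ c₂ c₃ i + c₁ • ∑ k, E i k := fun i => by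
    rw [gOp_eq, ← add_sum_erase _ (E i) (mem_univ i)]
    congr 2
    have : E i i = 0 := if_pos rfl
    rw [this, zero_add]
    exact sum_congr rfl fun k hk => (hE i k (ne_of_mem_erase hk).symm).symm
  have key := sum_sq_zero_order (A := Module.End ℂ (AnGerm (nearReg x₀))) (fOp x₀ c₂ c₃) E
    (fun i => ∑ k, if i < k then 1 else 0) c₁ (c₂ + 2 * c₃) (fun i => rfl) (fun i => if_pos rfl)
    (fun i => two_terms_sq (A := Module.End ℂ (AnGerm (nearReg x₀))) c₂ c₃
      (rOp_mul_self x₀ (eV_mem i)) (rOp_mul_self x₀ (two_eV_mem i)) (rOp_eV_mul_two x₀ i)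
      (rOp_two_mul_eV x₀ i))
    (fun i j hij => by
      rw [hE i j hij.ne, hE j i hij.ne']
      obtain ⟨⟨-, h1⟩, ⟨-, h2⟩⟩ := eOp_pair x₀ hij
      refine pair_relation (A := Module.End ℂ (AnGerm (nearReg x₀))) c₂ c₃ ?_ h1 h2
      rw [eOp_of_lt x₀ hij, eOp_of_gt x₀ hij]
      exact add_add_sub_eq (A := Module.End ℂ (AnGerm (nearReg x₀))) _ _)
    (fun i j hij => by
      rw [hE i j hij.ne, hE j i hij.ne', eOp_of_lt x₀ hij, eOp_of_gt x₀ hij]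
      exact sq_relation (A := Module.End ℂ (AnGerm (nearReg x₀)))
        (rOp_mul_self x₀ (eM_mem_of_lt hij)) (rOp_mul_self x₀ (eP_mem hij.ne)))
    (fun i j k hij hjk => by
      have hik := hij.trans hjk
      rw [hE i j hij.ne, hE j i hij.ne', hE i k hik.ne, hE k i hik.ne', hE j k hjk.ne,
        hE k j hjk.ne']
      exact (eOp_triple x₀ hij hjk).2.2.2)
  simp only [two_mul_weylVec_eq, hg]
  exact key

theorem toV_eq_sum (α : Fin N → ℤ) : toV α = ∑ i, (α i : ℂ) • bV i := by
  funext a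
  simp [toV, Pi.single_apply]

/-- The sum of the squares of the Dunkl operators. -/
theorem sum_dunkl_sq : ∑ i, dunkl x₀ c₁ c₂ c₃ i ^ 2 =
    ∑ i, dOp x₀ (bV i) * dOp x₀ (bV i) - ∑ α ∈ posRoots N, mult c₁ c₂ c₃ α •
      (dOp x₀ (toV α) * rOp x₀ α + rOp x₀ α * dOp x₀ (toV α) - dOp x₀ (toV α)) +
      (∑ i, weylVec N c₁ c₂ c₃ i ^ 2) • 1 := by
  have h1 := sum_sq_expand (A := Module.End ℂ (AnGerm (nearReg x₀))) (fun i => dOp x₀ (bV i)) _ _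
    (gOp_sum_sq x₀ c₁ c₂ c₃)
  have h2 := sum_anticomm_expand (A := Module.End ℂ (AnGerm (nearReg x₀))) (posRoots N)
    (fun i => dOp x₀ (bV i)) (rOp x₀) (fun α => dOp x₀ (toV α)) (mult c₁ c₂ c₃)
    (fun α i => (α i : ℂ)) (weylVec N c₁ c₂ c₃)
    (fun α => by
      rw [dOp, toV_eq_sum, dirDeriv_sum]
      exact sum_congr rfl fun i _ => dirDeriv_smul _ _ _)
    (two_mul_weylVec c₁ c₂ c₃)
  simp only [dunkl_eq]
  refine h1.trans ?_
  rw [← h2]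
  simp only [gOp]
  abel

/-- The action of the sum of the squares of the Dunkl operators on functions. -/
def sumSqFun (f : (Fin N → ℂ) → ℂ) (y : Fin N → ℂ) : ℂ :=
  ∑ i, fderiv ℂ (fun z => fderiv ℂ f z (bV i)) y (bV i) -
    ∑ α ∈ posRoots N, mult c₁ c₂ c₃ α * ((normSq α : ℂ) *
      (aF (pairing α y) - aF (pairing α y) ^ 2) * (f y - f (refl α y)) +
      (2 * aF (pairing α y) - 1) * fderiv ℂ f y (toV α)) +
    (∑ i, weylVec N c₁ c₂ c₃ i ^ 2) * f y

theorem refl_toV {α : Fin N → ℤ} (hα : α ∈ posRoots N) : refl α (toV α) = -toV α := by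
  funext i
  rw [refl_apply, pairing_toV, Pi.neg_apply, toV]
  field_simp [normSq_ne_zero hα]
  ring

variable {x₀ c₁ c₂ c₃}

theorem sum_dunkl_sq_mk {f g : (Fin N → ℂ) → ℂ} {hf : ∀ᶠ y in nearReg x₀, AnalyticAt ℂ f y}
    {hg : ∀ᶠ y in nearReg x₀, AnalyticAt ℂ g y}
    (h : (∑ i, dunkl x₀ c₁ c₂ c₃ i ^ 2) (AnGerm.mk f hf) = AnGerm.mk g hg) :
    ∀ᶠ y in nearReg x₀, g y = sumSqFun c₁ c₂ c₃ f y := by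
  have hr : ∀ α ∈ posRoots N, ∀ᶠ y in nearReg x₀, fderiv ℂ (rFun α f) y (toV α) +
      rFun α (fun z => fderiv ℂ f z (toV α)) y - fderiv ℂ f y (toV α) = (normSq α : ℂ) *
      (aF (pairing α y) - aF (pairing α y) ^ 2) * (f y - f (refl α y)) +
      (2 * aF (pairing α y) - 1) * fderiv ℂ f y (toV α) := fun α hα => by
    filter_upwards [hf, ev_refl x₀ hα hf, regSet_mem_nearReg x₀] with y h1 h2 h3
    rw [fderiv_rFun (h3 α hα) h1 h2, refl_toV hα, pairing_toV, rFun, map_neg]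
    ring
  have hev : ∀ α : posRoots N, ∀ᶠ y in nearReg x₀, AnalyticAt ℂ (fun y => mult c₁ c₂ c₃ α.1 *
      (fderiv ℂ (rFun α.1 f) y (toV α.1) +
        rFun α.1 (fun z => fderiv ℂ f z (toV α.1)) y - fderiv ℂ f y (toV α.1))) y := fun α =>
    ev_const_mul _ (ev_sub (ev_add (ev_dirDeriv _ (ev_rFun α.2 hf))
      (ev_rFun α.2 (ev_dirDeriv _ hf))) (ev_dirDeriv _ hf))
  have e1 : (∑ α ∈ posRoots N, mult c₁ c₂ c₃ α •
      (dOp x₀ (toV α) * rOp x₀ α + rOp x₀ α * dOp x₀ (toV α) - dOp x₀ (toV α)))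
      (AnGerm.mk f hf) = AnGerm.mk _ (analyticAt_sum_eventually univ _ hev) := by
    rw [← AnGerm.mk_sum _ _ hev, ← sum_coe_sort, LinearMap.sum_apply]
    refine sum_congr rfl fun α _ => ?_
    simp only [LinearMap.smul_apply, LinearMap.add_apply, LinearMap.sub_apply,
      Module.End.mul_apply, rOp_mk α.2, dirDeriv_mk, AnGerm.mk_add, AnGerm.mk_sub,
      AnGerm.mk_smul]
  have e2 : (∑ i, dOp x₀ (bV i) * dOp x₀ (bV i)) (AnGerm.mk f hf) =
      AnGerm.mk _ (analyticAt_sum_eventually univ _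
        fun i => ev_dirDeriv (bV i) (ev_dirDeriv (bV i) hf)) := by
    rw [← AnGerm.mk_sum _ _ fun i => ev_dirDeriv (bV i) (ev_dirDeriv (bV i) hf),
      LinearMap.sum_apply]
    rfl
  rw [sum_dunkl_sq, LinearMap.add_apply, LinearMap.sub_apply, e1, e2, LinearMap.smul_apply,
    Module.End.one_apply, AnGerm.mk_smul, AnGerm.mk_sub, AnGerm.mk_add, AnGerm.mk_eq_mk] at h
  filter_upwards [h, (Finset.eventually_all _).2 hr] with y h1 h2
  rw [← h1, sumSqFun, ← sum_coe_sort (posRoots N)]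
  congr 2
  exact sum_congr rfl fun α _ => by rw [h2 α.1 α.2]

end DunklSquares

section Polynomials

variable {A : Type*} [Ring A] [Algebra ℂ A] {N : ℕ}

/-- Evaluation of polynomials at commuting elements of an algebra. -/
theorem exists_algHom_of_commute (T : Fin N → A) (h : ∀ i j, Commute (T i) (T j)) :
    ∃ Φ : MvPolynomial (Fin N) ℂ →ₐ[ℂ] A, (∀ p : MvPolynomial (Fin N) ℂ,
      Φ p = ∑ s ∈ p.support, p.coeff s • (List.ofFn fun i => T i ^ s i).prod) ∧
      ∀ i, Φ (MvPolynomial.X i) = T i := by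
  let S := Algebra.adjoin ℂ (Set.range T)
  have hS : IsMulCommutative S := Algebra.isMulCommutative_adjoin ℂ
    (by rintro _ ⟨i, rfl⟩ _ ⟨j, rfl⟩; exact h i j)
  let _ : CommRing S := { (inferInstance : Ring S) with
    mul_comm := fun a b => hS.is_comm.comm a b }
  let T' : Fin N → S := fun i => ⟨T i, Algebra.subset_adjoin ⟨i, rfl⟩⟩
  refine ⟨S.val.comp (MvPolynomial.aeval T'), fun p => ?_, fun i => ?_⟩
  · rw [AlgHom.comp_apply, MvPolynomial.aeval_def, MvPolynomial.eval₂_eq', map_sum]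
    refine sum_congr rfl fun s _ => ?_
    rw [← Algebra.smul_def, map_smul, ← List.prod_ofFn, map_list_prod, List.map_ofFn]
    rfl
  · rw [AlgHom.comp_apply, MvPolynomial.aeval_X]
    rfl

theorem commute_of_hecke (Φ : MvPolynomial (Fin N) ℂ →ₐ[ℂ] A) (s : A)
    (φ : MvPolynomial (Fin N) ℂ →ₐ[ℂ] MvPolynomial (Fin N) ℂ) {a : MvPolynomial (Fin N) ℂ}
    (ha : a ≠ 0) (c : ℂ)
    (h : ∀ i, ∃ r, s * Φ (MvPolynomial.X i) = Φ (φ (MvPolynomial.X i)) * s + Φ r ∧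
      a * r = c • (MvPolynomial.X i - φ (MvPolynomial.X i)))
    {p : MvPolynomial (Fin N) ℂ} (hp : φ p = p) : Commute s (Φ p) := by
  have key : ∀ q, ∃ r, s * Φ q = Φ (φ q) * s + Φ r ∧ a * r = c • (q - φ q) := by
    intro q
    induction q using MvPolynomial.induction_on with
    | C z =>
      refine ⟨0, ?_, ?_⟩
      · rw [← MvPolynomial.algebraMap_eq, AlgHom.commutes, AlgHom.commutes, AlgHom.commutes,
          map_zero, add_zero]
        exact (Algebra.commutes z s).symm
      · rw [← MvPolynomial.algebraMap_eq, AlgHom.commutes, sub_self, smul_zero, mul_zero]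
    | add p q hp hq =>
      obtain ⟨r, h1, h2⟩ := hp
      obtain ⟨r', h3, h4⟩ := hq
      refine ⟨r + r', ?_, ?_⟩
      · simp only [map_add, mul_add, add_mul, h1, h3]; abel
      · rw [mul_add, h2, h4, map_add]; module
    | mul_X p i hp =>
      obtain ⟨r, h1, h2⟩ := hp
      obtain ⟨r', h3, h4⟩ := h i
      refine ⟨φ p * r' + r * MvPolynomial.X i, ?_, ?_⟩
      · simp only [map_add, map_mul]
        rw [← mul_assoc, h1, add_mul, mul_assoc, h3, mul_add, mul_assoc, add_assoc]
      · rw [mul_add, mul_left_comm, h4, ← mul_assoc, h2, map_mul, mul_smul_comm, smul_mul_assoc,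
          ← smul_add]
        congr 1
        ring
  obtain ⟨r, h1, h2⟩ := key p
  rw [hp, sub_self, smul_zero, mul_eq_zero] at h2
  rw [hp, h2.resolve_left ha, map_zero, add_zero] at h1
  exact h1

end Polynomials

section ActLemmas

variable {N : ℕ} (x₀ : Fin N → ℂ)

theorem W_dot (w : W N) (x y : Fin N → ℂ) : ∑ i, w.1 x i * w.1 y i = ∑ i, x i * y i := by
  obtain ⟨w, σ, ε, h⟩ := w
  simp only [h]
  rw [← Equiv.sum_comp σ fun i => x i * y i]
  refine sum_congr rfl fun i _ => ?_
  rcases Int.units_eq_one_or (ε i) with h2 | h2 <;> simp [h2]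

theorem pairing_eq_dot (α : Fin N → ℤ) (x : Fin N → ℂ) : pairing α x = ∑ i, toV α i * x i := rfl

theorem pairing_W {w : W N} {α β : Fin N → ℤ} (h : toV β = w.1 (toV α)) (y : Fin N → ℂ) :
    pairing β (w.1 y) = pairing α y := by
  rw [pairing_eq_dot, h, W_dot, pairing_eq_dot]

theorem pairing_W_neg {w : W N} {α β : Fin N → ℤ} (h : toV β = -w.1 (toV α)) (y : Fin N → ℂ) :
    pairing β (w.1 y) = -pairing α y := by
  simp only [pairing_eq_dot, h, Pi.neg_apply, neg_mul, sum_neg_distrib, W_dot]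

theorem refl_eq_sub (α : Fin N → ℤ) (y : Fin N → ℂ) :
    refl α y = y - (2 * pairing α y / (normSq α : ℂ)) • toV α := rfl

theorem refl_W {w : W N} {α β : Fin N → ℤ} (h : toV β = w.1 (toV α)) (y : Fin N → ℂ) :
    refl β (w.1 y) = w.1 (refl α y) := by
  rw [refl_eq_sub, refl_eq_sub, pairing_W h, map_sub, map_smul, ← h, ← pairing_toV, ← pairing_toV,
    h, pairing_W h]

theorem refl_W_neg {w : W N} {α β : Fin N → ℤ} (h : toV β = -w.1 (toV α)) (y : Fin N → ℂ) :
    refl β (w.1 y) = w.1 (refl α y) := by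
  have e : pairing β (toV β) = pairing α (toV α) := by
    have hn : pairing α (-toV α) = -pairing α (toV α) := map_neg (pairingL α) _
    rw [h, ← map_neg, pairing_W_neg h, hn, neg_neg]
  rw [refl_eq_sub, refl_eq_sub, pairing_W_neg h, map_sub, map_smul, ← pairing_toV, ← pairing_toV,
    e, h]
  module

theorem W_inv_apply (w : W N) (y : Fin N → ℂ) : w.1 ((w⁻¹).1 y) = y := w.1.apply_symm_apply y

theorem W_inv_apply' (w : W N) (y : Fin N → ℂ) : (w⁻¹).1 (w.1 y) = y := w.1.symm_apply_apply y

theorem act_mul (v w : W N) : act x₀ (v * w) = act x₀ v * act x₀ w :=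
  AnGerm.hom_ext fun f hf => by
    rw [Module.End.mul_apply, act_mk, act_mk, act_mk, AnGerm.mk_eq_mk]
    refine Eventually.of_forall fun y => ?_
    change f ((v * w)⁻¹.1 y) = f ((w⁻¹).1 ((v⁻¹).1 y))
    rw [mul_inv_rev]
    rfl

theorem act_one : act x₀ (1 : W N) = 1 :=
  AnGerm.hom_ext fun f hf => by
    rw [act_mk, Module.End.one_apply, AnGerm.mk_eq_mk]
    refine Eventually.of_forall fun y => ?_
    rw [inv_one]
    rfl

theorem act_sRefl_mul_self (α : posRoots N) : act x₀ (sRefl α) * act x₀ (sRefl α) = 1 := by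
  rw [← act_mul, sRefl_mul_self, act_one]

theorem fderiv_comp_W (w : W N) {f : (Fin N → ℂ) → ℂ} {y : Fin N → ℂ}
    (hf : AnalyticAt ℂ f (w.1 y)) (ξ : Fin N → ℂ) :
    fderiv ℂ (fun z => f (w.1 z)) y ξ = fderiv ℂ f (w.1 y) (w.1 ξ) := by
  set L : (Fin N → ℂ) →L[ℂ] (Fin N → ℂ) := LinearMap.toContinuousLinearMap w.1.toLinearMap
  have h : HasFDerivAt (fun z => f (L z)) ((fderiv ℂ f (L y)).comp L) y :=
    HasFDerivAt.comp y (g := f) hf.differentiableAt.hasFDerivAt L.hasFDerivAt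
  have h' : fderiv ℂ (fun z => f (w.1 z)) y = (fderiv ℂ f (L y)).comp L := h.fderiv
  rw [h']
  rfl

theorem act_mul_dOp (w : W N) (ξ : Fin N → ℂ) :
    act x₀ w * dOp x₀ ξ = dOp x₀ (w.1 ξ) * act x₀ w :=
  AnGerm.hom_ext fun f hf => by
    rw [Module.End.mul_apply, Module.End.mul_apply, dirDeriv_mk, act_mk, act_mk, dirDeriv_mk,
      AnGerm.mk_eq_mk]
    filter_upwards [(tendsto_nearReg x₀ w⁻¹).eventually hf] with y hy
    rw [fderiv_comp_W w⁻¹ hy, W_inv_apply']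

theorem act_mul_rOp {w : W N} {α β : Fin N → ℤ} (hα : α ∈ posRoots N) (hβ : β ∈ posRoots N)
    (h : toV β = w.1 (toV α)) : act x₀ w * rOp x₀ α = rOp x₀ β * act x₀ w :=
  AnGerm.hom_ext fun f hf => by
    rw [Module.End.mul_apply, Module.End.mul_apply, rOp_mk hα, act_mk, act_mk, rOp_mk hβ,
      AnGerm.mk_eq_mk]
    refine Eventually.of_forall fun y => ?_
    have h1 := pairing_W h ((w⁻¹).1 y)
    have h2 := refl_W h ((w⁻¹).1 y)
    rw [W_inv_apply] at h1 h2
    simp only [rFun]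
    rw [h1, h2, W_inv_apply']

theorem act_mul_rOp_neg {w : W N} {α β : Fin N → ℤ} (hα : α ∈ posRoots N) (hβ : β ∈ posRoots N)
    (h : toV β = -w.1 (toV α)) : act x₀ w * rOp x₀ α =
      (1 - act x₀ (sRefl ⟨β, hβ⟩) - rOp x₀ β) * act x₀ w :=
  AnGerm.hom_ext fun f hf => by
    rw [Module.End.mul_apply, Module.End.mul_apply, LinearMap.sub_apply, LinearMap.sub_apply,
      Module.End.one_apply, rOp_mk hα, act_mk, act_mk, act_mk, rOp_mk hβ, AnGerm.mk_sub,
      AnGerm.mk_sub, AnGerm.mk_eq_mk]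
    filter_upwards [regSet_mem_nearReg x₀] with y hy
    have h1 := pairing_W_neg h ((w⁻¹).1 y)
    have h2 := refl_W_neg h ((w⁻¹).1 y)
    rw [W_inv_apply] at h1 h2
    have h3 : pairing α ((w⁻¹).1 y) = -pairing β y := by rw [h1, neg_neg]
    have h4 : (sRefl ⟨β, hβ⟩)⁻¹.1 y = refl β y := by rw [sRefl_inv]; rfl
    simp only [rFun]
    rw [h4, h3, aF_neg (hy β hβ), h2, W_inv_apply']
    ring

end ActLemmas

section Generation

variable {N : ℕ}

/-- The permutations of the coordinates. -/
def permW (σ : Equiv.Perm (Fin N)) : W N :=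
  ⟨LinearEquiv.funCongrLeft ℂ ℂ σ.symm, σ.symm, 1, fun x i => by
    simp [LinearEquiv.funCongrLeft_apply, LinearMap.funLeft_apply]⟩

theorem permW_apply (σ : Equiv.Perm (Fin N)) (x : Fin N → ℂ) (i : Fin N) :
    (permW σ).1 x i = x (σ.symm i) := rfl

theorem permW_mul (σ τ : Equiv.Perm (Fin N)) : permW (σ * τ) = permW σ * permW τ :=
  Subtype.ext (LinearEquiv.ext fun _ => rfl)

theorem permW_one : permW (1 : Equiv.Perm (Fin N)) = 1 :=
  Subtype.ext (LinearEquiv.ext fun _ => rfl)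

theorem permW_swap {i j : Fin N} (h : i < j) :
    permW (Equiv.swap i j) = sRefl ⟨eV i - eV j, eM_mem_of_lt h⟩ := by
  refine Subtype.ext (LinearEquiv.ext fun x => funext fun a => ?_)
  change x ((Equiv.swap i j).symm a) = refl (eV i - eV j) x a
  rw [refl_apply, pairing_eV_sub, normSq_sub h.ne, Equiv.symm_swap]
  by_cases h1 : a = i
  · subst h1; simp [h.ne]
  · by_cases h2 : a = j
    · subst h2; simp [h1]
    · simp [h1, h2, Equiv.swap_apply_of_ne_of_ne]

theorem refl_eV_self (i : Fin N) (x : Fin N → ℂ) (a : Fin N) :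
    refl (eV i) x a = if a = i then -x a else x a := by
  rw [refl_apply, pairing_single, normSq_single]
  by_cases h : a = i
  · subst h; simp; ring
  · simp [h]

theorem exists_eq_mul_permW (w : W N) : ∃ (σ : Equiv.Perm (Fin N)) (ε : Fin N → ℤˣ),
    ∀ x i, w.1 x i = ((ε i : ℤ) : ℂ) * (permW σ).1 x i := by
  obtain ⟨w, σ, ε, h⟩ := w
  exact ⟨σ.symm, ε, h⟩

/-- The group `W` is generated by the reflections in the simple roots. -/
theorem W_induction (S : Subgroup (W N))
    (h1 : ∀ i j : Fin N, ∀ h : i < j, i.1 + 1 = j.1 → sRefl ⟨eV i - eV j, eM_mem_of_lt h⟩ ∈ S)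
    (h2 : ∀ i : Fin N, i.1 + 1 = N → sRefl ⟨eV i, eV_mem i⟩ ∈ S) (w : W N) : w ∈ S := by
  rcases N with _ | n
  · have : w = 1 := Subtype.ext (LinearEquiv.ext fun x => Subsingleton.elim _ _)
    rw [this]
    exact S.one_mem
  have hperm : ∀ σ : Equiv.Perm (Fin (n + 1)), permW σ ∈ S := by
    intro σ
    have hσ : σ ∈ Submonoid.closure (Set.range fun i : Fin n => Equiv.swap i.castSucc i.succ) := by
      rw [Equiv.Perm.mclosure_swap_castSucc_succ]; trivial
    induction hσ using Submonoid.closure_induction with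
    | mem σ hσ =>
      obtain ⟨i, rfl⟩ := hσ
      have h : i.castSucc < i.succ := Fin.castSucc_lt_succ
      change permW (Equiv.swap i.castSucc i.succ) ∈ S
      rw [permW_swap h]
      exact h1 _ _ h rfl
    | one => rw [permW_one]; exact S.one_mem
    | mul σ τ _ _ hs ht => rw [permW_mul]; exact S.mul_mem hs ht
  have hflip : ∀ i : Fin (n + 1), sRefl ⟨eV i, eV_mem i⟩ ∈ S := by
    intro i
    have e : sRefl ⟨eV i, eV_mem i⟩ = permW (Equiv.swap i (Fin.last n)) *
        sRefl ⟨eV (Fin.last n), eV_mem _⟩ * permW (Equiv.swap i (Fin.last n)) := by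
      refine Subtype.ext (LinearEquiv.ext fun x => funext fun a => ?_)
      change refl (eV i) x a = (refl (eV (Fin.last n))
        ((permW (Equiv.swap i (Fin.last n))).1 x)) ((Equiv.swap i (Fin.last n)).symm a)
      rw [refl_eV_self, refl_eV_self, permW_apply, Equiv.symm_swap, Equiv.swap_apply_self]
      have : (Equiv.swap i (Fin.last n)) a = Fin.last n ↔ a = i := by
        rw [Equiv.swap_apply_eq_iff, Equiv.swap_apply_right]
      simp only [this]
    rw [e]
    exact S.mul_mem (S.mul_mem (hperm _) (h2 _ rfl)) (hperm _)
  have hsign : ∀ (s : Finset (Fin (n + 1))) (v : W (n + 1)), (∀ x i, v.1 x i = if i ∈ s then -x i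
      else x i) → v ∈ S := by
    intro s
    induction s using Finset.induction_on with
    | empty =>
      intro v hv
      have : v = 1 := Subtype.ext (LinearEquiv.ext fun x => funext fun i => by rw [hv]; simp)
      rw [this]
      exact S.one_mem
    | insert a s ha ih =>
      intro v hv
      have : sRefl ⟨eV a, eV_mem a⟩ * v ∈ S := by
        refine ih _ fun x i => ?_
        change refl (eV a) (v.1 x) i = _
        rw [refl_eV_self, hv]
        by_cases h : i = a
        · subst h; simp [ha]
        · simp [h]
      exact (S.mul_mem_cancel_left (hflip a)).1 this
  obtain ⟨σ, ε, h⟩ := exists_eq_mul_permW w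
  have : w * permW σ⁻¹ ∈ S := by
    refine hsign (univ.filter fun i => ε i = -1) _ fun x i => ?_
    change w.1 ((permW σ⁻¹).1 x) i = _
    rw [h, permW_apply, permW_apply]
    have : σ⁻¹.symm (σ.symm i) = i := σ.apply_symm_apply i
    rw [this]
    rcases Int.units_eq_one_or (ε i) with h2 | h2 <;> simp [h2]
  exact (S.mul_mem_cancel_right (hperm σ⁻¹)).1 this

end Generation

section Hecke

variable {N : ℕ} (x₀ : Fin N → ℂ) (c₁ c₂ c₃ : ℂ)

theorem toV_eP (i k : Fin N) : toV (eP i k) = bV i + bV k := by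
  funext a; simp [toV, eP, Pi.single_apply]

theorem toV_eV_sub (i k : Fin N) : toV (eV i - eV k) = bV i - bV k := by
  funext a; simp [toV, Pi.single_apply]

theorem toV_two_eV (i : Fin N) : toV (2 • eV i) = (2 : ℂ) • bV i := by
  funext b; simp [toV, Pi.single_apply]

theorem permW_bV (σ : Equiv.Perm (Fin N)) (i : Fin N) : (permW σ).1 (bV i) = bV (σ i) := by
  funext a
  rw [permW_apply, bV, bV, Pi.single_apply, Pi.single_apply]
  simp only [Equiv.symm_apply_eq]

theorem smul_add_smul_mul_comm {A : Type*} [Ring A] [Algebra ℂ A] {s p q p' q' : A} (c d : ℂ)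
    (h1 : s * p = p' * s) (h2 : s * q = q' * s) :
    s * (c • p + d • q) = (c • p' + d • q') * s := by
  simp only [mul_add, add_mul, mul_smul_comm, smul_mul_assoc, h1, h2]

theorem act_mul_fOp (σ : Equiv.Perm (Fin N)) (i : Fin N) :
    act x₀ (permW σ) * fOp x₀ c₂ c₃ i = fOp x₀ c₂ c₃ (σ i) * act x₀ (permW σ) :=
  smul_add_smul_mul_comm (A := Module.End ℂ (AnGerm (nearReg x₀))) _ _
    (act_mul_rOp x₀ (eV_mem i) (eV_mem _) (by rw [toV_eV, toV_eV, permW_bV]))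
    (act_mul_rOp x₀ (two_eV_mem i) (two_eV_mem _)
      (by rw [toV_two_eV, toV_two_eV, map_smul, permW_bV]))

theorem act_mul_rOp_eP (σ : Equiv.Perm (Fin N)) {i k : Fin N} (h : i ≠ k) :
    act x₀ (permW σ) * rOp x₀ (eP i k) = rOp x₀ (eP (σ i) (σ k)) * act x₀ (permW σ) :=
  act_mul_rOp x₀ (eP_mem h) (eP_mem (σ.injective.ne h))
    (by rw [toV_eP, toV_eP, map_add, permW_bV, permW_bV])

theorem act_mul_eOp (σ : Equiv.Perm (Fin N)) {i k : Fin N} (h : i ≠ k)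
    (h' : i < k ↔ σ i < σ k) :
    act x₀ (permW σ) * eOp x₀ i k = eOp x₀ (σ i) (σ k) * act x₀ (permW σ) := by
  have hs : sgn (σ i) (σ k) = sgn i k := by simp only [sgn, h']
  have hM : act x₀ (permW σ) * rOp x₀ (eM i k) =
      rOp x₀ (eM (σ i) (σ k)) * act x₀ (permW σ) := by
    refine act_mul_rOp x₀ (eM_mem h) (eM_mem (σ.injective.ne h)) ?_
    simp only [eM, h']
    split_ifs <;> simp only [toV_eV_sub, map_sub, permW_bV]
  have hP := act_mul_rOp_eP x₀ σ h
  have := smul_add_smul_mul_comm (A := Module.End ℂ (AnGerm (nearReg x₀))) (sgn i k) 1 hM hP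
  rw [one_smul, one_smul] at this
  rw [eOp, eOp, hs]
  exact this

theorem hecke_pair {A : Type*} [Ring A] {s m p : A} (hs : s * s = 1)
    (hm : s * m = (1 - s - m) * s) (hp : s * p = p * s) :
    s * (m + p) = (p - m) * s + (s - 1) ∧ s * (p - m) = (m + p) * s - (s - 1) := by
  rw [sub_mul, sub_mul, hs, one_mul] at hm
  refine ⟨?_, ?_⟩
  · rw [mul_add, hm, hp, sub_mul]; abel
  · rw [mul_sub, hm, hp, add_mul]; abel

variable {i j : Fin N}

theorem act_mul_eOp_adj (h : i < j) :
    act x₀ (permW (Equiv.swap i j)) * eOp x₀ i j =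
      eOp x₀ j i * act x₀ (permW (Equiv.swap i j)) + (act x₀ (permW (Equiv.swap i j)) - 1) ∧
    act x₀ (permW (Equiv.swap i j)) * eOp x₀ j i =
      eOp x₀ i j * act x₀ (permW (Equiv.swap i j)) - (act x₀ (permW (Equiv.swap i j)) - 1) := by
  have hm : act x₀ (permW (Equiv.swap i j)) * rOp x₀ (eV i - eV j) = _ :=
    act_mul_rOp_neg x₀ (eM_mem_of_lt h) (eM_mem_of_lt h) (by
      rw [toV_eV_sub, map_sub, permW_bV, permW_bV, Equiv.swap_apply_left, Equiv.swap_apply_right,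
        neg_sub])
  have hp := act_mul_rOp_eP x₀ (Equiv.swap i j) h.ne
  rw [Equiv.swap_apply_left, Equiv.swap_apply_right, eP_comm j i] at hp
  rw [eOp_of_lt x₀ h, eOp_of_gt x₀ h]
  have hs : act x₀ (permW (Equiv.swap i j)) * act x₀ (permW (Equiv.swap i j)) = 1 := by
    rw [permW_swap h, act_sRefl_mul_self]
  rw [← permW_swap h] at hm
  exact hecke_pair (A := Module.End ℂ (AnGerm (nearReg x₀))) hs hm hp

/-- For adjacent indices, the transposition preserves the order of all other pairs. -/
theorem swap_lt_swap_iff (hij : i.1 + 1 = j.1) {a b : Fin N} (h : a ≠ b)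
    (h1 : ¬(a = i ∧ b = j)) (h2 : ¬(a = j ∧ b = i)) :
    a < b ↔ Equiv.swap i j a < Equiv.swap i j b := by
  simp only [Equiv.swap_apply_def, Fin.ext_iff, Fin.lt_def] at *
  split_ifs <;> omega

theorem sum_intertwine {A ι : Type*} [Ring A] [DecidableEq ι] (s d : A) (S S' : Finset ι)
    (E E' : ι → A) (σ : Equiv.Perm ι) (hσ : ∀ k, σ k ∈ S' ↔ k ∈ S) {k₀ : ι} (hk₀ : k₀ ∈ S)
    (h₀ : s * E k₀ = E' (σ k₀) * s + d) (h : ∀ k ∈ S, k ≠ k₀ → s * E k = E' (σ k) * s) :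
    s * ∑ k ∈ S, E k = (∑ k ∈ S', E' k) * s + d := by
  have h1 : ∑ k ∈ S', E' k = ∑ k ∈ S, E' (σ k) := by
    refine (sum_equiv σ (fun k => (hσ k).symm) fun k _ => rfl).symm
  rw [h1, ← add_sum_erase S E hk₀, ← add_sum_erase S (fun k => E' (σ k)) hk₀,
    mul_add, h₀, mul_sum, add_mul, sum_mul,
    sum_congr rfl fun k hk => h k (mem_of_mem_erase hk) (ne_of_mem_erase hk)]
  abel

theorem sum_intertwine' {A ι : Type*} [Ring A] (s : A) (S S' : Finset ι)
    (E E' : ι → A) (σ : Equiv.Perm ι) (hσ : ∀ k, σ k ∈ S' ↔ k ∈ S)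
    (h : ∀ k ∈ S, s * E k = E' (σ k) * s) :
    s * ∑ k ∈ S, E k = (∑ k ∈ S', E' k) * s := by
  have h1 : ∑ k ∈ S', E' k = ∑ k ∈ S, E' (σ k) := by
    refine (sum_equiv σ (fun k => (hσ k).symm) fun k _ => rfl).symm
  rw [h1, mul_sum, sum_mul, sum_congr rfl h]

theorem mem_erase_perm (σ : Equiv.Perm (Fin N)) (a k : Fin N) :
    σ k ∈ univ.erase (σ a) ↔ k ∈ univ.erase a := by
  simp

theorem mul_add_smul_eq {A : Type*} [Ring A] [Algebra ℂ A] {s f f' t t' d : A} (c : ℂ)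
    (hf : s * f = f' * s) (ht : s * t = t' * s + d) :
    s * (f + c • t) = (f' + c • t') * s + c • d := by
  rw [mul_add, hf, mul_smul_comm, ht, add_mul, smul_mul_assoc, smul_add, add_assoc]

theorem dunkl_intertwine {A : Type*} [Ring A] [Algebra ℂ A] {s D D' G G' : A} {r r' κ : ℂ}
    (hD : s * D = D' * s) (hG : s * G = G' * s + κ • (s - 1)) (hr : r = r' + κ) :
    s * (D - G + r • (1 : A)) = (D' - G' + r' • (1 : A)) * s + κ • (1 : A) := by
  rw [mul_add, mul_sub, hD, hG, add_mul, sub_mul, smul_mul_assoc, mul_smul_comm, mul_one, one_mul,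
    hr]
  module

theorem act_mul_dOp_perm (σ : Equiv.Perm (Fin N)) (a : Fin N) :
    act x₀ (permW σ) * dOp x₀ (bV a) = dOp x₀ (bV (σ a)) * act x₀ (permW σ) := by
  rw [act_mul_dOp, permW_bV]

/-- The commutation relation of a Dunkl operator with an adjacent transposition. -/
theorem act_swap_mul_dunkl (hij : i.1 + 1 = j.1) (a : Fin N) :
    act x₀ (permW (Equiv.swap i j)) * dunkl x₀ c₁ c₂ c₃ a =
      dunkl x₀ c₁ c₂ c₃ (Equiv.swap i j a) * act x₀ (permW (Equiv.swap i j)) +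
        (if a = i then c₁ else if a = j then -c₁ else 0 : ℂ) • 1 := by
  have h : i < j := by rw [Fin.lt_def]; omega
  have hr : weylVec N c₁ c₂ c₃ i = weylVec N c₁ c₂ c₃ j + c₁ := by
    have h1 : (∑ k, if i < k then (1 : ℂ) else 0) = (∑ k, if j < k then 1 else 0) + 1 := by
      have : ∀ k, (if i < k then (1 : ℂ) else 0) = (if j < k then 1 else 0) +
          if k = j then 1 else 0 := fun k => by
        simp only [Fin.ext_iff, Fin.lt_def]
        split_ifs <;> first | omega | simp
      rw [sum_congr rfl fun k _ => this k, sum_add_distrib]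
      simp
    have h2 := two_mul_weylVec_eq c₁ c₂ c₃ i
    have h3 := two_mul_weylVec_eq c₁ c₂ c₃ j
    rw [h1] at h2
    linear_combination h2 / 2 - h3 / 2
  have hE := act_mul_eOp_adj x₀ h
  rw [dunkl_eq, dunkl_eq]
  refine dunkl_intertwine (A := Module.End ℂ (AnGerm (nearReg x₀)))
    (act_mul_dOp_perm x₀ (Equiv.swap i j) a) ?_ ?_
  · rw [gOp_eq, gOp_eq]
    by_cases hai : a = i
    · subst hai
      rw [if_pos rfl]
      refine mul_add_smul_eq (A := Module.End ℂ (AnGerm (nearReg x₀))) _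
        (act_mul_fOp x₀ c₂ c₃ _ _) ?_
      refine sum_intertwine (A := Module.End ℂ (AnGerm (nearReg x₀))) _ _ _ _ _ _ _
        (mem_erase_perm _ a) (k₀ := j) (mem_erase.2 ⟨h.ne', mem_univ _⟩) ?_ ?_
      · rw [Equiv.swap_apply_left, Equiv.swap_apply_right]
        exact hE.1
      · intro k hk hkj
        have hk' := ne_of_mem_erase hk
        exact act_mul_eOp x₀ _ hk'.symm
          (swap_lt_swap_iff hij hk'.symm (fun h => hkj h.2) (fun h' => hk' h'.2))
    · by_cases haj : a = j
      · subst haj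
        rw [if_neg hai, if_pos rfl]
        have : ∀ d : Module.End ℂ (AnGerm (nearReg x₀)), (-c₁) • d = c₁ • (-d) := fun d => by
          module
        rw [this]
        refine mul_add_smul_eq (A := Module.End ℂ (AnGerm (nearReg x₀))) _
          (act_mul_fOp x₀ c₂ c₃ _ _) ?_
        refine sum_intertwine (A := Module.End ℂ (AnGerm (nearReg x₀))) _ _ _ _ _ _ _
          (mem_erase_perm _ a) (k₀ := i) (mem_erase.2 ⟨h.ne, mem_univ _⟩) ?_ ?_
        · rw [Equiv.swap_apply_left, Equiv.swap_apply_right]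
          exact hE.2.trans (by abel)
        · intro k hk hki
          have hk' := ne_of_mem_erase hk
          exact act_mul_eOp x₀ _ hk'.symm
            (swap_lt_swap_iff hij hk'.symm (fun h => hai h.1) (fun h' => hki h'.2))
      · rw [if_neg hai, if_neg haj]
        have e : (0 : ℂ) • (act x₀ (permW (Equiv.swap i j)) - 1) = c₁ • 0 := by module
        rw [e]
        refine mul_add_smul_eq (A := Module.End ℂ (AnGerm (nearReg x₀))) _
          (act_mul_fOp x₀ c₂ c₃ _ _) ?_
        rw [add_zero]
        refine sum_intertwine' (A := Module.End ℂ (AnGerm (nearReg x₀))) _ _ _ _ _ _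
          (mem_erase_perm _ a) ?_
        intro k hk
        have hk' := ne_of_mem_erase hk
        exact act_mul_eOp x₀ _ hk'.symm
          (swap_lt_swap_iff hij hk'.symm (fun h => hai h.1) (fun h' => haj h'.1))
  · by_cases hai : a = i
    · subst hai
      rw [if_pos rfl, Equiv.swap_apply_left, hr]
    · by_cases haj : a = j
      · subst haj
        rw [if_neg hai, if_pos rfl, Equiv.swap_apply_right, hr]
        ring
      · rw [if_neg hai, if_neg haj, Equiv.swap_apply_of_ne_of_ne hai haj, add_zero]

variable {l : Fin N}

theorem flip_bV (l a : Fin N) : (sRefl ⟨eV l, eV_mem l⟩).1 (bV a) =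
    if a = l then -bV a else bV a := by
  funext b
  change refl (eV l) (bV a) b = _
  rw [refl_eV_self]
  by_cases h : a = l
  · subst h
    by_cases h' : b = a <;> simp [h']
  · by_cases h' : b = l
    · subst h'; simp [h, Ne.symm h]
    · simp [h, h']

theorem flip_pair {A : Type*} [Ring A] {s p m : A} (h1 : s * p = m * s) (h2 : s * m = p * s) :
    s * (m + p) = (m + p) * s ∧ s * (p - m) = -(p - m) * s := by
  constructor
  · rw [mul_add, h1, h2, add_mul, add_comm]
  · rw [mul_sub, h1, h2, neg_mul, sub_mul]; abel

theorem flip_two {A : Type*} [Ring A] [Algebra ℂ A] {s p q : A} (c d : ℂ) (hs : s * s = 1)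
    (h1 : s * p = (1 - s - p) * s) (h2 : s * q = (1 - s - q) * s) :
    s * (c • p + (2 * d) • q) = -(c • p + (2 * d) • q) * s + (c + 2 * d) • (s - 1) := by
  rw [sub_mul, sub_mul, hs, one_mul] at h1 h2
  rw [mul_add, mul_smul_comm, mul_smul_comm, h1, h2, neg_mul, add_mul, smul_mul_assoc,
    smul_mul_assoc]
  module

theorem act_flip_mul_eOp {a b : Fin N} (hl : l.1 + 1 = N) (h : a ≠ b) :
    act x₀ (sRefl ⟨eV l, eV_mem l⟩) * eOp x₀ a b =
      (if a = l then -1 else 1 : ℂ) • eOp x₀ a b * act x₀ (sRefl ⟨eV l, eV_mem l⟩) := by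
  have hlt : ∀ k : Fin N, k ≠ l → k < l := fun k hk => by
    rw [Fin.lt_def]
    have := k.2
    have : k.1 ≠ l.1 := fun h => hk (Fin.ext h)
    omega
  have key : ∀ k, k ≠ l →
      act x₀ (sRefl ⟨eV l, eV_mem l⟩) * rOp x₀ (eP k l) =
        rOp x₀ (eV k - eV l) * act x₀ (sRefl ⟨eV l, eV_mem l⟩) ∧
      act x₀ (sRefl ⟨eV l, eV_mem l⟩) * rOp x₀ (eV k - eV l) =
        rOp x₀ (eP k l) * act x₀ (sRefl ⟨eV l, eV_mem l⟩) := fun k hk => by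
    constructor
    · refine act_mul_rOp x₀ (eP_mem hk) (eM_mem_of_lt (hlt k hk)) ?_
      rw [toV_eP, toV_eV_sub, map_add, flip_bV, flip_bV, if_neg hk, if_pos rfl, sub_eq_add_neg]
    · refine act_mul_rOp x₀ (eM_mem_of_lt (hlt k hk)) (eP_mem hk) ?_
      rw [toV_eP, toV_eV_sub, map_sub, flip_bV, flip_bV, if_neg hk, if_pos rfl, sub_neg_eq_add]
  by_cases ha : a = l
  · subst ha
    have h1 := flip_pair (A := Module.End ℂ (AnGerm (nearReg x₀))) (key b h.symm).1
      (key b h.symm).2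
    rw [eOp_of_gt x₀ (hlt b h.symm), if_pos rfl]
    refine h1.2.trans ?_
    congr 1
    module
  · rw [if_neg ha, one_smul]
    by_cases hb : b = l
    · subst hb
      have h1 := flip_pair (A := Module.End ℂ (AnGerm (nearReg x₀))) (key a ha).1 (key a ha).2
      rw [eOp_of_lt x₀ (hlt a ha)]
      exact h1.1
    · have hM : act x₀ (sRefl ⟨eV l, eV_mem l⟩) * rOp x₀ (eM a b) =
          rOp x₀ (eM a b) * act x₀ (sRefl ⟨eV l, eV_mem l⟩) := by
        refine act_mul_rOp x₀ (eM_mem h) (eM_mem h) ?_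
        simp only [eM]
        split_ifs <;> simp only [toV_eV_sub, map_sub, flip_bV, if_neg ha, if_neg hb]
      have hP : act x₀ (sRefl ⟨eV l, eV_mem l⟩) * rOp x₀ (eP a b) =
          rOp x₀ (eP a b) * act x₀ (sRefl ⟨eV l, eV_mem l⟩) := by
        refine act_mul_rOp x₀ (eP_mem h) (eP_mem h) ?_
        simp only [toV_eP, map_add, flip_bV, if_neg ha, if_neg hb]
      have := smul_add_smul_mul_comm (A := Module.End ℂ (AnGerm (nearReg x₀))) (sgn a b) 1 hM hP
      rw [one_smul] at this
      exact this

theorem flip_sum {A ι : Type*} [Ring A] [Algebra ℂ A] {s f d : A} {E : ι → A} {S : Finset ι}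
    (c ε : ℂ) (hf : s * f = (ε • f) * s + d) (hE : ∀ k ∈ S, s * E k = ε • E k * s) :
    s * (f + c • ∑ k ∈ S, E k) = (ε • (f + c • ∑ k ∈ S, E k)) * s + d := by
  rw [mul_add, hf, mul_smul_comm, mul_sum, sum_congr rfl hE]
  simp only [smul_add, add_mul, smul_mul_assoc, ← smul_sum, ← sum_mul]
  module

theorem dunkl_flip {A : Type*} [Ring A] [Algebra ℂ A] {s D G : A} {r κ ε : ℂ}
    (hD : s * D = (ε • D) * s) (hG : s * G = (ε • G) * s + κ • (s - 1)) (hr : r = ε * r + κ) :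
    s * (D - G + r • (1 : A)) = ε • (D - G + r • (1 : A)) * s + κ • (1 : A) := by
  have : ε • (D - G + r • (1 : A)) = ε • D - ε • G + (ε * r) • (1 : A) := by module
  rw [this]
  exact dunkl_intertwine hD hG hr

/-- The commutation relation of a Dunkl operator with the sign change of the last coordinate. -/
theorem act_flip_mul_dunkl (hl : l.1 + 1 = N) (a : Fin N) :
    act x₀ (sRefl ⟨eV l, eV_mem l⟩) * dunkl x₀ c₁ c₂ c₃ a =
      ((if a = l then -1 else 1 : ℂ) • dunkl x₀ c₁ c₂ c₃ a) * act x₀ (sRefl ⟨eV l, eV_mem l⟩) +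
        (if a = l then c₂ + 2 * c₃ else 0 : ℂ) • 1 := by
  have hs := act_sRefl_mul_self x₀ ⟨eV l, eV_mem l⟩
  rw [dunkl_eq]
  refine dunkl_flip (A := Module.End ℂ (AnGerm (nearReg x₀))) ?_ ?_ ?_
  · rw [act_mul_dOp, flip_bV]
    split_ifs
    · rw [← neg_one_smul ℂ (bV a), dOp, dirDeriv_smul]
    · rw [one_smul]
  · rw [gOp_eq]
    refine flip_sum (A := Module.End ℂ (AnGerm (nearReg x₀))) _ _ ?_
      fun k hk => act_flip_mul_eOp x₀ hl (ne_of_mem_erase hk).symm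
    by_cases ha : a = l
    · subst ha
      rw [if_pos rfl, if_pos rfl]
      have h1 : act x₀ (sRefl ⟨eV a, eV_mem a⟩) * rOp x₀ (eV a) = _ :=
        act_mul_rOp_neg x₀ (eV_mem a) (eV_mem a)
          (by rw [toV_eV, flip_bV, if_pos rfl, neg_neg])
      have e : sRefl ⟨2 • eV a, two_eV_mem a⟩ = sRefl ⟨eV a, eV_mem a⟩ :=
        Subtype.ext (refl_two_eV a)
      have h2 : act x₀ (sRefl ⟨eV a, eV_mem a⟩) * rOp x₀ (2 • eV a) = _ :=
        act_mul_rOp_neg x₀ (two_eV_mem a) (two_eV_mem a)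
          (by rw [toV_two_eV, map_smul, flip_bV, if_pos rfl]; module)
      rw [e] at h2
      have := flip_two (A := Module.End ℂ (AnGerm (nearReg x₀))) c₂ c₃ hs h1 h2
      rw [fOp]
      refine this.trans ?_
      congr 2
      module
    · rw [if_neg ha, if_neg ha, one_smul, zero_smul, add_zero]
      exact smul_add_smul_mul_comm (A := Module.End ℂ (AnGerm (nearReg x₀))) _ _
        (act_mul_rOp x₀ (eV_mem a) (eV_mem a) (by rw [toV_eV, flip_bV, if_neg ha]))
        (act_mul_rOp x₀ (two_eV_mem a) (two_eV_mem a)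
          (by rw [toV_two_eV, map_smul, flip_bV, if_neg ha]))
  · by_cases ha : a = l
    · subst ha
      have h1 := two_mul_weylVec_eq c₁ c₂ c₃ a
      rw [sum_eq_zero fun k _ => if_neg fun h => by
        rw [Fin.lt_def] at h; have := k.2; omega] at h1
      rw [if_pos rfl, if_pos rfl]
      linear_combination h1
    · rw [if_neg ha, if_neg ha]; ring

end Hecke

section PolyDunkl

variable {N : ℕ} (x₀ : Fin N → ℂ) (c₁ c₂ c₃ : ℂ)

/-- Evaluation of polynomials at the Dunkl operators. -/
theorem exists_polyDunkl_algHom : ∃ Φ : MvPolynomial (Fin N) ℂ →ₐ[ℂ]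
    Module.End ℂ (AnGerm (nearReg x₀)), (∀ p, Φ p = polyDunkl x₀ c₁ c₂ c₃ p) ∧
      ∀ i, Φ (MvPolynomial.X i) = dunkl x₀ c₁ c₂ c₃ i := by
  obtain ⟨Φ, h, h'⟩ := exists_algHom_of_commute (dunkl x₀ c₁ c₂ c₃) (commute_dunkl c₁ c₂ c₃)
  exact ⟨Φ, h, h'⟩

theorem commute_polyDunkl (p q : MvPolynomial (Fin N) ℂ) :
    Commute (polyDunkl x₀ c₁ c₂ c₃ p) (polyDunkl x₀ c₁ c₂ c₃ q) := by
  obtain ⟨Φ, h, -⟩ := exists_polyDunkl_algHom x₀ c₁ c₂ c₃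
  rw [← h, ← h]
  exact (Commute.all p q).map Φ

theorem polyDunkl_sum_sq :
    polyDunkl x₀ c₁ c₂ c₃ (∑ i, MvPolynomial.X i ^ 2) = ∑ i, dunkl x₀ c₁ c₂ c₃ i ^ 2 := by
  obtain ⟨Φ, h, h'⟩ := exists_polyDunkl_algHom x₀ c₁ c₂ c₃
  rw [← h, map_sum]
  exact sum_congr rfl fun i _ => by rw [map_pow, h']

theorem polyDunkl_mem_cherednik (p : MvPolynomial (Fin N) ℂ) :
    polyDunkl x₀ c₁ c₂ c₃ p ∈ cherednik x₀ c₁ c₂ c₃ := by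
  obtain ⟨Φ, h, h'⟩ := exists_polyDunkl_algHom x₀ c₁ c₂ c₃
  rw [← h]
  induction p using MvPolynomial.induction_on with
  | C z =>
    rw [← MvPolynomial.algebraMap_eq, AlgHom.commutes]
    exact Subalgebra.algebraMap_mem _ _
  | add p q hp hq => rw [map_add]; exact Subalgebra.add_mem _ hp hq
  | mul_X p i hp =>
    rw [map_mul, h']
    exact Subalgebra.mul_mem _ hp (Algebra.subset_adjoin (Or.inr ⟨i, rfl⟩))

theorem aeval_eq_self_of_isInvPoly {p : MvPolynomial (Fin N) ℂ} (hp : IsInvPoly p) (w : W N)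
    (v : Fin N → MvPolynomial (Fin N) ℂ)
    (hv : ∀ x i, MvPolynomial.eval x (v i) = w.1 x i) : MvPolynomial.aeval v p = p := by
  refine MvPolynomial.funext fun x => ?_
  rw [← hp w.1 w.2 x]
  have : (MvPolynomial.aeval x : MvPolynomial (Fin N) ℂ →ₐ[ℂ] ℂ).comp (MvPolynomial.aeval v) =
      MvPolynomial.aeval (w.1 x) := by
    refine MvPolynomial.algHom_ext fun i => ?_
    rw [AlgHom.comp_apply, MvPolynomial.aeval_X, MvPolynomial.aeval_X]
    exact hv x i
  exact congrArg (fun φ : MvPolynomial (Fin N) ℂ →ₐ[ℂ] ℂ => φ p) this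

/-- Invariant polynomials of the Dunkl operators commute with `W`. -/
theorem commute_act_polyDunkl {p : MvPolynomial (Fin N) ℂ} (hp : IsInvPoly p) (w : W N) :
    Commute (act x₀ w) (polyDunkl x₀ c₁ c₂ c₃ p) := by
  obtain ⟨Φ, h, h'⟩ := exists_polyDunkl_algHom x₀ c₁ c₂ c₃
  rw [← h]
  let S : Subgroup (W N) :=
    { carrier := {w | Commute (act x₀ w) (Φ p)}
      mul_mem' := fun {v w} hv hw => by
        change Commute (act x₀ (v * w)) (Φ p)
        rw [act_mul]
        exact Commute.mul_left hv hw
      one_mem' := by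
        change Commute (act x₀ 1) (Φ p)
        rw [act_one]
        exact Commute.one_left _
      inv_mem' := fun {w} hw => by
        have e1 : act x₀ w⁻¹ * act x₀ w = 1 := by rw [← act_mul, inv_mul_cancel, act_one]
        have e2 : act x₀ w * act x₀ w⁻¹ = 1 := by rw [← act_mul, mul_inv_cancel, act_one]
        change act x₀ w⁻¹ * Φ p = Φ p * act x₀ w⁻¹
        have hw' : act x₀ w * Φ p = Φ p * act x₀ w := hw
        calc act x₀ w⁻¹ * Φ p = act x₀ w⁻¹ * (Φ p * act x₀ w) * act x₀ w⁻¹ := by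
              rw [mul_assoc, mul_assoc, e2, mul_one]
          _ = _ := by rw [← hw', ← mul_assoc, e1, one_mul] }
  refine W_induction S (fun i j hlt hij => ?_) (fun l hl => ?_) w
  · change Commute (act x₀ _) (Φ p)
    rw [← permW_swap hlt]
    refine commute_of_hecke (A := Module.End ℂ (AnGerm (nearReg x₀))) Φ _
      (MvPolynomial.aeval fun a => MvPolynomial.X (Equiv.swap i j a))
      (a := MvPolynomial.X i - MvPolynomial.X j) ?_ c₁ (fun a => ?_)
      (aeval_eq_self_of_isInvPoly hp (permW (Equiv.swap i j)) _ fun x a => by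
        rw [MvPolynomial.eval_X, permW_apply, Equiv.symm_swap])
    · rw [sub_ne_zero]
      exact fun e => hlt.ne (MvPolynomial.X_injective e)
    · refine ⟨MvPolynomial.C (if a = i then c₁ else if a = j then -c₁ else 0), ?_, ?_⟩
      · rw [MvPolynomial.aeval_X, h', h', act_swap_mul_dunkl x₀ c₁ c₂ c₃ hij,
          ← MvPolynomial.algebraMap_eq, AlgHom.commutes, Algebra.algebraMap_eq_smul_one]
      · rw [MvPolynomial.aeval_X, MvPolynomial.smul_eq_C_mul]
        by_cases hai : a = i
        · subst hai
          rw [if_pos rfl, Equiv.swap_apply_left, mul_comm]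
        · by_cases haj : a = j
          · subst haj
            rw [if_neg hai, if_pos rfl, Equiv.swap_apply_right, map_neg]
            ring
          · rw [if_neg hai, if_neg haj, Equiv.swap_apply_of_ne_of_ne hai haj, sub_self, map_zero,
              mul_zero, mul_zero]
  · change Commute (act x₀ _) (Φ p)
    refine commute_of_hecke (A := Module.End ℂ (AnGerm (nearReg x₀))) Φ _
      (MvPolynomial.aeval fun a => (if a = l then -1 else 1 : ℂ) • MvPolynomial.X a)
      (a := (2 : ℂ) • MvPolynomial.X l) ?_ (c₂ + 2 * c₃) (fun a => ?_)
      (aeval_eq_self_of_isInvPoly hp (sRefl ⟨eV l, eV_mem l⟩) _ fun x a => by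
        rw [MvPolynomial.smul_eval, MvPolynomial.eval_X]
        change _ = refl (eV l) x a
        rw [refl_eV_self]
        split_ifs <;> ring)
    · exact smul_ne_zero two_ne_zero (MvPolynomial.X_ne_zero l)
    · refine ⟨MvPolynomial.C (if a = l then c₂ + 2 * c₃ else 0), ?_, ?_⟩
      · rw [MvPolynomial.aeval_X, map_smul, h', act_flip_mul_dunkl x₀ c₁ c₂ c₃ hl,
          ← MvPolynomial.algebraMap_eq, AlgHom.commutes, Algebra.algebraMap_eq_smul_one]
      · rw [MvPolynomial.aeval_X]
        by_cases ha : a = l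
        · subst ha
          simp only [if_true, MvPolynomial.smul_eq_C_mul, map_neg, map_one, map_ofNat]
          ring
        · rw [if_neg ha, if_neg ha, one_smul, sub_self, map_zero, mul_zero, smul_zero]

end PolyDunkl

section Geometry

variable {N : ℕ}

instance finite_W (N : ℕ) : Finite (W N) := by
  have h : ∀ w : W N, ∃ p : Equiv.Perm (Fin N) × (Fin N → ℤˣ),
      ∀ x i, w.1 x i = ((p.2 i : ℤ) : ℂ) * x (p.1 i) := fun ⟨w, σ, ε, h⟩ => ⟨(σ, ε), h⟩
  choose f hf using h
  refine Finite.of_injective f fun v w hvw => Subtype.ext (LinearEquiv.ext fun x => funext fun i => ?_)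
  rw [hf, hf, hvw]

instance fintype_W (N : ℕ) : Fintype (W N) := Fintype.ofFinite _

theorem finite_orbit (x₀ : Fin N → ℂ) : (orbit x₀).Finite := by
  have : orbit x₀ = Set.range fun w : W N => w.1 x₀ := by
    ext x
    constructor
    · rintro ⟨w, hw, rfl⟩
      exact ⟨⟨w, hw⟩, rfl⟩
    · rintro ⟨w, rfl⟩
      exact ⟨w.1, w.2, rfl⟩
  rw [this]
  exact Set.finite_range _

theorem mem_orbit_self (x₀ : Fin N → ℂ) : x₀ ∈ orbit x₀ := ⟨1, (W N).one_mem, rfl⟩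

theorem W_mem_orbit {x₀ x : Fin N → ℂ} (w : W N) (hx : x ∈ orbit x₀) : w.1 x ∈ orbit x₀ :=
  orbit_mapsTo x₀ w hx

theorem pairing_eM {i k : Fin N} (y : Fin N → ℂ) : pairing (eM i k) y = sgn i k * (y i - y k) := by
  unfold eM sgn
  split_ifs <;> rw [pairing_eV_sub] <;> ring

theorem sgn_eq (i k : Fin N) : sgn i k = 1 ∨ sgn i k = -1 := by
  unfold sgn
  split_ifs <;> simp

/-- `W` permutes the roots, up to sign. -/
theorem exists_root_W (w : W N) {β : Fin N → ℤ} (hβ : β ∈ posRoots N) :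
    ∃ α ∈ posRoots N, ∃ s : ℂ, (s = 1 ∨ s = -1) ∧ ∀ y, pairing β (w.1 y) = s * pairing α y := by
  obtain ⟨w, σ, ε, h⟩ := w
  have hε : ∀ i, ((ε i : ℤ) : ℂ) = 1 ∨ ((ε i : ℤ) : ℂ) = -1 := fun i => by
    rcases Int.units_eq_one_or (ε i) with h2 | h2 <;> simp [h2]
  have hpair : ∀ a b : Fin N, a ≠ b → ∀ s t : ℂ, (s = 1 ∨ s = -1) → (t = 1 ∨ t = -1) →
      ∃ α ∈ posRoots N, ∃ r : ℂ, (r = 1 ∨ r = -1) ∧ ∀ y : Fin N → ℂ,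
        s * y a + t * y b = r * pairing α y := by
    intro a b hab s t hs ht
    have hM : ∀ r : ℂ, r = 1 ∨ r = -1 → ∃ α ∈ posRoots N, ∃ r' : ℂ, (r' = 1 ∨ r' = -1) ∧
        ∀ y : Fin N → ℂ, r * (y a - y b) = r' * pairing α y := fun r hr => by
      refine ⟨eM a b, eM_mem hab, r * sgn a b, ?_, fun y => ?_⟩
      · rcases hr with rfl | rfl <;> rcases sgn_eq a b with h | h <;> simp [h]
      · rw [pairing_eM]
        rcases sgn_eq a b with h | h <;> rw [h] <;> ring
    have hP : ∀ r : ℂ, r = 1 ∨ r = -1 → ∃ α ∈ posRoots N, ∃ r' : ℂ, (r' = 1 ∨ r' = -1) ∧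
        ∀ y : Fin N → ℂ, r * (y a + y b) = r' * pairing α y := fun r hr =>
      ⟨eP a b, eP_mem hab, r, hr, fun y => by rw [pairing_eP]⟩
    rcases hs with rfl | rfl <;> rcases ht with rfl | rfl
    · obtain ⟨α, h1, r, h2, h3⟩ := hP 1 (Or.inl rfl)
      exact ⟨α, h1, r, h2, fun y => by rw [← h3]; ring⟩
    · obtain ⟨α, h1, r, h2, h3⟩ := hM 1 (Or.inl rfl)
      exact ⟨α, h1, r, h2, fun y => by rw [← h3]; ring⟩
    · obtain ⟨α, h1, r, h2, h3⟩ := hM (-1) (Or.inr rfl)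
      exact ⟨α, h1, r, h2, fun y => by rw [← h3]; ring⟩
    · obtain ⟨α, h1, r, h2, h3⟩ := hP (-1) (Or.inr rfl)
      exact ⟨α, h1, r, h2, fun y => by rw [← h3]; ring⟩
  rcases mem_posRoots.1 hβ with ⟨i, rfl⟩ | ⟨i, rfl⟩ | ⟨i, j, hij, rfl⟩ | ⟨i, j, hij, rfl⟩
  · exact ⟨eV (σ i), eV_mem _, _, hε i, fun y => by rw [pairing_single, pairing_single, h]⟩
  · exact ⟨2 • eV (σ i), two_eV_mem _, _, hε i, fun y => by
      rw [pairing_two_eV, pairing_two_eV, h]; ring⟩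
  · have hneg : -((ε j : ℤ) : ℂ) = 1 ∨ -((ε j : ℤ) : ℂ) = -1 := by
      rcases hε j with h | h <;> rw [h] <;> simp
    obtain ⟨α, h1, r, h2, h3⟩ := hpair _ _ (σ.injective.ne hij.ne) _ _ (hε i) hneg
    exact ⟨α, h1, r, h2, fun y => by rw [← h3, pairing_eV_sub, h, h]; ring⟩
  · obtain ⟨α, h1, r, h2, h3⟩ := hpair _ _ (σ.injective.ne hij.ne) _ _ (hε i) (hε j)
    exact ⟨α, h1, r, h2, fun y => by rw [← h3, pairing_add, pairing_single, pairing_single, h, h]⟩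

/-- The directions orthogonal to all roots `α` with `e^{(α, x)} = 1`. -/
def dirAt (x : Fin N → ℂ) : Submodule ℂ (Fin N → ℂ) where
  carrier := {ξ | ∀ α ∈ posRoots N, exp (pairing α x) = 1 → pairing α ξ = 0}
  add_mem' := fun {a b} ha hb α hα h => by rw [pairing_vadd, ha α hα h, hb α hα h, add_zero]
  zero_mem' := fun α _ _ => map_zero (pairingL α)
  smul_mem' := fun c a ha α hα h => by rw [pairing_vsmul, ha α hα h, mul_zero]

theorem mem_dirAt {x ξ : Fin N → ℂ} : ξ ∈ dirAt x ↔
    ∀ α ∈ posRoots N, exp (pairing α x) = 1 → pairing α ξ = 0 := Iff.rfl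

theorem W_mem_dirAt (w : W N) {x ξ : Fin N → ℂ} (h : ξ ∈ dirAt x) : w.1 ξ ∈ dirAt (w.1 x) := by
  intro β hβ h1
  obtain ⟨α, hα, s, hs, h2⟩ := exists_root_W w hβ
  rw [h2] at h1 ⊢
  have : exp (pairing α x) = 1 := by
    rcases hs with rfl | rfl
    · rwa [one_mul] at h1
    · rw [neg_one_mul] at h1
      exact exp_neg_eq_one_iff.1 h1
  rw [h α hα this, mul_zero]

theorem dirAt_of_latEq {x x' : Fin N → ℂ} (h : LatEq x x') : dirAt x = dirAt x' := by
  have : ∀ α : Fin N → ℤ, exp (pairing α x') = exp (pairing α x) := fun α => by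
    rw [← sub_add_cancel x' x, pairing_vadd, Complex.exp_add, exp_pairing_sub_of_latEq h, one_mul]
  ext ξ
  simp only [mem_dirAt, this]

variable {k m l₁ l₂ : ℕ}

theorem isClosed_plane (N k m l₁ l₂ : ℕ) : IsClosed (plane N k m l₁ l₂) := by
  have : plane N k m l₁ l₂ = (⋂ i, ⋂ j, {x : Fin N → ℂ | i.1 < m * k → j.1 < m * k →
      i.1 / k = j.1 / k → x i = x j}) ∩ ((⋂ i : Fin N, {x : Fin N → ℂ | N ≤ i.1 + l₁ → x i = 0}) ∩
      (⋂ i : Fin N, {x : Fin N → ℂ | InShift N l₁ l₂ i → x i = Real.pi * Complex.I})) := by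
    ext x; simp [plane]
  have c1 : ∀ (p : Prop) (q : (Fin N → ℂ) → Prop), IsClosed {x | q x} →
      IsClosed {x | p → q x} := fun p q hq => by
    by_cases hp : p <;> simp [hp, hq]
  rw [this]
  refine IsClosed.inter ?_ (IsClosed.inter ?_ ?_)
  · refine isClosed_iInter fun i => isClosed_iInter fun j => c1 _ _ (c1 _ _ (c1 _ _ ?_))
    exact isClosed_eq (continuous_apply i) (continuous_apply j)
  · exact isClosed_iInter fun i => c1 _ _ (isClosed_eq (continuous_apply i) continuous_const)
  · exact isClosed_iInter fun i => c1 _ _ (isClosed_eq (continuous_apply i) continuous_const)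

theorem add_smul_sub_mem_plane {x y : Fin N → ℂ} (hx : x ∈ plane N k m l₁ l₂)
    (hy : y ∈ plane N k m l₁ l₂) (t : ℂ) : x + t • (y - x) ∈ plane N k m l₁ l₂ := by
  obtain ⟨h1, h2, h3⟩ := hx
  obtain ⟨h4, h5, h6⟩ := hy
  refine ⟨fun i j hi hj hij => ?_, fun i hi => ?_, fun i hi => ?_⟩
  · simp only [Pi.add_apply, Pi.smul_apply, Pi.sub_apply, h1 i j hi hj hij, h4 i j hi hj hij]
  · simp [h2 i hi, h5 i hi]
  · simp [h3 i hi, h6 i hi]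

theorem eq_zero_of_exp_smul {a c : ℂ} (h : ∀ t : ℂ, exp (a + t * c) = 1) : c = 0 := by
  by_contra hc
  have h0 := h 0
  have h1 := h (1 / c)
  rw [zero_mul, add_zero] at h0
  rw [Complex.exp_add, h0, one_mul, one_div, inv_mul_cancel₀ hc] at h1
  have : ‖exp 1‖ = 1 := by rw [h1, norm_one]
  rw [Complex.norm_exp, Complex.one_re, Real.exp_eq_one_iff] at this
  exact one_ne_zero this

theorem sub_mem_dirAt_of_mem_plane {x₀ x y : Fin N → ℂ} (hx₀ : IsGeneric N k m l₁ l₂ x₀)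
    (hx : x ∈ plane N k m l₁ l₂) (hy : y ∈ plane N k m l₁ l₂) : y - x ∈ dirAt x₀ := by
  intro α hα h
  refine eq_zero_of_exp_smul (a := pairing α x) fun t => ?_
  rw [← pairing_vsmul, ← pairing_vadd]
  exact hx₀.2 α hα h _ (add_smul_sub_mem_plane hx hy t)

theorem mem_plane_iff {x₀ y : Fin N → ℂ} (hx₀ : IsGeneric N k m l₁ l₂ x₀) :
    y ∈ plane N k m l₁ l₂ ↔ y - x₀ ∈ dirAt x₀ := by
  refine ⟨fun h => sub_mem_dirAt_of_mem_plane hx₀ hx₀.1 h, fun h => ?_⟩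
  obtain ⟨h1, h2, h3⟩ := hx₀.1
  refine ⟨fun i j hi hj hij => ?_, fun i hi => ?_, fun i hi => ?_⟩
  · by_cases hne : i = j
    · rw [hne]
    · have h4 := h _ (eM_mem hne) (by
        rw [pairing_eM, h1 i j hi hj hij, sub_self, mul_zero, Complex.exp_zero])
      rw [pairing_eM] at h4
      have h5 : (y - x₀) i - (y - x₀) j = 0 := by
        rcases sgn_eq i j with h | h <;> rw [h] at h4
        · linear_combination h4
        · linear_combination -h4
      simp only [Pi.sub_apply, h1 i j hi hj hij] at h5
      linear_combination h5
  · have h4 := h _ (eV_mem i) (by rw [pairing_single, h2 i hi, Complex.exp_zero])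
    rw [pairing_single, Pi.sub_apply, h2 i hi, sub_zero] at h4
    exact h4
  · have h4 := h _ (two_eV_mem i) (by
      rw [pairing_two_eV, h3 i hi, ← mul_assoc, Complex.exp_two_pi_mul_I])
    rw [pairing_two_eV, Pi.sub_apply, h3 i hi] at h4
    linear_combination h4 / 2

theorem W_mem_stratum (w : W N) {y : Fin N → ℂ} (h : y ∈ stratum N k m l₁ l₂) :
    w.1 y ∈ stratum N k m l₁ l₂ := by
  obtain ⟨v, hv, z, hz, rfl⟩ := h
  exact ⟨w.1 * v, (W N).mul_mem w.2 hv, z, hz, rfl⟩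

theorem W_mem_stratum_iff (w : W N) {y : Fin N → ℂ} :
    w.1 y ∈ stratum N k m l₁ l₂ ↔ y ∈ stratum N k m l₁ l₂ :=
  ⟨fun h => by simpa only [W_inv_apply'] using W_mem_stratum w⁻¹ h, W_mem_stratum w⟩

theorem plane_subset_stratum : plane N k m l₁ l₂ ⊆ stratum N k m l₁ l₂ :=
  fun x hx => ⟨1, (W N).one_mem, x, hx, rfl⟩

theorem stratum_eventually_base {x₀ : Fin N → ℂ} (hx₀ : IsGeneric N k m l₁ l₂ x₀) :
    ∀ᶠ y in 𝓝 x₀, y ∈ stratum N k m l₁ l₂ ↔ y ∈ plane N k m l₁ l₂ := by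
  have h1 : ∀ w : W N, ∀ᶠ y in 𝓝 x₀, (w⁻¹).1 y ∈ plane N k m l₁ l₂ →
      (w⁻¹).1 x₀ ∈ plane N k m l₁ l₂ := fun w => by
    by_cases h : (w⁻¹).1 x₀ ∈ plane N k m l₁ l₂
    · exact Eventually.of_forall fun _ _ => h
    · filter_upwards [(continuous_W w⁻¹).continuousAt.eventually
        ((isClosed_plane N k m l₁ l₂).isOpen_compl.mem_nhds h)] with y hy hy'
      exact absurd hy' hy
  filter_upwards [eventually_all.2 h1] with y hy
  refine ⟨?_, fun h => plane_subset_stratum h⟩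
  rintro ⟨w, hw, z, hz, rfl⟩
  set v : W N := ⟨w, hw⟩
  have e : (v⁻¹).1 (w z) = z := W_inv_apply' v z
  have h2 := hy v (by rwa [e])
  have h3 : (v⁻¹).1 (w z - x₀) ∈ dirAt x₀ := by
    rw [map_sub, e]
    exact sub_mem_dirAt_of_mem_plane hx₀ h2 hz
  have h4 : (dirAt x₀).map (v⁻¹).1.toLinearMap ≤ dirAt x₀ := by
    rintro _ ⟨ξ, hξ, rfl⟩ α hα h
    exact W_mem_dirAt v⁻¹ hξ α hα (hx₀.2 α hα h _ h2)
  have h5 : (dirAt x₀).map (v⁻¹).1.toLinearMap = dirAt x₀ :=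
    Submodule.eq_of_le_of_finrank_eq h4 (LinearEquiv.finrank_map_eq (v⁻¹).1 _)
  rw [← h5] at h3
  obtain ⟨ξ, hξ, h6⟩ := h3
  have : ξ = w z - x₀ := (v⁻¹).1.injective h6
  rw [mem_plane_iff hx₀, ← this]
  exact hξ

/-- Near a point `x` of the orbit, the stratum is an affine plane. -/
theorem stratum_eventually {x₀ x : Fin N → ℂ} (hx₀ : IsGeneric N k m l₁ l₂ x₀)
    (hx : x ∈ orbit x₀) :
    ∀ᶠ y in 𝓝 x, y ∈ stratum N k m l₁ l₂ ↔ y - x ∈ dirAt x := by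
  obtain ⟨w, hw, rfl⟩ := hx
  set v : W N := ⟨w, hw⟩
  have h := (continuous_W v⁻¹).continuousAt (x := w x₀)
  have e : (v⁻¹).1 (w x₀) = x₀ := W_inv_apply' v x₀
  rw [ContinuousAt, e] at h
  filter_upwards [h.eventually (stratum_eventually_base hx₀)] with y hy
  rw [W_mem_stratum_iff, mem_plane_iff hx₀] at hy
  rw [hy]
  have e2 : (v⁻¹).1 y - x₀ = (v⁻¹).1 (y - w x₀) := by rw [map_sub, e]
  rw [e2]
  constructor
  · intro h
    have := W_mem_dirAt v h
    rwa [W_inv_apply] at this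
  · intro h
    have := W_mem_dirAt v⁻¹ h
    rwa [e] at this

theorem resStratum_mk_eq_zero {x₀ : Fin N → ℂ} (hx₀ : IsGeneric N k m l₁ l₂ x₀)
    {f : (Fin N → ℂ) → ℂ} {hf : ∀ x ∈ orbit x₀, AnalyticAt ℂ f x} {hp : IsPeriodicNear x₀ f} :
    resStratum k m l₁ l₂ x₀ (PerGerm.mk f hf hp) = 0 ↔
      ∀ x ∈ orbit x₀, ∀ᶠ y in 𝓝 x, y - x ∈ dirAt x → f y = 0 := by
  have : resStratum k m l₁ l₂ x₀ (PerGerm.mk f hf hp) = 0 ↔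
      ∀ᶠ y in 𝓝ˢ (orbit x₀) ⊓ 𝓟 (stratum N k m l₁ l₂), f y = 0 := Germ.coe_eq
  rw [this, eventually_inf_principal, eventually_nhdsSet_iff_forall]
  refine forall₂_congr fun x hx => ?_
  constructor
  · intro h
    filter_upwards [h, stratum_eventually hx₀ hx] with y h1 h2 h3
    exact h1 (h2.2 h3)
  · intro h
    filter_upwards [h, stratum_eventually hx₀ hx] with y h1 h2 h3
    exact h1 (h2.1 h3)

end Geometry

section LocalOperators

variable {N k m l₁ l₂ : ℕ} {x₀ : Fin N → ℂ} {f : (Fin N → ℂ) → ℂ} (c₁ c₂ c₃ : ℂ)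

open Classical in
/-- The endomorphism `ξ - ∑_α 2 c_α (α, ξ) / (α, α) α`, the sum being over the positive roots
with `e^{(α, x)} = 1`. -/
def mAt (x ξ : Fin N → ℂ) : Fin N → ℂ :=
  ξ - ∑ α ∈ posRoots N, (if exp (pairing α x) = 1 then
    2 * mult c₁ c₂ c₃ α * pairing α ξ / (normSq α : ℂ) else 0) • toV α

theorem divFun_reflDiff_of_mirror {α : Fin N → ℤ} (hα : α ∈ posRoots N)
    (hf : ∀ x ∈ orbit x₀, AnalyticAt ℂ f x) (hp : IsPeriodicNear x₀ f) {x : Fin N → ℂ}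
    (hx : x ∈ orbit x₀) (h : exp (pairing α x) = 1) :
    ∀ᶠ z in 𝓝 x, pairing α z = pairing α x →
      divFun α (reflDiff α f) z = 2 * fderiv ℂ f z (toV α) / (normSq α : ℂ) := by
  have hx' := refl_mem_orbit hα hx
  have h1 : ∀ᶠ z in 𝓝 x, AnalyticAt ℂ f (refl α z) :=
    (continuous_W (sRefl ⟨α, hα⟩)).continuousAt.eventually (hf _ hx').eventually_analyticAt
  filter_upwards [(hf x hx).eventually_analyticAt, h1,
    fderiv_periodic hp (toV α) x hx _ hx' (latEq_refl hα h)] with z h2 h3 h4 h5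
  have h6 : refl α z = z + refl α x - x := refl_eq_add h5
  have h7 : AnalyticAt ℂ (fun y => f (refl α y)) z := analyticAt_comp_W (sRefl ⟨α, hα⟩) h3
  have h8 : fderiv ℂ (reflDiff α f) z = fderiv ℂ f z - fderiv ℂ (fun y => f (refl α y)) z :=
    fderiv_sub h2.differentiableAt h7.differentiableAt
  rw [divFun, h5, if_pos h, h8]
  change (fderiv ℂ f z (toV α) - fderiv ℂ (fun y => f (refl α y)) z (toV α)) / _ = _
  rw [fderiv_comp_refl h3, refl_toV hα, map_neg, h6, h4]
  ring

/-- The Dunkl operators on functions that vanish on the stratum. -/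
theorem perDunkl_eq_fderiv (hf : ∀ x ∈ orbit x₀, AnalyticAt ℂ f x) (hp : IsPeriodicNear x₀ f)
    (h0 : ∀ x ∈ orbit x₀, ∀ᶠ y in 𝓝 x, y - x ∈ dirAt x → f y = 0) {x : Fin N → ℂ}
    (hx : x ∈ orbit x₀) (i : Fin N) :
    ∀ᶠ z in 𝓝 x, z - x ∈ dirAt x →
      perDunkl c₁ c₂ c₃ i f z = fderiv ℂ f z (mAt c₁ c₂ c₃ x (Pi.single i 1)) := by
  classical
  have key : ∀ α : posRoots N, ∀ᶠ z in 𝓝 x, z - x ∈ dirAt x → divFun α.1 (reflDiff α.1 f) z =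
      if exp (pairing α.1 x) = 1 then 2 * fderiv ℂ f z (toV α.1) / (normSq α.1 : ℂ)
      else 0 := by
    rintro ⟨α, hα⟩
    by_cases h : exp (pairing α x) = 1
    · filter_upwards [divFun_reflDiff_of_mirror hα hf hp hx h] with z hz hz'
      have := hz' α hα h
      rw [pairing_vsub, sub_eq_zero] at this
      rw [if_pos h]
      exact hz this
    · have h2 : ∀ᶠ z in 𝓝 x, exp (pairing α z) ≠ 1 :=
        (Complex.continuous_exp.comp (continuous_pairing α)).continuousAt.eventually_ne h
      have h3 := (continuous_W (sRefl ⟨α, hα⟩)).continuousAt.eventually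
        (h0 _ (refl_mem_orbit hα hx))
      filter_upwards [h0 x hx, h2, h3] with z h4 h5 h6 h7
      have h8 : f (refl α z) = 0 := by
        refine h6 ?_
        have := W_mem_dirAt (sRefl ⟨α, hα⟩) h7
        rwa [map_sub] at this
      rw [if_neg h, divFun, if_neg h5, reflDiff, h4 h7, h8, sub_zero, mul_zero]
  filter_upwards [eventually_all.2 key, h0 x hx] with z h1 h2 h3
  rw [perDunkl, h2 h3, mul_zero, add_zero, mAt, map_sub, map_sum, ← sum_coe_sort (posRoots N)]
  congr 1
  refine sum_congr rfl fun α _ => ?_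
  rw [h1 α h3, map_smul, smul_eq_mul]
  have : pairing α.1 (Pi.single i 1) = (α.1 i : ℂ) := by
    rw [pairing, sum_eq_single i] <;> simp +contextual
  rw [this]
  split_ifs <;> ring

theorem fderiv_eq_zero_of_vanish {x : Fin N → ℂ} (hf : AnalyticAt ℂ f x)
    (h0 : ∀ᶠ y in 𝓝 x, y - x ∈ dirAt x → f y = 0) {ξ : Fin N → ℂ} (hξ : ξ ∈ dirAt x) :
    ∀ᶠ z in 𝓝 x, z - x ∈ dirAt x → fderiv ℂ f z ξ = 0 := by
  filter_upwards [hf.eventually_analyticAt, h0.eventually_nhds] with z h1 h2 h3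
  have d1 : HasDerivAt (fun t : ℂ => z + t • ξ) ((1 : ℂ) • ξ) 0 :=
    ((hasDerivAt_id (0 : ℂ)).smul_const ξ).const_add z
  have e : z + (0 : ℂ) • ξ = z := by rw [zero_smul, add_zero]
  have d2 : HasFDerivAt f (fderiv ℂ f z) (z + (0 : ℂ) • ξ) := by
    rw [e]; exact h1.differentiableAt.hasFDerivAt
  have d3 := d2.comp_hasDerivAt (0 : ℂ) d1
  have d4 : (fun t : ℂ => f (z + t • ξ)) =ᶠ[𝓝 0] fun _ => 0 := by
    have hc : Tendsto (fun t : ℂ => z + t • ξ) (𝓝 0) (𝓝 z) := by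
      have := d1.continuousAt.tendsto
      rwa [e] at this
    filter_upwards [hc.eventually h2] with t ht
    refine ht ?_
    rw [add_sub_right_comm]
    exact Submodule.add_mem _ h3 (Submodule.smul_mem _ _ hξ)
  have d5 := d3.congr_of_eventuallyEq d4.symm
  have := d5.unique (hasDerivAt_const (0 : ℂ) (0 : ℂ))
  rwa [one_smul] at this

end LocalOperators

section MatrixAt

variable {N : ℕ} (c₁ c₂ c₃ : ℂ)

open Classical in
/-- The indicator function of `e^z = 1`. -/
def expInd (z : ℂ) : ℂ := if exp z = 1 then 1 else 0

theorem expInd_neg (z : ℂ) : expInd (-z) = expInd z := by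
  unfold expInd
  exact if_congr exp_neg_eq_one_iff rfl rfl

theorem mAt_apply (x ξ : Fin N → ℂ) (a : Fin N) :
    mAt c₁ c₂ c₃ x ξ a = ξ a - (2 * c₂ * expInd (x a) * ξ a + 2 * c₃ * expInd (2 * x a) * ξ a +
      ∑ b ∈ univ.erase a, c₁ * (expInd (x a - x b) * (ξ a - ξ b) +
        expInd (x a + x b) * (ξ a + ξ b))) := by
  have h := sum_posRoots_coord a (fun α : Fin N → ℤ => (if exp (pairing α x) = 1 then
    2 * mult c₁ c₂ c₃ α * pairing α ξ / (normSq α : ℂ) else 0))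
  have h2 : mAt c₁ c₂ c₃ x ξ a = ξ a - ∑ α ∈ posRoots N, (α a : ℂ) •
      (if exp (pairing α x) = 1 then
        2 * mult c₁ c₂ c₃ α * pairing α ξ / (normSq α : ℂ) else 0) := by
    rw [mAt, Pi.sub_apply, Finset.sum_apply]
    congr 1
    refine sum_congr rfl fun α _ => ?_
    rw [Pi.smul_apply, smul_eq_mul, smul_eq_mul, mul_comm]
    rfl
  rw [h2, h]
  congr 1
  congr 1
  · rw [pairing_eV, pairing_eV, pairing_two_eV, pairing_two_eV, mult_eV, mult_two_eV, normSq_single,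
      normSq_two_single]
    unfold expInd
    split_ifs <;> push_cast <;> simp only [smul_eq_mul] <;> ring
  · refine sum_congr rfl fun b hb => ?_
    have hab : a ≠ b := (ne_of_mem_erase hb).symm
    have e1 : exp (pairing (eM a b) x) = 1 ↔ exp (x a - x b) = 1 := by
      rw [pairing_eM]
      rcases sgn_eq a b with h | h <;> rw [h]
      · rw [one_mul]
      · rw [neg_one_mul, exp_neg_eq_one_iff]
    simp only [e1, mult_eM c₁ c₂ c₃ hab, mult_eP c₁ c₂ c₃ hab, normSq_eM hab, normSq_eP hab]
    rw [pairing_eM, pairing_eP, pairing_eP]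
    unfold expInd
    rcases sgn_eq a b with h | h <;> rw [h] <;> split_ifs <;> push_cast <;>
      simp only [smul_eq_mul] <;> ring

theorem mAt_W (w : W N) (x ξ : Fin N → ℂ) :
    mAt c₁ c₂ c₃ (w.1 x) (w.1 ξ) = w.1 (mAt c₁ c₂ c₃ x ξ) := by
  obtain ⟨w, σ, ε, h⟩ := w
  have hε : ∀ i, ((ε i : ℤ) : ℂ) = 1 ∨ ((ε i : ℤ) : ℂ) = -1 := fun i => by
    rcases Int.units_eq_one_or (ε i) with h2 | h2 <;> simp [h2]
  funext a
  rw [mAt_apply, h (mAt c₁ c₂ c₃ x ξ), mAt_apply]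
  simp only [h]
  have e : ∑ b ∈ univ.erase (σ a), c₁ * (expInd (x (σ a) - x b) * (ξ (σ a) - ξ b) +
        expInd (x (σ a) + x b) * (ξ (σ a) + ξ b)) =
      ∑ b ∈ univ.erase a, c₁ * (expInd (x (σ a) - x (σ b)) * (ξ (σ a) - ξ (σ b)) +
        expInd (x (σ a) + x (σ b)) * (ξ (σ a) + ξ (σ b))) := by
    rw [sum_erase_eq_sub (mem_univ _), sum_erase_eq_sub (mem_univ _),
      ← Equiv.sum_comp σ]
  rw [e, mul_sub, mul_add, mul_add, mul_sum]
  congr 1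
  congr 1
  · rcases hε a with h2 | h2 <;> rw [h2]
    · simp only [one_mul]
    · simp only [neg_one_mul, mul_neg, expInd_neg]
  · refine sum_congr rfl fun b _ => ?_
    rcases hε a with h2 | h2 <;> rcases hε b with h3 | h3 <;> rw [h2, h3]
    · simp only [one_mul]
    · simp only [one_mul, neg_one_mul, sub_neg_eq_add, ← sub_eq_add_neg]
      ring
    · have e1 : ∀ u v : ℂ, expInd (-u - v) = expInd (u + v) := fun u v => by
        rw [← expInd_neg]; congr 1; ring
      have e2 : ∀ u v : ℂ, expInd (-u + v) = expInd (u - v) := fun u v => by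
        rw [← expInd_neg]; congr 1; ring
      simp only [one_mul, neg_one_mul, e1, e2]
      ring
    · have e1 : ∀ u v : ℂ, expInd (-u - -v) = expInd (u - v) := fun u v => by
        rw [← expInd_neg]; congr 1; ring
      have e2 : ∀ u v : ℂ, expInd (-u + -v) = expInd (u + v) := fun u v => by
        rw [← expInd_neg]; congr 1; ring
      simp only [neg_one_mul, e1, e2]
      ring

end MatrixAt

section GenericPoint

variable {N k m l₁ l₂ : ℕ} {x₀ : Fin N → ℂ}

/-- The index of the block of equal coordinates, for coordinates that are not constant on `π^a`
(each free coordinate is a block of its own), and `0` for the constant coordinates. -/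
def blockIndex (k m l₁ l₂ : ℕ) (i : Fin N) : ℕ :=
  if i.1 < m * k then i.1 / k + 1 else if i.1 + l₁ + l₂ < N then i.1 + m + 1 else 0

/-- A point of `π^a` at which only the roots with `e^{(α, x)} = 1` on `π^a` have this property. -/
def genericPoint (N k m l₁ l₂ : ℕ) : Fin N → ℂ := fun i =>
  (blockIndex k m l₁ l₂ i : ℂ) + if InShift N l₁ l₂ i then Real.pi * Complex.I else 0

theorem genericPoint_mem (hN : m * k + l₁ + l₂ ≤ N) :
    genericPoint N k m l₁ l₂ ∈ plane N k m l₁ l₂ := by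
  refine ⟨fun i j hi hj hij => ?_, fun i hi => ?_, fun i hi => ?_⟩
  · have h1 : ¬ InShift N l₁ l₂ i := fun h => by have := h.1; omega
    have h2 : ¬ InShift N l₁ l₂ j := fun h => by have := h.1; omega
    simp only [genericPoint, blockIndex, hi, hj, hij, h1, h2, if_true, if_false]
  · have h1 : ¬ InShift N l₁ l₂ i := fun h => by have := h.2; omega
    have h2 : ¬ i.1 < m * k := by omega
    have h3 : ¬ i.1 + l₁ + l₂ < N := by omega
    simp [genericPoint, blockIndex, h1, h2, h3]
  · have h2 : ¬ i.1 < m * k := by have := hi.1; omega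
    have h3 : ¬ i.1 + l₁ + l₂ < N := by have := hi.1; omega
    simp [genericPoint, blockIndex, hi, h2, h3]

theorem exp_int_add_eq_one {n e : ℤ} (h : exp (n + e * (Real.pi * Complex.I)) = 1) :
    n = 0 ∧ Even e := by
  have h1 := congrArg norm h
  rw [Complex.norm_exp, norm_one, Real.exp_eq_one_iff] at h1
  have h2 : (n : ℝ) = 0 := by simpa using h1
  have h3 : n = 0 := by exact_mod_cast h2
  refine ⟨h3, ?_⟩
  obtain ⟨t, ht⟩ := Complex.exp_eq_one_iff.1 h
  rw [h3, Int.cast_zero, zero_add] at ht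
  have h4 : (e : ℂ) = 2 * t := by
    have hpi : (Real.pi : ℂ) * Complex.I ≠ 0 :=
      mul_ne_zero (by exact_mod_cast Real.pi_ne_zero) Complex.I_ne_zero
    refine mul_right_cancel₀ hpi ?_
    rw [ht]; ring
  exact ⟨t, by rw [← two_mul]; exact_mod_cast h4⟩

theorem expInd_eq (hx₀ : IsGeneric N k m l₁ l₂ x₀) (hN : m * k + l₁ + l₂ ≤ N) (z : ℂ) (n e : ℤ)
    (α : Fin N → ℤ) (hα : α ∈ posRoots N) {s : ℂ} (hs : s = 1 ∨ s = -1)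
    (hz : z = s * pairing α x₀)
    (hn : s * pairing α (genericPoint N k m l₁ l₂) = n + e * (Real.pi * Complex.I))
    (hplane : n = 0 → Even e → exp z = 1) :
    expInd z = if n = 0 ∧ Even e then 1 else 0 := by
  have hs' : ∀ t : ℂ, exp (s * t) = 1 ↔ exp t = 1 := fun t => by
    rcases hs with rfl | rfl
    · rw [one_mul]
    · rw [neg_one_mul, exp_neg_eq_one_iff]
  unfold expInd
  refine if_congr ⟨fun h => ?_, fun h => hplane h.1 h.2⟩ rfl rfl
  rw [hz, hs'] at h
  have h1 := (hs' _).2 (hx₀.2 α hα h _ (genericPoint_mem hN))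
  rw [hn] at h1
  exact exp_int_add_eq_one h1

theorem blockIndex_eq_zero {i : Fin N} (hN : m * k + l₁ + l₂ ≤ N) :
    blockIndex k m l₁ l₂ i = 0 ↔ N ≤ i.1 + l₁ + l₂ := by
  unfold blockIndex
  split_ifs with h1 h2
  · exact ⟨fun h => by simp at h, fun h => by omega⟩
  · exact ⟨fun h => by simp at h, fun h => by omega⟩
  · exact ⟨fun _ => by omega, fun _ => rfl⟩

theorem apply_of_blockIndex_eq_zero (hx : x₀ ∈ plane N k m l₁ l₂) (hN : m * k + l₁ + l₂ ≤ N)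
    {i : Fin N} (h : blockIndex k m l₁ l₂ i = 0) :
    x₀ i = (if InShift N l₁ l₂ i then (1 : ℤ) else 0 : ℤ) * (Real.pi * Complex.I) := by
  rw [blockIndex_eq_zero hN] at h
  split_ifs with h1
  · rw [hx.2.2 i h1]; simp
  · rw [hx.2.1 i]
    · simp
    · by_contra h2
      exact h1 ⟨h, by omega⟩

theorem apply_eq_of_blockIndex_eq (hx : x₀ ∈ plane N k m l₁ l₂) {i j : Fin N}
    (h : blockIndex k m l₁ l₂ i = blockIndex k m l₁ l₂ j) (hi : blockIndex k m l₁ l₂ i ≠ 0) :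
    x₀ i = x₀ j := by
  have hdiv : ∀ a : Fin N, a.1 < m * k → a.1 / k < m := fun a ha =>
    Nat.div_lt_of_lt_mul (by rwa [mul_comm] at ha)
  have h0 : blockIndex k m l₁ l₂ j ≠ 0 := h ▸ hi
  unfold blockIndex at h hi h0
  by_cases h1 : i.1 < m * k
  · have h2 := hdiv i h1
    by_cases h3 : j.1 < m * k
    · rw [if_pos h1, if_pos h3] at h
      exact hx.1 i j h1 h3 (by omega)
    · rw [if_neg h3] at h0 h
      rw [if_pos h1] at h
      split_ifs at h h0
      omega
  · rw [if_neg h1] at h hi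
    by_cases h3 : j.1 < m * k
    · have h2 := hdiv j h3
      rw [if_pos h3] at h
      split_ifs at h hi
      omega
    · rw [if_neg h3] at h h0
      split_ifs at h hi h0
      · congr 1; exact Fin.ext (by omega)
      all_goals omega

theorem exp_even_pi {e : ℤ} (h : Even e) : exp (e * (Real.pi * Complex.I)) = 1 := by
  obtain ⟨t, rfl⟩ := h
  rw [Complex.exp_eq_one_iff]
  exact ⟨t, by push_cast; ring⟩

theorem expInd_self (hx₀ : IsGeneric N k m l₁ l₂ x₀) (hN : m * k + l₁ + l₂ ≤ N)
    (a : Fin N) : expInd (x₀ a) = if N ≤ a.1 + l₁ then 1 else 0 := by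
  set e : ℤ := if InShift N l₁ l₂ a then 1 else 0 with he
  rw [expInd_eq hx₀ hN _ (blockIndex k m l₁ l₂ a) e (eV a) (eV_mem a) (Or.inl rfl)
    (by rw [pairing_eV, one_mul])]
  · refine if_congr ?_ rfl rfl
    rw [Nat.cast_eq_zero, blockIndex_eq_zero hN, he]
    split_ifs with h
    · have := h.2
      simp; omega
    · unfold InShift at h
      simp; omega
  · rw [pairing_eV, one_mul, genericPoint, he]
    split_ifs <;> simp
  · intro h1 h2
    rw [apply_of_blockIndex_eq_zero hx₀.1 hN (by exact_mod_cast h1)]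
    exact exp_even_pi h2

theorem expInd_two (hx₀ : IsGeneric N k m l₁ l₂ x₀) (hN : m * k + l₁ + l₂ ≤ N)
    (a : Fin N) : expInd (2 * x₀ a) = if N ≤ a.1 + l₁ + l₂ then 1 else 0 := by
  set e : ℤ := if InShift N l₁ l₂ a then 1 else 0 with he
  rw [expInd_eq hx₀ hN _ (2 * blockIndex k m l₁ l₂ a) (2 * e) (2 • eV a) (two_eV_mem a) (Or.inl rfl)
    (by rw [pairing_two_eV, one_mul])]
  · refine if_congr ?_ rfl rfl
    rw [← blockIndex_eq_zero hN]
    simp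
  · rw [pairing_two_eV, one_mul, genericPoint, he]
    split_ifs <;> push_cast <;> ring
  · intro h1 h2
    have h1 : blockIndex k m l₁ l₂ a = 0 := by omega
    rw [apply_of_blockIndex_eq_zero hx₀.1 hN h1, ← mul_assoc]
    have := exp_even_pi h2
    rw [he] at this
    push_cast at this ⊢
    exact this

theorem expInd_sub (hx₀ : IsGeneric N k m l₁ l₂ x₀) (hN : m * k + l₁ + l₂ ≤ N)
    {a b : Fin N} (hab : a ≠ b) : expInd (x₀ a - x₀ b) =
    if blockIndex k m l₁ l₂ a = blockIndex k m l₁ l₂ b ∧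
      (InShift N l₁ l₂ a ↔ InShift N l₁ l₂ b) then 1 else 0 := by
  set e : ℤ := (if InShift N l₁ l₂ a then 1 else 0) - (if InShift N l₁ l₂ b then 1 else 0) with he
  have hs : sgn a b * sgn a b = 1 := by rcases sgn_eq a b with h | h <;> rw [h] <;> ring
  rw [expInd_eq hx₀ hN _ (blockIndex k m l₁ l₂ a - blockIndex k m l₁ l₂ b) e (eM a b) (eM_mem hab)
    (sgn_eq a b) (by rw [pairing_eM, ← mul_assoc, hs, one_mul])]
  · refine if_congr ?_ rfl rfl
    rw [sub_eq_zero, Nat.cast_inj, he]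
    split_ifs with h1 h2 h2 <;> simp [h1, h2]
  · rw [pairing_eM, ← mul_assoc, hs, one_mul, genericPoint, genericPoint, he]
    split_ifs <;> push_cast <;> ring
  · intro h1 h2
    have h1 : blockIndex k m l₁ l₂ a = blockIndex k m l₁ l₂ b := by omega
    by_cases h3 : blockIndex k m l₁ l₂ a = 0
    · rw [apply_of_blockIndex_eq_zero hx₀.1 hN h3, apply_of_blockIndex_eq_zero hx₀.1 hN (h1 ▸ h3),
        ← sub_mul]
      have := exp_even_pi h2
      rw [he] at this
      push_cast at this ⊢
      exact this
    · rw [apply_eq_of_blockIndex_eq hx₀.1 h1 h3, sub_self, Complex.exp_zero]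

theorem expInd_add (hx₀ : IsGeneric N k m l₁ l₂ x₀) (hN : m * k + l₁ + l₂ ≤ N)
    {a b : Fin N} (hab : a ≠ b) : expInd (x₀ a + x₀ b) =
    if blockIndex k m l₁ l₂ a = 0 ∧ blockIndex k m l₁ l₂ b = 0 ∧
      (InShift N l₁ l₂ a ↔ InShift N l₁ l₂ b) then 1 else 0 := by
  set e : ℤ := (if InShift N l₁ l₂ a then 1 else 0) + (if InShift N l₁ l₂ b then 1 else 0) with he
  rw [expInd_eq hx₀ hN _ (blockIndex k m l₁ l₂ a + blockIndex k m l₁ l₂ b) e (eP a b) (eP_mem hab)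
    (Or.inl rfl) (by rw [pairing_eP, one_mul])]
  · refine if_congr ?_ rfl rfl
    rw [← and_assoc]
    refine and_congr (by omega) ?_
    rw [he]
    split_ifs with h1 h2 h2 <;> simp [h1, h2]
  · rw [pairing_eP, one_mul, genericPoint, genericPoint, he]
    split_ifs <;> push_cast <;> ring
  · intro h1 h2
    have h3 : blockIndex k m l₁ l₂ a = 0 := by omega
    have h4 : blockIndex k m l₁ l₂ b = 0 := by omega
    rw [apply_of_blockIndex_eq_zero hx₀.1 hN h3, apply_of_blockIndex_eq_zero hx₀.1 hN h4,
        ← add_mul]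
    have := exp_even_pi h2
    rw [he] at this
    push_cast at this ⊢
    exact this

end GenericPoint

section Count

variable {N : ℕ}

theorem card_filter_interval {lo c : ℕ} (h : lo + c ≤ N) :
    (univ.filter fun b : Fin N => lo ≤ b.1 ∧ b.1 < lo + c).card = c := by
  have e : (univ.filter fun b : Fin N => lo ≤ b.1 ∧ b.1 < lo + c).map Fin.valEmbedding =
      Finset.Ico lo (lo + c) := by
    ext i
    simp only [Finset.mem_map, mem_filter, mem_univ, true_and,
      Fin.valEmbedding_apply, mem_Ico]
    constructor
    · rintro ⟨b, hb, rfl⟩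
      exact hb
    · intro hi
      exact ⟨⟨i, by omega⟩, hi, rfl⟩
  rw [← card_map Fin.valEmbedding, e, Nat.card_Ico, Nat.add_sub_cancel_left]

theorem sum_ite_of_iff_interval {P : Fin N → Prop} [DecidablePred P] {lo c : ℕ}
    (h : lo + c ≤ N) (hP : ∀ b : Fin N, P b ↔ lo ≤ b.1 ∧ b.1 < lo + c) (z : ℂ) :
    ∑ b, (if P b then z else 0) = c * z := by
  rw [← sum_filter, sum_const, filter_congr fun b _ => hP b,
    card_filter_interval h, nsmul_eq_mul]

end Count

section ParamCondition

variable {N k m l₁ l₂ : ℕ} {x₀ : Fin N → ℂ} (c₁ c₂ c₃ : ℂ)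

theorem blockIndex_eq_iff (hk : 1 ≤ k) {a : Fin N} (ha : a.1 < m * k) (b : Fin N) :
    blockIndex k m l₁ l₂ a = blockIndex k m l₁ l₂ b ↔
      a.1 / k * k ≤ b.1 ∧ b.1 < a.1 / k * k + k := by
  have hdiv : a.1 / k < m := Nat.div_lt_of_lt_mul (by rwa [mul_comm] at ha)
  have h1 : b.1 / k = a.1 / k ↔ a.1 / k * k ≤ b.1 ∧ b.1 < a.1 / k * k + k := by
    rw [Nat.div_eq_iff hk]
    have : 0 < k := hk
    constructor <;> rintro ⟨h1, h2⟩ <;> exact ⟨by omega, by omega⟩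
  rw [← h1]
  have h2 : blockIndex k m l₁ l₂ a = a.1 / k + 1 := if_pos ha
  rw [h2]
  unfold blockIndex
  split_ifs with h3 h4
  · exact ⟨fun h => by omega, fun h => by omega⟩
  · refine ⟨fun h => by omega, fun h => ?_⟩
    rw [← h] at hdiv
    exact absurd ((Nat.div_lt_iff_lt_mul hk).1 hdiv) h3
  · refine ⟨fun h => by simp at h, fun h => ?_⟩
    rw [← h] at hdiv
    exact absurd ((Nat.div_lt_iff_lt_mul hk).1 hdiv) h3

theorem mAt_of_block (hx₀ : IsGeneric N k m l₁ l₂ x₀) (hk : 1 ≤ k) (hN : m * k + l₁ + l₂ ≤ N)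
    (ξ : Fin N → ℂ) {a : Fin N} (ha : a.1 < m * k) :
    mAt c₁ c₂ c₃ x₀ ξ a = (1 - k * c₁) * ξ a +
      c₁ * ∑ b, if blockIndex k m l₁ l₂ a = blockIndex k m l₁ l₂ b then ξ b else 0 := by
  have h0 : blockIndex k m l₁ l₂ a ≠ 0 := by
    rw [Ne, blockIndex_eq_zero hN]; omega
  have hs : ∀ b, blockIndex k m l₁ l₂ b ≠ 0 → ¬ InShift N l₁ l₂ b := fun b hb h =>
    hb ((blockIndex_eq_zero hN).2 h.1)
  have hle : a.1 / k * k + k ≤ N := by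
    have h1 : a.1 / k + 1 ≤ m := Nat.div_lt_of_lt_mul (by rwa [mul_comm] at ha)
    have := Nat.mul_le_mul_right k h1
    rw [add_mul, one_mul] at this
    omega
  rw [mAt_apply, expInd_self hx₀ hN, expInd_two hx₀ hN, if_neg (by omega), if_neg (by omega)]
  have e : ∑ b ∈ univ.erase a, c₁ * (expInd (x₀ a - x₀ b) * (ξ a - ξ b) +
        expInd (x₀ a + x₀ b) * (ξ a + ξ b)) =
      ∑ b, c₁ * ((if blockIndex k m l₁ l₂ a = blockIndex k m l₁ l₂ b then ξ a else 0) -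
        if blockIndex k m l₁ l₂ a = blockIndex k m l₁ l₂ b then ξ b else 0) := by
    rw [← sum_erase (a := a) univ (by simp)]
    refine sum_congr rfl fun b hb => ?_
    have hab : a ≠ b := (ne_of_mem_erase hb).symm
    have h5 : expInd (x₀ a + x₀ b) = 0 := by
      rw [expInd_add hx₀ hN hab, if_neg (fun h => h0 h.1)]
    rw [expInd_sub hx₀ hN hab, h5]
    by_cases h : blockIndex k m l₁ l₂ a = blockIndex k m l₁ l₂ b
    · rw [if_pos ⟨h, iff_of_false (hs a h0) (hs b (h ▸ h0))⟩, if_pos h, if_pos h]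
      ring
    · rw [if_neg (fun h' => h h'.1), if_neg h, if_neg h]
      ring
  rw [e, ← mul_sum, sum_sub_distrib,
    sum_ite_of_iff_interval hle (blockIndex_eq_iff hk ha)]
  ring

theorem mAt_of_const (hx₀ : IsGeneric N k m l₁ l₂ x₀) (hN : m * k + l₁ + l₂ ≤ N)
    (ξ : Fin N → ℂ) {a : Fin N} (ha : N ≤ a.1 + l₁ + l₂) {lo c : ℕ} (hlo : lo + c ≤ N)
    (hP : ∀ b : Fin N, (N ≤ b.1 + l₁ + l₂ ∧ (InShift N l₁ l₂ a ↔ InShift N l₁ l₂ b)) ↔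
      lo ≤ b.1 ∧ b.1 < lo + c) :
    mAt c₁ c₂ c₃ x₀ ξ a = (1 - (2 * c₂ * (if N ≤ a.1 + l₁ then 1 else 0) + 2 * c₃ +
      2 * (c - 1) * c₁)) * ξ a := by
  rw [mAt_apply, expInd_self hx₀ hN, expInd_two hx₀ hN, if_pos ha]
  have h0 := (blockIndex_eq_zero (k := k) (m := m) hN).2 ha
  have e : ∑ b ∈ univ.erase a, c₁ * (expInd (x₀ a - x₀ b) * (ξ a - ξ b) +
        expInd (x₀ a + x₀ b) * (ξ a + ξ b)) =
      ∑ b ∈ univ.erase a,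
        if N ≤ b.1 + l₁ + l₂ ∧ (InShift N l₁ l₂ a ↔ InShift N l₁ l₂ b) then
        2 * c₁ * ξ a else 0 := by
    refine sum_congr rfl fun b hb => ?_
    have hab : a ≠ b := (ne_of_mem_erase hb).symm
    rw [expInd_sub hx₀ hN hab, expInd_add hx₀ hN hab, h0]
    simp only [true_and, eq_comm (a := (0 : ℕ)), blockIndex_eq_zero hN]
    split_ifs <;> ring
  rw [e, sum_erase_eq_sub (mem_univ _), sum_ite_of_iff_interval hlo hP,
    if_pos (⟨ha, Iff.rfl⟩ : N ≤ a.1 + l₁ + l₂ ∧ (InShift N l₁ l₂ a ↔ InShift N l₁ l₂ a))]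
  ring

theorem mAt_of_zero (hx₀ : IsGeneric N k m l₁ l₂ x₀) (hN : m * k + l₁ + l₂ ≤ N)
    (ξ : Fin N → ℂ) {a : Fin N} (ha : N ≤ a.1 + l₁) :
    mAt c₁ c₂ c₃ x₀ ξ a = (1 - (2 * (c₂ + c₃) + 2 * ((l₁ : ℂ) - 1) * c₁)) * ξ a := by
  rw [mAt_of_const c₁ c₂ c₃ hx₀ hN ξ (by omega) (lo := N - l₁) (c := l₁) (by omega), if_pos ha]
  · ring
  · intro b
    unfold InShift
    have := b.2
    omega

theorem mAt_of_shift (hx₀ : IsGeneric N k m l₁ l₂ x₀) (hN : m * k + l₁ + l₂ ≤ N)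
    (ξ : Fin N → ℂ) {a : Fin N} (ha : InShift N l₁ l₂ a) :
    mAt c₁ c₂ c₃ x₀ ξ a = (1 - (2 * c₃ + 2 * ((l₂ : ℂ) - 1) * c₁)) * ξ a := by
  have h1 := ha.1
  have h2 := ha.2
  rw [mAt_of_const c₁ c₂ c₃ hx₀ hN ξ ha.1 (lo := N - l₁ - l₂) (c := l₂) (by omega),
    if_neg (by omega)]
  · ring
  · intro b
    unfold InShift
    have := b.2
    omega

theorem mem_dirAt_iff (hx₀ : IsGeneric N k m l₁ l₂ x₀) {η : Fin N → ℂ} : η ∈ dirAt x₀ ↔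
    (∀ i j : Fin N, i.1 < m * k → j.1 < m * k → i.1 / k = j.1 / k → η i = η j) ∧
    (∀ i : Fin N, N ≤ i.1 + l₁ → η i = 0) ∧ (∀ i : Fin N, InShift N l₁ l₂ i → η i = 0) := by
  have h := mem_plane_iff (y := x₀ + η) hx₀
  rw [add_sub_cancel_left] at h
  rw [← h]
  obtain ⟨h1, h2, h3⟩ := hx₀.1
  refine and_congr ?_ (and_congr ?_ ?_)
  · refine forall_congr' fun i => forall_congr' fun j => forall_congr' fun hi =>
      forall_congr' fun hj => forall_congr' fun hij => ?_
    rw [Pi.add_apply, Pi.add_apply, h1 i j hi hj hij, add_right_inj]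
  · refine forall_congr' fun i => forall_congr' fun hi => ?_
    rw [Pi.add_apply, h2 i hi, zero_add]
  · refine forall_congr' fun i => forall_congr' fun hi => ?_
    rw [Pi.add_apply, h3 i hi, add_eq_left]

theorem mAt_mem_dirAt (hx₀ : IsGeneric N k m l₁ l₂ x₀) (hk : 1 ≤ k) (hN : m * k + l₁ + l₂ ≤ N)
    (h : ParamCond k l₁ l₂ c₁ c₂ c₃) (ξ : Fin N → ℂ) : mAt c₁ c₂ c₃ x₀ ξ ∈ dirAt x₀ := by
  obtain ⟨h1, h2, h3⟩ := h
  rw [mem_dirAt_iff hx₀]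
  refine ⟨fun i j hi hj hij => ?_, fun i hi => ?_, fun i hi => ?_⟩
  · by_cases hk1 : 1 < k
    · have hk0 : (k : ℂ) ≠ 0 := Nat.cast_ne_zero.2 (by omega)
      have hb : blockIndex k m l₁ l₂ i = blockIndex k m l₁ l₂ j := by
        unfold blockIndex; rw [if_pos hi, if_pos hj, hij]
      rw [mAt_of_block c₁ c₂ c₃ hx₀ hk hN ξ hi, mAt_of_block c₁ c₂ c₃ hx₀ hk hN ξ hj, hb, h1 hk1,
        mul_one_div_cancel hk0]
      ring
    · obtain rfl : k = 1 := by omega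
      rw [Nat.div_one, Nat.div_one] at hij
      rw [Fin.ext hij]
  · rw [mAt_of_zero c₁ c₂ c₃ hx₀ hN ξ hi, h2 (by have := i.2; omega), sub_self, zero_mul]
  · rw [mAt_of_shift c₁ c₂ c₃ hx₀ hN ξ hi, h3 (by have := hi.1; have := hi.2; omega), sub_self,
      zero_mul]

theorem paramCond_of_mAt_mem_dirAt (hx₀ : IsGeneric N k m l₁ l₂ x₀) (hk : 1 ≤ k) (hm : 1 ≤ m)
    (hN : m * k + l₁ + l₂ ≤ N)
    (h : ∀ b : Fin N, mAt c₁ c₂ c₃ x₀ (Pi.single b 1) ∈ dirAt x₀) :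
    ParamCond k l₁ l₂ c₁ c₂ c₃ := by
  have hmk : k ≤ m * k := Nat.le_mul_of_pos_left k hm
  refine ⟨fun hk1 => ?_, fun hl => ?_, fun hl => ?_⟩
  · have hk0 : (k : ℂ) ≠ 0 := Nat.cast_ne_zero.2 (by omega)
    let a : Fin N := ⟨0, by omega⟩
    let b : Fin N := ⟨1, by omega⟩
    have ha : a.1 < m * k := by change 0 < _; omega
    have hb : b.1 < m * k := by change 1 < _; omega
    have hd : a.1 / k = b.1 / k := by
      change 0 / k = 1 / k
      rw [Nat.zero_div, Nat.div_eq_of_lt hk1]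
    have hi : blockIndex k m l₁ l₂ a = blockIndex k m l₁ l₂ b := by
        unfold blockIndex; rw [if_pos ha, if_pos hb, hd]
    have hab : a ≠ b := fun h => by have := congrArg Fin.val h; simp [a, b] at this
    have e := ((mem_dirAt_iff hx₀).1 (h a)).1 a b ha hb hd
    rw [mAt_of_block c₁ c₂ c₃ hx₀ hk hN _ ha, mAt_of_block c₁ c₂ c₃ hx₀ hk hN _ hb, hi,
      Pi.single_eq_same, Pi.single_eq_of_ne hab.symm] at e
    rw [eq_div_iff hk0]
    linear_combination -e
  · let a : Fin N := ⟨N - l₁, by omega⟩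
    have ha : N ≤ a.1 + l₁ := by change _ ≤ N - l₁ + l₁; omega
    have e := ((mem_dirAt_iff hx₀).1 (h a)).2.1 a ha
    rw [mAt_of_zero c₁ c₂ c₃ hx₀ hN _ ha, Pi.single_eq_same] at e
    linear_combination -e
  · let a : Fin N := ⟨N - l₁ - l₂, by omega⟩
    have ha : InShift N l₁ l₂ a := by
      constructor
      · change _ ≤ N - l₁ - l₂ + l₁ + l₂; omega
      · change N - l₁ - l₂ + l₁ < _; omega
    have e := ((mem_dirAt_iff hx₀).1 (h a)).2.2 a ha
    rw [mAt_of_shift c₁ c₂ c₃ hx₀ hN _ ha, Pi.single_eq_same] at e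
    linear_combination -e

end ParamCondition

section Spread

variable {N : ℕ} {x₀ : Fin N → ℂ}

/-- Near the orbit, the map to the nearest point of the orbit. -/
theorem exists_locate (x₀ : Fin N → ℂ) :
    ∃ P : (Fin N → ℂ) → (Fin N → ℂ), ∀ x ∈ orbit x₀, ∀ᶠ y in 𝓝 x, P y = x := by
  classical
  obtain ⟨u, hu, hd⟩ := (finite_orbit x₀).t2_separation
  refine ⟨fun y => if h : ∃ x ∈ orbit x₀, y ∈ u x then h.choose else 0, fun x hx => ?_⟩
  filter_upwards [(hu x).2.mem_nhds (hu x).1] with y hy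
  have h : ∃ x ∈ orbit x₀, y ∈ u x := ⟨x, hx, hy⟩
  rw [dif_pos h]
  by_contra hne
  exact Set.disjoint_left.1 (hd h.choose_spec.1 hx hne) h.choose_spec.2 hy

/-- A choice of the nearest point of the orbit. -/
def locate (x₀ : Fin N → ℂ) : (Fin N → ℂ) → (Fin N → ℂ) := (exists_locate x₀).choose

theorem locate_eventually {x : Fin N → ℂ} (hx : x ∈ orbit x₀) : ∀ᶠ y in 𝓝 x, locate x₀ y = x :=
  (exists_locate x₀).choose_spec x hx

open Classical in
/-- The periodic continuation of a function near `x₀` to the points of the orbit that are congruent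
to `x₀`, and by `0` to the other ones. -/
def spread (x₀ : Fin N → ℂ) (g : (Fin N → ℂ) → ℂ) (y : Fin N → ℂ) : ℂ :=
  if LatEq (locate x₀ y) x₀ then g (y - locate x₀ y + x₀) else 0

variable {g : (Fin N → ℂ) → ℂ}

theorem spread_of_latEq {x : Fin N → ℂ} (hx : x ∈ orbit x₀) (h : LatEq x x₀) :
    ∀ᶠ y in 𝓝 x, spread x₀ g y = g (y - x + x₀) := by
  filter_upwards [locate_eventually hx] with y hy
  rw [spread, hy, if_pos h]

theorem spread_of_not_latEq {x : Fin N → ℂ} (hx : x ∈ orbit x₀) (h : ¬ LatEq x x₀) :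
    ∀ᶠ y in 𝓝 x, spread x₀ g y = 0 := by
  filter_upwards [locate_eventually hx] with y hy
  rw [spread, hy, if_neg h]

theorem spread_base (x₀ : Fin N → ℂ) (g : (Fin N → ℂ) → ℂ) : spread x₀ g =ᶠ[𝓝 x₀] g := by
  filter_upwards [spread_of_latEq (g := g) (mem_orbit_self x₀) (LatEq.refl x₀)] with y hy
  rw [hy, sub_add_cancel]

theorem tendsto_sub_add (x x' : Fin N → ℂ) : Tendsto (fun y => y - x + x') (𝓝 x) (𝓝 x') := by
  have : Continuous fun y : Fin N → ℂ => y - x + x' := by fun_prop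
  simpa using this.tendsto x

theorem analyticAt_spread (hg : AnalyticAt ℂ g x₀) : ∀ x ∈ orbit x₀, AnalyticAt ℂ (spread x₀ g) x := by
  intro x hx
  by_cases h : LatEq x x₀
  · refine AnalyticAt.congr ?_ ((spread_of_latEq (g := g) hx h).mono fun y hy => hy.symm)
    have h1 : AnalyticAt ℂ g (x - x + x₀) := by rwa [sub_self, zero_add]
    exact AnalyticAt.comp (g := g) h1 ((analyticAt_id.sub analyticAt_const).add analyticAt_const)
  · exact analyticAt_const.congr ((spread_of_not_latEq (g := g) hx h).mono fun y hy => hy.symm)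

theorem spread_periodic (x₀ : Fin N → ℂ) (g : (Fin N → ℂ) → ℂ) :
    IsPeriodicNear x₀ (spread x₀ g) := by
  intro x hx x' hx' h
  have ht : Tendsto (fun y => y + x' - x) (𝓝 x) (𝓝 x') := by
    have : Continuous fun y : Fin N → ℂ => y + x' - x := by fun_prop
    simpa using this.tendsto x
  filter_upwards [locate_eventually hx, ht.eventually (locate_eventually hx')] with y h1 h2
  have h3 : LatEq x' x₀ ↔ LatEq x x₀ := ⟨fun h' => LatEq.trans h h', fun h' => (LatEq.symm h).trans h'⟩
  have h4 : y + x' - x - x' + x₀ = y - x + x₀ := by abel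
  rw [spread, spread, h1, h2, h4]
  by_cases h5 : LatEq x x₀
  · rw [if_pos h5, if_pos (h3.2 h5)]
  · rw [if_neg h5, if_neg (fun h => h5 (h3.1 h))]

end Spread

section Invariance

variable {N k m l₁ l₂ : ℕ} {x₀ : Fin N → ℂ} (c₁ c₂ c₃ : ℂ)

theorem mAt_mem_dirAt_orbit (h : ∀ ξ, mAt c₁ c₂ c₃ x₀ ξ ∈ dirAt x₀) {x : Fin N → ℂ}
    (hx : x ∈ orbit x₀) (ξ : Fin N → ℂ) : mAt c₁ c₂ c₃ x ξ ∈ dirAt x := by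
  obtain ⟨w, hw, rfl⟩ := hx
  have := W_mem_dirAt ⟨w, hw⟩ (h ((⟨w, hw⟩ : W N)⁻¹.1 ξ))
  rwa [← mAt_W, W_inv_apply] at this

theorem resStratum_eq_zero_of_paramCond (hx₀ : IsGeneric N k m l₁ l₂ x₀) (hk : 1 ≤ k)
    (hN : m * k + l₁ + l₂ ≤ N) (hc : ParamCond k l₁ l₂ c₁ c₂ c₃)
    {h : Module.End ℂ (AnGerm (nearReg x₀))} (hh : h ∈ cherednik x₀ c₁ c₂ c₃) :
    ∀ F G : PerGerm x₀, resStratum k m l₁ l₂ x₀ F = 0 → toReg x₀ G = h (toReg x₀ F) →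
      resStratum k m l₁ l₂ x₀ G = 0 := by
  induction hh using Algebra.adjoin_induction with
  | mem h hh =>
    intro F G hF hG
    obtain ⟨f, hf, hp, rfl⟩ := PerGerm.exists_mk F
    rw [resStratum_mk_eq_zero hx₀] at hF
    rcases hh with (⟨w, rfl⟩ | ⟨p, rfl⟩) | ⟨i, rfl⟩
    · have e : G = PerGerm.mk (fun y => f ((w⁻¹).1 y))
          (fun x hx => analyticAt_comp_W w⁻¹ (hf _ (orbit_mapsTo x₀ w⁻¹ hx))) (hp.comp_W w⁻¹) :=
        toReg_injective x₀ hG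
      rw [e, resStratum_mk_eq_zero hx₀]
      intro x hx
      filter_upwards [(continuous_W w⁻¹).continuousAt.eventually (hF _ (W_mem_orbit w⁻¹ hx))]
        with y h1 h2
      exact h1 (by rw [← map_sub]; exact W_mem_dirAt w⁻¹ h2)
    · have hp' : IsPeriodicNear x₀ (fun y => exp (pairing p y) * f y) := by
        intro x hx x' hx' h
        filter_upwards [hp x hx x' hx' h] with y hy
        rw [hy, add_sub_assoc, pairing_vadd, Complex.exp_add, exp_pairing_sub_of_latEq h, mul_one]
      have e : G = PerGerm.mk (fun y => exp (pairing p y) * f y)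
          (fun x hx => (analyticAt_pairing p x).cexp.mul (hf x hx)) hp' :=
        toReg_injective x₀ hG
      rw [e, resStratum_mk_eq_zero hx₀]
      intro x hx
      filter_upwards [hF x hx] with y h1 h2
      rw [h1 h2, mul_zero]
    · rw [dunkl_toReg] at hG
      rw [toReg_injective x₀ hG, resStratum_mk_eq_zero hx₀]
      intro x hx
      filter_upwards [perDunkl_eq_fderiv c₁ c₂ c₃ hf hp hF hx i,
        fderiv_eq_zero_of_vanish (hf x hx) (hF x hx) (mAt_mem_dirAt_orbit c₁ c₂ c₃
          (mAt_mem_dirAt c₁ c₂ c₃ hx₀ hk hN hc) hx (Pi.single i 1))] with y h1 h2 h3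
      rw [h1 h3, h2 h3]
  | algebraMap r =>
    intro F G hF hG
    have : toReg x₀ G = toReg x₀ (r • F) := by rw [hG, map_smul]; rfl
    rw [toReg_injective x₀ this, map_smul, hF, smul_zero]
  | add h h' hh hh' ih ih' =>
    intro F G hF hG
    have e : toReg x₀ G = toReg x₀ (liftPer h (preservesPer_cherednik hh) F +
        liftPer h' (preservesPer_cherednik hh') F) := by
      rw [map_add, toReg_liftPer, toReg_liftPer, hG]; rfl
    rw [toReg_injective x₀ e, map_add, ih F _ hF (toReg_liftPer _ _ _),
      ih' F _ hF (toReg_liftPer _ _ _), add_zero]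
  | mul h h' hh hh' ih ih' =>
    intro F G hF hG
    refine ih (liftPer h' (preservesPer_cherednik hh') F) G
      (ih' F _ hF (toReg_liftPer _ _ _)) ?_
    rw [toReg_liftPer, hG]
    rfl

theorem mAt_mem_dirAt_of_invariant (hx₀ : IsGeneric N k m l₁ l₂ x₀)
    (H : ∀ h ∈ cherednik x₀ c₁ c₂ c₃, ∀ F G : PerGerm x₀, resStratum k m l₁ l₂ x₀ F = 0 →
      toReg x₀ G = h (toReg x₀ F) → resStratum k m l₁ l₂ x₀ G = 0) (b : Fin N) :
    mAt c₁ c₂ c₃ x₀ (Pi.single b 1) ∈ dirAt x₀ := by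
  intro α hα h1
  set g : (Fin N → ℂ) → ℂ := fun y => exp (pairing α y) - 1
  have hg : AnalyticAt ℂ g x₀ := (analyticAt_pairing α x₀).cexp.sub analyticAt_const
  have hf := analyticAt_spread hg
  have hp := spread_periodic x₀ g
  have h0 : ∀ x ∈ orbit x₀, ∀ᶠ y in 𝓝 x, y - x ∈ dirAt x → spread x₀ g y = 0 := by
    intro x hx
    by_cases hL : LatEq x x₀
    · filter_upwards [spread_of_latEq (g := g) hx hL] with y hy hy'
      rw [dirAt_of_latEq hL] at hy'
      rw [hy]
      simp only [g]
      rw [pairing_vadd, hy' α hα h1, zero_add, h1, sub_self]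
    · filter_upwards [spread_of_not_latEq (g := g) hx hL] with y hy _
      exact hy
  have h2 : dunkl x₀ c₁ c₂ c₃ b ∈ cherednik x₀ c₁ c₂ c₃ :=
    Algebra.subset_adjoin (Or.inr ⟨b, rfl⟩)
  have h3 := H _ h2 _ _ ((resStratum_mk_eq_zero hx₀ (hf := hf) (hp := hp)).2 h0)
    (dunkl_toReg c₁ c₂ c₃ b hf hp).symm
  rw [resStratum_mk_eq_zero hx₀] at h3
  have hx := mem_orbit_self x₀
  have h4 : x₀ - x₀ ∈ dirAt x₀ := by rw [sub_self]; exact Submodule.zero_mem _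
  have h5 := (h3 x₀ hx).self_of_nhds h4
  rw [(perDunkl_eq_fderiv c₁ c₂ c₃ hf hp h0 hx b).self_of_nhds h4,
    (spread_base x₀ g).fderiv_eq] at h5
  have h6 : HasFDerivAt g (exp (pairing α x₀) • pairingL α) x₀ :=
    ((pairingL α).hasFDerivAt (x := x₀)).cexp.sub_const 1
  rw [h6.fderiv, h1, one_smul] at h5
  exact h5

theorem isInvariant_IpU_iff_paramCond {U : Type*} [AddCommGroup U] [Module ℂ U] [Nontrivial U]
    (hx₀ : IsGeneric N k m l₁ l₂ x₀) (hk : 1 ≤ k) (hm : 1 ≤ m) (hN : m * k + l₁ + l₂ ≤ N) :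
    IsInvariant c₁ c₂ c₃ (IpU k m l₁ l₂ x₀ U) ↔ ParamCond k l₁ l₂ c₁ c₂ c₃ := by
  rw [isInvariant_IpU_iff]
  exact ⟨fun H => paramCond_of_mAt_mem_dirAt c₁ c₂ c₃ hx₀ hk hm hN
      (mAt_mem_dirAt_of_invariant c₁ c₂ c₃ hx₀ H),
    fun hc h hh => resStratum_eq_zero_of_paramCond c₁ c₂ c₃ hx₀ hk hN hc hh⟩

end Invariance

section Contraction

variable {U U' M M' : Type*} [AddCommGroup U] [Module ℂ U] [AddCommGroup U'] [Module ℂ U']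
  [AddCommGroup M] [Module ℂ M] [AddCommGroup M'] [Module ℂ M']

/-- Contraction of the left factor of `U ⊗ M` with a linear form. -/
def contr (φ : U →ₗ[ℂ] ℂ) : U ⊗[ℂ] M →ₗ[ℂ] M :=
  (TensorProduct.lid ℂ M).toLinearMap ∘ₗ rTensor M φ

@[simp] theorem contr_tmul (φ : U →ₗ[ℂ] ℂ) (u : U) (F : M) : contr φ (u ⊗ₜ F) = φ u • F := by
  simp [contr]

theorem contr_map (φ : U' →ₗ[ℂ] ℂ) (A : U →ₗ[ℂ] U') (f : M →ₗ[ℂ] M') (T : U ⊗[ℂ] M) :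
    contr φ (TensorProduct.map A f T) = f (contr (φ ∘ₗ A) T) := by
  have : contr φ ∘ₗ TensorProduct.map A f = f ∘ₗ contr (φ ∘ₗ A) :=
    TensorProduct.ext' fun u F => by simp
  exact LinearMap.congr_fun this T

theorem contr_lTensor (φ : U →ₗ[ℂ] ℂ) (f : M →ₗ[ℂ] M') (T : U ⊗[ℂ] M) :
    contr φ (lTensor U f T) = f (contr φ T) := contr_map φ LinearMap.id f T

theorem contr_rTensor (φ : U' →ₗ[ℂ] ℂ) (A : U →ₗ[ℂ] U') (T : U ⊗[ℂ] M) :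
    contr φ (rTensor M A T) = contr (φ ∘ₗ A) T := contr_map φ A LinearMap.id T

theorem contr_add (φ ψ : U →ₗ[ℂ] ℂ) (T : U ⊗[ℂ] M) : contr (φ + ψ) T = contr φ T + contr ψ T := by
  simp [contr, LinearMap.rTensor_add]

theorem contr_sub (φ ψ : U →ₗ[ℂ] ℂ) (T : U ⊗[ℂ] M) : contr (φ - ψ) T = contr φ T - contr ψ T := by
  simp [contr, LinearMap.rTensor_sub]

theorem contr_smul (c : ℂ) (φ : U →ₗ[ℂ] ℂ) (T : U ⊗[ℂ] M) :
    contr (c • φ) T = c • contr φ T := by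
  simp [contr, LinearMap.rTensor_smul]

theorem contr_sum {ι : Type*} (s : Finset ι) (φ : ι → U →ₗ[ℂ] ℂ) (T : U ⊗[ℂ] M) :
    contr (∑ i ∈ s, φ i) T = ∑ i ∈ s, contr (φ i) T := by
  classical
  induction s using Finset.induction_on with
  | empty => simp [contr]
  | insert i s his ih => rw [sum_insert his, sum_insert his, contr_add, ih]

/-- Elements of `U ⊗ M` are determined by their contractions. -/
theorem ext_contr {T T' : U ⊗[ℂ] M} (h : ∀ φ : U →ₗ[ℂ] ℂ, contr φ T = contr φ T') : T = T' := by
  classical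
  refine (TensorProduct.equivFinsuppOfBasisLeft (N := M) (Module.Free.chooseBasis ℂ U)).injective ?_
  ext i
  rw [TensorProduct.equivFinsuppOfBasisLeft_apply, TensorProduct.equivFinsuppOfBasisLeft_apply]
  exact h _

theorem lTensor_eq_zero_iff (f : M →ₗ[ℂ] M') (T : U ⊗[ℂ] M) :
    lTensor U f T = 0 ↔ ∀ φ : U →ₗ[ℂ] ℂ, f (contr φ T) = 0 := by
  constructor
  · intro h φ
    rw [← contr_lTensor, h, map_zero]
  · intro h
    refine ext_contr fun φ => ?_
    rw [contr_lTensor, h, map_zero]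

/-- Tensors that are fixed by all endomorphisms of a family belong to the subspace of fixed
vectors. -/
theorem exists_rTensor_subtype {ι : Type*} (A : ι → Module.End ℂ U) (S : Submodule ℂ U)
    (hS : ∀ v, (∀ i, A i v = v) → v ∈ S) {T : U ⊗[ℂ] M}
    (hT : ∀ i, rTensor M (A i) T = T) : ∃ g, T = rTensor M S.subtype g := by
  classical
  set b := Module.Free.chooseBasis ℂ M
  set e := TensorProduct.equivFinsuppOfBasisRight (M := U) b
  have h1 : ∀ j, e T j ∈ S := fun j => hS _ fun i => by
    have h2 : ∀ T : U ⊗[ℂ] M, e (rTensor M (A i) T) j = A i (e T j) := fun T => by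
      induction T with
      | zero => simp
      | add x y hx hy => rw [map_add, map_add, map_add, Finsupp.add_apply, hx, hy, Finsupp.add_apply,
          map_add]
      | tmul u F =>
        rw [LinearMap.rTensor_tmul, TensorProduct.equivFinsuppOfBasisRight_apply_tmul_apply,
          TensorProduct.equivFinsuppOfBasisRight_apply_tmul_apply, map_smul]
    rw [← h2, hT]
  refine ⟨∑ j ∈ (e T).support, (⟨e T j, h1 j⟩ : S) ⊗ₜ[ℂ] b j, ?_⟩
  rw [map_sum]
  conv_lhs => rw [← e.symm_apply_apply T, TensorProduct.equivFinsuppOfBasisRight_symm_apply]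
  rfl

end Contraction

section Chart

variable {N k m l₁ l₂ : ℕ}

/-- The index of the coordinate on `π^a` that corresponds to a coordinate of `V`. -/
def coordIndex (k m : ℕ) (i : ℕ) : ℕ := if i < m * k then i / k else m + (i - m * k)

/-- The numbers of coordinates in the blocks. -/
def blockSize (k m : ℕ) (j : ℕ) : ℕ := if j < m then k else 1

/-- The lengths of the basis vectors of `π`. -/
def invSqrt (k m : ℕ) (j : ℕ) : ℂ := ((Real.sqrt (blockSize k m j) : ℝ) : ℂ)⁻¹

theorem blockSize_pos (hk : 1 ≤ k) (j : ℕ) : 0 < blockSize k m j := by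
  unfold blockSize; split_ifs <;> omega

theorem sq_sqrt_blockSize (j : ℕ) :
    ((Real.sqrt (blockSize k m j) : ℝ) : ℂ) ^ 2 = blockSize k m j := by
  rw [← Complex.ofReal_pow, Real.sq_sqrt (Nat.cast_nonneg _), Complex.ofReal_natCast]

theorem blockSize_mul_invSqrt_sq (hk : 1 ≤ k) (j : ℕ) :
    (blockSize k m j : ℂ) * invSqrt k m j ^ 2 = 1 := by
  have h : (blockSize k m j : ℂ) ≠ 0 := Nat.cast_ne_zero.2 (blockSize_pos hk j).ne'
  rw [invSqrt, inv_pow, sq_sqrt_blockSize, mul_inv_cancel₀ h]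

theorem invSqrt_ne_zero (hk : 1 ≤ k) (j : ℕ) : invSqrt k m j ≠ 0 := fun h => by
  have := blockSize_mul_invSqrt_sq (m := m) hk j
  rw [h] at this
  simp at this

theorem coordIndex_lt (hN : m * k + l₁ + l₂ ≤ N) {i : Fin N} (h : i.1 + l₁ + l₂ < N) :
    coordIndex k m i < dimPlane N k m l₁ l₂ := by
  unfold coordIndex dimPlane
  split_ifs with h1
  · exact (Nat.div_lt_of_lt_mul (by rwa [mul_comm] at h1)).trans_le (Nat.le_add_right _ _)
  · omega

theorem basisVec_eq (hk : 1 ≤ k) (hN : m * k + l₁ + l₂ ≤ N) (j : Fin (dimPlane N k m l₁ l₂)) (i : Fin N) :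
    basisVec N k m l₁ l₂ j i =
      if i.1 + l₁ + l₂ < N ∧ coordIndex k m i = j then invSqrt k m j else 0 := by
  have hj := j.2
  unfold dimPlane at hj
  unfold basisVec
  by_cases h1 : j.1 < m
  · rw [if_pos h1, invSqrt, blockSize, if_pos h1]
    refine if_congr ?_ rfl rfl
    constructor
    · intro h
      have h2 : i.1 < m * k := (Nat.div_lt_iff_lt_mul hk).1 (h ▸ h1)
      exact ⟨by omega, by rw [coordIndex, if_pos h2, h]⟩
    · rintro ⟨-, h⟩
      unfold coordIndex at h
      split_ifs at h with h2
      · exact h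
      · omega
  · rw [if_neg h1, invSqrt, blockSize, if_neg h1, Nat.cast_one, Real.sqrt_one, Complex.ofReal_one,
      inv_one]
    refine if_congr ?_ rfl rfl
    constructor
    · intro h
      exact ⟨by omega, by rw [coordIndex, if_neg (by omega)]; omega⟩
    · rintro ⟨-, h⟩
      unfold coordIndex at h
      split_ifs at h with h2
      · have := Nat.div_lt_of_lt_mul (by rwa [mul_comm] at h2 : i.1 < k * m)
        omega
      · omega

theorem coordIndex_eq_iff_interval (hk : 1 ≤ k) (hN : m * k + l₁ + l₂ ≤ N)
    (j : Fin (dimPlane N k m l₁ l₂)) :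
    ∃ lo, lo + blockSize k m j ≤ N ∧ ∀ i : Fin N,
      (i.1 + l₁ + l₂ < N ∧ coordIndex k m i = j) ↔ lo ≤ i.1 ∧ i.1 < lo + blockSize k m j := by
  have hj := j.2
  unfold dimPlane at hj
  by_cases h1 : j.1 < m
  · have h0 : j.1 * k + k ≤ m * k := by
      have := Nat.mul_le_mul_right k h1
      rwa [Nat.succ_mul] at this
    refine ⟨j.1 * k, by rw [blockSize, if_pos h1]; omega, fun i => ?_⟩
    rw [blockSize, if_pos h1]
    have h2 : i.1 / k = j.1 ↔ j.1 * k ≤ i.1 ∧ i.1 < j.1 * k + k := by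
      rw [Nat.div_eq_iff hk]
      constructor <;> rintro ⟨h1, h2⟩ <;> exact ⟨by omega, by omega⟩
    rw [← h2]
    unfold coordIndex
    constructor
    · rintro ⟨-, h⟩
      split_ifs at h with h3
      · exact h
      · omega
    · intro h
      have h3 : i.1 < m * k := (Nat.div_lt_iff_lt_mul hk).1 (h ▸ h1)
      exact ⟨by omega, by rw [if_pos h3, h]⟩
  · refine ⟨m * k + (j.1 - m), by rw [blockSize, if_neg h1]; omega, fun i => ?_⟩
    rw [blockSize, if_neg h1]
    unfold coordIndex
    constructor
    · rintro ⟨-, h⟩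
      split_ifs at h with h3
      · have := Nat.div_lt_of_lt_mul (by rwa [mul_comm] at h3 : i.1 < k * m)
        omega
      · omega
    · intro h
      exact ⟨by omega, by rw [if_neg (by omega)]; omega⟩

theorem sum_coordIndex (hk : 1 ≤ k) (hN : m * k + l₁ + l₂ ≤ N) (j : Fin (dimPlane N k m l₁ l₂))
    (z : ℂ) : ∑ i : Fin N, (if i.1 + l₁ + l₂ < N ∧ coordIndex k m i = j then z else 0) =
      blockSize k m j * z := by
  obtain ⟨lo, h1, h2⟩ := coordIndex_eq_iff_interval hk hN j
  exact sum_ite_of_iff_interval h1 h2 z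

theorem basisVec_orthonormal (hk : 1 ≤ k) (hN : m * k + l₁ + l₂ ≤ N)
    (j j' : Fin (dimPlane N k m l₁ l₂)) :
    ∑ i, basisVec N k m l₁ l₂ j i * basisVec N k m l₁ l₂ j' i = if j = j' then 1 else 0 := by
  simp only [basisVec_eq hk hN]
  by_cases h : j = j'
  · subst h
    rw [if_pos rfl, ← blockSize_mul_invSqrt_sq (m := m) hk j, ← sum_coordIndex hk hN]
    refine sum_congr rfl fun i _ => ?_
    split_ifs <;> ring
  · rw [if_neg h]
    refine sum_eq_zero fun i _ => ?_
    split_ifs with h1 h2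
    · exact absurd (Fin.ext (h1.2.symm.trans h2.2)) h
    · rw [mul_zero]
    · rw [zero_mul]
    · rw [zero_mul]

/-- The coordinates of the orthogonal projection to `π^a`. -/
def proj (N k m l₁ l₂ : ℕ) (x : Fin N → ℂ) : Fin (dimPlane N k m l₁ l₂) → ℂ := fun j =>
  ∑ i, (x i - if InShift N l₁ l₂ i then Real.pi * Complex.I else 0) * basisVec N k m l₁ l₂ j i

/-- The linear part of `proj`. -/
def projL (N k m l₁ l₂ : ℕ) : (Fin N → ℂ) →L[ℂ] (Fin (dimPlane N k m l₁ l₂) → ℂ) :=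
  LinearMap.toContinuousLinearMap
    { toFun := fun x j => ∑ i, x i * basisVec N k m l₁ l₂ j i
      map_add' := fun x y => funext fun j => by
        simp [add_mul, sum_add_distrib]
      map_smul' := fun c x => funext fun j => by
        simp [mul_sum, mul_assoc] }

theorem projL_apply (x : Fin N → ℂ) (j : Fin (dimPlane N k m l₁ l₂)) :
    projL N k m l₁ l₂ x j = ∑ i, x i * basisVec N k m l₁ l₂ j i := rfl

theorem proj_sub (x x' : Fin N → ℂ) :
    proj N k m l₁ l₂ x - proj N k m l₁ l₂ x' = projL N k m l₁ l₂ (x - x') := by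
  funext j
  simp only [proj, projL_apply, Pi.sub_apply, ← sum_sub_distrib]
  exact sum_congr rfl fun i _ => by ring

theorem proj_eq (x : Fin N → ℂ) :
    proj N k m l₁ l₂ x = projL N k m l₁ l₂ x + proj N k m l₁ l₂ 0 := by
  have := proj_sub (k := k) (m := m) (l₁ := l₁) (l₂ := l₂) x 0
  rw [sub_zero] at this
  rw [← this, sub_add_cancel]

theorem hasFDerivAt_proj (x : Fin N → ℂ) :
    HasFDerivAt (proj N k m l₁ l₂) (projL N k m l₁ l₂) x := by
  have : proj N k m l₁ l₂ = fun x => projL N k m l₁ l₂ x + proj N k m l₁ l₂ 0 :=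
    funext proj_eq
  rw [this]
  exact (projL N k m l₁ l₂).hasFDerivAt.add_const _

theorem analyticAt_proj (x : Fin N → ℂ) : AnalyticAt ℂ (proj N k m l₁ l₂) x := by
  have : proj N k m l₁ l₂ = fun x => projL N k m l₁ l₂ x + proj N k m l₁ l₂ 0 :=
    funext proj_eq
  rw [this]
  exact ((projL N k m l₁ l₂).analyticAt x).add analyticAt_const

theorem proj_chart (hk : 1 ≤ k) (hN : m * k + l₁ + l₂ ≤ N) (y : Fin (dimPlane N k m l₁ l₂) → ℂ) :
    proj N k m l₁ l₂ (chart N k m l₁ l₂ y) = y := by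
  funext j
  simp only [proj, chart, add_sub_cancel_right, sum_mul, mul_assoc]
  rw [sum_comm]
  simp only [← mul_sum, basisVec_orthonormal hk hN]
  simp

theorem chart_mem_plane (hk : 1 ≤ k) (hN : m * k + l₁ + l₂ ≤ N)
    (y : Fin (dimPlane N k m l₁ l₂) → ℂ) : chart N k m l₁ l₂ y ∈ plane N k m l₁ l₂ := by
  refine ⟨fun i i' hi hi' hii => ?_, fun i hi => ?_, fun i hi => ?_⟩
  · have h1 : ¬ InShift N l₁ l₂ i := fun h => by have := h.1; omega
    have h2 : ¬ InShift N l₁ l₂ i' := fun h => by have := h.1; omega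
    have h3 : coordIndex k m i = coordIndex k m i' := by
      unfold coordIndex; rw [if_pos hi, if_pos hi', hii]
    have h4 : i.1 + l₁ + l₂ < N := by omega
    have h5 : i'.1 + l₁ + l₂ < N := by omega
    simp only [chart, if_neg h1, if_neg h2, basisVec_eq hk hN, h3, h4, h5]
  · have h1 : ¬ InShift N l₁ l₂ i := fun h => by have := h.2; omega
    have h4 : ¬ i.1 + l₁ + l₂ < N := by omega
    simp [chart, h1, basisVec_eq hk hN, h4]
  · have h4 : ¬ i.1 + l₁ + l₂ < N := by have := hi.1; omega
    simp [chart, hi, basisVec_eq hk hN, h4]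

theorem chart_proj (hk : 1 ≤ k) (hN : m * k + l₁ + l₂ ≤ N) {x : Fin N → ℂ}
    (hx : x ∈ plane N k m l₁ l₂) : chart N k m l₁ l₂ (proj N k m l₁ l₂ x) = x := by
  obtain ⟨y, rfl⟩ := exists_chart_eq hk hN hx
  rw [proj_chart hk hN]

/-- Roots that are equal to `0` modulo `2πi` on `π^a` have the projection `0`. -/
theorem projL_toV_eq_zero {x₀ : Fin N → ℂ} (hk : 1 ≤ k) (hN : m * k + l₁ + l₂ ≤ N)
    (hx₀ : IsGeneric N k m l₁ l₂ x₀) {α : Fin N → ℤ} (hα : α ∈ posRoots N)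
    (h : exp (pairing α x₀) = 1) : projL N k m l₁ l₂ (toV α) = 0 := by
  funext j
  have h1 := sub_mem_dirAt_of_mem_plane hx₀ (chart_mem_plane hk hN 0)
    (chart_mem_plane hk hN (Pi.single j 1)) α hα h
  have h2 : chart N k m l₁ l₂ (Pi.single j 1) - chart N k m l₁ l₂ 0 = basisVec N k m l₁ l₂ j := by
    funext i
    simp only [chart, Pi.sub_apply, Pi.zero_apply, zero_mul, sum_const_zero]
    rw [sum_eq_single j (fun j' _ h => by simp [h]) (by simp), Pi.single_eq_same]
    ring
  rw [h2] at h1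
  exact h1

end Chart

section Stabilizer

variable {N : ℕ} {x₀ : Fin N → ℂ}

/-- The stabilizer of the class of `x₀` modulo `2πi ℤ^N` is generated by reflections. -/
theorem mem_of_latEq (K : Subgroup (W N))
    (hK : ∀ α : posRoots N, exp (pairing α.1 x₀) = 1 → sRefl α ∈ K) (w : W N)
    (hw : LatEq (w.1 x₀) x₀) : w ∈ K := by
  classical
  have key : ∀ n : ℕ, ∀ w : W N, LatEq (w.1 x₀) x₀ →
      (univ.filter fun i => ¬ ∀ y, w.1 y i = y i).card = n → w ∈ K := by
    intro n
    induction n using Nat.strong_induction_on with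
    | _ n ih =>
    intro w hw hn
    by_cases h0 : ∀ i y, w.1 y i = y i
    · have : w = 1 := Subtype.ext (LinearEquiv.ext fun y => funext fun i => h0 i y)
      rw [this]
      exact K.one_mem
    rw [not_forall] at h0
    obtain ⟨i, hi⟩ := h0
    have step : ∀ α : posRoots N, exp (pairing α.1 x₀) = 1 →
        (∀ y, w.1 (refl α.1 y) i = y i) →
        (∀ a, a ≠ i → (∀ y, w.1 y a = y a) → ∀ y, refl α.1 y a = y a) → w ∈ K := by
      intro α h1 h2 h3
      have h4 : LatEq ((w * sRefl α).1 x₀) x₀ :=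
        ((latEq_refl α.2 h1).symm.map w).trans hw
      have h5 : (univ.filter fun i => ¬ ∀ y, (w * sRefl α).1 y i = y i).card < n := by
        rw [← hn]
        refine card_lt_card (ssubset_iff_of_subset ?_ |>.2 ⟨i, by simpa using hi, ?_⟩)
        · intro a ha
          rw [mem_filter] at ha ⊢
          refine ⟨ha.1, fun h => ha.2 fun y => ?_⟩
          have hai : a ≠ i := by
            rintro rfl
            exact hi h
          exact (h (refl α.1 y)).trans (h3 a hai h y)
        · rw [mem_filter, not_and, not_not]
          exact fun _ => h2
      have h6 := K.mul_mem (ih _ h5 _ h4 rfl) (hK α h1)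
      rwa [mul_assoc, sRefl_mul_self, mul_one] at h6
    obtain ⟨σ, ε, hσ⟩ := w.2
    obtain ⟨p, hp⟩ := hw
    have hpi := hp i
    rw [hσ] at hpi
    have hexp : exp (((ε i : ℤ) : ℂ) * x₀ (σ i) - x₀ i) = 1 := by
      rw [Complex.exp_eq_one_iff]
      exact ⟨p i, by rw [hpi]; ring⟩
    by_cases hs : σ i = i
    · rcases Int.units_eq_one_or (ε i) with h2 | h2
      · exact absurd (fun y => by rw [hσ, h2, hs]; simp) hi
      · refine step ⟨2 • eV i, two_eV_mem i⟩ ?_ (fun y => ?_) (fun a ha _ y => ?_)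
        · change exp (pairing (2 • eV i) x₀) = 1
          rw [hs, h2] at hexp
          rw [pairing_two_eV, ← exp_neg_eq_one_iff, ← hexp]
          congr 1
          push_cast
          ring
        · change w.1 (refl (2 • eV i) y) i = y i
          rw [hσ, hs, h2, refl_two_eV, refl_eV_apply]
          simp
        · change refl (2 • eV i) y a = y a
          rw [refl_two_eV, refl_eV_apply, if_neg ha]
    · have hfix : ∀ a, a ≠ i → (∀ y, w.1 y a = y a) → a ≠ σ i := by
        rintro a ha h rfl
        have h1 := h (Pi.single (σ i) 1)
        rw [hσ, Pi.single_eq_same] at h1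
        by_cases h2 : σ (σ i) = σ i
        · exact hs (σ.injective h2)
        · rw [Pi.single_eq_of_ne h2, mul_zero] at h1
          exact zero_ne_one h1
      rcases Int.units_eq_one_or (ε i) with h2 | h2
      · refine step ⟨eM i (σ i), eM_mem (Ne.symm hs)⟩ ?_ (fun y => ?_) (fun a ha hfa y => ?_)
        · change exp (pairing (eM i (σ i)) x₀) = 1
          rw [h2, Units.val_one, Int.cast_one, one_mul] at hexp
          rw [pairing_eM]
          rcases sgn_eq i (σ i) with h | h <;> rw [h]
          · rw [one_mul, ← neg_sub, exp_neg_eq_one_iff, hexp]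
          · rw [neg_one_mul, neg_sub, hexp]
        · change w.1 (refl (eM i (σ i)) y) i = y i
          rw [hσ, h2]
          unfold eM
          split_ifs
          · rw [refl_eV_sub_apply (Ne.symm hs)]; simp [hs]
          · rw [refl_eV_sub_apply hs]; simp
        · change refl (eM i (σ i)) y a = y a
          have := hfix a ha hfa
          unfold eM
          split_ifs
          · rw [refl_eV_sub_apply (Ne.symm hs)]; simp [ha, this]
          · rw [refl_eV_sub_apply hs]; simp [ha, this]
      · refine step ⟨eP i (σ i), eP_mem (Ne.symm hs)⟩ ?_ (fun y => ?_) (fun a ha hfa y => ?_)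
        · change exp (pairing (eP i (σ i)) x₀) = 1
          rw [h2] at hexp
          rw [pairing_eP, ← exp_neg_eq_one_iff, ← hexp]
          congr 1
          push_cast
          ring
        · change w.1 (refl (eP i (σ i)) y) i = y i
          rw [hσ, h2, refl_eP_apply (Ne.symm hs)]
          simp [hs]
        · change refl (eP i (σ i)) y a = y a
          rw [refl_eP_apply (Ne.symm hs)]
          simp [ha, hfix a ha hfa]
  exact key _ w hw rfl

end Stabilizer

section PeriodicGerms

variable {N : ℕ} {x₀ : Fin N → ℂ}

theorem PerGerm.mk_eq_mk {f g : (Fin N → ℂ) → ℂ} {hf : ∀ x ∈ orbit x₀, AnalyticAt ℂ f x}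
    {hp : IsPeriodicNear x₀ f} {hg : ∀ x ∈ orbit x₀, AnalyticAt ℂ g x} {hq : IsPeriodicNear x₀ g}
    (h : ∀ x ∈ orbit x₀, f =ᶠ[𝓝 x] g) : PerGerm.mk f hf hp = PerGerm.mk g hg hq :=
  Subtype.ext (Germ.coe_eq.2 (eventually_nhdsSet_iff_forall.2 h))

theorem act_mem_cherednik (c₁ c₂ c₃ : ℂ) (w : W N) : act x₀ w ∈ cherednik x₀ c₁ c₂ c₃ :=
  Algebra.subset_adjoin (Or.inl (Or.inl ⟨w, rfl⟩))

theorem preservesPer_act (w : W N) : PreservesPer (act x₀ w) :=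
  preservesPer_cherednik (act_mem_cherednik 0 0 0 w)

/-- The action of `W` on periodic germs. -/
def perAct (x₀ : Fin N → ℂ) (w : W N) : Module.End ℂ (PerGerm x₀) :=
  liftPer (act x₀ w) (preservesPer_act w)

theorem toReg_perAct (w : W N) (F : PerGerm x₀) :
    toReg x₀ (perAct x₀ w F) = act x₀ w (toReg x₀ F) := toReg_liftPer _ _ F

theorem perAct_mk (w : W N) {f : (Fin N → ℂ) → ℂ} (hf : ∀ x ∈ orbit x₀, AnalyticAt ℂ f x)
    (hp : IsPeriodicNear x₀ f) : perAct x₀ w (PerGerm.mk f hf hp) =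
      PerGerm.mk (fun y => f ((w⁻¹).1 y))
        (fun _ hx => analyticAt_comp_W w⁻¹ (hf _ (orbit_mapsTo x₀ w⁻¹ hx))) (hp.comp_W w⁻¹) :=
  toReg_injective x₀ (by rw [toReg_perAct]; rfl)

theorem perAct_mul (v w : W N) : perAct x₀ (v * w) = perAct x₀ v * perAct x₀ w :=
  LinearMap.ext fun F => toReg_injective x₀ (by
    rw [toReg_perAct, Module.End.mul_apply, toReg_perAct, toReg_perAct, act_mul]; rfl)

/-- The germ at `x₀` of a periodic germ. -/
def germAt (x₀ : Fin N → ℂ) : PerGerm x₀ →ₗ[ℂ] AnGerm (𝓝 x₀) where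
  toFun F := ⟨F.1.compTendsto id (tendsto_id'.2 (nhds_le_nhdsSet (mem_orbit_self x₀))), by
    obtain ⟨_, f, hf, _, rfl⟩ := F
    exact ⟨f, hf.filter_mono (nhds_le_nhdsSet (mem_orbit_self x₀)), rfl⟩⟩
  map_add' F G := by
    obtain ⟨_, f, hf, _, rfl⟩ := F
    obtain ⟨_, g, hg, _, rfl⟩ := G
    rfl
  map_smul' c F := by
    obtain ⟨_, f, hf, _, rfl⟩ := F
    rfl

theorem germAt_mk {f : (Fin N → ℂ) → ℂ} (hf : ∀ x ∈ orbit x₀, AnalyticAt ℂ f x)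
    (hp : IsPeriodicNear x₀ f) : germAt x₀ (PerGerm.mk f hf hp) =
      AnGerm.mk f (hf x₀ (mem_orbit_self x₀)).eventually_analyticAt := rfl

end PeriodicGerms

section Extension

variable {N k m l₁ l₂ : ℕ} {x₀ : Fin N → ℂ} {y₀ : Fin (dimPlane N k m l₁ l₂) → ℂ}

theorem spread_congr {g h : (Fin N → ℂ) → ℂ} (e : g =ᶠ[𝓝 x₀] h) {x : Fin N → ℂ}
    (hx : x ∈ orbit x₀) : spread x₀ g =ᶠ[𝓝 x] spread x₀ h := by
  filter_upwards [locate_eventually hx, (tendsto_sub_add x x₀).eventually e] with y h1 h2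
  rw [spread, spread, h1, h2]

theorem analyticAt_comp_proj {f : (Fin (dimPlane N k m l₁ l₂) → ℂ) → ℂ}
    (hf : ∀ᶠ y in 𝓝 (proj N k m l₁ l₂ x₀), AnalyticAt ℂ f y) :
    AnalyticAt ℂ (fun x => f (proj N k m l₁ l₂ x)) x₀ :=
  AnalyticAt.comp (g := f) hf.self_of_nhds (analyticAt_proj x₀)

/-- The periodic germ that extends a germ on `π^a` near the points congruent to `x₀`. -/
def extFun (f : (Fin (dimPlane N k m l₁ l₂) → ℂ) → ℂ)
    (hf : ∀ᶠ y in 𝓝 (proj N k m l₁ l₂ x₀), AnalyticAt ℂ f y) : PerGerm x₀ :=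
  PerGerm.mk (spread x₀ fun x => f (proj N k m l₁ l₂ x))
    (analyticAt_spread (analyticAt_comp_proj hf)) (spread_periodic x₀ _)

theorem extFun_congr {f g : (Fin (dimPlane N k m l₁ l₂) → ℂ) → ℂ}
    {hf : ∀ᶠ y in 𝓝 (proj N k m l₁ l₂ x₀), AnalyticAt ℂ f y}
    {hg : ∀ᶠ y in 𝓝 (proj N k m l₁ l₂ x₀), AnalyticAt ℂ g y}
    (h : AnGerm.mk f hf = AnGerm.mk g hg) : extFun f hf = extFun g hg :=
  PerGerm.mk_eq_mk fun _ hx => spread_congr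
    ((analyticAt_proj x₀).continuousAt.eventually (AnGerm.mk_eq_mk.1 h)) hx

theorem extFun_add {f g : (Fin (dimPlane N k m l₁ l₂) → ℂ) → ℂ}
    (hf : ∀ᶠ y in 𝓝 (proj N k m l₁ l₂ x₀), AnalyticAt ℂ f y)
    (hg : ∀ᶠ y in 𝓝 (proj N k m l₁ l₂ x₀), AnalyticAt ℂ g y) :
    extFun _ (ev_add hf hg) = extFun f hf + extFun g hg := by
  refine Subtype.ext (Germ.coe_eq.2 (Eventually.of_forall fun y => ?_))
  change spread x₀ _ y = spread x₀ _ y + spread x₀ _ y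
  simp only [spread]
  split_ifs
  · rfl
  · rw [add_zero]

theorem extFun_smul (c : ℂ) {f : (Fin (dimPlane N k m l₁ l₂) → ℂ) → ℂ}
    (hf : ∀ᶠ y in 𝓝 (proj N k m l₁ l₂ x₀), AnalyticAt ℂ f y) :
    extFun _ (ev_const_mul c hf) = c • extFun f hf := by
  refine Subtype.ext (Germ.coe_eq.2 (Eventually.of_forall fun y => ?_))
  change spread x₀ _ y = c * spread x₀ _ y
  simp only [spread]
  split_ifs
  · rfl
  · rw [mul_zero]

/-- A function that represents a germ. -/
def AnGerm.rep {n : ℕ} {l : Filter (Fin n → ℂ)} (F : AnGerm l) : (Fin n → ℂ) → ℂ :=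
  (AnGerm.exists_mk F).choose

theorem AnGerm.rep_analyticAt {n : ℕ} {l : Filter (Fin n → ℂ)} (F : AnGerm l) :
    ∀ᶠ y in l, AnalyticAt ℂ (AnGerm.rep F) y := (AnGerm.exists_mk F).choose_spec.choose

theorem AnGerm.mk_rep {n : ℕ} {l : Filter (Fin n → ℂ)} (F : AnGerm l) :
    AnGerm.mk (AnGerm.rep F) (AnGerm.rep_analyticAt F) = F := (AnGerm.exists_mk F).choose_spec.choose_spec.symm

/-- The periodic germ that extends a germ on `π^a` near the points congruent to `x₀`, as a linear
map. -/
def extGerm (N k m l₁ l₂ : ℕ) (x₀ : Fin N → ℂ) :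
    AnGerm (𝓝 (proj N k m l₁ l₂ x₀)) →ₗ[ℂ] PerGerm x₀ where
  toFun F := extFun (AnGerm.rep F) (AnGerm.rep_analyticAt F)
  map_add' F G := by
    rw [← extFun_add]
    refine extFun_congr ?_
    rw [AnGerm.mk_rep, ← AnGerm.mk_add (AnGerm.rep_analyticAt F) (AnGerm.rep_analyticAt G), AnGerm.mk_rep,
      AnGerm.mk_rep]
  map_smul' c F := by
    rw [RingHom.id_apply, ← extFun_smul]
    refine extFun_congr ?_
    rw [AnGerm.mk_rep, ← AnGerm.mk_smul c (AnGerm.rep_analyticAt F), AnGerm.mk_rep]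

theorem extGerm_mk (f : (Fin (dimPlane N k m l₁ l₂) → ℂ) → ℂ)
    (hf : ∀ᶠ y in 𝓝 (proj N k m l₁ l₂ x₀), AnalyticAt ℂ f y) :
    extGerm N k m l₁ l₂ x₀ (AnGerm.mk f hf) = extFun f hf :=
  extFun_congr (AnGerm.mk_rep _)

/-- The pullback of germs on `π^a` under the orthogonal projection. -/
def pullProj (N k m l₁ l₂ : ℕ) (x₀ : Fin N → ℂ) :
    AnGerm (𝓝 (proj N k m l₁ l₂ x₀)) →ₗ[ℂ] AnGerm (𝓝 x₀) where
  toFun F := ⟨F.1.compTendsto (proj N k m l₁ l₂) (analyticAt_proj x₀).continuousAt, by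
    obtain ⟨_, f, hf, rfl⟩ := F
    exact ⟨fun x => f (proj N k m l₁ l₂ x), (analyticAt_comp_proj hf).eventually_analyticAt, rfl⟩⟩
  map_add' F G := by
    obtain ⟨_, f, hf, rfl⟩ := F
    obtain ⟨_, g, hg, rfl⟩ := G
    rfl
  map_smul' c F := by
    obtain ⟨_, f, hf, rfl⟩ := F
    rfl

theorem pullProj_mk (f : (Fin (dimPlane N k m l₁ l₂) → ℂ) → ℂ)
    (hf : ∀ᶠ y in 𝓝 (proj N k m l₁ l₂ x₀), AnalyticAt ℂ f y) :
    pullProj N k m l₁ l₂ x₀ (AnGerm.mk f hf) = AnGerm.mk (fun x => f (proj N k m l₁ l₂ x))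
      (analyticAt_comp_proj hf).eventually_analyticAt := rfl

/-- The subgroup that does not change orthogonal projections to `π`. -/
def projStabilizer (N k m l₁ l₂ : ℕ) : Subgroup (W N) where
  carrier := {w | ∀ ξ, projL N k m l₁ l₂ (w.1 ξ) = projL N k m l₁ l₂ ξ}
  mul_mem' {v w} hv hw ξ := (hv (w.1 ξ)).trans (hw ξ)
  one_mem' _ := rfl
  inv_mem' {w} hw ξ := by rw [← hw, W_inv_apply]

theorem projL_W (hk : 1 ≤ k) (hN : m * k + l₁ + l₂ ≤ N) (hx₀ : IsGeneric N k m l₁ l₂ x₀)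
    {w : W N} (hw : LatEq (w.1 x₀) x₀) (ξ : Fin N → ℂ) :
    projL N k m l₁ l₂ (w.1 ξ) = projL N k m l₁ l₂ ξ := by
  refine mem_of_latEq (projStabilizer N k m l₁ l₂) (fun α hα ξ => ?_) w hw ξ
  change projL N k m l₁ l₂ (refl α.1 ξ) = _
  rw [refl_eq_sub, map_sub, map_smul, projL_toV_eq_zero hk hN hx₀ α.2 hα, smul_zero, sub_zero]

theorem latEq_inv {w : W N} : LatEq ((w⁻¹).1 x₀) x₀ ↔ LatEq (w.1 x₀) x₀ := by
  constructor
  · intro h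
    have := h.map w
    rw [W_inv_apply] at this
    exact this.symm
  · intro h
    have := h.map w⁻¹
    rw [W_inv_apply'] at this
    exact this.symm

theorem germAt_perAct_extGerm (hk : 1 ≤ k) (hN : m * k + l₁ + l₂ ≤ N)
    (hx₀ : IsGeneric N k m l₁ l₂ x₀) {w : W N} (hw : LatEq (w.1 x₀) x₀)
    (F : AnGerm (𝓝 (proj N k m l₁ l₂ x₀))) :
    germAt x₀ (perAct x₀ w (extGerm N k m l₁ l₂ x₀ F)) = pullProj N k m l₁ l₂ x₀ F := by
  obtain ⟨f, hf, rfl⟩ := AnGerm.exists_mk F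
  rw [extGerm_mk, extFun, perAct_mk, germAt_mk, pullProj_mk, AnGerm.mk_eq_mk]
  have hw' := latEq_inv.2 hw
  filter_upwards [(continuous_W w⁻¹).continuousAt.eventually (spread_of_latEq
    (g := fun x => f (proj N k m l₁ l₂ x)) (W_mem_orbit w⁻¹ (mem_orbit_self x₀)) hw')] with y hy
  rw [hy]
  congr 1
  have h1 := proj_sub (k := k) (m := m) (l₁ := l₁) (l₂ := l₂)
    ((w⁻¹).1 y - (w⁻¹).1 x₀ + x₀) x₀
  rw [add_sub_cancel_right, ← map_sub, projL_W hk hN hx₀ hw', ← proj_sub] at h1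
  rw [map_sub] at h1
  exact sub_left_injective h1

theorem germAt_perAct_extGerm_of_not {w : W N} (hw : ¬ LatEq (w.1 x₀) x₀)
    (F : AnGerm (𝓝 (proj N k m l₁ l₂ x₀))) :
    germAt x₀ (perAct x₀ w (extGerm N k m l₁ l₂ x₀ F)) = 0 := by
  obtain ⟨f, hf, rfl⟩ := AnGerm.exists_mk F
  rw [extGerm_mk, extFun, perAct_mk, germAt_mk]
  refine Subtype.ext (Germ.coe_eq.2 ?_)
  filter_upwards [(continuous_W w⁻¹).continuousAt.eventually (spread_of_not_latEq
    (g := fun x => f (proj N k m l₁ l₂ x)) (W_mem_orbit w⁻¹ (mem_orbit_self x₀))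
    (fun h => hw (latEq_inv.1 h)))] with y hy
  exact hy

end Extension

section Restriction

variable {N k m l₁ l₂ : ℕ} {x₀ : Fin N → ℂ}
  (hy : chart N k m l₁ l₂ (proj N k m l₁ l₂ x₀) = x₀)

theorem tendsto_chart_base (hy : chart N k m l₁ l₂ (proj N k m l₁ l₂ x₀) = x₀) :
    Tendsto (chart N k m l₁ l₂) (𝓝 (proj N k m l₁ l₂ x₀)) (𝓝 x₀) := by
  have := (continuous_chart N k m l₁ l₂).tendsto (proj N k m l₁ l₂ x₀)
  rwa [hy] at this

theorem ev_chart (hy : chart N k m l₁ l₂ (proj N k m l₁ l₂ x₀) = x₀)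
    {f : (Fin N → ℂ) → ℂ} (hf : AnalyticAt ℂ f x₀) :
    ∀ᶠ y in 𝓝 (proj N k m l₁ l₂ x₀), AnalyticAt ℂ (fun y => f (chart N k m l₁ l₂ y)) y := by
  filter_upwards [(tendsto_chart_base hy).eventually hf.eventually_analyticAt] with y h
  exact AnalyticAt.comp (g := f) h (analyticAt_chart N k m l₁ l₂ y)

theorem resPlane_mk {f : (Fin N → ℂ) → ℂ} (hf : ∀ x ∈ orbit x₀, AnalyticAt ℂ f x)
    (hp : IsPeriodicNear x₀ f) : resPlane hy (PerGerm.mk f hf hp) =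
      AnGerm.mk (fun y => f (chart N k m l₁ l₂ y)) (ev_chart hy (hf x₀ (mem_orbit_self x₀))) := rfl

theorem resPlane_eq_of_germAt (hk : 1 ≤ k) (hN : m * k + l₁ + l₂ ≤ N) {F : PerGerm x₀}
    {G : AnGerm (𝓝 (proj N k m l₁ l₂ x₀))} (h : germAt x₀ F = pullProj N k m l₁ l₂ x₀ G) :
    resPlane hy F = G := by
  obtain ⟨f, hf, hp, rfl⟩ := PerGerm.exists_mk F
  obtain ⟨g, hg, rfl⟩ := AnGerm.exists_mk G
  rw [germAt_mk, pullProj_mk, AnGerm.mk_eq_mk] at h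
  rw [resPlane_mk, AnGerm.mk_eq_mk]
  filter_upwards [(tendsto_chart_base hy).eventually h] with y hy
  rw [hy, proj_chart hk hN]

theorem resPlane_eq_zero_iff (hk : 1 ≤ k) (hN : m * k + l₁ + l₂ ≤ N)
    {f : (Fin N → ℂ) → ℂ} (hf : ∀ x ∈ orbit x₀, AnalyticAt ℂ f x)
    (hp : IsPeriodicNear x₀ f) : resPlane hy (PerGerm.mk f hf hp) = 0 ↔
      ∀ᶠ z in 𝓝 x₀, z ∈ plane N k m l₁ l₂ → f z = 0 := by
  rw [resPlane_mk]
  have e : AnGerm.mk (fun y => f (chart N k m l₁ l₂ y)) (ev_chart hy (hf x₀ (mem_orbit_self x₀))) = 0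
      ↔ ∀ᶠ y in 𝓝 (proj N k m l₁ l₂ x₀), f (chart N k m l₁ l₂ y) = 0 :=
    ⟨fun h => Germ.coe_eq.1 (congrArg Subtype.val h), fun h => Subtype.ext (Germ.coe_eq.2 h)⟩
  rw [e]
  constructor
  · intro h
    filter_upwards [(analyticAt_proj x₀).continuousAt.eventually h] with z h1 h2
    rwa [chart_proj hk hN h2] at h1
  · intro h
    filter_upwards [(tendsto_chart_base hy).eventually h] with y h1
    exact h1 (chart_mem_plane hk hN y)

/-- Vanishing on the stratum is vanishing of all translates on `π^a` near `x₀`. -/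
theorem resStratum_eq_zero_iff (hk : 1 ≤ k) (hN : m * k + l₁ + l₂ ≤ N)
    (hx₀ : IsGeneric N k m l₁ l₂ x₀) (F : PerGerm x₀) :
    resStratum k m l₁ l₂ x₀ F = 0 ↔ ∀ w : W N, resPlane hy (perAct x₀ w F) = 0 := by
  obtain ⟨f, hf, hp, rfl⟩ := PerGerm.exists_mk F
  rw [resStratum_mk_eq_zero hx₀]
  simp only [perAct_mk, resPlane_eq_zero_iff hy hk hN, mem_plane_iff hx₀]
  constructor
  · intro h w
    filter_upwards [(continuous_W w⁻¹).continuousAt.eventually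
      (h _ (W_mem_orbit w⁻¹ (mem_orbit_self x₀)))] with z h1 h2
    refine h1 ?_
    rw [← map_sub]
    exact W_mem_dirAt w⁻¹ h2
  · rintro h x ⟨w, hw, rfl⟩
    set v : W N := ⟨w, hw⟩
    have hc := (continuous_W v⁻¹).continuousAt (x := w x₀)
    have e : (v⁻¹).1 (w x₀) = x₀ := W_inv_apply' v x₀
    rw [ContinuousAt, e] at hc
    filter_upwards [hc.eventually (h v⁻¹)] with z h1 h2
    rw [inv_inv, W_inv_apply] at h1
    refine h1 ?_
    have := W_mem_dirAt v⁻¹ h2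
    rwa [e, map_sub, e] at this

theorem resPlane_perAct_sRefl (hk : 1 ≤ k) (hN : m * k + l₁ + l₂ ≤ N)
    (hx₀ : IsGeneric N k m l₁ l₂ x₀) {α : posRoots N} (hα : exp (pairing α.1 x₀) = 1)
    (F : PerGerm x₀) : resPlane hy (perAct x₀ (sRefl α) F) = resPlane hy F := by
  obtain ⟨f, hf, hp, rfl⟩ := PerGerm.exists_mk F
  rw [perAct_mk, resPlane_mk, resPlane_mk, AnGerm.mk_eq_mk]
  have hx := mem_orbit_self x₀
  filter_upwards [(tendsto_chart_base hy).eventually (hp x₀ hx _ (refl_mem_orbit α.2 hx)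
    (latEq_refl α.2 hα))] with y h
  have h1 := sub_mem_dirAt_of_mem_plane hx₀ hx₀.1 (chart_mem_plane hk hN y) α.1 α.2 hα
  rw [pairing_vsub, sub_eq_zero] at h1
  rw [sRefl_inv]
  change f (refl α.1 _) = _
  rw [refl_eq_add h1, h]

end Restriction

section VectorValued

variable {N k m l₁ l₂ : ℕ} {x₀ : Fin N → ℂ} {U : Type*} [AddCommGroup U] [Module ℂ U]
  (ρ : Representation ℂ (W N)ᵐᵒᵖ U) (hy : chart N k m l₁ l₂ (proj N k m l₁ l₂ x₀) = x₀)

/-- The diagonal action of `W` on periodic germs. -/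
def diagPer (x₀ : Fin N → ℂ) (ρ : Representation ℂ (W N)ᵐᵒᵖ U) (w : W N) :
    Module.End ℂ (U ⊗[ℂ] PerGerm x₀) :=
  TensorProduct.map (ρ (MulOpposite.op w⁻¹)) (perAct x₀ w)

theorem toRegU_diagPer (w : W N) (T : U ⊗[ℂ] PerGerm x₀) :
    toRegU x₀ U (diagPer x₀ ρ w T) = diagAct x₀ ρ w (toRegU x₀ U T) := by
  have : toRegU x₀ U ∘ₗ diagPer x₀ ρ w = diagAct x₀ ρ w ∘ₗ toRegU x₀ U :=
    TensorProduct.ext' fun u F => by simp [toRegU, diagPer, diagAct, toReg_perAct]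
  exact LinearMap.congr_fun this T

theorem diagPer_mul (v w : W N) (T : U ⊗[ℂ] PerGerm x₀) :
    diagPer x₀ ρ (v * w) T = diagPer x₀ ρ v (diagPer x₀ ρ w T) := by
  have : diagPer x₀ ρ (v * w) = diagPer x₀ ρ v ∘ₗ diagPer x₀ ρ w :=
    TensorProduct.ext' fun u F => by
      simp only [diagPer, LinearMap.comp_apply, TensorProduct.map_tmul, perAct_mul, mul_inv_rev,
        MulOpposite.op_mul, map_mul, Module.End.mul_apply]
  exact LinearMap.congr_fun this T

theorem isInvMod_iff (T : U ⊗[ℂ] PerGerm x₀) : IsInvMod k m l₁ l₂ x₀ ρ T ↔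
    ∀ w : W N, lTensor U (resStratum k m l₁ l₂ x₀) (diagPer x₀ ρ w T - T) = 0 := by
  refine forall_congr' fun w => ?_
  rw [← toRegU_diagPer, ← map_sub, toRegU_mem_IpU]

theorem isInvMod_of_invariant {T : U ⊗[ℂ] PerGerm x₀} (h : ∀ w : W N, diagPer x₀ ρ w T = T) :
    IsInvMod k m l₁ l₂ x₀ ρ T :=
  (isInvMod_iff ρ T).2 fun w => by rw [h, sub_self, map_zero]

theorem lTensor_resPlane_eq_zero (hk : 1 ≤ k) (hN : m * k + l₁ + l₂ ≤ N)
    (hx₀ : IsGeneric N k m l₁ l₂ x₀) {T : U ⊗[ℂ] PerGerm x₀}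
    (h : lTensor U (resStratum k m l₁ l₂ x₀) T = 0) :
    lTensor U (resPlane hy) T = 0 := by
  rw [lTensor_eq_zero_iff] at h ⊢
  intro φ
  have := (resStratum_eq_zero_iff hy hk hN hx₀ _).1 (h φ) 1
  rwa [show perAct x₀ (1 : W N) (contr φ T) = contr φ T from
    toReg_injective x₀ (by rw [toReg_perAct, act_one]; rfl)] at this

theorem lTensor_resPlane_diagPer {T : U ⊗[ℂ] PerGerm x₀} (hk : 1 ≤ k) (hN : m * k + l₁ + l₂ ≤ N)
    (hx₀ : IsGeneric N k m l₁ l₂ x₀) (hT : IsInvMod k m l₁ l₂ x₀ ρ T) (w : W N) :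
    lTensor U (resPlane hy) (diagPer x₀ ρ w T) = lTensor U (resPlane hy) T := by
  rw [← sub_eq_zero, ← map_sub]
  exact lTensor_resPlane_eq_zero hy hk hN hx₀ ((isInvMod_iff ρ T).1 hT w)

theorem ρ_inv_apply (w : W N) (u : U) : ρ (MulOpposite.op w) (ρ (MulOpposite.op w⁻¹) u) = u := by
  rw [← Module.End.mul_apply, ← map_mul, ← MulOpposite.op_mul, inv_mul_cancel, MulOpposite.op_one,
    map_one, Module.End.one_apply]

theorem lTensor_resStratum_eq_zero (hk : 1 ≤ k) (hN : m * k + l₁ + l₂ ≤ N)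
    (hx₀ : IsGeneric N k m l₁ l₂ x₀) {T : U ⊗[ℂ] PerGerm x₀} (hT : IsInvMod k m l₁ l₂ x₀ ρ T)
    (h : lTensor U (resPlane hy) T = 0) :
    lTensor U (resStratum k m l₁ l₂ x₀) T = 0 := by
  rw [lTensor_eq_zero_iff]
  intro φ
  rw [resStratum_eq_zero_iff hy hk hN hx₀]
  intro w
  have h1 := lTensor_resPlane_diagPer ρ hy hk hN hx₀ hT w
  rw [h, lTensor_eq_zero_iff] at h1
  have h2 := h1 (φ ∘ₗ ρ (MulOpposite.op w))
  rw [diagPer, contr_map, LinearMap.comp_assoc] at h2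
  have h3 : ρ (MulOpposite.op w) ∘ₗ ρ (MulOpposite.op w⁻¹) = LinearMap.id :=
    LinearMap.ext (ρ_inv_apply ρ w)
  rwa [h3] at h2

theorem exists_eq_rTensor_subtype (hk : 1 ≤ k) (hN : m * k + l₁ + l₂ ≤ N)
    (hx₀ : IsGeneric N k m l₁ l₂ x₀) {T : U ⊗[ℂ] PerGerm x₀} (hT : IsInvMod k m l₁ l₂ x₀ ρ T) :
    ∃ g, lTensor U (resPlane hy) T =
      rTensor (AnGerm (𝓝 (proj N k m l₁ l₂ x₀))) (fixedU k m l₁ l₂ ρ).subtype g := by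
  refine exists_rTensor_subtype
    (fun α : {α : posRoots N // exp (pairing α.1 x₀) = 1} =>
      ρ (MulOpposite.op (sRefl α.1))) (fixedU k m l₁ l₂ ρ)
      (fun v hv α hα => hv ⟨α, hα _ hx₀.1⟩) fun α => ?_
  refine Eq.trans (ext_contr fun φ => ?_) (lTensor_resPlane_diagPer ρ hy hk hN hx₀ hT (sRefl α.1))
  rw [contr_rTensor, contr_lTensor, contr_lTensor, diagPer, contr_map,
    resPlane_perAct_sRefl hy hk hN hx₀ α.2, sRefl_inv]

open Classical in
/-- The elements of `W` that fix the class of `x₀`. -/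
def latStabilizer (x₀ : Fin N → ℂ) : Finset (W N) :=
  univ.filter fun w => LatEq (w.1 x₀) x₀

theorem card_latStabilizer_ne_zero (x₀ : Fin N → ℂ) : ((latStabilizer x₀).card : ℂ) ≠ 0 := by
  rw [Nat.cast_ne_zero, ← Nat.pos_iff_ne_zero, card_pos]
  classical
  exact ⟨1, mem_filter.2 ⟨mem_univ _, LatEq.refl x₀⟩⟩

/-- The invariant periodic germ that extends a `U^{W₀}`-valued germ on `π^a`. -/
def extInv (k m l₁ l₂ : ℕ) (x₀ : Fin N → ℂ) (ρ : Representation ℂ (W N)ᵐᵒᵖ U) :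
    fixedU k m l₁ l₂ ρ ⊗[ℂ] AnGerm (𝓝 (proj N k m l₁ l₂ x₀)) →ₗ[ℂ] U ⊗[ℂ] PerGerm x₀ :=
  ((latStabilizer x₀).card : ℂ)⁻¹ • ∑ w : W N, diagPer x₀ ρ w ∘ₗ
    TensorProduct.map (fixedU k m l₁ l₂ ρ).subtype (extGerm N k m l₁ l₂ x₀)

theorem diagPer_extInv (w : W N)
    (g : fixedU k m l₁ l₂ ρ ⊗[ℂ] AnGerm (𝓝 (proj N k m l₁ l₂ x₀))) :
    diagPer x₀ ρ w (extInv k m l₁ l₂ x₀ ρ g) = extInv k m l₁ l₂ x₀ ρ g := by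
  simp only [extInv, LinearMap.smul_apply, LinearMap.sum_apply, map_smul, map_sum,
    LinearMap.comp_apply, ← diagPer_mul]
  congr 1
  exact Fintype.sum_equiv (Equiv.mulLeft w) _ _ fun v => rfl

theorem fixedU_of_latEq (hx₀ : IsGeneric N k m l₁ l₂ x₀) {w : W N} (hw : LatEq (w.1 x₀) x₀)
    (u : fixedU k m l₁ l₂ ρ) : ρ (MulOpposite.op w) u.1 = u.1 := by
  let K : Subgroup (W N) :=
    { carrier := {w | ρ (MulOpposite.op w) u.1 = u.1}
      mul_mem' := fun {v w} hv hw => by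
        change ρ (MulOpposite.op (v * w)) u.1 = u.1
        rw [MulOpposite.op_mul, map_mul, Module.End.mul_apply]
        exact (congrArg _ hv).trans hw
      one_mem' := by
        change ρ (MulOpposite.op 1) u.1 = u.1
        rw [MulOpposite.op_one, map_one, Module.End.one_apply]
      inv_mem' := fun {w} hw => by
        change ρ (MulOpposite.op w⁻¹) u.1 = u.1
        conv_lhs => rw [← (hw : ρ (MulOpposite.op w) u.1 = u.1)]
        have := ρ_inv_apply ρ w⁻¹ u.1
        rwa [inv_inv] at this }
  exact mem_of_latEq K (fun α hα => u.2 α (hx₀.2 α.1 α.2 hα)) w hw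

/-- Near `x₀`, the extension of a germ is its pullback under the orthogonal projection. -/
theorem germAt_contr_extInv (hk : 1 ≤ k) (hN : m * k + l₁ + l₂ ≤ N)
    (hx₀ : IsGeneric N k m l₁ l₂ x₀) (φ : U →ₗ[ℂ] ℂ)
    (g : fixedU k m l₁ l₂ ρ ⊗[ℂ] AnGerm (𝓝 (proj N k m l₁ l₂ x₀))) :
    germAt x₀ (contr φ (extInv k m l₁ l₂ x₀ ρ g)) = pullProj N k m l₁ l₂ x₀
      (contr φ (rTensor _ (fixedU k m l₁ l₂ ρ).subtype g)) := by
  classical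
  have : germAt x₀ ∘ₗ contr φ ∘ₗ extInv k m l₁ l₂ x₀ ρ = pullProj N k m l₁ l₂ x₀ ∘ₗ
      contr φ ∘ₗ rTensor _ (fixedU k m l₁ l₂ ρ).subtype := by
    refine TensorProduct.ext' fun u F => ?_
    simp only [LinearMap.comp_apply, LinearMap.rTensor_tmul, contr_tmul, map_smul, extInv,
      LinearMap.smul_apply, LinearMap.sum_apply, map_sum, diagPer, TensorProduct.map_tmul,
      Submodule.subtype_apply]
    have h1 : ∀ w : W N, φ (ρ (MulOpposite.op w⁻¹) u.1) •
        germAt x₀ (perAct x₀ w (extGerm N k m l₁ l₂ x₀ F)) =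
        if LatEq (w.1 x₀) x₀ then φ u.1 • pullProj N k m l₁ l₂ x₀ F else 0 := fun w => by
      split_ifs with h
      · rw [germAt_perAct_extGerm hk hN hx₀ h, fixedU_of_latEq ρ hx₀ (latEq_inv.2 h)]
      · rw [germAt_perAct_extGerm_of_not h, smul_zero]
    rw [sum_congr rfl fun w _ => h1 w, ← sum_filter, sum_const]
    change (_ : ℂ) • ((latStabilizer x₀).card • _) = _
    rw [← Nat.cast_smul_eq_nsmul ℂ, smul_smul, inv_mul_cancel₀ (card_latStabilizer_ne_zero x₀),
      one_smul]
  exact LinearMap.congr_fun this g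

theorem lTensor_resPlane_extInv (hk : 1 ≤ k) (hN : m * k + l₁ + l₂ ≤ N)
    (hx₀ : IsGeneric N k m l₁ l₂ x₀)
    (g : fixedU k m l₁ l₂ ρ ⊗[ℂ] AnGerm (𝓝 (proj N k m l₁ l₂ x₀))) :
    lTensor U (resPlane hy) (extInv k m l₁ l₂ x₀ ρ g) =
      rTensor _ (fixedU k m l₁ l₂ ρ).subtype g := by
  refine ext_contr fun φ => ?_
  rw [contr_lTensor]
  exact resPlane_eq_of_germAt hy hk hN (germAt_contr_extInv ρ hk hN hx₀ φ g)

variable (c₁ c₂ c₃ : ℂ)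

/-- The operator `p(∇)` on periodic germs. -/
def polyPer (x₀ : Fin N → ℂ) (c₁ c₂ c₃ : ℂ) (p : MvPolynomial (Fin N) ℂ) :
    Module.End ℂ (PerGerm x₀) :=
  liftPer _ (preservesPer_cherednik (polyDunkl_mem_cherednik x₀ c₁ c₂ c₃ p))

theorem toReg_polyPer (p : MvPolynomial (Fin N) ℂ) (F : PerGerm x₀) :
    toReg x₀ (polyPer x₀ c₁ c₂ c₃ p F) = polyDunkl x₀ c₁ c₂ c₃ p (toReg x₀ F) :=
  toReg_liftPer _ _ F

theorem toRegU_polyPer (p : MvPolynomial (Fin N) ℂ) (T : U ⊗[ℂ] PerGerm x₀) :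
    toRegU x₀ U (lTensor U (polyPer x₀ c₁ c₂ c₃ p) T) =
      lTensor U (polyDunkl x₀ c₁ c₂ c₃ p) (toRegU x₀ U T) :=
  toRegU_lTensor_liftPer _ _ T

theorem polyPer_comm (p q : MvPolynomial (Fin N) ℂ) :
    polyPer x₀ c₁ c₂ c₃ p ∘ₗ polyPer x₀ c₁ c₂ c₃ q =
      polyPer x₀ c₁ c₂ c₃ q ∘ₗ polyPer x₀ c₁ c₂ c₃ p :=
  LinearMap.ext fun F => toReg_injective x₀ (by
    rw [LinearMap.comp_apply, LinearMap.comp_apply, toReg_polyPer, toReg_polyPer, toReg_polyPer,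
      toReg_polyPer]
    exact LinearMap.congr_fun (commute_polyDunkl x₀ c₁ c₂ c₃ p q).eq _)

theorem perAct_polyPer {p : MvPolynomial (Fin N) ℂ} (hp : IsInvPoly p) (w : W N) (F : PerGerm x₀) :
    perAct x₀ w (polyPer x₀ c₁ c₂ c₃ p F) = polyPer x₀ c₁ c₂ c₃ p (perAct x₀ w F) :=
  toReg_injective x₀ (by
    rw [toReg_perAct, toReg_polyPer, toReg_polyPer, toReg_perAct]
    exact LinearMap.congr_fun (commute_act_polyDunkl x₀ c₁ c₂ c₃ hp w).eq _)

theorem diagPer_polyPer {p : MvPolynomial (Fin N) ℂ} (hp : IsInvPoly p) (w : W N)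
    (T : U ⊗[ℂ] PerGerm x₀) :
    diagPer x₀ ρ w (lTensor U (polyPer x₀ c₁ c₂ c₃ p) T) =
      lTensor U (polyPer x₀ c₁ c₂ c₃ p) (diagPer x₀ ρ w T) := by
  have : diagPer x₀ ρ w ∘ₗ lTensor U (polyPer x₀ c₁ c₂ c₃ p) =
      lTensor U (polyPer x₀ c₁ c₂ c₃ p) ∘ₗ diagPer x₀ ρ w :=
    TensorProduct.ext' fun u F => by
      simp only [diagPer, LinearMap.comp_apply, TensorProduct.map_tmul, LinearMap.lTensor_tmul,
        perAct_polyPer c₁ c₂ c₃ hp]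
  exact LinearMap.congr_fun this T

variable (hx₀ : IsGeneric N k m l₁ l₂ x₀) (hk : 1 ≤ k) (hN : m * k + l₁ + l₂ ≤ N)
  (hc : ParamCond k l₁ l₂ c₁ c₂ c₃)

theorem lTensor_resStratum_polyPer (hx₀ : IsGeneric N k m l₁ l₂ x₀) (hk : 1 ≤ k)
    (hN : m * k + l₁ + l₂ ≤ N) (hc : ParamCond k l₁ l₂ c₁ c₂ c₃) (p : MvPolynomial (Fin N) ℂ)
    {T : U ⊗[ℂ] PerGerm x₀} (h : lTensor U (resStratum k m l₁ l₂ x₀) T = 0) :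
    lTensor U (resStratum k m l₁ l₂ x₀)
      (lTensor U (polyPer x₀ c₁ c₂ c₃ p) T) = 0 := by
  rw [lTensor_eq_zero_iff] at h ⊢
  intro φ
  rw [contr_lTensor]
  exact resStratum_eq_zero_of_paramCond c₁ c₂ c₃ hx₀ hk hN hc
    (polyDunkl_mem_cherednik x₀ c₁ c₂ c₃ p) _ _ (h φ) (toReg_polyPer c₁ c₂ c₃ p _)

theorem isInvMod_polyPer (hx₀ : IsGeneric N k m l₁ l₂ x₀) (hk : 1 ≤ k)
    (hN : m * k + l₁ + l₂ ≤ N) (hc : ParamCond k l₁ l₂ c₁ c₂ c₃) {p : MvPolynomial (Fin N) ℂ}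
    (hp : IsInvPoly p) {T : U ⊗[ℂ] PerGerm x₀} (hT : IsInvMod k m l₁ l₂ x₀ ρ T) :
    IsInvMod k m l₁ l₂ x₀ ρ (lTensor U (polyPer x₀ c₁ c₂ c₃ p) T) := by
  rw [isInvMod_iff] at hT ⊢
  intro w
  rw [diagPer_polyPer ρ c₁ c₂ c₃ hp, ← map_sub]
  exact lTensor_resStratum_polyPer c₁ c₂ c₃ hx₀ hk hN hc p (hT w)

/-- A projection of `U` onto `U^{W₀}`. -/
def fixedProj (k m l₁ l₂ : ℕ) (ρ : Representation ℂ (W N)ᵐᵒᵖ U) : U →ₗ[ℂ] fixedU k m l₁ l₂ ρ :=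
  ((fixedU k m l₁ l₂ ρ).subtype.exists_leftInverse_of_injective
    (Submodule.ker_subtype _)).choose

theorem fixedProj_comp_subtype :
    fixedProj k m l₁ l₂ ρ ∘ₗ (fixedU k m l₁ l₂ ρ).subtype = LinearMap.id :=
  ((fixedU k m l₁ l₂ ρ).subtype.exists_leftInverse_of_injective
    (Submodule.ker_subtype _)).choose_spec

theorem rTensor_fixedProj {M : Type*} [AddCommGroup M] [Module ℂ M]
    (g : fixedU k m l₁ l₂ ρ ⊗[ℂ] M) :
    rTensor M (fixedProj k m l₁ l₂ ρ)
      (rTensor M (fixedU k m l₁ l₂ ρ).subtype g) = g := by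
  rw [← LinearMap.comp_apply, ← LinearMap.rTensor_comp, fixedProj_comp_subtype,
    LinearMap.rTensor_id]
  rfl

/-- The operator `p(∇)` on the invariants, in terms of restrictions to `π^a`. -/
def resOp (hy : chart N k m l₁ l₂ (proj N k m l₁ l₂ x₀) = x₀) (c₁ c₂ c₃ : ℂ)
    (ρ : Representation ℂ (W N)ᵐᵒᵖ U) (p : MvPolynomial (Fin N) ℂ) :
    Module.End ℂ (fixedU k m l₁ l₂ ρ ⊗[ℂ] AnGerm (𝓝 (proj N k m l₁ l₂ x₀))) :=
  rTensor _ (fixedProj k m l₁ l₂ ρ) ∘ₗ lTensor U (resPlane hy) ∘ₗ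
    lTensor U (polyPer x₀ c₁ c₂ c₃ p) ∘ₗ extInv k m l₁ l₂ x₀ ρ

theorem rTensor_resOp (hx₀ : IsGeneric N k m l₁ l₂ x₀) (hk : 1 ≤ k)
    (hN : m * k + l₁ + l₂ ≤ N) (hc : ParamCond k l₁ l₂ c₁ c₂ c₃) {p : MvPolynomial (Fin N) ℂ}
    (hp : IsInvPoly p) (g : fixedU k m l₁ l₂ ρ ⊗[ℂ] AnGerm (𝓝 (proj N k m l₁ l₂ x₀))) :
    rTensor _ (fixedU k m l₁ l₂ ρ).subtype (resOp hy c₁ c₂ c₃ ρ p g) =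
      lTensor U (resPlane hy) (lTensor U (polyPer x₀ c₁ c₂ c₃ p)
        (extInv k m l₁ l₂ x₀ ρ g)) := by
  obtain ⟨g', hg'⟩ := exists_eq_rTensor_subtype ρ hy hk hN hx₀
    (isInvMod_polyPer ρ c₁ c₂ c₃ hx₀ hk hN hc hp
      (isInvMod_of_invariant ρ fun w => diagPer_extInv ρ w g))
  simp only [resOp, LinearMap.comp_apply]
  rw [hg', rTensor_fixedProj]

theorem lTensor_resPlane_polyPer (hx₀ : IsGeneric N k m l₁ l₂ x₀) (hk : 1 ≤ k)
    (hN : m * k + l₁ + l₂ ≤ N) (hc : ParamCond k l₁ l₂ c₁ c₂ c₃) {p : MvPolynomial (Fin N) ℂ}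
    (hp : IsInvPoly p) {T : U ⊗[ℂ] PerGerm x₀} (hT : IsInvMod k m l₁ l₂ x₀ ρ T)
    {g : fixedU k m l₁ l₂ ρ ⊗[ℂ] AnGerm (𝓝 (proj N k m l₁ l₂ x₀))}
    (hg : lTensor U (resPlane hy) T =
      rTensor _ (fixedU k m l₁ l₂ ρ).subtype g) :
    lTensor U (resPlane hy) (lTensor U (polyPer x₀ c₁ c₂ c₃ p) T) =
      rTensor _ (fixedU k m l₁ l₂ ρ).subtype (resOp hy c₁ c₂ c₃ ρ p g) := by
  rw [rTensor_resOp ρ hy c₁ c₂ c₃ hx₀ hk hN hc hp, ← sub_eq_zero, ← map_sub, ← map_sub]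
  refine lTensor_resPlane_eq_zero hy hk hN hx₀
    (lTensor_resStratum_polyPer c₁ c₂ c₃ hx₀ hk hN hc p ?_)
  refine lTensor_resStratum_eq_zero ρ hy hk hN hx₀ ?_ ?_
  · rw [isInvMod_iff] at hT ⊢
    intro w
    rw [map_sub (diagPer x₀ ρ w), diagPer_extInv, sub_sub_sub_cancel_right, hT]
  · rw [map_sub, hg, lTensor_resPlane_extInv ρ hy hk hN hx₀, sub_self]

theorem isRestriction_resOp (hx₀ : IsGeneric N k m l₁ l₂ x₀) (hk : 1 ≤ k)
    (hN : m * k + l₁ + l₂ ≤ N) (hc : ParamCond k l₁ l₂ c₁ c₂ c₃) :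
    IsRestriction hy c₁ c₂ c₃ ρ (resOp hy c₁ c₂ c₃ ρ) := by
  refine ⟨fun T hT => exists_eq_rTensor_subtype ρ hy hk hN hx₀ hT, fun g => ⟨extInv k m l₁ l₂ x₀ ρ g,
    isInvMod_of_invariant ρ fun w => diagPer_extInv ρ w g, lTensor_resPlane_extInv ρ hy hk hN hx₀ g⟩,
    fun T hT h => toRegU_mem_IpU.2 (lTensor_resStratum_eq_zero ρ hy hk hN hx₀ hT h), ?_⟩
  intro p hp T T' hT hT'
  rw [← toRegU_polyPer] at hT'
  rw [toRegU_injective x₀ U hT']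
  exact ⟨isInvMod_polyPer ρ c₁ c₂ c₃ hx₀ hk hN hc hp hT, fun g hg =>
    lTensor_resPlane_polyPer ρ hy c₁ c₂ c₃ hx₀ hk hN hc hp hT hg⟩

theorem commute_resOp (hx₀ : IsGeneric N k m l₁ l₂ x₀) (hk : 1 ≤ k)
    (hN : m * k + l₁ + l₂ ≤ N) (hc : ParamCond k l₁ l₂ c₁ c₂ c₃) {p q : MvPolynomial (Fin N) ℂ}
    (hp : IsInvPoly p) (hq : IsInvPoly q) :
    Commute (resOp hy c₁ c₂ c₃ ρ p) (resOp hy c₁ c₂ c₃ ρ q) := by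
  have key : ∀ {p q : MvPolynomial (Fin N) ℂ}, IsInvPoly p → IsInvPoly q → ∀ g,
      rTensor _ (fixedU k m l₁ l₂ ρ).subtype
        (resOp hy c₁ c₂ c₃ ρ p (resOp hy c₁ c₂ c₃ ρ q g)) =
      lTensor U (resPlane hy) (lTensor U
        (polyPer x₀ c₁ c₂ c₃ p ∘ₗ polyPer x₀ c₁ c₂ c₃ q) (extInv k m l₁ l₂ x₀ ρ g)) := by
    intro p q hp hq g
    rw [LinearMap.lTensor_comp, LinearMap.comp_apply]
    exact (lTensor_resPlane_polyPer ρ hy c₁ c₂ c₃ hx₀ hk hN hc hp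
      (isInvMod_polyPer ρ c₁ c₂ c₃ hx₀ hk hN hc hq
        (isInvMod_of_invariant ρ fun w => diagPer_extInv ρ w g))
      (rTensor_resOp ρ hy c₁ c₂ c₃ hx₀ hk hN hc hq g).symm).symm
  refine LinearMap.ext fun g => ?_
  rw [Module.End.mul_apply, Module.End.mul_apply]
  refine Function.LeftInverse.injective (rTensor_fixedProj ρ) ?_
  rw [key hp hq, key hq hp, polyPer_comm]

end VectorValued

section HalfArgument

variable {N k m l₁ l₂ d : ℕ}

theorem analyticAt_halfArg (q : (Fin d → ℂ) × ZMod 2) (y : Fin d → ℂ) :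
    AnalyticAt ℂ (halfArg q) y := by
  unfold halfArg
  refine AnalyticAt.div ?_ analyticAt_const two_ne_zero
  refine AnalyticAt.add ?_ analyticAt_const
  apply Finset.analyticAt_fun_sum
  intro j _
  exact analyticAt_const.mul ((ContinuousLinearMap.proj (R := ℂ) j).analyticAt y)

theorem aF_two_mul {z : ℂ} (hz : sinh z ≠ 0) :
    aF (2 * z) = (sinh z + cosh z) / (2 * sinh z) := by
  have h1 : exp z * (1 - exp (-(2 * z))) = 2 * sinh z := by
    rw [mul_sub, ← Complex.exp_add, sinh]
    ring_nf
  have h2 : 1 - exp (-(2 * z)) ≠ 0 := by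
    intro h
    rw [h, mul_zero] at h1
    exact hz (by linear_combination -h1 / 2)
  rw [aF, Complex.sinh_add_cosh, ← h1]
  field_simp [Complex.exp_ne_zero z]

theorem aF_add_int (t : ℂ) (n : ℤ) : aF (t + n * (2 * Real.pi * Complex.I)) = aF t := by
  rw [aF, aF, neg_add, Complex.exp_add, Complex.exp_neg (n * _),
    Complex.exp_int_mul_two_pi_mul_I, inv_one, mul_one]

theorem two_mul_aF_sub_one {z : ℂ} (hz : sinh z ≠ 0) :
    2 * aF (2 * z) - 1 = cosh z / sinh z := by
  rw [aF_two_mul hz]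
  field_simp
  ring

theorem aF_sub_sq {z : ℂ} (hz : sinh z ≠ 0) :
    aF (2 * z) - aF (2 * z) ^ 2 = -(1 / (4 * sinh z ^ 2)) := by
  rw [aF_two_mul hz]
  have := Complex.cosh_sq z
  field_simp
  linear_combination -4 * this

theorem sinh_eq_zero_iff {z : ℂ} : sinh z = 0 ↔ exp (2 * z) = 1 := by
  have h1 : exp (-z) * (exp (2 * z) - 1) = 2 * sinh z := by
    rw [mul_sub, ← Complex.exp_add, sinh]
    ring_nf
  constructor
  · intro h
    rw [h, mul_zero] at h1
    exact sub_eq_zero.1 ((mul_eq_zero.1 h1).resolve_left (Complex.exp_ne_zero _))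
  · intro h
    rw [h, sub_self, mul_zero] at h1
    linear_combination -h1 / 2

/-- The sum of the coordinates of `α` in which `π^a` is shifted. -/
def shiftSum (N l₁ l₂ : ℕ) (α : Fin N → ℤ) : ℤ := ∑ i, if InShift N l₁ l₂ i then α i else 0

theorem pairing_chart (α : Fin N → ℤ) (y : Fin (dimPlane N k m l₁ l₂) → ℂ) :
    pairing α (chart N k m l₁ l₂ y) = ∑ j, (hatPair N k m l₁ l₂ α).1 j * y j +
      (shiftSum N l₁ l₂ α : ℂ) * (Real.pi * Complex.I) := by
  simp only [pairing, chart, mul_add, sum_add_distrib, shiftSum, hatPair]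
  congr 1
  · simp only [mul_sum, sum_mul]
    rw [sum_comm]
    exact sum_congr rfl fun j _ => sum_congr rfl fun i _ => by ring
  · push_cast
    rw [sum_mul]
    refine sum_congr rfl fun i _ => ?_
    split_ifs <;> simp

theorem exists_two_mul_halfArg (α : Fin N → ℤ) : ∃ n : ℤ,
    ∀ y : Fin (dimPlane N k m l₁ l₂) → ℂ, pairing α (chart N k m l₁ l₂ y) =
      2 * halfArg (hatPair N k m l₁ l₂ α) y + n * (2 * Real.pi * Complex.I) := by
  refine ⟨shiftSum N l₁ l₂ α / 2, fun y => ?_⟩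
  have h1 : ((((shiftSum N l₁ l₂ α : ℤ) : ZMod 2).val : ℤ) : ℤ) = shiftSum N l₁ l₂ α % 2 :=
    ZMod.val_intCast (shiftSum N l₁ l₂ α)
  have h2 : ((shiftSum N l₁ l₂ α : ℤ) : ℂ) = ((((shiftSum N l₁ l₂ α : ℤ) : ZMod 2).val : ℤ) : ℂ) +
      2 * ((shiftSum N l₁ l₂ α / 2 : ℤ) : ℂ) := by
    rw [h1]
    exact_mod_cast (Int.emod_add_mul_ediv (shiftSum N l₁ l₂ α) 2).symm
  rw [pairing_chart, halfArg]
  have h3 : (hatPair N k m l₁ l₂ α).2 = ((shiftSum N l₁ l₂ α : ℤ) : ZMod 2) := rfl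
  rw [h3]
  generalize ((shiftSum N l₁ l₂ α : ℤ) : ZMod 2).val = v at *
  rw [h2]
  push_cast
  ring

theorem aF_pairing_chart (α : Fin N → ℤ) (y : Fin (dimPlane N k m l₁ l₂) → ℂ) :
    aF (pairing α (chart N k m l₁ l₂ y)) = aF (2 * halfArg (hatPair N k m l₁ l₂ α) y) := by
  obtain ⟨n, hn⟩ := exists_two_mul_halfArg (k := k) (m := m) (l₁ := l₁) (l₂ := l₂) α
  rw [hn, aF_add_int]

theorem sinh_halfArg_eq_zero_iff (α : Fin N → ℤ) (y : Fin (dimPlane N k m l₁ l₂) → ℂ) :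
    sinh (halfArg (hatPair N k m l₁ l₂ α) y) = 0 ↔
      exp (pairing α (chart N k m l₁ l₂ y)) = 1 := by
  obtain ⟨n, hn⟩ := exists_two_mul_halfArg (k := k) (m := m) (l₁ := l₁) (l₂ := l₂) α
  rw [sinh_eq_zero_iff, hn, Complex.exp_add, Complex.exp_int_mul_two_pi_mul_I, mul_one]

theorem projL_toV (α : Fin N → ℤ) : projL N k m l₁ l₂ (toV α) = (hatPair N k m l₁ l₂ α).1 := rfl

variable {x₀ : Fin N → ℂ}

theorem hatPair_eq_zero_iff (hk : 1 ≤ k) (hN : m * k + l₁ + l₂ ≤ N)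
    (hx₀ : IsGeneric N k m l₁ l₂ x₀) {α : Fin N → ℤ} (hα : α ∈ posRoots N) :
    hatPair N k m l₁ l₂ α = 0 ↔ exp (pairing α x₀) = 1 := by
  have hy := chart_proj hk hN hx₀.1
  have h3 : (hatPair N k m l₁ l₂ α).2 = ((shiftSum N l₁ l₂ α : ℤ) : ZMod 2) := rfl
  have h4 : ((shiftSum N l₁ l₂ α : ℤ) : ZMod 2) = 0 ↔ Even (shiftSum N l₁ l₂ α) :=
    ZMod.intCast_eq_zero_iff_even
  constructor
  · intro h
    have h1 := congrArg Prod.snd h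
    rw [h3] at h1
    rw [← hy, pairing_chart, h]
    simp only [Prod.fst_zero, Pi.zero_apply, zero_mul, sum_const_zero, zero_add]
    exact exp_even_pi (h4.1 h1)
  · intro h
    have h1 := projL_toV_eq_zero hk hN hx₀ hα h
    rw [projL_toV] at h1
    refine Prod.ext h1 ?_
    rw [h3]
    rw [← hy, pairing_chart, h1] at h
    simp only [Pi.zero_apply, zero_mul, sum_const_zero] at h
    exact h4.2 (exp_int_add_eq_one (n := 0) (by rwa [Int.cast_zero])).2

theorem sinh_halfArg_ne_zero (hk : 1 ≤ k) (hN : m * k + l₁ + l₂ ≤ N)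
    (hx₀ : IsGeneric N k m l₁ l₂ x₀) {q : (Fin (dimPlane N k m l₁ l₂) → ℂ) × ZMod 2}
    (hq : q ∈ hatPairs N k m l₁ l₂) :
    ∀ᶠ y in 𝓝 (proj N k m l₁ l₂ x₀), sinh (halfArg q y) ≠ 0 := by
  classical
  unfold hatPairs at hq
  obtain ⟨h0, h1⟩ := mem_erase.1 hq
  obtain ⟨α, hα, rfl⟩ := mem_image.1 h1
  have hc : ContinuousAt (fun y => sinh (halfArg (hatPair N k m l₁ l₂ α) y))
      (proj N k m l₁ l₂ x₀) :=
    (Complex.continuous_sinh.continuousAt).comp (analyticAt_halfArg _ _).continuousAt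
  refine hc.eventually_ne ?_
  rw [Ne, sinh_halfArg_eq_zero_iff, chart_proj hk hN hx₀.1, ← hatPair_eq_zero_iff hk hN hx₀ hα]
  exact h0

theorem ev_csch_sq {q : (Fin d → ℂ) × ZMod 2} {y₀ : Fin d → ℂ}
    (h : ∀ᶠ y in 𝓝 y₀, sinh (halfArg q y) ≠ 0) :
    ∀ᶠ y in 𝓝 y₀, AnalyticAt ℂ (fun y => 1 / (4 * sinh (halfArg q y) ^ 2)) y := by
  filter_upwards [h] with y hy
  refine analyticAt_const.div (analyticAt_const.mul
    ((AnalyticAt.comp (g := sinh) ?_ (analyticAt_halfArg q y)).pow 2)) (by simp [hy])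
  exact Complex.analyticAt_sinh

theorem ev_coth {q : (Fin d → ℂ) × ZMod 2} {y₀ : Fin d → ℂ}
    (h : ∀ᶠ y in 𝓝 y₀, sinh (halfArg q y) ≠ 0) :
    ∀ᶠ y in 𝓝 y₀, AnalyticAt ℂ
      (fun y => cosh (halfArg q y) / sinh (halfArg q y)) y := by
  filter_upwards [h] with y hy
  refine AnalyticAt.div (AnalyticAt.comp (g := cosh) ?_ (analyticAt_halfArg q y))
    (AnalyticAt.comp (g := sinh) ?_ (analyticAt_halfArg q y)) hy
  · exact Complex.analyticAt_cosh
  · exact Complex.analyticAt_sinh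

theorem mulOp_eq {n : ℕ} {l : Filter (Fin n → ℂ)} {φ : (Fin n → ℂ) → ℂ}
    (hφ : ∀ᶠ y in l, AnalyticAt ℂ φ y) : mulOp l φ = mulAn φ hφ := dif_pos hφ

end HalfArgument

section RadialPart

variable {N k m l₁ l₂ : ℕ} {x₀ : Fin N → ℂ}

theorem fderiv_comp_proj {f : (Fin N → ℂ) → ℂ} {h : (Fin (dimPlane N k m l₁ l₂) → ℂ) → ℂ}
    (hh : ∀ᶠ y in 𝓝 (proj N k m l₁ l₂ x₀), AnalyticAt ℂ h y)
    (e : f =ᶠ[𝓝 x₀] fun x => h (proj N k m l₁ l₂ x)) (ξ : Fin N → ℂ) :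
    (fun x => fderiv ℂ f x ξ) =ᶠ[𝓝 x₀]
      fun x => fderiv ℂ h (proj N k m l₁ l₂ x) (projL N k m l₁ l₂ ξ) := by
  filter_upwards [e.fderiv (𝕜 := ℂ), (analyticAt_proj x₀).continuousAt.eventually hh] with x h1 h2
  have h3 : HasFDerivAt (fun x => h (proj N k m l₁ l₂ x)) _ x :=
    HasFDerivAt.comp x (g := h) h2.differentiableAt.hasFDerivAt (hasFDerivAt_proj x)
  rw [h1, h3.fderiv]
  rfl

theorem fderiv_fderiv_apply {n : ℕ} {h : (Fin n → ℂ) → ℂ} {y : Fin n → ℂ} (hh : AnalyticAt ℂ h y)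
    (ξ η : Fin n → ℂ) :
    fderiv ℂ (fun z => fderiv ℂ h z ξ) y η = fderiv ℂ (fderiv ℂ h) y η ξ := by
  have h1 : HasFDerivAt (fun z => fderiv ℂ h z ξ)
      ((ContinuousLinearMap.apply ℂ ℂ ξ).comp (fderiv ℂ (fderiv ℂ h) y)) y :=
    HasFDerivAt.comp y (ContinuousLinearMap.apply ℂ ℂ ξ).hasFDerivAt
      hh.fderiv.differentiableAt.hasFDerivAt
  rw [h1.fderiv]
  rfl

theorem projL_bV (i : Fin N) : projL N k m l₁ l₂ (bV i) =
    ∑ j, basisVec N k m l₁ l₂ j i • (Pi.single j 1 : Fin (dimPlane N k m l₁ l₂) → ℂ) := by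
  funext j
  rw [projL_apply, Finset.sum_apply, sum_eq_single i, sum_eq_single j]
  · simp [bV]
  · intro j' _ h
    simp [h.symm]
  · simp
  · intro i' _ h
    simp [bV, h]
  · simp

theorem sum_fderiv_projL (hk : 1 ≤ k) (hN : m * k + l₁ + l₂ ≤ N)
    {h : (Fin (dimPlane N k m l₁ l₂) → ℂ) → ℂ} {y : Fin (dimPlane N k m l₁ l₂) → ℂ}
    (hh : AnalyticAt ℂ h y) :
    ∑ i, fderiv ℂ (fun z => fderiv ℂ h z (projL N k m l₁ l₂ (bV i))) y
      (projL N k m l₁ l₂ (bV i)) =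
    ∑ j, fderiv ℂ (fun z => fderiv ℂ h z (Pi.single j 1)) y (Pi.single j 1) := by
  rw [sum_congr rfl fun i _ => fderiv_fderiv_apply hh _ _,
    sum_congr rfl fun j _ => fderiv_fderiv_apply hh _ _]
  simp only [projL_bV, map_sum, map_smul, sum_apply, smul_apply, smul_eq_mul, mul_sum]
  rw [sum_comm]
  refine sum_congr rfl fun j _ => ?_
  rw [sum_comm, sum_eq_single j]
  · simp only [← mul_assoc]
    rw [← sum_mul, basisVec_orthonormal hk hN, if_pos rfl, one_mul]
  · intro j' _ hj
    simp only [← mul_assoc]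
    rw [← sum_mul, basisVec_orthonormal hk hN]
    simp [hj.symm]
  · simp

variable (c₁ c₂ c₃ : ℂ)

/-- The radial part of the sum of the squares of the Dunkl operators on functions. -/
def radialFun (c₁ c₂ c₃ : ℂ) (h : (Fin (dimPlane N k m l₁ l₂) → ℂ) → ℂ)
    (ha : {α : posRoots N // hatPair N k m l₁ l₂ α.1 ≠ 0} →
      (Fin (dimPlane N k m l₁ l₂) → ℂ) → ℂ) (t : (Fin N → ℤ) → ℂ)
    (y : Fin (dimPlane N k m l₁ l₂) → ℂ) : ℂ :=
  ∑ j, fderiv ℂ (fun z => fderiv ℂ h z (Pi.single j 1)) y (Pi.single j 1) -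
    ∑ α : {α : posRoots N // hatPair N k m l₁ l₂ α.1 ≠ 0}, mult c₁ c₂ c₃ α.1.1 *
      ((normSq α.1.1 : ℂ) * (t α.1.1 - t α.1.1 ^ 2) * (h y - ha α y) +
      (2 * t α.1.1 - 1) * fderiv ℂ h y (hatPair N k m l₁ l₂ α.1.1).1) +
    (∑ i, weylVec N c₁ c₂ c₃ i ^ 2) * h y

open Classical in
theorem sumSqFun_eq_radialFun (hk : 1 ≤ k) (hN : m * k + l₁ + l₂ ≤ N) {f : (Fin N → ℂ) → ℂ}
    {h : (Fin (dimPlane N k m l₁ l₂) → ℂ) → ℂ}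
    {ha : posRoots N → (Fin (dimPlane N k m l₁ l₂) → ℂ) → ℂ}
    (hh : ∀ᶠ y in 𝓝 (proj N k m l₁ l₂ x₀), AnalyticAt ℂ h y)
    (e : f =ᶠ[𝓝 x₀] fun x => h (proj N k m l₁ l₂ x))
    (e' : ∀ α : posRoots N, (fun x => f (refl α.1 x)) =ᶠ[𝓝 x₀]
      fun x => ha α (proj N k m l₁ l₂ x))
    (h0 : ∀ α : posRoots N, hatPair N k m l₁ l₂ α.1 = 0 →
      ∀ᶠ y in 𝓝 (proj N k m l₁ l₂ x₀), ha α y = h y) :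
    ∀ᶠ x in 𝓝 x₀, sumSqFun c₁ c₂ c₃ f x = radialFun c₁ c₂ c₃ h (fun α => ha α.1)
      (fun α => aF (pairing α x)) (proj N k m l₁ l₂ x) := by
  have h1 : ∀ i : Fin N, ∀ᶠ x in 𝓝 x₀, fderiv ℂ (fun z => fderiv ℂ f z (bV i)) x (bV i) =
      fderiv ℂ (fun z => fderiv ℂ h z (projL N k m l₁ l₂ (bV i))) (proj N k m l₁ l₂ x)
        (projL N k m l₁ l₂ (bV i)) := fun i =>
    fderiv_comp_proj (ev_dirDeriv _ hh) (fderiv_comp_proj hh e (bV i)) (bV i)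
  have h2 : ∀ α : posRoots N, ∀ᶠ x in 𝓝 x₀, fderiv ℂ f x (toV α.1) =
      fderiv ℂ h (proj N k m l₁ l₂ x) (hatPair N k m l₁ l₂ α.1).1 := fun α =>
    fderiv_comp_proj hh e (toV α.1)
  have h3 : ∀ α : posRoots N, ∀ᶠ x in 𝓝 x₀, hatPair N k m l₁ l₂ α.1 = 0 →
      ha α (proj N k m l₁ l₂ x) = h (proj N k m l₁ l₂ x) := fun α => by
    by_cases hα : hatPair N k m l₁ l₂ α.1 = 0
    · filter_upwards [(analyticAt_proj x₀).continuousAt.eventually (h0 α hα)] with x hx _ using hx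
    · exact Eventually.of_forall fun x hx => absurd hx hα
  filter_upwards [eventually_all.2 h1, eventually_all.2 h2, eventually_all.2 h3, e,
    eventually_all.2 e', (analyticAt_proj x₀).continuousAt.eventually hh] with x g1 g2 g3 g4 g5 g6
  rw [sumSqFun, radialFun, ← sum_fderiv_projL hk hN g6, g4, ← sum_coe_sort (posRoots N)]
  congr 1
  rw [sum_congr rfl fun i _ => g1 i]
  congr 1
  rw [← sum_subtype (s := univ.filter fun α : posRoots N =>
      hatPair N k m l₁ l₂ α.1 ≠ 0) (by simp) fun α : posRoots N => mult c₁ c₂ c₃ α.1 *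
      ((normSq α.1 : ℂ) * (aF (pairing α.1 x) - aF (pairing α.1 x) ^ 2) *
        (h (proj N k m l₁ l₂ x) - ha α (proj N k m l₁ l₂ x)) +
      (2 * aF (pairing α.1 x) - 1) * fderiv ℂ h (proj N k m l₁ l₂ x)
        (hatPair N k m l₁ l₂ α.1).1), sum_filter]
  refine sum_congr rfl fun α _ => ?_
  rw [g5, g2]
  split_ifs with hα
  · rfl
  · rw [not_not] at hα
    rw [g3 α hα, hα]
    simp

theorem radialFun_analyticAt (hk : 1 ≤ k) (hN : m * k + l₁ + l₂ ≤ N)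
    (hx₀ : IsGeneric N k m l₁ l₂ x₀) {h : (Fin (dimPlane N k m l₁ l₂) → ℂ) → ℂ}
    {ha : posRoots N → (Fin (dimPlane N k m l₁ l₂) → ℂ) → ℂ}
    (hh : AnalyticAt ℂ h (proj N k m l₁ l₂ x₀))
    (hha : ∀ α, AnalyticAt ℂ (ha α) (proj N k m l₁ l₂ x₀)) :
    AnalyticAt ℂ (fun x => radialFun c₁ c₂ c₃ h (fun α => ha α.1)
      (fun α => aF (pairing α x)) (proj N k m l₁ l₂ x)) x₀ := by
  have hc : ∀ {g : (Fin (dimPlane N k m l₁ l₂) → ℂ) → ℂ}, AnalyticAt ℂ g (proj N k m l₁ l₂ x₀) →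
      AnalyticAt ℂ (fun x => g (proj N k m l₁ l₂ x)) x₀ := fun hg =>
    AnalyticAt.comp hg (analyticAt_proj x₀)
  unfold radialFun
  refine ((Finset.analyticAt_fun_sum _ fun j _ => hc (AnalyticAt.dirDeriv
    (AnalyticAt.dirDeriv hh _) _)).sub (Finset.analyticAt_fun_sum _ fun α _ => ?_)).add
    (analyticAt_const.mul (hc hh))
  have ht : AnalyticAt ℂ (fun x => aF (pairing α.1.1 x)) x₀ := by
    refine analyticAt_const.div (analyticAt_const.sub (analyticAt_pairing α.1.1 x₀).neg.cexp) ?_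
    rw [sub_ne_zero]
    intro h
    exact α.2 ((hatPair_eq_zero_iff hk hN hx₀ α.1.2).2 (exp_neg_eq_one_iff.1 h.symm))
  exact analyticAt_const.mul (((analyticAt_const.mul (ht.sub (ht.pow 2))).mul
    ((hc hh).sub (hc (hha α.1)))).add (((analyticAt_const.mul ht).sub analyticAt_const).mul
    (hc (AnalyticAt.dirDeriv hh _))))

/-- The restriction to `π^a` of the sum of the squares of the Dunkl operators. -/
theorem resPlane_polyPer_sum_sq (hy : chart N k m l₁ l₂ (proj N k m l₁ l₂ x₀) = x₀) (hk : 1 ≤ k)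
    (hN : m * k + l₁ + l₂ ≤ N) (hx₀ : IsGeneric N k m l₁ l₂ x₀) {f : (Fin N → ℂ) → ℂ}
    {hf : ∀ x ∈ orbit x₀, AnalyticAt ℂ f x} {hp : IsPeriodicNear x₀ f}
    {h : (Fin (dimPlane N k m l₁ l₂) → ℂ) → ℂ}
    {ha : posRoots N → (Fin (dimPlane N k m l₁ l₂) → ℂ) → ℂ}
    (hh : ∀ᶠ y in 𝓝 (proj N k m l₁ l₂ x₀), AnalyticAt ℂ h y)
    (hha : ∀ α, ∀ᶠ y in 𝓝 (proj N k m l₁ l₂ x₀), AnalyticAt ℂ (ha α) y)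
    (e : germAt x₀ (PerGerm.mk f hf hp) = pullProj N k m l₁ l₂ x₀ (AnGerm.mk h hh))
    (e' : ∀ α : posRoots N, germAt x₀ (perAct x₀ (sRefl α) (PerGerm.mk f hf hp)) =
      pullProj N k m l₁ l₂ x₀ (AnGerm.mk (ha α) (hha α)))
    (h0 : ∀ α : posRoots N, hatPair N k m l₁ l₂ α.1 = 0 →
      AnGerm.mk (ha α) (hha α) = AnGerm.mk h hh) :
    resPlane hy (polyPer x₀ c₁ c₂ c₃ (∑ i, MvPolynomial.X i ^ 2) (PerGerm.mk f hf hp)) =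
      laplacian (proj N k m l₁ l₂ x₀) (AnGerm.mk h hh) -
        ∑ α : {α : posRoots N // hatPair N k m l₁ l₂ α.1 ≠ 0}, mult c₁ c₂ c₃ α.1.1 •
          (mulOp _ (fun y => cosh (halfArg (hatPair N k m l₁ l₂ α.1.1) y) /
            sinh (halfArg (hatPair N k m l₁ l₂ α.1.1) y))
            (dirDeriv (openBased_nhds _) (hatPair N k m l₁ l₂ α.1.1).1 (AnGerm.mk h hh)) -
          (normSq α.1.1 : ℂ) • mulOp _ (fun y => 1 / (4 * sinh
            (halfArg (hatPair N k m l₁ l₂ α.1.1) y) ^ 2))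
            (AnGerm.mk h hh - AnGerm.mk (ha α.1) (hha α.1))) +
        (∑ i, weylVec N c₁ c₂ c₃ i ^ 2) • AnGerm.mk h hh := by
  classical
  have hs : ∀ α : {α : posRoots N // hatPair N k m l₁ l₂ α.1 ≠ 0},
      ∀ᶠ y in 𝓝 (proj N k m l₁ l₂ x₀),
        sinh (halfArg (hatPair N k m l₁ l₂ α.1.1) y) ≠ 0 := fun α =>
    sinh_halfArg_ne_zero hk hN hx₀ (mem_erase.2
      ⟨α.2, mem_image_of_mem _ α.1.2⟩)
  set G := polyPer x₀ c₁ c₂ c₃ (∑ i, MvPolynomial.X i ^ 2) (PerGerm.mk f hf hp) with hG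
  obtain ⟨g, hg, hgp, hGg⟩ := PerGerm.exists_mk G
  have h1 : toReg x₀ G = (∑ i, dunkl x₀ c₁ c₂ c₃ i ^ 2) (toReg x₀ (PerGerm.mk f hf hp)) := by
    rw [hG, toReg_polyPer, polyDunkl_sum_sq]
  rw [hGg, toReg_mk, toReg_mk] at h1
  have h2 := (sum_dunkl_sq_mk h1.symm).filter_mono (nhds_inf_le_nearReg (mem_orbit_self x₀))
  rw [germAt_mk, pullProj_mk, AnGerm.mk_eq_mk] at e
  have e'' : ∀ α : posRoots N, (fun x => f (refl α.1 x)) =ᶠ[𝓝 x₀]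
      fun x => ha α (proj N k m l₁ l₂ x) := fun α => by
    have := e' α
    rw [perAct_mk, germAt_mk, pullProj_mk, AnGerm.mk_eq_mk, sRefl_inv] at this
    exact this
  have h3 := sumSqFun_eq_radialFun c₁ c₂ c₃ hk hN hh e e''
    fun α hα => AnGerm.mk_eq_mk.1 (h0 α hα)
  have h4 := radialFun_analyticAt c₁ c₂ c₃ hk hN hx₀ hh.self_of_nhds
    fun α => (hha α).self_of_nhds
  have h5 : g =ᶠ[𝓝 x₀] fun x => radialFun c₁ c₂ c₃ h (fun α => ha α.1)
      (fun α => aF (pairing α x)) (proj N k m l₁ l₂ x) := by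
    refine eventuallyEq_of_eventuallyEq_reg (hg x₀ (mem_orbit_self x₀)) h4 ?_
    filter_upwards [h2, h3.filter_mono inf_le_left] with x g1 g2
    rw [g1, g2]
  have h6 : ∀ α : {α : posRoots N // hatPair N k m l₁ l₂ α.1 ≠ 0},
      ∀ᶠ y in 𝓝 (proj N k m l₁ l₂ x₀), AnalyticAt ℂ _ y := fun α =>
    ev_const_mul (mult c₁ c₂ c₃ α.1.1) (ev_sub (ev_mul (ev_coth (hs α))
      (ev_dirDeriv (hatPair N k m l₁ l₂ α.1.1).1 hh))
      (ev_const_mul (normSq α.1.1 : ℂ) (ev_mul (ev_csch_sq (hs α)) (ev_sub hh (hha α.1)))))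
  have h7 : ∀ j, ∀ᶠ y in 𝓝 (proj N k m l₁ l₂ x₀), AnalyticAt ℂ _ y := fun j =>
    ev_dirDeriv (Pi.single j 1) (ev_dirDeriv (Pi.single j 1) hh)
  have e1 : laplacian (proj N k m l₁ l₂ x₀) (AnGerm.mk h hh) =
      AnGerm.mk _ (analyticAt_sum_eventually univ _ h7) := by
    rw [← AnGerm.mk_sum _ _ h7, laplacian, LinearMap.sum_apply]
    rfl
  have e2 : ∑ α : {α : posRoots N // hatPair N k m l₁ l₂ α.1 ≠ 0}, mult c₁ c₂ c₃ α.1.1 •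
          (mulOp _ (fun y => cosh (halfArg (hatPair N k m l₁ l₂ α.1.1) y) /
            sinh (halfArg (hatPair N k m l₁ l₂ α.1.1) y))
            (dirDeriv (openBased_nhds _) (hatPair N k m l₁ l₂ α.1.1).1 (AnGerm.mk h hh)) -
          (normSq α.1.1 : ℂ) • mulOp _ (fun y => 1 / (4 * sinh
            (halfArg (hatPair N k m l₁ l₂ α.1.1) y) ^ 2))
            (AnGerm.mk h hh - AnGerm.mk (ha α.1) (hha α.1))) =
      AnGerm.mk _ (analyticAt_sum_eventually univ _ h6) := by
    rw [← AnGerm.mk_sum _ _ h6]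
    refine sum_congr rfl fun α _ => ?_
    rw [mulOp_eq (ev_coth (hs α)), mulOp_eq (ev_csch_sq (hs α))]
    rfl
  rw [e1, e2, hGg, resPlane_mk, AnGerm.mk_smul, AnGerm.mk_sub, AnGerm.mk_add, AnGerm.mk_eq_mk]
  filter_upwards [(tendsto_chart_base hy).eventually h5, eventually_all.2 hs] with y g1 g2
  rw [g1, proj_chart hk hN, radialFun]
  congr 2
  refine sum_congr rfl fun α _ => ?_
  rw [aF_pairing_chart, two_mul_aF_sub_one (g2 α), aF_sub_sq (g2 α)]
  ring

end RadialPart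

section SumOfSquares

variable {N k m l₁ l₂ : ℕ} {x₀ : Fin N → ℂ} {U : Type*} [AddCommGroup U] [Module ℂ U]
  (ρ : Representation ℂ (W N)ᵐᵒᵖ U)

theorem isInvPoly_sum_sq : IsInvPoly (∑ i : Fin N, MvPolynomial.X i ^ 2 : MvPolynomial (Fin N) ℂ) := by
  rintro w ⟨σ, ε, h⟩ x
  simp only [map_sum, map_pow, MvPolynomial.eval_X, h]
  refine Fintype.sum_equiv σ _ _ fun i => ?_
  rcases Int.units_eq_one_or (ε i) with h1 | h1 <;> simp [h1]

theorem perAct_sRefl_contr_extInv (φ : U →ₗ[ℂ] ℂ) (α : posRoots N)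
    (g : fixedU k m l₁ l₂ ρ ⊗[ℂ] AnGerm (𝓝 (proj N k m l₁ l₂ x₀))) :
    perAct x₀ (sRefl α) (contr φ (extInv k m l₁ l₂ x₀ ρ g)) =
      contr (φ ∘ₗ ρ (MulOpposite.op (sRefl α))) (extInv k m l₁ l₂ x₀ ρ g) := by
  conv_rhs => rw [← diagPer_extInv ρ (sRefl α) g, diagPer, contr_map, LinearMap.comp_assoc]
  have h3 : ρ (MulOpposite.op (sRefl α)) ∘ₗ ρ (MulOpposite.op (sRefl α)⁻¹) = LinearMap.id :=
    LinearMap.ext (ρ_inv_apply ρ (sRefl α))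
  rw [h3]
  rfl

/-- The matrices `∑ c_γ (γ, γ) (P_γ - 1)`, the sums being over the fibres of `hatPair`. -/
def reflPart {N : ℕ} (k m l₁ l₂ : ℕ) (c₁ c₂ c₃ : ℂ) (ρ : Representation ℂ (W N)ᵐᵒᵖ U)
    (q : (Fin (dimPlane N k m l₁ l₂) → ℂ) × ZMod 2) : Module.End ℂ U :=
  cHatPHat k m l₁ l₂ c₁ c₂ c₃ ρ q - (hatNormSq q * cHat N k m l₁ l₂ c₁ c₂ c₃ q) • 1

open Classical in
theorem reflPart_eq (c₁ c₂ c₃ : ℂ) (q : (Fin (dimPlane N k m l₁ l₂) → ℂ) × ZMod 2) :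
    reflPart k m l₁ l₂ c₁ c₂ c₃ ρ q =
      ∑ γ ∈ univ.filter (fun γ : posRoots N => hatPair N k m l₁ l₂ γ.1 = q),
        (mult c₁ c₂ c₃ γ.1 * (normSq γ.1 : ℂ)) • (ρ (MulOpposite.op (sRefl γ)) - 1) :=
  add_sub_cancel_left _ _

open Classical in
theorem sum_hatPair_ne_zero {A : Type*} [AddCommGroup A] (Y : posRoots N → A) :
    ∑ α : {α : posRoots N // hatPair N k m l₁ l₂ α.1 ≠ 0}, Y α.1 =
      ∑ q ∈ hatPairs N k m l₁ l₂,
        ∑ γ ∈ univ.filter (fun γ : posRoots N => hatPair N k m l₁ l₂ γ.1 = q), Y γ := by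
  rw [← sum_subtype (s := univ.filter fun α : posRoots N =>
      hatPair N k m l₁ l₂ α.1 ≠ 0) (by simp) Y,
    ← sum_fiberwise_of_maps_to (t := hatPairs N k m l₁ l₂)
      (g := fun α : posRoots N => hatPair N k m l₁ l₂ α.1)]
  · refine sum_congr rfl fun q hq => sum_congr ?_ fun _ _ => rfl
    ext γ
    simp only [mem_filter, mem_univ, true_and]
    refine ⟨fun h => h.2, fun h => ⟨?_, h⟩⟩
    rw [h]
    exact (mem_erase.1 hq).1
  · intro α hα
    exact mem_erase.2 ⟨(mem_filter.1 hα).2, mem_image_of_mem _ α.2⟩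

open Classical in
theorem cHat_eq (c₁ c₂ c₃ : ℂ) (q : (Fin (dimPlane N k m l₁ l₂) → ℂ) × ZMod 2) :
    cHat N k m l₁ l₂ c₁ c₂ c₃ q =
      ∑ γ ∈ univ.filter (fun γ : posRoots N => hatPair N k m l₁ l₂ γ.1 = q),
        mult c₁ c₂ c₃ γ.1 := by
  rw [cHat, sum_filter, sum_filter, ← sum_coe_sort (posRoots N)]

/-- The scalar part of the restriction of `∑ ∇_i ^ 2`. -/
def radialOp (N k m l₁ l₂ : ℕ) (c₁ c₂ c₃ : ℂ) (y₀ : Fin (dimPlane N k m l₁ l₂) → ℂ) :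
    Module.End ℂ (AnGerm (𝓝 y₀)) :=
  laplacian y₀ - ∑ q ∈ hatPairs N k m l₁ l₂, cHat N k m l₁ l₂ c₁ c₂ c₃ q •
    (mulOp _ (fun y => cosh (halfArg q y) / sinh (halfArg q y)) *
      dirDeriv (openBased_nhds y₀) q.1)

theorem contr_resOp_sum_sq_roots (hy : chart N k m l₁ l₂ (proj N k m l₁ l₂ x₀) = x₀) (c₁ c₂ c₃ : ℂ)
    (hx₀ : IsGeneric N k m l₁ l₂ x₀) (hk : 1 ≤ k) (hN : m * k + l₁ + l₂ ≤ N)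
    (hc : ParamCond k l₁ l₂ c₁ c₂ c₃) (φ : U →ₗ[ℂ] ℂ)
    (g : fixedU k m l₁ l₂ ρ ⊗[ℂ] AnGerm (𝓝 (proj N k m l₁ l₂ x₀)))
    {T : U ⊗[ℂ] AnGerm (𝓝 (proj N k m l₁ l₂ x₀))}
    (hT : rTensor _ (fixedU k m l₁ l₂ ρ).subtype g = T) :
    contr φ (rTensor _ (fixedU k m l₁ l₂ ρ).subtype
      (resOp hy c₁ c₂ c₃ ρ (∑ i, MvPolynomial.X i ^ 2) g)) =
      laplacian (proj N k m l₁ l₂ x₀) (contr φ T) -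
        ∑ α : {α : posRoots N // hatPair N k m l₁ l₂ α.1 ≠ 0}, mult c₁ c₂ c₃ α.1.1 •
          (mulOp _ (fun y => cosh (halfArg (hatPair N k m l₁ l₂ α.1.1) y) /
            sinh (halfArg (hatPair N k m l₁ l₂ α.1.1) y))
            (dirDeriv (openBased_nhds _) (hatPair N k m l₁ l₂ α.1.1).1 (contr φ T)) -
          (normSq α.1.1 : ℂ) • mulOp _ (fun y => 1 / (4 * sinh
            (halfArg (hatPair N k m l₁ l₂ α.1.1) y) ^ 2))
            (contr φ T - contr (φ ∘ₗ ρ (MulOpposite.op (sRefl α.1))) T)) +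
        (∑ i, weylVec N c₁ c₂ c₃ i ^ 2) • contr φ T := by
  rw [rTensor_resOp ρ hy c₁ c₂ c₃ hx₀ hk hN hc isInvPoly_sum_sq, contr_lTensor, contr_lTensor]
  have e := germAt_contr_extInv ρ hk hN hx₀ φ g
  have e' := fun α : posRoots N => (congrArg (germAt x₀)
    (perAct_sRefl_contr_extInv ρ φ α g)).trans (germAt_contr_extInv ρ hk hN hx₀ _ g)
  have h0 : ∀ α : posRoots N, hatPair N k m l₁ l₂ α.1 = 0 →
      contr (φ ∘ₗ ρ (MulOpposite.op (sRefl α))) T = contr φ T := by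
    intro α hα
    rw [← hT, contr_rTensor, contr_rTensor]
    have h1 : (φ ∘ₗ ρ (MulOpposite.op (sRefl α))) ∘ₗ (fixedU k m l₁ l₂ ρ).subtype =
        φ ∘ₗ (fixedU k m l₁ l₂ ρ).subtype := by
      refine LinearMap.ext fun u => ?_
      exact congrArg φ (u.2 α (hx₀.2 α.1 α.2 ((hatPair_eq_zero_iff hk hN hx₀ α.2).1 hα)))
    rw [h1]
  obtain ⟨f, hf, hp, hF⟩ := PerGerm.exists_mk (contr φ (extInv k m l₁ l₂ x₀ ρ g))
  rw [hF] at e e' ⊢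
  rw [hT, ← AnGerm.mk_rep (contr φ T)] at e
  simp only [hT] at e'
  have h := resPlane_polyPer_sum_sq c₁ c₂ c₃ hy hk hN hx₀ (f := f) (hf := hf) (hp := hp)
    (ha := fun α => AnGerm.rep (contr (φ ∘ₗ ρ (MulOpposite.op (sRefl α))) T))
    (AnGerm.rep_analyticAt (contr φ T)) (fun α => AnGerm.rep_analyticAt _) e
    (fun α => by rw [AnGerm.mk_rep]; exact e' α)
    (fun α hα => by rw [AnGerm.mk_rep, AnGerm.mk_rep, h0 α hα])
  simp only [AnGerm.mk_rep] at h
  exact h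

theorem contr_comp_reflPart (c₁ c₂ c₃ : ℂ) (φ : U →ₗ[ℂ] ℂ)
    (q : (Fin (dimPlane N k m l₁ l₂) → ℂ) × ZMod 2) {M : Type*} [AddCommGroup M] [Module ℂ M]
    (T : U ⊗[ℂ] M) :
    contr (φ ∘ₗ reflPart k m l₁ l₂ c₁ c₂ c₃ ρ q) T = open Classical in
      ∑ γ ∈ univ.filter (fun γ : posRoots N => hatPair N k m l₁ l₂ γ.1 = q),
        (mult c₁ c₂ c₃ γ.1 * (normSq γ.1 : ℂ)) •
          (contr (φ ∘ₗ ρ (MulOpposite.op (sRefl γ))) T - contr φ T) := by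
  classical
  have h1 : φ ∘ₗ reflPart k m l₁ l₂ c₁ c₂ c₃ ρ q =
      ∑ γ ∈ univ.filter (fun γ : posRoots N => hatPair N k m l₁ l₂ γ.1 = q),
        (mult c₁ c₂ c₃ γ.1 * (normSq γ.1 : ℂ)) • (φ ∘ₗ ρ (MulOpposite.op (sRefl γ)) - φ) := by
    refine LinearMap.ext fun u => ?_
    rw [reflPart_eq]
    simp [LinearMap.sum_apply]
  rw [h1, contr_sum]
  exact sum_congr rfl fun γ _ => by rw [contr_smul, contr_sub]

theorem contr_resOp_sum_sq (hy : chart N k m l₁ l₂ (proj N k m l₁ l₂ x₀) = x₀) (c₁ c₂ c₃ : ℂ)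
    (hx₀ : IsGeneric N k m l₁ l₂ x₀) (hk : 1 ≤ k) (hN : m * k + l₁ + l₂ ≤ N)
    (hc : ParamCond k l₁ l₂ c₁ c₂ c₃) (φ : U →ₗ[ℂ] ℂ)
    (g : fixedU k m l₁ l₂ ρ ⊗[ℂ] AnGerm (𝓝 (proj N k m l₁ l₂ x₀)))
    {T : U ⊗[ℂ] AnGerm (𝓝 (proj N k m l₁ l₂ x₀))}
    (hT : rTensor _ (fixedU k m l₁ l₂ ρ).subtype g = T) :
    contr φ (rTensor _ (fixedU k m l₁ l₂ ρ).subtype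
      (resOp hy c₁ c₂ c₃ ρ (∑ i, MvPolynomial.X i ^ 2) g)) =
    radialOp N k m l₁ l₂ c₁ c₂ c₃ _ (contr φ T) -
      ∑ q ∈ hatPairs N k m l₁ l₂,
        mulOp _ (fun y => 1 / (4 * sinh (halfArg q y) ^ 2))
          (contr (φ ∘ₗ reflPart k m l₁ l₂ c₁ c₂ c₃ ρ q) T) +
      (∑ i, weylVec N c₁ c₂ c₃ i ^ 2) • contr φ T := by
  classical
  rw [contr_resOp_sum_sq_roots ρ hy c₁ c₂ c₃ hx₀ hk hN hc φ g hT,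
    sum_hatPair_ne_zero (fun α : posRoots N => mult c₁ c₂ c₃ α.1 •
          (mulOp _ (fun y => cosh (halfArg (hatPair N k m l₁ l₂ α.1) y) /
            sinh (halfArg (hatPair N k m l₁ l₂ α.1) y))
            (dirDeriv (openBased_nhds _) (hatPair N k m l₁ l₂ α.1).1 (contr φ T)) -
          (normSq α.1 : ℂ) • mulOp _ (fun y => 1 / (4 * sinh
            (halfArg (hatPair N k m l₁ l₂ α.1) y) ^ 2))
            (contr φ T - contr (φ ∘ₗ ρ (MulOpposite.op (sRefl α))) T)))]
  congr 1
  rw [radialOp, LinearMap.sub_apply, sub_sub, LinearMap.sum_apply, ← sum_add_distrib]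
  congr 1
  refine sum_congr rfl fun q _ => ?_
  rw [contr_comp_reflPart, LinearMap.smul_apply, Module.End.mul_apply, cHat_eq, sum_smul,
    map_sum, ← sum_add_distrib]
  refine sum_congr rfl fun γ hγ => ?_
  obtain rfl := (mem_filter.1 hγ).2
  rw [map_smul, map_sub, map_sub, mul_smul]
  module

end SumOfSquares

section FibreSums

/-- Sums over pairs of functions of classes that form consecutive intervals. -/
theorem sum_lt_of_monotone {n D : ℕ} {t : Fin n → Fin D} (ht : Monotone t) {c : Fin D → ℂ}
    (hc : ∀ a, ∑ i, (if t i = a then 1 else 0) = c a) (F : Fin D → Fin D → ℂ) :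
    (∑ i, ∑ j, if i < j then F (t i) (t j) else 0) =
      ∑ a, c a * (c a - 1) / 2 * F a a + ∑ a, ∑ b, if a < b then c a * c b * F a b else 0 := by
  have h1 : ∀ g : Fin D → ℂ, ∑ i, g (t i) = ∑ a, c a * g a := fun g => by
    simp only [← hc, sum_mul]
    rw [sum_comm]
    refine sum_congr rfl fun i _ => ?_
    simp
  have h2 : ∀ i j, (if i < j then F (t i) (t j) else 0) =
      (if t i < t j then F (t i) (t j) else 0) +
        if i < j then (if t j = t i then F (t i) (t i) else 0) else 0 := fun i j => by
    rcases lt_trichotomy i j with h | h | h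
    · rcases (ht h.le).lt_or_eq with h' | h'
      · simp [h, h', h'.ne']
      · simp [h, h']
    · simp [h]
    · simp [h.not_gt, (ht h.le).not_gt]
  simp only [h2, sum_add_distrib]
  have h3 : ∑ i, ∑ j, (if i < j then (if t j = t i then F (t i) (t i) else 0) else 0) =
      ∑ j, ∑ i, if i < j then (if t j = t i then F (t i) (t i) else 0) else 0 := sum_comm
  have h4 : 2 * ∑ i, ∑ j, (if i < j then (if t j = t i then F (t i) (t i) else 0) else 0) =
      ∑ a, c a * ((c a - 1) * F a a) := by
    rw [two_mul]
    nth_rewrite 2 [h3]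
    rw [← h1 fun a => (c a - 1) * F a a, ← sum_add_distrib]
    refine sum_congr rfl fun i _ => ?_
    have h5 : (c (t i) - 1) * F (t i) (t i) =
        ∑ j, ((if t j = t i then F (t i) (t i) else 0) - if j = i then F (t i) (t i) else 0) := by
      rw [sum_sub_distrib, sum_ite_eq' univ i, if_pos (mem_univ i),
        ← hc, sub_mul, sum_mul, one_mul]
      simp
    rw [h5, ← sum_add_distrib]
    refine sum_congr rfl fun j _ => ?_
    rcases lt_trichotomy i j with h | h | h
    · simp [h, h.not_gt, h.ne']
    · simp [h]
    · by_cases h' : t j = t i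
      · simp [h, h.not_gt, h.ne, h']
      · simp [h, h.not_gt, h.ne, h', Ne.symm h']
  rw [add_comm]
  congr 1
  · rw [← mul_right_inj' (two_ne_zero' ℂ), h4, mul_sum]
    exact sum_congr rfl fun a _ => by ring
  · rw [h1 fun a => ∑ j, if a < t j then F a (t j) else 0]
    refine sum_congr rfl fun a _ => ?_
    rw [h1 fun b => if a < b then F a b else 0, mul_sum]
    refine sum_congr rfl fun b _ => ?_
    split_ifs <;> ring

variable {N k m l₁ l₂ : ℕ}

theorem hatPair_add (α β : Fin N → ℤ) :
    hatPair N k m l₁ l₂ (α + β) = hatPair N k m l₁ l₂ α + hatPair N k m l₁ l₂ β := by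
  refine Prod.ext (funext fun j => ?_) ?_
  · simp [hatPair, add_mul, sum_add_distrib]
  · simp only [hatPair, Prod.snd_add, ← Int.cast_add, ← sum_add_distrib]
    congr 1
    exact sum_congr rfl fun i _ => by split_ifs <;> simp

theorem hatPair_sub (α β : Fin N → ℤ) :
    hatPair N k m l₁ l₂ (α - β) = hatPair N k m l₁ l₂ α - hatPair N k m l₁ l₂ β :=
  eq_sub_of_add_eq (by rw [← hatPair_add, sub_add_cancel])

/-- The classes of coordinates: the blocks, the shifted coordinates, and the zero coordinates. -/
def coordClass (N k m l₁ l₂ : ℕ) (hN : m * k + l₁ + l₂ ≤ N) (i : Fin N) :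
    Fin (dimPlane N k m l₁ l₂ + 2) :=
  ⟨if i.1 + l₁ + l₂ < N then coordIndex k m i else
    if i.1 + l₁ < N then dimPlane N k m l₁ l₂ else dimPlane N k m l₁ l₂ + 1, by
    split_ifs with h1
    · have := coordIndex_lt (k := k) (m := m) hN h1
      omega
    · omega
    · omega⟩

/-- The projections of the roots `e_i` for coordinates in the given class. -/
def classVec (N k m l₁ l₂ : ℕ) (a : ℕ) : (Fin (dimPlane N k m l₁ l₂) → ℂ) × ZMod 2 :=
  (fun j => if a = j then invSqrt k m j else 0, if a = dimPlane N k m l₁ l₂ then 1 else 0)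

theorem hatPair_eV (hk : 1 ≤ k) (hN : m * k + l₁ + l₂ ≤ N) (i : Fin N) :
    hatPair N k m l₁ l₂ (eV i) = classVec N k m l₁ l₂ (coordClass N k m l₁ l₂ hN i) := by
  refine Prod.ext (funext fun j => ?_) ?_
  · simp only [hatPair, classVec, coordClass]
    rw [sum_eq_single i (fun i' _ h => by simp [eV, h]) (by simp), basisVec_eq hk hN]
    have := j.2
    have e : ((eV i i : ℤ) : ℂ) = 1 := by simp [eV]
    rw [e, one_mul]
    refine if_congr ?_ rfl rfl
    split_ifs with h1 h2
    · simp [h1]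
    · simp only [h1, false_and, false_iff]
      omega
    · simp only [h1, false_and, false_iff]
      omega
  · simp only [hatPair, classVec, coordClass]
    rw [sum_eq_single i (fun i' _ h => by simp [eV, h]) (by simp)]
    have e : eV i i = 1 := by simp [eV]
    rw [e]
    by_cases h1 : i.1 + l₁ + l₂ < N
    · have h2 := coordIndex_lt (k := k) (m := m) hN h1
      have h3 : ¬ InShift N l₁ l₂ i := fun h => by have := h.1; omega
      simp [h1, h2.ne, h3]
    · by_cases h2 : i.1 + l₁ < N
      · have h3 : InShift N l₁ l₂ i := ⟨by omega, h2⟩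
        simp [h1, h2, h3]
      · have h3 : ¬ InShift N l₁ l₂ i := fun h => h2 h.2
        simp [h1, h2, h3]

theorem coordIndex_mono : Monotone (coordIndex k m) := by
  intro i j h
  unfold coordIndex
  split_ifs with h1 h2 h2
  · exact Nat.div_le_div_right h
  · have := Nat.div_lt_of_lt_mul (by rwa [mul_comm] at h1 : i < k * m)
    omega
  · omega
  · omega

theorem coordClass_mono (hN : m * k + l₁ + l₂ ≤ N) : Monotone (coordClass N k m l₁ l₂ hN) := by
  intro i j h
  have h0 : i.1 ≤ j.1 := h
  have h3 := coordIndex_mono (k := k) (m := m) h0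
  change (if i.1 + l₁ + l₂ < N then coordIndex k m i else
    if i.1 + l₁ < N then dimPlane N k m l₁ l₂ else dimPlane N k m l₁ l₂ + 1) ≤
    (if j.1 + l₁ + l₂ < N then coordIndex k m j else
    if j.1 + l₁ < N then dimPlane N k m l₁ l₂ else dimPlane N k m l₁ l₂ + 1)
  by_cases h1 : i.1 + l₁ + l₂ < N
  · have := coordIndex_lt (k := k) (m := m) hN h1
    rw [if_pos h1]
    split_ifs <;> omega
  · rw [if_neg h1]
    split_ifs <;> omega

/-- The numbers of coordinates in the classes. -/
def classSize (N k m l₁ l₂ : ℕ) (a : ℕ) : ℂ :=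
  if a < dimPlane N k m l₁ l₂ then blockSize k m a else if a = dimPlane N k m l₁ l₂ then l₂ else l₁

theorem sum_coordClass (hk : 1 ≤ k) (hN : m * k + l₁ + l₂ ≤ N)
    (a : Fin (dimPlane N k m l₁ l₂ + 2)) :
    ∑ i, (if coordClass N k m l₁ l₂ hN i = a then 1 else 0) = classSize N k m l₁ l₂ a := by
  have h0 := a.2
  have key : ∀ i : Fin N, coordClass N k m l₁ l₂ hN i = a ↔
      (if i.1 + l₁ + l₂ < N then coordIndex k m i else
    if i.1 + l₁ < N then dimPlane N k m l₁ l₂ else dimPlane N k m l₁ l₂ + 1) = a.1 :=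
    fun i => Fin.ext_iff
  unfold classSize
  split_ifs with h1 h2
  · refine Eq.trans ?_ ((sum_coordIndex hk hN (⟨a.1, h1⟩ : Fin (dimPlane N k m l₁ l₂)) 1).trans
      (mul_one _))
    refine sum_congr rfl fun i _ => if_congr ?_ rfl rfl
    rw [key]
    split_ifs with h3 h4
    · simp [h3]
    · simp only [h3, false_and, iff_false]
      omega
    · simp only [h3, false_and, iff_false]
      omega
  · rw [← mul_one (l₂ : ℂ)]
    refine sum_ite_of_iff_interval (lo := N - l₁ - l₂) (by omega) (fun i => ?_) 1
    rw [key]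
    split_ifs with h3 h4
    · have := coordIndex_lt (k := k) (m := m) hN h3
      omega
    · omega
    · omega
  · rw [← mul_one (l₁ : ℂ)]
    refine sum_ite_of_iff_interval (lo := N - l₁) (by omega) (fun i => ?_) 1
    rw [key]
    split_ifs with h3 h4
    · have := coordIndex_lt (k := k) (m := m) hN h3
      omega
    · omega
    · omega

theorem classVec_last : classVec N k m l₁ l₂ (dimPlane N k m l₁ l₂ + 1) = 0 := by
  refine Prod.ext (funext fun j => ?_) ?_
  · simp only [classVec, Prod.fst_zero, Pi.zero_apply]
    exact if_neg (by omega)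
  · simp [classVec]

theorem classVec_shift : classVec N k m l₁ l₂ (dimPlane N k m l₁ l₂) = (0, 1) := by
  refine Prod.ext (funext fun j => ?_) ?_
  · simp only [classVec, Pi.zero_apply]
    exact if_neg (by omega)
  · simp [classVec]

/-- The vector of length `invSqrt` along a coordinate. -/
def blockVec (N k m l₁ l₂ : ℕ) (j : Fin (dimPlane N k m l₁ l₂)) :
    (Fin (dimPlane N k m l₁ l₂) → ℂ) :=
  Pi.single j (invSqrt k m j)

theorem classVec_block (j : Fin (dimPlane N k m l₁ l₂)) :
    classVec N k m l₁ l₂ j = (blockVec N k m l₁ l₂ j, 0) := by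
  refine Prod.ext (funext fun j' => ?_) ?_
  · simp only [classVec, blockVec, Pi.single_apply, Fin.ext_iff]
    by_cases h : j'.1 = j.1
    · rw [if_pos h.symm, if_pos h, Fin.ext h]
    · rw [if_neg (Ne.symm h), if_neg h]
  · simp only [classVec]
    exact if_neg (by omega)

/-- Sums over the positive roots of functions of the projections. -/
theorem sum_mult_hatPair (hk : 1 ≤ k) (hN : m * k + l₁ + l₂ ≤ N) (c₁ c₂ c₃ : ℂ)
    (Y : (Fin (dimPlane N k m l₁ l₂) → ℂ) × ZMod 2 → ℂ) (h0 : Y 0 = 0) (h1 : Y (0, 1) = 0) :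
    ∑ α ∈ posRoots N, mult c₁ c₂ c₃ α * Y (hatPair N k m l₁ l₂ α) =
      ∑ j : Fin (dimPlane N k m l₁ l₂),
        ((blockSize k m j : ℂ) * (c₂ + 2 * l₁ * c₁) * Y (blockVec N k m l₁ l₂ j, 0) +
        2 * blockSize k m j * l₂ * c₁ * Y (blockVec N k m l₁ l₂ j, 1) +
        blockSize k m j * (2 * c₃ + (blockSize k m j - 1) * c₁) / 2 *
          Y (2 • blockVec N k m l₁ l₂ j, 0)) +
      ∑ j : Fin (dimPlane N k m l₁ l₂), ∑ j' : Fin (dimPlane N k m l₁ l₂), if j < j' then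
        (blockSize k m j : ℂ) * blockSize k m j' * c₁ *
        (Y (blockVec N k m l₁ l₂ j - blockVec N k m l₁ l₂ j', 0) +
          Y (blockVec N k m l₁ l₂ j + blockVec N k m l₁ l₂ j', 0)) else 0 := by
  have hs := sum_coordClass hk hN
  have e1 : ∀ g : Fin (dimPlane N k m l₁ l₂ + 2) → ℂ, ∑ i, g (coordClass N k m l₁ l₂ hN i) =
      ∑ a : Fin (dimPlane N k m l₁ l₂ + 2), classSize N k m l₁ l₂ a * g a := fun g => by
    simp only [← hs, sum_mul]
    rw [sum_comm]
    refine sum_congr rfl fun i _ => ?_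
    simp
  have h2 : (2 : ℕ) • (1 : ZMod 2) = 0 := by decide
  have h2' : (-1 : ZMod 2) = 1 := by decide
  have h3 : (1 : ZMod 2) + 1 = 0 := by decide
  rw [sum_posRoots]
  have e2 : ∀ i j : Fin N, (if i < j then
      mult c₁ c₂ c₃ (eV i - eV j) * Y (hatPair N k m l₁ l₂ (eV i - eV j)) +
      mult c₁ c₂ c₃ (eV i + eV j) * Y (hatPair N k m l₁ l₂ (eV i + eV j)) else 0) =
      if i < j then (fun a b : Fin (dimPlane N k m l₁ l₂ + 2) =>
        c₁ * (Y (classVec N k m l₁ l₂ a - classVec N k m l₁ l₂ b) +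
          Y (classVec N k m l₁ l₂ a + classVec N k m l₁ l₂ b)))
        (coordClass N k m l₁ l₂ hN i) (coordClass N k m l₁ l₂ hN j) else 0 := fun i j => by
    split_ifs with h
    · have hM := mult_eM c₁ c₂ c₃ h.ne
      have hP := mult_eP c₁ c₂ c₃ h.ne
      rw [eM, if_pos h] at hM
      rw [eP] at hP
      rw [hM, hP, hatPair_sub, hatPair_add, hatPair_eV hk hN, hatPair_eV hk hN]
      ring
    · rfl
  simp only [e2, mult_eV, mult_two_eV]
  simp only [two_smul ℕ (eV _), hatPair_add, hatPair_eV hk hN]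
  have e3 := sum_lt_of_monotone (coordClass_mono hN) hs
    fun a b : Fin (dimPlane N k m l₁ l₂ + 2) =>
        c₁ * (Y (classVec N k m l₁ l₂ a - classVec N k m l₁ l₂ b) +
          Y (classVec N k m l₁ l₂ a + classVec N k m l₁ l₂ b))
  beta_reduce at e3
  rw [e3, e1 fun a => c₂ * Y (classVec N k m l₁ l₂ a),
    e1 fun a => c₃ * Y (classVec N k m l₁ l₂ a + classVec N k m l₁ l₂ a)]
  simp only [Fin.sum_univ_castSucc]
  have h4 : ∀ a : Fin (dimPlane N k m l₁ l₂ + 1), ¬ Fin.last (dimPlane N k m l₁ l₂ + 1) < a.castSucc :=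
    fun a => (Fin.le_last _).not_gt
  have h5 : ∀ a : Fin (dimPlane N k m l₁ l₂), ¬ Fin.last (dimPlane N k m l₁ l₂) < a.castSucc :=
    fun a => (Fin.le_last _).not_gt
  have h6 : ¬ dimPlane N k m l₁ l₂ + 1 < dimPlane N k m l₁ l₂ := by omega
  simp [h4, h5, h6, classVec_last, classVec_shift, classVec_block, classSize, h0, h1, h3, h2']
  have h8 : Y (0, 0) = 0 := h0
  simp only [h8, mul_zero, add_zero, two_mul (blockVec N k m l₁ l₂ _)]
  simp only [← sum_add_distrib]
  refine sum_congr rfl fun j _ => ?_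
  rw [sum_congr rfl fun (j' : Fin (dimPlane N k m l₁ l₂)) _ => if_congr Iff.rfl
    (mul_assoc ((blockSize k m j : ℂ) * blockSize k m j') c₁ _) rfl]
  ring

end FibreSums

section RationalIdentity

variable {d : ℕ}

theorem sum_mul_sq_expand (κ α : Fin d → ℂ) (c : ℂ) (C : Fin d → Fin d → ℂ) :
    ∑ j, κ j * (α j + c * ∑ i, κ i * C j i) ^ 2 = ∑ j, κ j * α j ^ 2 +
      ∑ j, ∑ i, (2 * c * κ j * κ i * (α j * C j i) + c ^ 2 * κ j * κ i ^ 2 * C j i ^ 2) +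
      c ^ 2 * ∑ j, ∑ i, ∑ l, if i = l then 0 else κ j * κ i * κ l * (C j i * C j l) := by
  rw [mul_sum, ← sum_add_distrib, ← sum_add_distrib]
  refine sum_congr rfl fun j _ => ?_
  have h1 : (∑ i, κ i * C j i) ^ 2 = ∑ i, κ i ^ 2 * C j i ^ 2 +
      ∑ i, ∑ l, if i = l then 0 else κ i * κ l * (C j i * C j l) := by
    rw [sq, sum_mul_sum, ← sum_add_distrib]
    refine sum_congr rfl fun i _ => ?_
    rw [← add_sum_erase _ _ (mem_univ i),
      ← add_sum_erase univ (fun l => if i = l then 0 else κ i * κ l * (C j i * C j l))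
        (mem_univ i), if_pos rfl, zero_add]
    congr 1
    · ring
    · refine sum_congr rfl fun l hl => ?_
      rw [if_neg (ne_of_mem_erase hl).symm]
      ring
  have h2 : ∑ i, ∑ l, (if i = l then 0 else κ j * κ i * κ l * (C j i * C j l)) =
      κ j * ∑ i, ∑ l, if i = l then 0 else κ i * κ l * (C j i * C j l) := by
    simp only [mul_sum, mul_ite, mul_zero, mul_assoc]
  have h3 : ∑ i, (2 * c * κ j * κ i * (α j * C j i) + c ^ 2 * κ j * κ i ^ 2 * C j i ^ 2) =
      2 * c * κ j * α j * ∑ i, κ i * C j i + c ^ 2 * κ j * ∑ i, κ i ^ 2 * C j i ^ 2 := by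
    rw [sum_add_distrib, mul_sum, mul_sum]
    congr 1 <;> exact sum_congr rfl fun i _ => by ring
  rw [h2, h3, add_sq, mul_pow, h1]
  ring

theorem cyclic_trig {X S : Fin d → ℂ} (hS : ∀ j, S j ^ 2 = X j ^ 2 - 1)
    (hX : ∀ j i, j ≠ i → X j - X i ≠ 0) {i j k : Fin d} (hij : i ≠ j) (hjk : j ≠ k) (hki : k ≠ i) :
    2 * S i / (X i - X j) * (2 * S i / (X i - X k)) + 2 * S j / (X j - X k) * (2 * S j / (X j - X i)) +
      2 * S k / (X k - X i) * (2 * S k / (X k - X j)) = 4 := by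
  have e1 : 2 * S i / (X i - X j) * (2 * S i / (X i - X k)) =
      4 * (X i ^ 2 - 1) / ((X i - X j) * (X i - X k)) := by
    rw [div_mul_div_comm, ← hS]; ring
  have e2 : 2 * S j / (X j - X k) * (2 * S j / (X j - X i)) =
      4 * (X j ^ 2 - 1) / ((X j - X k) * (X j - X i)) := by
    rw [div_mul_div_comm, ← hS]; ring
  have e3 : 2 * S k / (X k - X i) * (2 * S k / (X k - X j)) =
      4 * (X k ^ 2 - 1) / ((X k - X i) * (X k - X j)) := by
    rw [div_mul_div_comm, ← hS]; ring
  have h1 := hX i j hij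
  have h2 := hX j k hjk
  have h3 := hX k i hki
  rw [e1, e2, e3, ← neg_sub (X k) (X i), ← neg_sub (X i) (X j), ← neg_sub (X j) (X k)]
  field_simp
  ring

theorem cyclic_lt {i j k : Fin d} (hij : i ≠ j) (hjk : j ≠ k) (hki : k ≠ i) :
    (if i < j then 2 else 0 : ℂ) * (if i < k then 2 else 0) +
      (if j < k then 2 else 0) * (if j < i then 2 else 0) +
      (if k < i then 2 else 0) * (if k < j then 2 else 0) = 4 := by
  rcases lt_or_gt_of_ne hij with h1 | h1 <;> rcases lt_or_gt_of_ne hjk with h2 | h2 <;>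
    rcases lt_or_gt_of_ne hki with h3 | h3
  · exact absurd (h1.trans (h2.trans h3)) (lt_irrefl _)
  all_goals first
    | (simp [h1, h2, h3, h1.not_gt, h2.not_gt, h3.not_gt]; norm_num; done)
    | exact absurd (h3.trans (h2.trans h1)) (lt_irrefl _)

/-- The identity behind the computation of the potential in coordinates. -/
theorem sum_mul_sq_sub {X S κ a : Fin d → ℂ} {b c : ℂ} (hS : ∀ j, S j ^ 2 = X j ^ 2 - 1)
    (hS0 : ∀ j, S j ≠ 0) (hX : ∀ j i, j ≠ i → X j - X i ≠ 0)
    (ha : ∀ j i, a j - a i = (κ j - κ i) * c) :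
    ∑ j, κ j * ((a j * X j + b) / S j + c * ∑ i, κ i * (2 * S j / (X j - X i))) ^ 2 =
      ∑ j, κ j * (a j + c * ∑ i, κ i * (if j < i then 2 else 0)) ^ 2 +
      ∑ j, κ j * (a j ^ 2 + b ^ 2 + 2 * a j * b * X j) / S j ^ 2 +
      ∑ j, ∑ i, if j < i then
        4 * c ^ 2 * κ j * κ i * (κ j + κ i) * (X j * X i - 1) / (X j - X i) ^ 2 else 0 := by
  rw [sum_mul_sq_expand, sum_mul_sq_expand]
  have e1 : ∑ j, κ j * ((a j * X j + b) / S j) ^ 2 = ∑ j, κ j * a j ^ 2 +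
      ∑ j, κ j * (a j ^ 2 + b ^ 2 + 2 * a j * b * X j) / S j ^ 2 := by
    rw [← sum_add_distrib]
    refine sum_congr rfl fun j _ => ?_
    have h := hS0 j
    field_simp
    linear_combination κ j * a j ^ 2 * (-hS j)
  have e2 : (∑ j, ∑ i, ∑ l, if i = l then 0 else κ j * κ i * κ l *
        (2 * S j / (X j - X i) * (2 * S j / (X j - X l)))) =
      ∑ j, ∑ i, ∑ l, if i = l then 0 else κ j * κ i * κ l *
        ((if j < i then 2 else 0) * (if j < l then 2 else 0)) := by
    rw [← sub_eq_zero]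
    simp only [← sum_sub_distrib]
    refine sum_eq_zero_of_cyclic _ fun i j k => ?_
    by_cases hij : i = j
    · subst hij; simp
    by_cases hjk : j = k
    · subst hjk; simp
    by_cases hki : k = i
    · subst hki; simp
    rw [if_neg hjk, if_neg hki, if_neg hij, if_neg hjk, if_neg hki, if_neg hij]
    linear_combination κ i * κ j * κ k * (cyclic_trig hS hX hij hjk hki - cyclic_lt hij hjk hki)
  have e3 : ∑ j, ∑ i, (2 * c * κ j * κ i * ((a j * X j + b) / S j * (2 * S j / (X j - X i))) +
        c ^ 2 * κ j * κ i ^ 2 * (2 * S j / (X j - X i)) ^ 2) =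
      ∑ j, ∑ i, (2 * c * κ j * κ i * (a j * (if j < i then 2 else 0)) +
        c ^ 2 * κ j * κ i ^ 2 * (if j < i then 2 else 0) ^ 2) +
      ∑ j, ∑ i, if j < i then
        4 * c ^ 2 * κ j * κ i * (κ j + κ i) * (X j * X i - 1) / (X j - X i) ^ 2 else 0 := by
    rw [← sub_eq_zero]
    simp only [← sum_add_distrib, ← sum_sub_distrib]
    have key : ∀ j i, j < i →
        2 * c * κ j * κ i * ((a j * X j + b) / S j * (2 * S j / (X j - X i))) +
        c ^ 2 * κ j * κ i ^ 2 * (2 * S j / (X j - X i)) ^ 2 +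
        (2 * c * κ i * κ j * ((a i * X i + b) / S i * (2 * S i / (X i - X j))) +
        c ^ 2 * κ i * κ j ^ 2 * (2 * S i / (X i - X j)) ^ 2) =
        2 * c * κ j * κ i * (a j * 2) + c ^ 2 * κ j * κ i ^ 2 * 2 ^ 2 +
        4 * c ^ 2 * κ j * κ i * (κ j + κ i) * (X j * X i - 1) / (X j - X i) ^ 2 := by
      intro j i hji
      have h1 := hX j i hji.ne
      have h2 := hS0 j
      have h3 := hS0 i
      have h4 := hS j
      have h5 := hS i
      have h6 := ha j i
      rw [← neg_sub (X j) (X i)]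
      have f1 : (a j * X j + b) / S j * (2 * S j / (X j - X i)) =
          2 * (a j * X j + b) / (X j - X i) := by
        field_simp
      have f2 : (a i * X i + b) / S i * (2 * S i / -(X j - X i)) =
          -(2 * (a i * X i + b) / (X j - X i)) := by
        field_simp
      have f3 : (2 * S j / (X j - X i)) ^ 2 = 4 * (X j ^ 2 - 1) / (X j - X i) ^ 2 := by
        rw [div_pow, mul_pow, h4]; norm_num
      have f4 : (2 * S i / -(X j - X i)) ^ 2 = 4 * (X i ^ 2 - 1) / (X j - X i) ^ 2 := by
        rw [div_pow, neg_sq, mul_pow, h5]; norm_num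
      rw [f1, f2, f3, f4]
      field_simp
      linear_combination (4 * c * κ j * κ i * X i * (X j - X i)) * h6
    refine sum_eq_zero_of_antisymm _ fun j i => ?_
    rcases lt_trichotomy j i with h | h | h
    · simp only [if_pos h, if_neg h.not_gt]
      linear_combination key j i h
    · subst h
      simp
    · simp only [if_pos h, if_neg h.not_gt]
      linear_combination key i j h
  rw [e1, e2, e3]
  ring

end RationalIdentity

section RestrictedMultiplicities

variable {N k m l₁ l₂ : ℕ}

/-- The vectors on `π` with integer coordinates with respect to the basis `blockVec`. -/
def latVec (N k m l₁ l₂ : ℕ) (β : Fin (dimPlane N k m l₁ l₂) → ℤ) :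
    Fin (dimPlane N k m l₁ l₂) → ℂ := fun j => β j * invSqrt k m j

theorem latVec_injective (hk : 1 ≤ k) : Function.Injective (latVec N k m l₁ l₂) := fun β β' h => by
  funext j
  exact_mod_cast mul_right_cancel₀ (invSqrt_ne_zero (m := m) hk j) (congrFun h j)

theorem latVec_add (β β' : Fin (dimPlane N k m l₁ l₂) → ℤ) :
    latVec N k m l₁ l₂ (β + β') = latVec N k m l₁ l₂ β + latVec N k m l₁ l₂ β' :=
  funext fun j => by simp [latVec, add_mul]

theorem latVec_sub (β β' : Fin (dimPlane N k m l₁ l₂) → ℤ) :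
    latVec N k m l₁ l₂ (β - β') = latVec N k m l₁ l₂ β - latVec N k m l₁ l₂ β' :=
  funext fun j => by simp [latVec, sub_mul]

theorem latVec_eV (j : Fin (dimPlane N k m l₁ l₂)) :
    latVec N k m l₁ l₂ (eV j) = blockVec N k m l₁ l₂ j := by
  funext i
  by_cases h : i = j
  · subst h; simp [latVec, blockVec]
  · simp [latVec, blockVec, h]

theorem latVec_two_eV (j : Fin (dimPlane N k m l₁ l₂)) :
    latVec N k m l₁ l₂ (2 • eV j) = 2 • blockVec N k m l₁ l₂ j := by
  rw [two_smul, latVec_add, latVec_eV, two_smul]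

/-- The multiplicities of the restricted roots. -/
def latMult (k m l₁ : ℕ) (c₁ c₂ c₃ : ℂ) {d : ℕ} (β : Fin d → ℤ) : ℂ :=
  if normSq β = 1 then (∏ j, if β j = 0 then 1 else (blockSize k m j : ℂ)) * (c₂ + 2 * l₁ * c₁)
  else if normSq β = 4 then
    ∑ j, if β j = 0 then 0 else
      (blockSize k m j : ℂ) * (2 * c₃ + (blockSize k m j - 1) * c₁) / 2
  else (∏ j, if β j = 0 then 1 else (blockSize k m j : ℂ)) * c₁

theorem latMult_eV (c₁ c₂ c₃ : ℂ) {d : ℕ} (j : Fin d) :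
    latMult k m l₁ c₁ c₂ c₃ (eV j) = blockSize k m j * (c₂ + 2 * l₁ * c₁) := by
  rw [latMult, normSq_single, if_pos rfl, prod_eq_single j]
  · simp
  · intro i _ h
    simp [h]
  · simp

theorem latMult_two_eV (c₁ c₂ c₃ : ℂ) {d : ℕ} (j : Fin d) :
    latMult k m l₁ c₁ c₂ c₃ (2 • eV j) =
      blockSize k m j * (2 * c₃ + (blockSize k m j - 1) * c₁) / 2 := by
  rw [latMult, normSq_two_single, if_neg (by norm_num), if_pos rfl, sum_eq_single j]
  · simp
  · intro i _ h
    simp [h]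
  · simp

theorem latMult_sub (c₁ c₂ c₃ : ℂ) {d : ℕ} {j i : Fin d} (h : j ≠ i) :
    latMult k m l₁ c₁ c₂ c₃ (eV j - eV i) = blockSize k m j * blockSize k m i * c₁ := by
  rw [latMult, normSq_sub h, if_neg (by norm_num), if_neg (by norm_num),
    prod_eq_mul j i h]
  · simp [h, h.symm]
  · rintro a - ⟨h1, h2⟩
    simp [h1, h2]
  · simp
  · simp

theorem latMult_add (c₁ c₂ c₃ : ℂ) {d : ℕ} {j i : Fin d} (h : j ≠ i) :
    latMult k m l₁ c₁ c₂ c₃ (eV j + eV i) = blockSize k m j * blockSize k m i * c₁ := by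
  rw [latMult, normSq_add h, if_neg (by norm_num), if_neg (by norm_num),
    prod_eq_mul j i h]
  · simp [h, h.symm]
  · rintro a - ⟨h1, h2⟩
    simp [h1, h2]
  · simp
  · simp

theorem sum_mult_hatPair_eq (hk : 1 ≤ k) (hN : m * k + l₁ + l₂ ≤ N) (c₁ c₂ c₃ : ℂ)
    (Y : (Fin (dimPlane N k m l₁ l₂) → ℂ) × ZMod 2 → ℂ) (h0 : Y 0 = 0) (h1 : Y (0, 1) = 0) :
    ∑ α ∈ posRoots N, mult c₁ c₂ c₃ α * Y (hatPair N k m l₁ l₂ α) =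
      ∑ β ∈ posRoots (dimPlane N k m l₁ l₂),
        latMult k m l₁ c₁ c₂ c₃ β * Y (latVec N k m l₁ l₂ β, 0) +
      ∑ j : Fin (dimPlane N k m l₁ l₂),
        2 * blockSize k m j * l₂ * c₁ * Y (blockVec N k m l₁ l₂ j, 1) := by
  rw [sum_mult_hatPair hk hN c₁ c₂ c₃ Y h0 h1, sum_posRoots]
  have e : ∀ j i : Fin (dimPlane N k m l₁ l₂), (if j < i then
      latMult k m l₁ c₁ c₂ c₃ (eV j - eV i) * Y (latVec N k m l₁ l₂ (eV j - eV i), 0) +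
      latMult k m l₁ c₁ c₂ c₃ (eV j + eV i) * Y (latVec N k m l₁ l₂ (eV j + eV i), 0) else 0) =
      if j < i then
        (blockSize k m j : ℂ) * blockSize k m i * c₁ *
        (Y (blockVec N k m l₁ l₂ j - blockVec N k m l₁ l₂ i, 0) +
          Y (blockVec N k m l₁ l₂ j + blockVec N k m l₁ l₂ i, 0)) else 0 := fun j i => by
    split_ifs with h
    · rw [latMult_sub _ _ _ h.ne, latMult_add _ _ _ h.ne, latVec_sub, latVec_add, latVec_eV,
        latVec_eV]
      ring
    · rfl
  simp only [e, latMult_eV, latMult_two_eV, latVec_eV, latVec_two_eV]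
  simp only [sum_add_distrib]
  ring

theorem cHat_eq_sum (c₁ c₂ c₃ : ℂ) (q : (Fin (dimPlane N k m l₁ l₂) → ℂ) × ZMod 2) :
    cHat N k m l₁ l₂ c₁ c₂ c₃ q = open Classical in ∑ α ∈ posRoots N, mult c₁ c₂ c₃ α *
      (fun q' => if q' = q then (1 : ℂ) else 0) (hatPair N k m l₁ l₂ α) := by
  classical
  rw [cHat, sum_filter]
  exact sum_congr rfl fun α _ => by rw [mul_ite, mul_one, mul_zero]

theorem cHat_latVec (hk : 1 ≤ k) (hN : m * k + l₁ + l₂ ≤ N) (c₁ c₂ c₃ : ℂ)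
    {β : Fin (dimPlane N k m l₁ l₂) → ℤ} (hβ : β ≠ 0) :
    cHat N k m l₁ l₂ c₁ c₂ c₃ (latVec N k m l₁ l₂ β, 0) =
      if β ∈ posRoots (dimPlane N k m l₁ l₂) then latMult k m l₁ c₁ c₂ c₃ β else 0 := by
  classical
  have h0 : latVec N k m l₁ l₂ β ≠ 0 := fun h => hβ (latVec_injective hk (h.trans
    (by funext j; simp [latVec])))
  rw [cHat_eq_sum]
  refine (sum_mult_hatPair_eq hk hN c₁ c₂ c₃
    (fun q' => if q' = (latVec N k m l₁ l₂ β, 0) then (1 : ℂ) else 0) ?_ ?_).trans ?_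
  · simp [Prod.ext_iff, h0.symm]
  · simp
  · rw [← sum_ite_eq' (posRoots (dimPlane N k m l₁ l₂)) β fun β =>
      latMult k m l₁ c₁ c₂ c₃ β]
    simp [Prod.ext_iff, (latVec_injective hk).eq_iff]

theorem cHat_latVec_of_mem (hk : 1 ≤ k) (hN : m * k + l₁ + l₂ ≤ N) (c₁ c₂ c₃ : ℂ)
    {β : Fin (dimPlane N k m l₁ l₂) → ℤ} (hβ : β ∈ posRoots (dimPlane N k m l₁ l₂)) :
    cHat N k m l₁ l₂ c₁ c₂ c₃ (latVec N k m l₁ l₂ β, 0) = latMult k m l₁ c₁ c₂ c₃ β := by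
  rw [cHat_latVec hk hN, if_pos hβ]
  rintro rfl
  simpa [normSq] using normSq_pos hβ

theorem cHat_two_latVec (hk : 1 ≤ k) (hN : m * k + l₁ + l₂ ≤ N) (c₁ c₂ c₃ : ℂ)
    {β : Fin (dimPlane N k m l₁ l₂) → ℤ} (hβ : 1 < normSq β) :
    cHat N k m l₁ l₂ c₁ c₂ c₃ ((latVec N k m l₁ l₂ β, 0) + (latVec N k m l₁ l₂ β, 0)) = 0 := by
  have h1 : normSq (β + β) = 4 * normSq β := by
    simp only [normSq, mul_sum, Pi.add_apply]
    exact sum_congr rfl fun i _ => by ring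
  rw [Prod.mk_add_mk, add_zero, ← latVec_add, cHat_latVec hk hN, if_neg]
  · intro h
    rcases mem_posRoots.1 h with ⟨i, e⟩ | ⟨i, e⟩ | ⟨i, j, hij, e⟩ | ⟨i, j, hij, e⟩
    · rw [e, normSq_single] at h1; omega
    · rw [e, normSq_two_single] at h1; omega
    · rw [e, normSq_sub hij.ne] at h1; omega
    · rw [e, normSq_add hij.ne] at h1; omega
  · intro h
    rw [h] at h1
    simp [normSq] at h1
    simp [normSq] at hβ
    omega

theorem cHat_shift (hk : 1 ≤ k) (hN : m * k + l₁ + l₂ ≤ N) (c₁ c₂ c₃ : ℂ)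
    (j : Fin (dimPlane N k m l₁ l₂)) :
    cHat N k m l₁ l₂ c₁ c₂ c₃ (blockVec N k m l₁ l₂ j, 1) = 2 * blockSize k m j * l₂ * c₁ := by
  classical
  have h0 : blockVec N k m l₁ l₂ j ≠ 0 := fun h => invSqrt_ne_zero (m := m) hk j (by
    simpa [blockVec] using congrFun h j)
  have h1 : ∀ i, blockVec N k m l₁ l₂ i = blockVec N k m l₁ l₂ j ↔ i = j := fun i => by
    rw [← latVec_eV, ← latVec_eV, (latVec_injective hk).eq_iff]
    constructor
    · intro h
      by_contra hij
      have := congrFun h i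
      simp [hij] at this
    · rintro rfl; rfl
  rw [cHat_eq_sum]
  refine (sum_mult_hatPair_eq hk hN c₁ c₂ c₃
    (fun q' => if q' = (blockVec N k m l₁ l₂ j, 1) then (1 : ℂ) else 0) ?_ ?_).trans ?_
  · simp [Prod.ext_iff]
  · simp [Prod.ext_iff, h0.symm]
  · simp [h1]

theorem mem_hatPairs_of_cHat {q : (Fin (dimPlane N k m l₁ l₂) → ℂ) × ZMod 2}
    (h0 : q ≠ 0) {α : Fin N → ℤ} (hα : α ∈ posRoots N) (h : hatPair N k m l₁ l₂ α = q) :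
    q ∈ hatPairs N k m l₁ l₂ := by
  classical
  exact mem_erase.2 ⟨h0, mem_image.2 ⟨α, hα, h⟩⟩

theorem sum_hatPairs (c₁ c₂ c₃ : ℂ) (Y : (Fin (dimPlane N k m l₁ l₂) → ℂ) × ZMod 2 → ℂ)
    (h0 : Y 0 = 0) : ∑ q ∈ hatPairs N k m l₁ l₂, cHat N k m l₁ l₂ c₁ c₂ c₃ q * Y q =
      ∑ α ∈ posRoots N, mult c₁ c₂ c₃ α * Y (hatPair N k m l₁ l₂ α) := by
  classical
  rw [← sum_fiberwise_of_maps_to (s := posRoots N)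
    (t := (posRoots N).image (hatPair N k m l₁ l₂)) fun α hα => mem_image_of_mem _ hα]
  have h1 : ∀ q, ∑ α ∈ posRoots N with hatPair N k m l₁ l₂ α = q,
      mult c₁ c₂ c₃ α * Y (hatPair N k m l₁ l₂ α) = cHat N k m l₁ l₂ c₁ c₂ c₃ q * Y q := fun q => by
    rw [cHat, sum_mul]
    refine sum_congr (by congr) fun α hα => ?_
    rw [(mem_filter.1 hα).2]
  rw [sum_congr rfl fun q _ => h1 q]
  unfold hatPairs
  refine sum_subset (by convert erase_subset _ _) fun q h2 h3 => ?_
  have : q = 0 := by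
    by_contra h
    exact h3 (mem_erase.2 ⟨h, by convert h2⟩)
  rw [this, h0, mul_zero]

end RestrictedMultiplicities

section Hyperbolic

theorem coth_half {v : ℂ} (h : sinh v ≠ 0) :
    cosh (v / 2) / sinh (v / 2) = (cosh v + 1) / sinh v := by
  have h1 : sinh v = 2 * sinh (v / 2) * cosh (v / 2) := by
    rw [← Complex.sinh_two_mul, mul_div_cancel₀ _ two_ne_zero]
  have h2 : cosh v = cosh (v / 2) ^ 2 + sinh (v / 2) ^ 2 := by
    rw [← Complex.cosh_two_mul, mul_div_cancel₀ _ two_ne_zero]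
  have h3 := Complex.cosh_sq (v / 2)
  rw [h1] at h ⊢
  obtain ⟨h4, h5⟩ := mul_ne_zero_iff.1 h
  have h6 := (mul_ne_zero_iff.1 h4).2
  rw [h2]
  field_simp
  linear_combination h3

theorem cosh_add_half_pi (z : ℂ) :
    cosh (z + Real.pi * Complex.I / 2) = Complex.I * sinh z := by
  rw [Complex.cosh_add, mul_div_right_comm, Complex.cosh_mul_I, Complex.sinh_mul_I,
    Complex.cos_pi_div_two, Complex.sin_pi_div_two]
  ring

theorem sinh_add_half_pi (z : ℂ) :
    sinh (z + Real.pi * Complex.I / 2) = Complex.I * cosh z := by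
  rw [Complex.sinh_add, mul_div_right_comm, Complex.cosh_mul_I, Complex.sinh_mul_I,
    Complex.cos_pi_div_two, Complex.sin_pi_div_two]
  ring

theorem tanh_half {v : ℂ} (h : sinh v ≠ 0) :
    sinh (v / 2) / cosh (v / 2) = (cosh v - 1) / sinh v := by
  have h1 : sinh v = 2 * sinh (v / 2) * cosh (v / 2) := by
    rw [← Complex.sinh_two_mul, mul_div_cancel₀ _ two_ne_zero]
  have h2 : cosh v = cosh (v / 2) ^ 2 + sinh (v / 2) ^ 2 := by
    rw [← Complex.cosh_two_mul, mul_div_cancel₀ _ two_ne_zero]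
  have h3 := Complex.cosh_sq (v / 2)
  rw [h1] at h ⊢
  obtain ⟨h4, h5⟩ := mul_ne_zero_iff.1 h
  have h6 := (mul_ne_zero_iff.1 h4).2
  rw [h2]
  field_simp
  linear_combination -h3

theorem two_sinh_sq_half (v : ℂ) : 2 * sinh (v / 2) ^ 2 = cosh v - 1 := by
  have h2 : cosh v = cosh (v / 2) ^ 2 + sinh (v / 2) ^ 2 := by
    rw [← Complex.cosh_two_mul, mul_div_cancel₀ _ two_ne_zero]
  rw [h2, Complex.cosh_sq]
  ring

theorem two_cosh_sq_half (v : ℂ) : 2 * cosh (v / 2) ^ 2 = cosh v + 1 := by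
  have h := two_sinh_sq_half v
  rw [Complex.cosh_sq]
  linear_combination h

theorem cosh_sub_cosh (u v : ℂ) : cosh u - cosh v =
    2 * (sinh ((u - v) / 2) * sinh ((u + v) / 2)) := by
  have h1 : u = (u + v) / 2 + (u - v) / 2 := by ring
  have h2 : v = (u + v) / 2 - (u - v) / 2 := by ring
  conv_lhs => rw [h1, h2, Complex.cosh_add, Complex.cosh_sub]
  ring_nf

theorem coth_sub_add_coth_add {u v : ℂ} (h1 : sinh ((u - v) / 2) ≠ 0)
    (h2 : sinh ((u + v) / 2) ≠ 0) :
    cosh ((u - v) / 2) / sinh ((u - v) / 2) +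
      cosh ((u + v) / 2) / sinh ((u + v) / 2) =
      2 * sinh u / (cosh u - cosh v) := by
  have h3 : sinh u = sinh ((u + v) / 2) * cosh ((u - v) / 2) +
      cosh ((u + v) / 2) * sinh ((u - v) / 2) := by
    rw [← Complex.sinh_add]
    congr 1
    ring
  rw [cosh_sub_cosh, h3]
  field_simp

theorem coth_add_sub_coth_sub {u v : ℂ} (h1 : sinh ((u - v) / 2) ≠ 0)
    (h2 : sinh ((u + v) / 2) ≠ 0) :
    cosh ((u + v) / 2) / sinh ((u + v) / 2) -
      cosh ((u - v) / 2) / sinh ((u - v) / 2) =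
      2 * sinh v / (cosh v - cosh u) := by
  have h3 : sinh v = sinh ((u + v) / 2) * cosh ((u - v) / 2) -
      cosh ((u + v) / 2) * sinh ((u - v) / 2) := by
    rw [← Complex.sinh_sub]
    congr 1
    ring
  rw [← neg_sub (cosh u), cosh_sub_cosh, h3]
  field_simp
  ring

theorem csch_sq_sub_add_csch_sq_add {u v : ℂ} (h1 : sinh ((u - v) / 2) ≠ 0)
    (h2 : sinh ((u + v) / 2) ≠ 0) :
    1 / sinh ((u - v) / 2) ^ 2 + 1 / sinh ((u + v) / 2) ^ 2 =
      4 * (cosh u * cosh v - 1) / (cosh u - cosh v) ^ 2 := by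
  have h3 := two_sinh_sq_half (u - v)
  have h4 := two_sinh_sq_half (u + v)
  rw [Complex.cosh_sub] at h3
  rw [Complex.cosh_add] at h4
  rw [cosh_sub_cosh]
  field_simp
  linear_combination 2 * h3 + 2 * h4

end Hyperbolic

section Potential

variable {N k m l₁ l₂ : ℕ}

/-- The value of the coordinates of a block. -/
def angle (k m : ℕ) {d : ℕ} (y : Fin d → ℂ) (j : Fin d) : ℂ := invSqrt k m j * y j

theorem halfArg_latVec (β : Fin (dimPlane N k m l₁ l₂) → ℤ) (y : Fin (dimPlane N k m l₁ l₂) → ℂ) :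
    halfArg (latVec N k m l₁ l₂ β, 0) y = pairing β (angle k m y) / 2 := by
  simp [halfArg, latVec, pairing, angle, mul_assoc]

theorem halfArg_blockVec (j : Fin (dimPlane N k m l₁ l₂)) (y : Fin (dimPlane N k m l₁ l₂) → ℂ) :
    halfArg (blockVec N k m l₁ l₂ j, 0) y = angle k m y j / 2 := by
  rw [← latVec_eV, halfArg_latVec, pairing_single]

theorem halfArg_blockVec_shift (j : Fin (dimPlane N k m l₁ l₂))
    (y : Fin (dimPlane N k m l₁ l₂) → ℂ) :
    halfArg (blockVec N k m l₁ l₂ j, 1) y = angle k m y j / 2 + Real.pi * Complex.I / 2 := by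
  rw [← halfArg_blockVec]
  have : (1 : ZMod 2).val = 1 := rfl
  simp only [halfArg, this, ZMod.val_zero, Nat.cast_zero, Nat.cast_one]
  ring

theorem halfArg_two_blockVec (j : Fin (dimPlane N k m l₁ l₂))
    (y : Fin (dimPlane N k m l₁ l₂) → ℂ) :
    halfArg (2 • blockVec N k m l₁ l₂ j, 0) y = angle k m y j := by
  rw [← latVec_two_eV, halfArg_latVec, two_smul, pairing_add, pairing_single]
  ring

theorem halfArg_sub (j i : Fin (dimPlane N k m l₁ l₂)) (y : Fin (dimPlane N k m l₁ l₂) → ℂ) :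
    halfArg (blockVec N k m l₁ l₂ j - blockVec N k m l₁ l₂ i, 0) y =
      (angle k m y j - angle k m y i) / 2 := by
  rw [← latVec_eV, ← latVec_eV, ← latVec_sub, halfArg_latVec, pairing_sub, pairing_single,
    pairing_single]

theorem halfArg_add (j i : Fin (dimPlane N k m l₁ l₂)) (y : Fin (dimPlane N k m l₁ l₂) → ℂ) :
    halfArg (blockVec N k m l₁ l₂ j + blockVec N k m l₁ l₂ i, 0) y =
      (angle k m y j + angle k m y i) / 2 := by
  rw [← latVec_eV, ← latVec_eV, ← latVec_add, halfArg_latVec, pairing_add, pairing_single,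
    pairing_single]

theorem exists_hatPair_eV (hk : 1 ≤ k) (hN : m * k + l₁ + l₂ ≤ N)
    (j : Fin (dimPlane N k m l₁ l₂)) : ∃ i : Fin N,
      hatPair N k m l₁ l₂ (eV i) = (blockVec N k m l₁ l₂ j, 0) ∧
      coordClass N k m l₁ l₂ hN i = j.castSucc.castSucc := by
  by_contra h
  rw [not_exists] at h
  have h1 := sum_coordClass hk hN j.castSucc.castSucc
  rw [sum_eq_zero fun i _ => if_neg fun hi => h i ⟨?_, hi⟩] at h1
  · have h2 := blockSize_pos (m := m) hk j
    exact Nat.cast_ne_zero.2 h2.ne' (by simpa [classSize] using h1.symm : (blockSize k m j : ℂ) = 0)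
  · rw [hatPair_eV hk hN, hi, ← classVec_block]
    rfl

theorem latVec_mem_hatPairs (hk : 1 ≤ k) (hN : m * k + l₁ + l₂ ≤ N)
    {β : Fin (dimPlane N k m l₁ l₂) → ℤ} (hβ : β ∈ posRoots (dimPlane N k m l₁ l₂)) :
    (latVec N k m l₁ l₂ β, 0) ∈ hatPairs N k m l₁ l₂ := by
  have h0 : (latVec N k m l₁ l₂ β, (0 : ZMod 2)) ≠ 0 := fun h => by
    have h1 : β = 0 := latVec_injective hk ((congrArg Prod.fst h).trans (by funext j; simp [latVec]))
    rw [h1] at hβ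
    simpa [normSq] using normSq_pos hβ
  rcases mem_posRoots.1 hβ with ⟨j, rfl⟩ | ⟨j, rfl⟩ | ⟨j, j', hj, rfl⟩ | ⟨j, j', hj, rfl⟩
  · obtain ⟨i, h1, -⟩ := exists_hatPair_eV hk hN j
    exact mem_hatPairs_of_cHat h0 (mem_posRoots.2 (Or.inl ⟨i, rfl⟩)) (by rw [h1, latVec_eV])
  · obtain ⟨i, h1, -⟩ := exists_hatPair_eV hk hN j
    refine mem_hatPairs_of_cHat h0 (mem_posRoots.2 (Or.inr (Or.inl ⟨i, rfl⟩))) ?_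
    rw [two_smul ℕ, hatPair_add, h1, Prod.mk_add_mk, add_zero, two_smul ℕ, latVec_add, latVec_eV]
  all_goals
    obtain ⟨i, h1, h2⟩ := exists_hatPair_eV hk hN j
    obtain ⟨i', h3, h4⟩ := exists_hatPair_eV hk hN j'
    have hi : i < i' := by
      by_contra h
      have := coordClass_mono (k := k) (m := m) hN (not_lt.1 h)
      rw [h2, h4] at this
      exact absurd hj (not_lt.2 (by simpa using this))
  · refine mem_hatPairs_of_cHat h0 (mem_posRoots.2 (Or.inr (Or.inr (Or.inl ⟨i, i', hi, rfl⟩)))) ?_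
    rw [hatPair_sub, h1, h3, Prod.mk_sub_mk, sub_zero, latVec_sub, latVec_eV, latVec_eV]
  · refine mem_hatPairs_of_cHat h0 (mem_posRoots.2 (Or.inr (Or.inr (Or.inr ⟨i, i', hi, rfl⟩)))) ?_
    rw [hatPair_add, h1, h3, Prod.mk_add_mk, add_zero, latVec_add, latVec_eV, latVec_eV]

theorem sum_lt_add_swap {d : ℕ} (w : Fin d → Fin d → ℂ) (h : ∀ j, w j j = 0) :
    (∑ j, ∑ i, if j < i then w j i + w i j else 0) = ∑ j, ∑ i, w j i := by
  rw [← sub_eq_zero]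
  simp only [← sum_sub_distrib]
  refine sum_eq_zero_of_antisymm _ fun j i => ?_
  rcases lt_trichotomy j i with h1 | h1 | h1
  · simp only [if_pos h1, if_neg h1.not_gt]
    ring
  · subst h1
    simp [h]
  · simp only [if_pos h1, if_neg h1.not_gt]
    ring

/-- Components of weighted sums of the restricted roots. -/
theorem sum_hatPairs_coord (hk : 1 ≤ k) (hN : m * k + l₁ + l₂ ≤ N) (c₁ c₂ c₃ : ℂ)
    (Z : (Fin (dimPlane N k m l₁ l₂) → ℂ) × ZMod 2 → ℂ)
    (w : Fin (dimPlane N k m l₁ l₂) → Fin (dimPlane N k m l₁ l₂) → ℂ) (hw : ∀ j, w j j = 0)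
    (h : ∀ j i, j < i → Z (blockVec N k m l₁ l₂ j - blockVec N k m l₁ l₂ i, 0) +
      Z (blockVec N k m l₁ l₂ j + blockVec N k m l₁ l₂ i, 0) = w j i)
    (h' : ∀ j i, j < i → Z (blockVec N k m l₁ l₂ j + blockVec N k m l₁ l₂ i, 0) -
      Z (blockVec N k m l₁ l₂ j - blockVec N k m l₁ l₂ i, 0) = w i j)
    (j : Fin (dimPlane N k m l₁ l₂)) :
    ∑ q ∈ hatPairs N k m l₁ l₂, cHat N k m l₁ l₂ c₁ c₂ c₃ q * (q.1 j * Z q) =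
      invSqrt k m j * blockSize k m j * ((c₂ + 2 * l₁ * c₁) * Z (blockVec N k m l₁ l₂ j, 0) +
        2 * l₂ * c₁ * Z (blockVec N k m l₁ l₂ j, 1) +
        (2 * c₃ + (blockSize k m j - 1) * c₁) * Z (2 • blockVec N k m l₁ l₂ j, 0) +
        c₁ * ∑ i : Fin (dimPlane N k m l₁ l₂), blockSize k m i * w j i) := by
  rw [sum_hatPairs c₁ c₂ c₃ (fun q => q.1 j * Z q) (by simp)]
  refine (sum_mult_hatPair hk hN c₁ c₂ c₃ (fun q => q.1 j * Z q) (by simp) (by simp)).trans ?_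
  have e1 : ∀ a b : Fin (dimPlane N k m l₁ l₂), (if a < b then
        (blockSize k m a : ℂ) * blockSize k m b * c₁ *
        ((blockVec N k m l₁ l₂ a - blockVec N k m l₁ l₂ b) j *
          Z (blockVec N k m l₁ l₂ a - blockVec N k m l₁ l₂ b, 0) +
        (blockVec N k m l₁ l₂ a + blockVec N k m l₁ l₂ b) j *
          Z (blockVec N k m l₁ l₂ a + blockVec N k m l₁ l₂ b, 0)) else 0) =
      if a < b then
        (blockSize k m a : ℂ) * blockSize k m b * c₁ * (blockVec N k m l₁ l₂ a j * w a b) +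
        (blockSize k m b : ℂ) * blockSize k m a * c₁ * (blockVec N k m l₁ l₂ b j * w b a)
        else 0 := fun a b => by
    split_ifs with hab
    · rw [← h a b hab, ← h' a b hab, Pi.sub_apply, Pi.add_apply]
      ring
    · rfl
  simp only [e1]
  rw [sum_lt_add_swap (fun a b => (blockSize k m a : ℂ) * blockSize k m b * c₁ *
    (blockVec N k m l₁ l₂ a j * w a b)) (fun a => by simp [hw]), ← sum_add_distrib,
    sum_eq_single j]
  · have e2 : blockVec N k m l₁ l₂ j j = invSqrt k m j := by simp [blockVec]
    have e3 : (2 • blockVec N k m l₁ l₂ j) j = 2 * invSqrt k m j := by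
      rw [Pi.smul_apply, e2, nsmul_eq_mul, Nat.cast_ofNat]
    simp only [e2, e3]
    have e4 : ∑ b : Fin (dimPlane N k m l₁ l₂), (blockSize k m j : ℂ) * blockSize k m b * c₁ *
        (invSqrt k m j * w j b) =
        blockSize k m j * c₁ * invSqrt k m j * ∑ b : Fin (dimPlane N k m l₁ l₂), blockSize k m b * w j b := by
      rw [mul_sum]
      exact sum_congr rfl fun b _ => by ring
    rw [e4]
    ring
  · intro a _ ha
    have e2 : blockVec N k m l₁ l₂ a j = 0 := by simp [blockVec, ha.symm]
    have e3 : (2 • blockVec N k m l₁ l₂ a) j = 0 := by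
      rw [Pi.smul_apply, e2, smul_zero]
    simp [e2, e3]
  · simp

end Potential

section Potential

variable {N k m l₁ l₂ : ℕ}

theorem sinh_angle_ne_zero (hk : 1 ≤ k) (hN : m * k + l₁ + l₂ ≤ N)
    {y : Fin (dimPlane N k m l₁ l₂) → ℂ}
    (hs : ∀ q ∈ hatPairs N k m l₁ l₂, sinh (halfArg q y) ≠ 0)
    (j : Fin (dimPlane N k m l₁ l₂)) : sinh (angle k m y j) ≠ 0 := by
  have := hs _ (latVec_mem_hatPairs hk hN (mem_posRoots.2 (Or.inr (Or.inl ⟨j, rfl⟩))))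
  rwa [latVec_two_eV, halfArg_two_blockVec] at this

theorem sinh_angle_sub_ne_zero (hk : 1 ≤ k) (hN : m * k + l₁ + l₂ ≤ N)
    {y : Fin (dimPlane N k m l₁ l₂) → ℂ}
    (hs : ∀ q ∈ hatPairs N k m l₁ l₂, sinh (halfArg q y) ≠ 0)
    {j i : Fin (dimPlane N k m l₁ l₂)} (h : j < i) :
    sinh ((angle k m y j - angle k m y i) / 2) ≠ 0 := by
  have := hs _ (latVec_mem_hatPairs hk hN
    (mem_posRoots.2 (Or.inr (Or.inr (Or.inl ⟨j, i, h, rfl⟩)))))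
  rwa [latVec_sub, latVec_eV, latVec_eV, halfArg_sub] at this

theorem sinh_angle_add_ne_zero (hk : 1 ≤ k) (hN : m * k + l₁ + l₂ ≤ N)
    {y : Fin (dimPlane N k m l₁ l₂) → ℂ}
    (hs : ∀ q ∈ hatPairs N k m l₁ l₂, sinh (halfArg q y) ≠ 0)
    {j i : Fin (dimPlane N k m l₁ l₂)} (h : j < i) :
    sinh ((angle k m y j + angle k m y i) / 2) ≠ 0 := by
  have := hs _ (latVec_mem_hatPairs hk hN
    (mem_posRoots.2 (Or.inr (Or.inr (Or.inr ⟨j, i, h, rfl⟩)))))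
  rwa [latVec_add, latVec_eV, latVec_eV, halfArg_add] at this

theorem cosh_angle_sub_ne_zero (hk : 1 ≤ k) (hN : m * k + l₁ + l₂ ≤ N)
    {y : Fin (dimPlane N k m l₁ l₂) → ℂ}
    (hs : ∀ q ∈ hatPairs N k m l₁ l₂, sinh (halfArg q y) ≠ 0)
    {j i : Fin (dimPlane N k m l₁ l₂)} (h : j ≠ i) :
    cosh (angle k m y j) - cosh (angle k m y i) ≠ 0 := by
  rcases lt_or_gt_of_ne h with h | h
  · rw [cosh_sub_cosh]
    exact mul_ne_zero two_ne_zero (mul_ne_zero (sinh_angle_sub_ne_zero hk hN hs h)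
      (sinh_angle_add_ne_zero hk hN hs h))
  · rw [← neg_sub, cosh_sub_cosh]
    exact neg_ne_zero.2 (mul_ne_zero two_ne_zero (mul_ne_zero (sinh_angle_sub_ne_zero hk hN hs h)
      (sinh_angle_add_ne_zero hk hN hs h)))

theorem sum_hatPairs_coth (hk : 1 ≤ k) (hN : m * k + l₁ + l₂ ≤ N) (c₁ c₂ c₃ : ℂ)
    {y : Fin (dimPlane N k m l₁ l₂) → ℂ}
    (hs : ∀ q ∈ hatPairs N k m l₁ l₂, sinh (halfArg q y) ≠ 0)
    (j : Fin (dimPlane N k m l₁ l₂)) :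
    ∑ q ∈ hatPairs N k m l₁ l₂, cHat N k m l₁ l₂ c₁ c₂ c₃ q *
      (q.1 j * (cosh (halfArg q y) / sinh (halfArg q y))) =
    invSqrt k m j * blockSize k m j *
      (((c₂ + 2 * l₁ * c₁ + 2 * l₂ * c₁ + (2 * c₃ + (blockSize k m j - 1) * c₁)) *
        cosh (angle k m y j) + (c₂ + 2 * l₁ * c₁ - 2 * l₂ * c₁)) /
        sinh (angle k m y j) +
      c₁ * ∑ i : Fin (dimPlane N k m l₁ l₂), blockSize k m i * (2 * sinh (angle k m y j) /
        (cosh (angle k m y j) - cosh (angle k m y i)))) := by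
  have h0 := sinh_angle_ne_zero hk hN hs j
  rw [sum_hatPairs_coord hk hN c₁ c₂ c₃
    (fun q => cosh (halfArg q y) / sinh (halfArg q y))
    (fun a b => 2 * sinh (angle k m y a) /
        (cosh (angle k m y a) - cosh (angle k m y b))) (fun a => by simp)
    (fun a b hab => ?_) (fun a b hab => ?_)]
  · rw [halfArg_blockVec, halfArg_blockVec_shift, halfArg_two_blockVec, cosh_add_half_pi,
      sinh_add_half_pi, mul_div_mul_left _ _ Complex.I_ne_zero, coth_half h0, tanh_half h0]
    congr 2
    field_simp
    ring
  · rw [halfArg_sub, halfArg_add]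
    exact coth_sub_add_coth_add (sinh_angle_sub_ne_zero hk hN hs hab)
      (sinh_angle_add_ne_zero hk hN hs hab)
  · rw [halfArg_sub, halfArg_add]
    exact coth_add_sub_coth_sub (sinh_angle_sub_ne_zero hk hN hs hab)
      (sinh_angle_add_ne_zero hk hN hs hab)

theorem sum_hatPairs_one (hk : 1 ≤ k) (hN : m * k + l₁ + l₂ ≤ N) (c₁ c₂ c₃ : ℂ)
    (j : Fin (dimPlane N k m l₁ l₂)) :
    ∑ q ∈ hatPairs N k m l₁ l₂, cHat N k m l₁ l₂ c₁ c₂ c₃ q * q.1 j =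
    invSqrt k m j * blockSize k m j *
      (c₂ + 2 * l₁ * c₁ + 2 * l₂ * c₁ + (2 * c₃ + (blockSize k m j - 1) * c₁) +
      c₁ * ∑ i : Fin (dimPlane N k m l₁ l₂), (blockSize k m i : ℂ) * if j < i then 2 else 0) := by
  have h := sum_hatPairs_coord hk hN c₁ c₂ c₃ (fun _ => 1)
    (fun a b => if a < b then 2 else 0) (fun a => by simp)
    (fun a b hab => by rw [if_pos hab]; norm_num)
    (fun a b hab => by rw [if_neg hab.not_gt]; norm_num) j
  simp only [mul_one] at h
  exact h

theorem cHat_double_blockVec (hk : 1 ≤ k) (hN : m * k + l₁ + l₂ ≤ N) (c₁ c₂ c₃ : ℂ)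
    (j : Fin (dimPlane N k m l₁ l₂)) (t : ZMod 2) :
    cHat N k m l₁ l₂ c₁ c₂ c₃ ((blockVec N k m l₁ l₂ j, t) + (blockVec N k m l₁ l₂ j, t)) =
      blockSize k m j * (2 * c₃ + (blockSize k m j - 1) * c₁) / 2 := by
  have h1 : t + t = 0 := by
    revert t
    decide
  rw [Prod.mk_add_mk, h1, ← latVec_eV, ← latVec_add, ← two_smul ℕ,
    cHat_latVec_of_mem hk hN c₁ c₂ c₃ (mem_posRoots.2 (Or.inr (Or.inl ⟨j, rfl⟩))), latMult_two_eV]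

theorem hatNormSq_blockVec (j : Fin (dimPlane N k m l₁ l₂)) (t : ZMod 2) :
    hatNormSq (blockVec N k m l₁ l₂ j, t) = invSqrt k m j ^ 2 := by
  rw [hatNormSq, sum_eq_single j]
  · simp [blockVec]
  · intro i _ h
    simp [blockVec, h]
  · simp

theorem hatNormSq_two_blockVec (j : Fin (dimPlane N k m l₁ l₂)) :
    hatNormSq (2 • blockVec N k m l₁ l₂ j, 0) = 4 * invSqrt k m j ^ 2 := by
  rw [← hatNormSq_blockVec j 0, hatNormSq, hatNormSq, mul_sum]
  refine sum_congr rfl fun i _ => ?_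
  change ((2 : ℕ) • blockVec N k m l₁ l₂ j i) ^ 2 = 4 * blockVec N k m l₁ l₂ j i ^ 2
  rw [nsmul_eq_mul]
  push_cast
  ring

theorem hatNormSq_sub {j i : Fin (dimPlane N k m l₁ l₂)} (h : j ≠ i) :
    hatNormSq (blockVec N k m l₁ l₂ j - blockVec N k m l₁ l₂ i, 0) =
      invSqrt k m j ^ 2 + invSqrt k m i ^ 2 := by
  rw [hatNormSq, sum_eq_add j i h]
  · simp [blockVec, h, h.symm]
  · rintro a - ⟨h1, h2⟩
    simp [blockVec, h1, h2]
  · simp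
  · simp

theorem hatNormSq_add {j i : Fin (dimPlane N k m l₁ l₂)} (h : j ≠ i) :
    hatNormSq (blockVec N k m l₁ l₂ j + blockVec N k m l₁ l₂ i, 0) =
      invSqrt k m j ^ 2 + invSqrt k m i ^ 2 := by
  rw [hatNormSq, sum_eq_add j i h]
  · simp [blockVec, h, h.symm]
  · rintro a - ⟨h1, h2⟩
    simp [blockVec, h1, h2]
  · simp
  · simp

/-- The potential in coordinates. -/
theorem sum_hatPairs_potential (hk : 1 ≤ k) (hN : m * k + l₁ + l₂ ≤ N) (c₁ c₂ c₃ : ℂ)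
    {y : Fin (dimPlane N k m l₁ l₂) → ℂ}
    (hs : ∀ q ∈ hatPairs N k m l₁ l₂, sinh (halfArg q y) ≠ 0) :
    ∑ q ∈ hatPairs N k m l₁ l₂, cHat N k m l₁ l₂ c₁ c₂ c₃ q *
      ((cHat N k m l₁ l₂ c₁ c₂ c₃ q + 2 * cHat N k m l₁ l₂ c₁ c₂ c₃ (q + q)) * hatNormSq q /
        sinh (halfArg q y) ^ 2) =
    ∑ j : Fin (dimPlane N k m l₁ l₂), blockSize k m j *
      ((c₂ + 2 * l₁ * c₁ + 2 * l₂ * c₁ + (2 * c₃ + (blockSize k m j - 1) * c₁)) ^ 2 +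
        (c₂ + 2 * l₁ * c₁ - 2 * l₂ * c₁) ^ 2 +
        2 * (c₂ + 2 * l₁ * c₁ + 2 * l₂ * c₁ + (2 * c₃ + (blockSize k m j - 1) * c₁)) *
        (c₂ + 2 * l₁ * c₁ - 2 * l₂ * c₁) * cosh (angle k m y j)) /
        sinh (angle k m y j) ^ 2 +
    ∑ j : Fin (dimPlane N k m l₁ l₂), ∑ i : Fin (dimPlane N k m l₁ l₂), if j < i then
      4 * c₁ ^ 2 * blockSize k m j * blockSize k m i * (blockSize k m j + blockSize k m i) *
        (cosh (angle k m y j) * cosh (angle k m y i) - 1) /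
        (cosh (angle k m y j) - cosh (angle k m y i)) ^ 2 else 0 := by
  rw [sum_hatPairs c₁ c₂ c₃ (fun q =>
    (cHat N k m l₁ l₂ c₁ c₂ c₃ q + 2 * cHat N k m l₁ l₂ c₁ c₂ c₃ (q + q)) * hatNormSq q /
        sinh (halfArg q y) ^ 2) (by simp [hatNormSq])]
  refine (sum_mult_hatPair hk hN c₁ c₂ c₃ (fun q =>
    (cHat N k m l₁ l₂ c₁ c₂ c₃ q + 2 * cHat N k m l₁ l₂ c₁ c₂ c₃ (q + q)) * hatNormSq q /
        sinh (halfArg q y) ^ 2) (by simp [hatNormSq]) (by simp [hatNormSq])).trans ?_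
  have hκ : ∀ j : Fin (dimPlane N k m l₁ l₂), (blockSize k m j : ℂ) * invSqrt k m j ^ 2 = 1 :=
    fun j => blockSize_mul_invSqrt_sq hk j
  congr 1
  · refine sum_congr rfl fun j _ => ?_
    have h0 := sinh_angle_ne_zero hk hN hs j
    have h1 : cHat N k m l₁ l₂ c₁ c₂ c₃ (blockVec N k m l₁ l₂ j, 0) =
        blockSize k m j * (c₂ + 2 * l₁ * c₁) := by
      rw [← latVec_eV, cHat_latVec_of_mem hk hN c₁ c₂ c₃ (mem_posRoots.2 (Or.inl ⟨j, rfl⟩)),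
        latMult_eV]
    have h2 : cHat N k m l₁ l₂ c₁ c₂ c₃ (2 • blockVec N k m l₁ l₂ j, 0) =
        blockSize k m j * (2 * c₃ + (blockSize k m j - 1) * c₁) / 2 := by
      rw [← latVec_two_eV, cHat_latVec_of_mem hk hN c₁ c₂ c₃
        (mem_posRoots.2 (Or.inr (Or.inl ⟨j, rfl⟩))), latMult_two_eV]
    have h3 : cHat N k m l₁ l₂ c₁ c₂ c₃ ((2 • blockVec N k m l₁ l₂ j, 0) +
        (2 • blockVec N k m l₁ l₂ j, 0)) = 0 := by
      rw [← latVec_two_eV]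
      exact cHat_two_latVec hk hN c₁ c₂ c₃ (by rw [normSq_two_single]; norm_num)
    have h4 := two_sinh_sq_half (angle k m y j)
    have h5 := two_cosh_sq_half (angle k m y j)
    have h6 := Complex.cosh_sq (angle k m y j)
    have h7 : cosh (angle k m y j) - 1 ≠ 0 := fun h => h0 (by
      have : sinh (angle k m y j) ^ 2 = 0 := by
        linear_combination -h6 + (cosh (angle k m y j) + 1) * h
      exact pow_eq_zero_iff two_ne_zero |>.1 this)
    have h8 : cosh (angle k m y j) + 1 ≠ 0 := fun h => h0 (by
      have : sinh (angle k m y j) ^ 2 = 0 := by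
        linear_combination -h6 + (cosh (angle k m y j) - 1) * h
      exact pow_eq_zero_iff two_ne_zero |>.1 this)
    have h9 : sinh (angle k m y j) ^ 2 =
        (cosh (angle k m y j) - 1) * (cosh (angle k m y j) + 1) := by
      linear_combination -h6
    have h10 : sinh (angle k m y j / 2) ^ 2 = (cosh (angle k m y j) - 1) / 2 := by
      linear_combination h4 / 2
    have h11 : sinh (angle k m y j / 2 + Real.pi * Complex.I / 2) ^ 2 =
        -((cosh (angle k m y j) + 1) / 2) := by
      rw [sinh_add_half_pi, mul_pow, Complex.I_sq]
      linear_combination -h5 / 2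
    rw [h1, h2, h3, cHat_shift hk hN, cHat_double_blockVec hk hN, cHat_double_blockVec hk hN,
      hatNormSq_blockVec, hatNormSq_blockVec, hatNormSq_two_blockVec, halfArg_blockVec,
      halfArg_blockVec_shift, halfArg_two_blockVec, h10, h11, h9]
    have hκj := hκ j
    generalize cosh (angle k m y j) = X at *
    generalize (blockSize k m j : ℂ) = κ at *
    generalize invSqrt k m j = ν at *
    field_simp
    linear_combination (4 * κ * ((c₂ + 2 * l₁ * c₁ + 2 * l₂ * c₁ + (2 * c₃ + (κ - 1) * c₁)) ^ 2 +
        (c₂ + 2 * l₁ * c₁ - 2 * l₂ * c₁) ^ 2 +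
        2 * (c₂ + 2 * l₁ * c₁ + 2 * l₂ * c₁ + (2 * c₃ + (κ - 1) * c₁)) *
        (c₂ + 2 * l₁ * c₁ - 2 * l₂ * c₁) * X)) * hκj
  · refine sum_congr rfl fun j _ => sum_congr rfl fun i _ => ?_
    split_ifs with h
    · have h1 := csch_sq_sub_add_csch_sq_add (sinh_angle_sub_ne_zero hk hN hs h)
        (sinh_angle_add_ne_zero hk hN hs h)
      have h2 : cHat N k m l₁ l₂ c₁ c₂ c₃
          (blockVec N k m l₁ l₂ j - blockVec N k m l₁ l₂ i, 0) =
          blockSize k m j * blockSize k m i * c₁ := by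
        rw [← latVec_eV, ← latVec_eV, ← latVec_sub, cHat_latVec_of_mem hk hN c₁ c₂ c₃
          (mem_posRoots.2 (Or.inr (Or.inr (Or.inl ⟨j, i, h, rfl⟩)))), latMult_sub _ _ _ h.ne]
      have h3 : cHat N k m l₁ l₂ c₁ c₂ c₃
          (blockVec N k m l₁ l₂ j + blockVec N k m l₁ l₂ i, 0) =
          blockSize k m j * blockSize k m i * c₁ := by
        rw [← latVec_eV, ← latVec_eV, ← latVec_add, cHat_latVec_of_mem hk hN c₁ c₂ c₃
          (mem_posRoots.2 (Or.inr (Or.inr (Or.inr ⟨j, i, h, rfl⟩)))), latMult_add _ _ _ h.ne]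
      have h4 : cHat N k m l₁ l₂ c₁ c₂ c₃ ((blockVec N k m l₁ l₂ j - blockVec N k m l₁ l₂ i, 0) +
          (blockVec N k m l₁ l₂ j - blockVec N k m l₁ l₂ i, 0)) = 0 := by
        rw [← latVec_eV, ← latVec_eV, ← latVec_sub]
        exact cHat_two_latVec hk hN c₁ c₂ c₃ (by rw [BCN.normSq_sub h.ne]; norm_num)
      have h5 : cHat N k m l₁ l₂ c₁ c₂ c₃ ((blockVec N k m l₁ l₂ j + blockVec N k m l₁ l₂ i, 0) +
          (blockVec N k m l₁ l₂ j + blockVec N k m l₁ l₂ i, 0)) = 0 := by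
        rw [← latVec_eV, ← latVec_eV, ← latVec_add]
        exact cHat_two_latVec hk hN c₁ c₂ c₃ (by rw [BCN.normSq_add h.ne]; norm_num)
      rw [h2, h3, h4, h5, hatNormSq_sub h.ne, hatNormSq_add h.ne, halfArg_sub, halfArg_add]
      have h6 : (blockSize k m j : ℂ) * blockSize k m i * (invSqrt k m j ^ 2 + invSqrt k m i ^ 2) =
          blockSize k m j + blockSize k m i := by
        linear_combination (blockSize k m i : ℂ) * hκ j + (blockSize k m j : ℂ) * hκ i
      rw [mul_zero, add_zero]
      linear_combination (blockSize k m j * blockSize k m i * c₁ ^ 2 *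
        (blockSize k m j + blockSize k m i) : ℂ) * h1 +
        (blockSize k m j * blockSize k m i * c₁ ^ 2 *
        (1 / sinh ((angle k m y j - angle k m y i) / 2) ^ 2 +
          1 / sinh ((angle k m y j + angle k m y i) / 2) ^ 2) : ℂ) * h6
    · rfl

theorem sum_sq_hatPairs_coth (hk : 1 ≤ k) (hN : m * k + l₁ + l₂ ≤ N) (c₁ c₂ c₃ : ℂ)
    {y : Fin (dimPlane N k m l₁ l₂) → ℂ}
    (hs : ∀ q ∈ hatPairs N k m l₁ l₂, sinh (halfArg q y) ≠ 0) :
    ∑ j, (∑ q ∈ hatPairs N k m l₁ l₂, cHat N k m l₁ l₂ c₁ c₂ c₃ q *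
      (q.1 j * (cosh (halfArg q y) / sinh (halfArg q y)))) ^ 2 =
    ∑ j, (∑ q ∈ hatPairs N k m l₁ l₂, cHat N k m l₁ l₂ c₁ c₂ c₃ q * q.1 j) ^ 2 +
    ∑ q ∈ hatPairs N k m l₁ l₂, cHat N k m l₁ l₂ c₁ c₂ c₃ q *
      ((cHat N k m l₁ l₂ c₁ c₂ c₃ q + 2 * cHat N k m l₁ l₂ c₁ c₂ c₃ (q + q)) * hatNormSq q /
        sinh (halfArg q y) ^ 2) := by
  have hκ : ∀ (j : Fin (dimPlane N k m l₁ l₂)) (z : ℂ),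
      (invSqrt k m j * blockSize k m j * z) ^ 2 = blockSize k m j * z ^ 2 := fun j z => by
    linear_combination blockSize k m j * z ^ 2 * blockSize_mul_invSqrt_sq (m := m) hk j
  rw [sum_hatPairs_potential hk hN c₁ c₂ c₃ hs]
  simp only [sum_hatPairs_coth hk hN c₁ c₂ c₃ hs, sum_hatPairs_one hk hN, hκ]
  rw [sum_mul_sq_sub (fun j => by rw [Complex.cosh_sq]; ring)
    (fun j => sinh_angle_ne_zero hk hN hs j) (fun j i h => cosh_angle_sub_ne_zero hk hN hs h)
    (fun j i => by ring), add_assoc]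

end Potential

section Gauge

variable {d : ℕ} {y₀ : Fin d → ℂ}

theorem fderiv_eq_sum (h : (Fin d → ℂ) → ℂ) (y ξ : Fin d → ℂ) :
    fderiv ℂ h y ξ = ∑ j, ξ j * fderiv ℂ h y (Pi.single j 1) := by
  have e : ξ = ∑ j, ξ j • (Pi.single j 1 : Fin d → ℂ) := by
    funext i
    simp [Pi.single_apply]
  conv_lhs => rw [e, map_sum]
  exact sum_congr rfl fun j _ => by rw [map_smul, smul_eq_mul]

theorem fderiv_exp_mul {G h : (Fin d → ℂ) → ℂ} {y : Fin d → ℂ} (hG : AnalyticAt ℂ G y)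
    (hh : AnalyticAt ℂ h y) (ξ : Fin d → ℂ) :
    fderiv ℂ (fun z => exp (G z) * h z) y ξ =
      exp (G y) * (fderiv ℂ h y ξ + fderiv ℂ G y ξ * h y) := by
  have h1 : HasFDerivAt (fun z => exp (G z) * h z) _ y :=
    hG.differentiableAt.hasFDerivAt.cexp.mul hh.differentiableAt.hasFDerivAt
  rw [h1.fderiv]
  simp only [add_apply, smul_apply, smul_eq_mul]
  ring

theorem fderiv_fderiv_exp_mul {G h : (Fin d → ℂ) → ℂ} {y : Fin d → ℂ} (hG : AnalyticAt ℂ G y)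
    (hh : AnalyticAt ℂ h y) (ξ : Fin d → ℂ) :
    fderiv ℂ (fun z => fderiv ℂ (fun z => exp (G z) * h z) z ξ) y ξ =
      exp (G y) * (fderiv ℂ (fun z => fderiv ℂ h z ξ) y ξ +
        2 * fderiv ℂ G y ξ * fderiv ℂ h y ξ +
        (fderiv ℂ (fun z => fderiv ℂ G z ξ) y ξ + fderiv ℂ G y ξ ^ 2) * h y) := by
  have e : (fun z => fderiv ℂ (fun z => exp (G z) * h z) z ξ) =ᶠ[𝓝 y]
      fun z => exp (G z) * (fderiv ℂ h z ξ + fderiv ℂ G z ξ * h z) := by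
    filter_upwards [hG.eventually_analyticAt, hh.eventually_analyticAt] with z h1 h2
    exact fderiv_exp_mul h1 h2 ξ
  have h1 := AnalyticAt.dirDeriv hh ξ
  have h2 := AnalyticAt.dirDeriv hG ξ
  rw [e.fderiv_eq, fderiv_exp_mul (h := fun z => fderiv ℂ h z ξ + fderiv ℂ G z ξ * h z) hG
    (h1.add (h2.mul hh))]
  have h3 := h1.differentiableAt.hasFDerivAt.add
    (h2.differentiableAt.hasFDerivAt.mul hh.differentiableAt.hasFDerivAt)
  have h4 : fderiv ℂ (fun z => fderiv ℂ h z ξ + fderiv ℂ G z ξ * h z) y ξ =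
      fderiv ℂ (fun z => fderiv ℂ h z ξ) y ξ + (fderiv ℂ G y ξ * fderiv ℂ h y ξ +
        h y * fderiv ℂ (fun z => fderiv ℂ G z ξ) y ξ) := by
    exact congrArg (fun L : (Fin d → ℂ) →L[ℂ] ℂ => L ξ) h3.fderiv
  refine (congrArg (fun t => exp (G y) * (t + _)) h4).trans ?_
  ring

theorem fderiv_halfArg (q : (Fin d → ℂ) × ZMod 2) (y ξ : Fin d → ℂ) :
    fderiv ℂ (halfArg q) y ξ = (∑ j, q.1 j * ξ j) / 2 := by
  have h1 : HasFDerivAt (fun y : Fin d → ℂ => ∑ j, q.1 j * y j)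
      (∑ j, q.1 j • (ContinuousLinearMap.proj (R := ℂ) j : (Fin d → ℂ) →L[ℂ] ℂ)) y :=
    HasFDerivAt.fun_sum fun j _ =>
      (ContinuousLinearMap.proj (R := ℂ) j : (Fin d → ℂ) →L[ℂ] ℂ).hasFDerivAt.const_mul (q.1 j)
  have h2 : HasFDerivAt (halfArg q) _ y := (h1.add_const (Real.pi * Complex.I * (q.2.val : ℂ))).mul_const
    (2 : ℂ)⁻¹
  rw [h2.fderiv]
  simp only [smul_apply, sum_apply, ContinuousLinearMap.proj_apply, smul_eq_mul]
  ring

theorem fderiv_coth_halfArg {q : (Fin d → ℂ) × ZMod 2} {y : Fin d → ℂ}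
    (h : sinh (halfArg q y) ≠ 0) (ξ : Fin d → ℂ) :
    fderiv ℂ (fun y => cosh (halfArg q y) / sinh (halfArg q y)) y ξ =
      -((∑ j, q.1 j * ξ j) / (2 * sinh (halfArg q y) ^ 2)) := by
  have h1 := ((Complex.hasDerivAt_cosh (halfArg q y)).div (Complex.hasDerivAt_sinh (halfArg q y)) h)
  have h2 : HasFDerivAt (fun y => cosh (halfArg q y) / sinh (halfArg q y)) _ y :=
    h1.comp_hasFDerivAt y (analyticAt_halfArg q y).differentiableAt.hasFDerivAt
  rw [h2.fderiv, smul_apply, fderiv_halfArg, smul_eq_mul, ← sq, ← sq, Complex.cosh_sq]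
  field_simp
  ring

theorem fderiv_of_exp_eq_sinh {q : (Fin d → ℂ) × ZMod 2} {y : Fin d → ℂ}
    {l : (Fin d → ℂ) → ℂ} (hl : AnalyticAt ℂ l y)
    (h : ∀ᶠ z in 𝓝 y, exp (l z) = sinh (halfArg q z)) (ξ : Fin d → ℂ) :
    fderiv ℂ l y ξ = (∑ j, q.1 j * ξ j) / 2 *
      (cosh (halfArg q y) / sinh (halfArg q y)) := by
  have h1 := hl.differentiableAt.hasFDerivAt.cexp.fderiv
  have h2 : HasFDerivAt (fun y => sinh (halfArg q y)) _ y :=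
    (Complex.hasDerivAt_sinh (halfArg q y)).comp_hasFDerivAt y
      (analyticAt_halfArg q y).differentiableAt.hasFDerivAt
  have h3 := (show (fun z => exp (l z)) =ᶠ[𝓝 y] fun z => sinh (halfArg q z)
    from h).fderiv_eq (𝕜 := ℂ)
  rw [h1, h2.fderiv] at h3
  have h4 := congrArg (fun L : (Fin d → ℂ) →L[ℂ] ℂ => L ξ) h3
  simp only [smul_apply, smul_eq_mul, fderiv_halfArg] at h4
  have h5 := Complex.exp_ne_zero (l y)
  rw [h.self_of_nhds] at h4 h5
  field_simp at h4 ⊢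
  linear_combination h4

variable {N k m l₁ l₂ : ℕ}

section LogGauge

variable {y₀ : Fin (dimPlane N k m l₁ l₂) → ℂ}
  {ℓ : (Fin (dimPlane N k m l₁ l₂) → ℂ) × ZMod 2 → (Fin (dimPlane N k m l₁ l₂) → ℂ) → ℂ}

theorem IsLogBranch.analyticAt_logGauge (hℓ : IsLogBranch y₀ ℓ) (c₁ c₂ c₃ : ℂ) :
    AnalyticAt ℂ (logGauge c₁ c₂ c₃ ℓ) y₀ :=
  Finset.analyticAt_fun_sum _ fun q hq => analyticAt_const.mul (hℓ q hq).1

theorem IsLogBranch.fderiv_logGauge (hℓ : IsLogBranch y₀ ℓ) (c₁ c₂ c₃ : ℂ) :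
    ∀ᶠ y in 𝓝 y₀, ∀ ξ, fderiv ℂ (logGauge c₁ c₂ c₃ ℓ) y ξ =
      ∑ q ∈ hatPairs N k m l₁ l₂, cHat N k m l₁ l₂ c₁ c₂ c₃ q * ((∑ j, q.1 j * ξ j) / 2 *
        (cosh (halfArg q y) / sinh (halfArg q y))) := by
  have h1 : ∀ᶠ y in 𝓝 y₀, ∀ q ∈ hatPairs N k m l₁ l₂, AnalyticAt ℂ (ℓ q) y ∧
      ∀ᶠ z in 𝓝 y, exp (ℓ q z) = sinh (halfArg q z) :=
    (Finset.eventually_all _).2 fun q hq =>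
      (hℓ q hq).1.eventually_analyticAt.and (hℓ q hq).2.eventually_nhds
  filter_upwards [h1] with y h2 ξ
  have h3 : HasFDerivAt (logGauge c₁ c₂ c₃ ℓ) _ y := HasFDerivAt.fun_sum fun q hq =>
    (h2 q hq).1.differentiableAt.hasFDerivAt.const_mul (cHat N k m l₁ l₂ c₁ c₂ c₃ q)
  rw [h3.fderiv]
  simp only [sum_apply, smul_apply, smul_eq_mul]
  exact sum_congr rfl fun q hq => by rw [fderiv_of_exp_eq_sinh (h2 q hq).1 (h2 q hq).2]

/-- Conjugation of the scalar part by the gauge function. -/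
theorem IsLogBranch.radial_identity (hℓ : IsLogBranch y₀ ℓ) (hk : 1 ≤ k)
    (hN : m * k + l₁ + l₂ ≤ N) (c₁ c₂ c₃ : ℂ)
    (hs : ∀ᶠ y in 𝓝 y₀, ∀ q ∈ hatPairs N k m l₁ l₂, sinh (halfArg q y) ≠ 0)
    {h : (Fin (dimPlane N k m l₁ l₂) → ℂ) → ℂ} (hh : ∀ᶠ y in 𝓝 y₀, AnalyticAt ℂ h y) :
    ∀ᶠ y in 𝓝 y₀,
      ∑ j, fderiv ℂ (fun z => fderiv ℂ (fun z => exp (logGauge c₁ c₂ c₃ ℓ z) * h z) z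
        (Pi.single j 1)) y (Pi.single j 1) -
      ∑ q ∈ hatPairs N k m l₁ l₂, cHat N k m l₁ l₂ c₁ c₂ c₃ q *
        (cosh (halfArg q y) / sinh (halfArg q y) *
          fderiv ℂ (fun z => exp (logGauge c₁ c₂ c₃ ℓ z) * h z) y q.1) =
      exp (logGauge c₁ c₂ c₃ ℓ y) *
        (∑ j, fderiv ℂ (fun z => fderiv ℂ h z (Pi.single j 1)) y (Pi.single j 1) -
        ∑ q ∈ hatPairs N k m l₁ l₂,
          (cHat N k m l₁ l₂ c₁ c₂ c₃ q *
            (cHat N k m l₁ l₂ c₁ c₂ c₃ q + 2 * cHat N k m l₁ l₂ c₁ c₂ c₃ (q + q)) * hatNormSq q +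
            hatNormSq q * cHat N k m l₁ l₂ c₁ c₂ c₃ q) *
          (1 / (4 * sinh (halfArg q y) ^ 2) * h y) -
        (∑ j, (∑ q ∈ hatPairs N k m l₁ l₂, cHat N k m l₁ l₂ c₁ c₂ c₃ q * q.1 j) ^ 2) / 4 * h y) := by
  set G := logGauge c₁ c₂ c₃ ℓ with hG
  have hGa := (hℓ.analyticAt_logGauge c₁ c₂ c₃).eventually_analyticAt
  have h1 : ∀ᶠ y in 𝓝 y₀, ∀ j, fderiv ℂ G y (Pi.single j 1) =
      (∑ q ∈ hatPairs N k m l₁ l₂, cHat N k m l₁ l₂ c₁ c₂ c₃ q *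
        (q.1 j * (cosh (halfArg q y) / sinh (halfArg q y)))) / 2 := by
    filter_upwards [hℓ.fderiv_logGauge c₁ c₂ c₃] with y h2 j
    rw [hG, h2, sum_div]
    refine sum_congr rfl fun q _ => ?_
    have : ∑ i, q.1 i * (Pi.single j 1 : Fin (dimPlane N k m l₁ l₂) → ℂ) i = q.1 j := by
      simp [Pi.single_apply]
    rw [this]
    ring
  filter_upwards [h1.eventually_nhds, hs, hh, hGa] with y g1 g2 g3 g4
  have e1 : ∀ j, fderiv ℂ (fun z => fderiv ℂ G z (Pi.single j 1)) y (Pi.single j 1) =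
      -∑ q ∈ hatPairs N k m l₁ l₂, cHat N k m l₁ l₂ c₁ c₂ c₃ q *
        (q.1 j ^ 2 / (4 * sinh (halfArg q y) ^ 2)) := by
    intro j
    have e2 : (fun z => fderiv ℂ G z (Pi.single j 1)) =ᶠ[𝓝 y] fun z =>
        ∑ q ∈ hatPairs N k m l₁ l₂, (cHat N k m l₁ l₂ c₁ c₂ c₃ q * q.1 j / 2) *
        (cosh (halfArg q z) / sinh (halfArg q z)) := by
      filter_upwards [g1] with z hz
      rw [hz, sum_div]
      exact sum_congr rfl fun q _ => by ring
    have e3 := HasFDerivAt.fun_sum (u := hatPairs N k m l₁ l₂) (x := y)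
      (A := fun q z => (cHat N k m l₁ l₂ c₁ c₂ c₃ q * q.1 j / 2) *
        (cosh (halfArg q z) / sinh (halfArg q z))) fun q hq =>
        ((DifferentiableAt.hasFDerivAt (𝕜 := ℂ)
          (ev_coth (ContinuousAt.eventually_ne (Complex.continuous_sinh.continuousAt.comp
            (analyticAt_halfArg q y).continuousAt) (g2 q hq))).self_of_nhds.differentiableAt).const_mul
            (cHat N k m l₁ l₂ c₁ c₂ c₃ q * q.1 j / 2))
    rw [e2.fderiv_eq, e3.fderiv, sum_apply, ← sum_neg_distrib]
    refine sum_congr rfl fun q hq => ?_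
    have : ∑ i, q.1 i * (Pi.single j 1 : Fin (dimPlane N k m l₁ l₂) → ℂ) i = q.1 j := by
      simp [Pi.single_apply]
    rw [smul_apply, fderiv_coth_halfArg (g2 q hq), this, smul_eq_mul]
    ring
  have g5 := g1.self_of_nhds
  have e4 := sum_sq_hatPairs_coth hk hN c₁ c₂ c₃ g2
  set A : Fin (dimPlane N k m l₁ l₂) → ℂ := fun j =>
    ∑ q ∈ hatPairs N k m l₁ l₂, cHat N k m l₁ l₂ c₁ c₂ c₃ q *
        (q.1 j * (cosh (halfArg q y) / sinh (halfArg q y))) with hA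
  have e5 : ∑ q ∈ hatPairs N k m l₁ l₂, cHat N k m l₁ l₂ c₁ c₂ c₃ q *
        (cosh (halfArg q y) / sinh (halfArg q y) *
          fderiv ℂ (fun z => exp (G z) * h z) y q.1) =
      ∑ j, A j * (exp (G y) * (fderiv ℂ h y (Pi.single j 1) + A j / 2 * h y)) := by
    have e0 : ∀ q : (Fin (dimPlane N k m l₁ l₂) → ℂ) × ZMod 2,
        fderiv ℂ (fun z => exp (G z) * h z) y q.1 = ∑ j, q.1 j *
          (exp (G y) * (fderiv ℂ h y (Pi.single j 1) + A j / 2 * h y)) := fun q => by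
      rw [fderiv_eq_sum]
      exact sum_congr rfl fun j _ => by rw [fderiv_exp_mul g4 g3, g5]
    rw [sum_congr rfl fun q _ => by rw [e0 q, mul_sum, mul_sum],
      sum_comm]
    refine sum_congr rfl fun j _ => ?_
    generalize exp (G y) * (fderiv ℂ h y (Pi.single j 1) + A j / 2 * h y) = B
    rw [hA, sum_mul]
    exact sum_congr rfl fun q _ => by ring
  have e6 : ∑ j, ∑ q ∈ hatPairs N k m l₁ l₂, cHat N k m l₁ l₂ c₁ c₂ c₃ q *
        (q.1 j ^ 2 / (4 * sinh (halfArg q y) ^ 2)) =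
      ∑ q ∈ hatPairs N k m l₁ l₂, hatNormSq q * cHat N k m l₁ l₂ c₁ c₂ c₃ q *
        (1 / (4 * sinh (halfArg q y) ^ 2)) := by
    rw [sum_comm]
    refine sum_congr rfl fun q _ => ?_
    rw [hatNormSq, sum_mul, sum_mul]
    exact sum_congr rfl fun j _ => by ring
  have e7 : ∑ q ∈ hatPairs N k m l₁ l₂, cHat N k m l₁ l₂ c₁ c₂ c₃ q *
      ((cHat N k m l₁ l₂ c₁ c₂ c₃ q + 2 * cHat N k m l₁ l₂ c₁ c₂ c₃ (q + q)) * hatNormSq q /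
        sinh (halfArg q y) ^ 2) =
      4 * ∑ q ∈ hatPairs N k m l₁ l₂, cHat N k m l₁ l₂ c₁ c₂ c₃ q *
            (cHat N k m l₁ l₂ c₁ c₂ c₃ q + 2 * cHat N k m l₁ l₂ c₁ c₂ c₃ (q + q)) * hatNormSq q *
          (1 / (4 * sinh (halfArg q y) ^ 2)) := by
    rw [mul_sum]
    refine sum_congr rfl fun q hq => ?_
    have := g2 q hq
    field_simp
  rw [e7] at e4
  rw [e5, sum_congr rfl fun j _ => by
    rw [fderiv_fderiv_exp_mul g4 g3 (Pi.single j 1), e1, g5]]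
  have e8 : ∑ j, exp (G y) * (fderiv ℂ (fun z => fderiv ℂ h z (Pi.single j 1)) y
        (Pi.single j 1) + 2 * (A j / 2) * fderiv ℂ h y (Pi.single j 1) +
        (-∑ q ∈ hatPairs N k m l₁ l₂, cHat N k m l₁ l₂ c₁ c₂ c₃ q *
        (q.1 j ^ 2 / (4 * sinh (halfArg q y) ^ 2)) + (A j / 2) ^ 2) * h y) -
      ∑ j, A j * (exp (G y) * (fderiv ℂ h y (Pi.single j 1) + A j / 2 * h y)) =
      exp (G y) * (∑ j, fderiv ℂ (fun z => fderiv ℂ h z (Pi.single j 1)) y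
        (Pi.single j 1) - (∑ j, ∑ q ∈ hatPairs N k m l₁ l₂, cHat N k m l₁ l₂ c₁ c₂ c₃ q *
        (q.1 j ^ 2 / (4 * sinh (halfArg q y) ^ 2))) * h y - (∑ j, A j ^ 2) / 4 * h y) := by
    rw [← sum_sub_distrib, sum_div, sum_mul, sum_mul,
      ← sum_sub_distrib, ← sum_sub_distrib, mul_sum]
    exact sum_congr rfl fun j _ => by ring
  refine e8.trans ?_
  rw [e6, e4]
  congr 1
  simp only [add_mul, ← mul_assoc, sum_add_distrib, ← sum_mul]
  ring

end LogGauge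

end Gauge

section MulOp

variable {n : ℕ} {l : Filter (Fin n → ℂ)}

theorem mulOp_comm (φ ψ : (Fin n → ℂ) → ℂ) (F : AnGerm l) :
    mulOp l φ (mulOp l ψ F) = mulOp l ψ (mulOp l φ F) := by
  by_cases h1 : ∀ᶠ y in l, AnalyticAt ℂ φ y
  · by_cases h2 : ∀ᶠ y in l, AnalyticAt ℂ ψ y
    · rw [mulOp_eq h1, mulOp_eq h2]
      exact Subtype.ext (mul_left_comm _ _ _)
    · rw [mulOp, mulOp, dif_neg h2]
      simp
  · rw [mulOp, mulOp, dif_neg h1]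
    simp

theorem mulOp_exp_mulOp_exp {G G' : (Fin n → ℂ) → ℂ} (hG : ∀ᶠ y in l, AnalyticAt ℂ G y)
    (hG' : ∀ᶠ y in l, AnalyticAt ℂ G' y) (h : ∀ y, G y + G' y = 0) (F : AnGerm l) :
    mulOp l (fun y => exp (G y)) (mulOp l (fun y => exp (G' y)) F) = F := by
  have h1 : ∀ᶠ y in l, AnalyticAt ℂ (fun y => exp (G y)) y := hG.mono fun _ h => h.cexp
  have h2 : ∀ᶠ y in l, AnalyticAt ℂ (fun y => exp (G' y)) y := hG'.mono fun _ h => h.cexp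
  obtain ⟨f, hf, rfl⟩ := AnGerm.exists_mk F
  rw [mulOp_eq h1, mulOp_eq h2, mulAn_mk, mulAn_mk, AnGerm.mk_eq_mk]
  refine Eventually.of_forall fun y => ?_
  change exp (G y) * (exp (G' y) * f y) = f y
  rw [← mul_assoc, ← Complex.exp_add, h, Complex.exp_zero, one_mul]

theorem laplacian_mk {y₀ : Fin n → ℂ} {h : (Fin n → ℂ) → ℂ} (hh : ∀ᶠ y in 𝓝 y₀, AnalyticAt ℂ h y) :
    laplacian y₀ (AnGerm.mk h hh) =
      AnGerm.mk _ (analyticAt_sum_eventually univ _ fun j =>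
        ev_dirDeriv (Pi.single j 1) (ev_dirDeriv (Pi.single j 1) hh)) := by
  rw [← AnGerm.mk_sum _ _ fun j => ev_dirDeriv (Pi.single j 1) (ev_dirDeriv (Pi.single j 1) hh),
    laplacian, LinearMap.sum_apply]
  rfl

end MulOp

section GaugeConjugation

variable {d : ℕ} {y₀ : Fin d → ℂ} {U₀ : Type*} [AddCommGroup U₀] [Module ℂ U₀]
  {G : (Fin d → ℂ) → ℂ}

theorem lTensor_exp_mul_lTensor_exp {G' : (Fin d → ℂ) → ℂ} (hG : AnalyticAt ℂ G y₀)
    (hG' : AnalyticAt ℂ G' y₀) (h : ∀ y, G y + G' y = 0) :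
    (lTensor U₀ (mulOp (𝓝 y₀) fun y => exp (G y)) *
      lTensor U₀ (mulOp (𝓝 y₀) fun y => exp (G' y)) :
      Module.End ℂ (U₀ ⊗[ℂ] AnGerm (𝓝 y₀))) = 1 := by
  rw [← LinearMap.lTensor_mul]
  refine (congrArg (lTensor U₀) (LinearMap.ext fun F => ?_)).trans
    (LinearMap.lTensor_id U₀ _)
  exact mulOp_exp_mulOp_exp hG.eventually_analyticAt hG'.eventually_analyticAt h F

theorem commute_conj {A : Type*} [Ring A] {u v a b : A} (h : v * u = 1) (hab : Commute a b) :
    Commute (u * a * v) (u * b * v) := by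
  have h1 : ∀ a b : A, u * a * v * (u * b * v) = u * (a * b) * v := fun a b => by
    rw [show u * a * v * (u * b * v) = u * a * (v * u) * b * v by noncomm_ring, h]
    noncomm_ring
  rw [commute_iff_eq, h1, h1, hab.eq]

theorem commute_sub_smul_one {A : Type*} [Ring A] [Algebra ℂ A] {a b : A} (h : Commute a b) (c : ℂ) :
    Commute (a - c • 1) b :=
  h.sub_left ((Commute.one_left b).smul_left c)

theorem commute_gaugeConj (hG : AnalyticAt ℂ G y₀)
    {A B : Module.End ℂ (U₀ ⊗[ℂ] AnGerm (𝓝 y₀))} (h : Commute A B) :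
    Commute (gaugeConj G A) (gaugeConj G B) :=
  commute_conj (A := Module.End ℂ (U₀ ⊗[ℂ] AnGerm (𝓝 y₀)))
    (lTensor_exp_mul_lTensor_exp hG hG.neg fun _ => add_neg_cancel _) h

end GaugeConjugation

section LogBranch

variable {N k m l₁ l₂ : ℕ} {y₀ : Fin (dimPlane N k m l₁ l₂) → ℂ}
  {ℓ : (Fin (dimPlane N k m l₁ l₂) → ℂ) × ZMod 2 → (Fin (dimPlane N k m l₁ l₂) → ℂ) → ℂ}

theorem exists_isLogBranch
    (hs : ∀ q ∈ hatPairs N k m l₁ l₂, ∀ᶠ y in 𝓝 y₀, sinh (halfArg q y) ≠ 0) :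
    ∃ ℓ, IsLogBranch (N := N) (k := k) (m := m) (l₁ := l₁) (l₂ := l₂) y₀ ℓ := by
  refine ⟨fun q y => Complex.log (sinh (halfArg q y) / sinh (halfArg q y₀)) +
    Complex.log (sinh (halfArg q y₀)), fun q hq => ⟨?_, ?_⟩⟩
  · have h0 := (hs q hq).self_of_nhds
    refine AnalyticAt.add (AnalyticAt.clog (AnalyticAt.div ?_ analyticAt_const h0) ?_)
      analyticAt_const
    · exact AnalyticAt.comp (g := sinh) Complex.analyticAt_sinh (analyticAt_halfArg q y₀)
    · rw [div_self h0]
      exact Complex.one_mem_slitPlane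
  · have h0 := (hs q hq).self_of_nhds
    filter_upwards [hs q hq] with y hy
    rw [Complex.exp_add, Complex.exp_log (div_ne_zero hy h0), Complex.exp_log h0,
      div_mul_cancel₀ _ h0]

theorem sum_sq_cHat (c₁ c₂ c₃ : ℂ) :
    (∑ j, (∑ q ∈ hatPairs N k m l₁ l₂, cHat N k m l₁ l₂ c₁ c₂ c₃ q * q.1 j) ^ 2) / 4 =
      ∑ j : Fin (dimPlane N k m l₁ l₂),
        (∑ i, weylVec N c₁ c₂ c₃ i * basisVec N k m l₁ l₂ j i) ^ 2 := by
  rw [sum_div]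
  refine sum_congr rfl fun j _ => ?_
  have h1 : ∑ q ∈ hatPairs N k m l₁ l₂, cHat N k m l₁ l₂ c₁ c₂ c₃ q * q.1 j =
      2 * ∑ i, weylVec N c₁ c₂ c₃ i * basisVec N k m l₁ l₂ j i := by
    refine (sum_hatPairs c₁ c₂ c₃ (fun q => q.1 j) rfl).trans ?_
    simp only [hatPair, mul_sum, ← mul_assoc, two_mul_weylVec, sum_mul]
    exact sum_comm
  rw [h1]
  ring

theorem IsLogBranch.radialOp_gauge (hℓ : IsLogBranch y₀ ℓ) (hk : 1 ≤ k)
    (hN : m * k + l₁ + l₂ ≤ N) (c₁ c₂ c₃ : ℂ)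
    (hs : ∀ q ∈ hatPairs N k m l₁ l₂, ∀ᶠ y in 𝓝 y₀, sinh (halfArg q y) ≠ 0)
    (F : AnGerm (𝓝 y₀)) :
    radialOp N k m l₁ l₂ c₁ c₂ c₃ y₀
        (mulOp _ (fun y => exp (logGauge c₁ c₂ c₃ ℓ y)) F) =
      mulOp _ (fun y => exp (logGauge c₁ c₂ c₃ ℓ y)) (laplacian y₀ F -
        ∑ q ∈ hatPairs N k m l₁ l₂,
          (cHat N k m l₁ l₂ c₁ c₂ c₃ q *
            (cHat N k m l₁ l₂ c₁ c₂ c₃ q + 2 * cHat N k m l₁ l₂ c₁ c₂ c₃ (q + q)) * hatNormSq q +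
            hatNormSq q * cHat N k m l₁ l₂ c₁ c₂ c₃ q) •
          mulOp _ (fun y => 1 / (4 * sinh (halfArg q y) ^ 2)) F -
        ((∑ j, (∑ q ∈ hatPairs N k m l₁ l₂, cHat N k m l₁ l₂ c₁ c₂ c₃ q * q.1 j) ^ 2) / 4) • F) := by
  have hE : ∀ᶠ y in 𝓝 y₀, AnalyticAt ℂ (fun y => exp (logGauge c₁ c₂ c₃ ℓ y)) y :=
    (hℓ.analyticAt_logGauge c₁ c₂ c₃).eventually_analyticAt.mono fun _ h => h.cexp
  obtain ⟨h, hh, rfl⟩ := AnGerm.exists_mk F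
  have h1 : ∀ q : hatPairs N k m l₁ l₂, ∀ᶠ y in 𝓝 y₀, AnalyticAt ℂ _ y := fun q =>
    ev_const_mul (cHat N k m l₁ l₂ c₁ c₂ c₃ q.1) (ev_mul (ev_coth (hs q.1 q.2))
      (ev_dirDeriv q.1.1 (ev_mul hE hh)))
  have h2 : ∀ q : hatPairs N k m l₁ l₂, ∀ᶠ y in 𝓝 y₀, AnalyticAt ℂ _ y := fun q =>
    ev_const_mul (cHat N k m l₁ l₂ c₁ c₂ c₃ q.1 *
            (cHat N k m l₁ l₂ c₁ c₂ c₃ q.1 + 2 * cHat N k m l₁ l₂ c₁ c₂ c₃ (q.1 + q.1)) *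
            hatNormSq q.1 + hatNormSq q.1 * cHat N k m l₁ l₂ c₁ c₂ c₃ q.1)
      (ev_mul (ev_csch_sq (hs q.1 q.2)) hh)
  have e1 : ∑ q ∈ hatPairs N k m l₁ l₂, (cHat N k m l₁ l₂ c₁ c₂ c₃ q •
      (mulOp (𝓝 y₀) (fun y => cosh (halfArg q y) / sinh (halfArg q y)) *
      dirDeriv (openBased_nhds y₀) q.1)) (AnGerm.mk _ (ev_mul hE hh)) =
      AnGerm.mk _ (analyticAt_sum_eventually univ _ h1) := by
    rw [← AnGerm.mk_sum _ _ h1, ← sum_coe_sort]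
    refine sum_congr rfl fun q _ => ?_
    rw [mulOp_eq (ev_coth (hs q.1 q.2))]
    rfl
  have e2 : ∑ q ∈ hatPairs N k m l₁ l₂,
          (cHat N k m l₁ l₂ c₁ c₂ c₃ q *
            (cHat N k m l₁ l₂ c₁ c₂ c₃ q + 2 * cHat N k m l₁ l₂ c₁ c₂ c₃ (q + q)) * hatNormSq q +
            hatNormSq q * cHat N k m l₁ l₂ c₁ c₂ c₃ q) •
          mulOp (𝓝 y₀) (fun y => 1 / (4 * sinh (halfArg q y) ^ 2)) (AnGerm.mk h hh) =
      AnGerm.mk _ (analyticAt_sum_eventually univ _ h2) := by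
    rw [← AnGerm.mk_sum _ _ h2, ← sum_coe_sort]
    refine sum_congr rfl fun q _ => ?_
    rw [mulOp_eq (ev_csch_sq (hs q.1 q.2))]
    rfl
  rw [radialOp, LinearMap.sub_apply, LinearMap.sum_apply, mulOp_eq hE, mulAn_mk, laplacian_mk,
    laplacian_mk, e1, e2, AnGerm.mk_sub, AnGerm.mk_smul, AnGerm.mk_sub, AnGerm.mk_sub, mulAn_mk,
    AnGerm.mk_eq_mk]
  filter_upwards [hℓ.radial_identity hk hN c₁ c₂ c₃ ((Finset.eventually_all _).2 hs) hh] with y hy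
  have e3 := sum_coe_sort (hatPairs N k m l₁ l₂) fun q => cHat N k m l₁ l₂ c₁ c₂ c₃ q *
        (cosh (halfArg q y) / sinh (halfArg q y) *
          fderiv ℂ (fun z => exp (logGauge c₁ c₂ c₃ ℓ z) * h z) y q.1)
  have e4 := sum_coe_sort (hatPairs N k m l₁ l₂) fun q => (cHat N k m l₁ l₂ c₁ c₂ c₃ q *
            (cHat N k m l₁ l₂ c₁ c₂ c₃ q + 2 * cHat N k m l₁ l₂ c₁ c₂ c₃ (q + q)) * hatNormSq q +
            hatNormSq q * cHat N k m l₁ l₂ c₁ c₂ c₃ q) *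
          (1 / (4 * sinh (halfArg q y) ^ 2) * h y)
  rw [← e3, ← e4] at hy
  exact hy

end LogBranch

section GaugedSumOfSquares

variable {N k m l₁ l₂ : ℕ} {x₀ : Fin N → ℂ} {U : Type*} [AddCommGroup U] [Module ℂ U]
  (ρ : Representation ℂ (W N)ᵐᵒᵖ U)

theorem contr_opL (c₁ c₂ c₃ : ℂ) (y₀ : Fin (dimPlane N k m l₁ l₂) → ℂ) (φ : U →ₗ[ℂ] ℂ)
    (T : U ⊗[ℂ] AnGerm (𝓝 y₀)) :
    contr φ (opL c₁ c₂ c₃ ρ y₀ T) = laplacian y₀ (contr φ T) -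
      ∑ q ∈ hatPairs N k m l₁ l₂,
        ((cHat N k m l₁ l₂ c₁ c₂ c₃ q *
            (cHat N k m l₁ l₂ c₁ c₂ c₃ q + 2 * cHat N k m l₁ l₂ c₁ c₂ c₃ (q + q)) * hatNormSq q +
            hatNormSq q * cHat N k m l₁ l₂ c₁ c₂ c₃ q) •
          mulOp _ (fun y => 1 / (4 * sinh (halfArg q y) ^ 2)) (contr φ T) +
        mulOp _ (fun y => 1 / (4 * sinh (halfArg q y) ^ 2))
          (contr (φ ∘ₗ reflPart k m l₁ l₂ c₁ c₂ c₃ ρ q) T)) := by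
  rw [opL, LinearMap.sub_apply, LinearMap.sum_apply, map_sub, map_sum, contr_lTensor]
  congr 1
  refine sum_congr rfl fun q _ => ?_
  have h : φ ∘ₗ ((cHat N k m l₁ l₂ c₁ c₂ c₃ q *
      (cHat N k m l₁ l₂ c₁ c₂ c₃ q + 2 * cHat N k m l₁ l₂ c₁ c₂ c₃ (q + q)) *
      hatNormSq q) • 1 + cHatPHat k m l₁ l₂ c₁ c₂ c₃ ρ q) =
      (cHat N k m l₁ l₂ c₁ c₂ c₃ q *
            (cHat N k m l₁ l₂ c₁ c₂ c₃ q + 2 * cHat N k m l₁ l₂ c₁ c₂ c₃ (q + q)) * hatNormSq q +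
            hatNormSq q * cHat N k m l₁ l₂ c₁ c₂ c₃ q) • φ +
        φ ∘ₗ reflPart k m l₁ l₂ c₁ c₂ c₃ ρ q := by
    refine LinearMap.ext fun u => ?_
    simp only [reflPart, LinearMap.comp_apply, LinearMap.add_apply, LinearMap.sub_apply,
      LinearMap.smul_apply, Module.End.one_apply, map_add, map_sub, map_smul, smul_eq_mul]
    ring
  rw [contr_map, h, contr_add, contr_smul, map_add, map_smul]

/-- The gauge transformation of the restriction of the sum of the squares of the Dunkl operators. -/
theorem rTensor_gaugeConj_resOp_sum_sq (hy : chart N k m l₁ l₂ (proj N k m l₁ l₂ x₀) = x₀)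
    (c₁ c₂ c₃ : ℂ) (hx₀ : IsGeneric N k m l₁ l₂ x₀) (hk : 1 ≤ k) (hN : m * k + l₁ + l₂ ≤ N)
    (hc : ParamCond k l₁ l₂ c₁ c₂ c₃)
    {ℓ : (Fin (dimPlane N k m l₁ l₂) → ℂ) × ZMod 2 → (Fin (dimPlane N k m l₁ l₂) → ℂ) → ℂ}
    (hℓ : IsLogBranch (proj N k m l₁ l₂ x₀) ℓ)
    (g : fixedU k m l₁ l₂ ρ ⊗[ℂ] AnGerm (𝓝 (proj N k m l₁ l₂ x₀))) :
    rTensor _ (fixedU k m l₁ l₂ ρ).subtype (gaugeConj (logGauge c₁ c₂ c₃ ℓ)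
      (resOp hy c₁ c₂ c₃ ρ (∑ i, MvPolynomial.X i ^ 2)) g) =
    opL c₁ c₂ c₃ ρ _ (rTensor _ (fixedU k m l₁ l₂ ρ).subtype g) +
      gaugeConst N k m l₁ l₂ c₁ c₂ c₃ • rTensor _ (fixedU k m l₁ l₂ ρ).subtype g := by
  have hs : ∀ q ∈ hatPairs N k m l₁ l₂, ∀ᶠ y in 𝓝 (proj N k m l₁ l₂ x₀),
    sinh (halfArg q y) ≠ 0 := fun q hq => sinh_halfArg_ne_zero hk hN hx₀ hq
  have hG := hℓ.analyticAt_logGauge c₁ c₂ c₃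
  set G := logGauge c₁ c₂ c₃ ℓ with hGdef
  have hlr : ∀ (f : Module.End ℂ (AnGerm (𝓝 (proj N k m l₁ l₂ x₀)))) g',
      rTensor _ (fixedU k m l₁ l₂ ρ).subtype (lTensor _ f g') =
      lTensor U f (rTensor _ (fixedU k m l₁ l₂ ρ).subtype g') := fun f g' => by
    rw [← LinearMap.comp_apply, ← LinearMap.comp_apply, LinearMap.rTensor_comp_lTensor,
      LinearMap.lTensor_comp_rTensor]
  refine ext_contr fun φ => ?_
  rw [map_add, map_smul, contr_opL, gaugeConj, Module.End.mul_apply, Module.End.mul_apply, hlr,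
    contr_lTensor, contr_resOp_sum_sq ρ hy c₁ c₂ c₃ hx₀ hk hN hc φ _ (hlr _ g)]
  generalize rTensor _ (fixedU k m l₁ l₂ ρ).subtype g = T
  simp only [contr_lTensor]
  rw [hℓ.radialOp_gauge hk hN c₁ c₂ c₃ hs, map_add, map_sub, map_smul, map_sum]
  have e : ∀ F, mulOp (𝓝 (proj N k m l₁ l₂ x₀)) (fun y => exp (-G y))
      (mulOp _ (fun y => exp (G y)) F) = F :=
    mulOp_exp_mulOp_exp hG.neg.eventually_analyticAt hG.eventually_analyticAt
      fun _ => neg_add_cancel _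
  have e' : ∀ q F, mulOp (𝓝 (proj N k m l₁ l₂ x₀)) (fun y => exp (-G y))
      (mulOp _ (fun y => 1 / (4 * sinh (halfArg q y) ^ 2))
        (mulOp _ (fun y => exp (G y)) F)) =
      mulOp _ (fun y => 1 / (4 * sinh (halfArg q y) ^ 2)) F := fun q F => by
    rw [mulOp_comm, e]
  simp only [e, e']
  rw [← hGdef, e, sum_sq_cHat, gaugeConst, sum_add_distrib]
  module

end GaugedSumOfSquares

end BCN

end

theorem mainTheorem5 (N k m l₁ l₂ : ℕ) (hk : 1 ≤ k) (hm : 1 ≤ m) (hN : m * k + l₁ + l₂ ≤ N)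
    (c₁ c₂ c₃ : ℂ) (x₀ : Fin N → ℂ) (hx₀ : BCN.IsGeneric N k m l₁ l₂ x₀)
    {U : Type*} [AddCommGroup U] [Module ℂ U] [Nontrivial U]
    (ρ : Representation ℂ (BCN.W N)ᵐᵒᵖ U) :
    BCN.IsInvariant c₁ c₂ c₃ (BCN.CpU x₀ U) ∧
    (BCN.IsInvariant c₁ c₂ c₃ (BCN.IpU k m l₁ l₂ x₀ U) ↔ BCN.ParamCond k l₁ l₂ c₁ c₂ c₃) ∧
    (BCN.ParamCond k l₁ l₂ c₁ c₂ c₃ →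
      ∀ (y₀ : Fin (BCN.dimPlane N k m l₁ l₂) → ℂ) (hy : BCN.chart N k m l₁ l₂ y₀ = x₀),
      ∃ (H : MvPolynomial (Fin N) ℂ →
            Module.End ℂ (BCN.fixedU k m l₁ l₂ ρ ⊗[ℂ] BCN.AnGerm (𝓝 y₀)))
        (L₀ : Module.End ℂ (BCN.fixedU k m l₁ l₂ ρ ⊗[ℂ] BCN.AnGerm (𝓝 y₀))),
        BCN.IsRestriction hy c₁ c₂ c₃ ρ H ∧
        (∀ p q, BCN.IsInvPoly p → BCN.IsInvPoly q → Commute (H p) (H q)) ∧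
        (∀ g, LinearMap.rTensor (BCN.AnGerm (𝓝 y₀)) (BCN.fixedU k m l₁ l₂ ρ).subtype (L₀ g) =
          BCN.opL c₁ c₂ c₃ ρ y₀
            (LinearMap.rTensor (BCN.AnGerm (𝓝 y₀)) (BCN.fixedU k m l₁ l₂ ρ).subtype g)) ∧
        ∀ ℓ, BCN.IsLogBranch y₀ ℓ →
          BCN.gaugeConj (BCN.logGauge c₁ c₂ c₃ ℓ) (H (∑ i, MvPolynomial.X i ^ 2)) =
            L₀ + BCN.gaugeConst N k m l₁ l₂ c₁ c₂ c₃ • 1 ∧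
          ∀ p, BCN.IsInvPoly p →
            Commute L₀ (BCN.gaugeConj (BCN.logGauge c₁ c₂ c₃ ℓ) (H p))) := by
  refine ⟨BCN.isInvariant_CpU c₁ c₂ c₃,
    BCN.isInvariant_IpU_iff_paramCond c₁ c₂ c₃ hx₀ hk hm hN, fun hc y₀ hy => ?_⟩
  obtain rfl : y₀ = BCN.proj N k m l₁ l₂ x₀ := by rw [← hy, BCN.proj_chart hk hN]
  set H := BCN.resOp hy c₁ c₂ c₃ ρ with hH
  have hs : ∀ q ∈ BCN.hatPairs N k m l₁ l₂, ∀ᶠ y in 𝓝 (BCN.proj N k m l₁ l₂ x₀),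
    Complex.sinh (BCN.halfArg q y) ≠ 0 := fun q hq => BCN.sinh_halfArg_ne_zero hk hN hx₀ hq
  obtain ⟨ℓ₀, hℓ₀⟩ := BCN.exists_isLogBranch hs
  have key := fun ℓ (hℓ : BCN.IsLogBranch (BCN.proj N k m l₁ l₂ x₀) ℓ) g =>
    BCN.rTensor_gaugeConj_resOp_sum_sq ρ hy c₁ c₂ c₃ hx₀ hk hN hc hℓ g
  have hL : ∀ ℓ, BCN.IsLogBranch (BCN.proj N k m l₁ l₂ x₀) ℓ →
      BCN.gaugeConj (BCN.logGauge c₁ c₂ c₃ ℓ) (H (∑ i, MvPolynomial.X i ^ 2)) =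
      BCN.gaugeConj (BCN.logGauge c₁ c₂ c₃ ℓ₀) (H (∑ i, MvPolynomial.X i ^ 2)) := by
    refine fun ℓ hℓ => LinearMap.ext fun g => ?_
    exact (Function.LeftInverse.injective (BCN.rTensor_fixedProj ρ))
      ((key ℓ hℓ g).trans (key ℓ₀ hℓ₀ g).symm)
  refine ⟨H, BCN.gaugeConj (BCN.logGauge c₁ c₂ c₃ ℓ₀) (H (∑ i, MvPolynomial.X i ^ 2)) -
      BCN.gaugeConst N k m l₁ l₂ c₁ c₂ c₃ • 1,
    BCN.isRestriction_resOp ρ hy c₁ c₂ c₃ hx₀ hk hN hc,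
    fun p q hp hq => BCN.commute_resOp ρ hy c₁ c₂ c₃ hx₀ hk hN hc hp hq, fun g => ?_,
    fun ℓ hℓ => ⟨?_, fun p hp => ?_⟩⟩
  · rw [LinearMap.sub_apply, map_sub, key ℓ₀ hℓ₀ g, LinearMap.smul_apply, Module.End.one_apply,
      map_smul, add_sub_cancel_right]
  · rw [hL ℓ hℓ]
    abel
  · rw [← hL ℓ hℓ]
    exact BCN.commute_sub_smul_one (A := Module.End ℂ (BCN.fixedU k m l₁ l₂ ρ ⊗[ℂ]
        BCN.AnGerm (𝓝 (BCN.proj N k m l₁ l₂ x₀))))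
      (BCN.commute_gaugeConj (hℓ.analyticAt_logGauge c₁ c₂ c₃)
        (BCN.commute_resOp ρ hy c₁ c₂ c₃ hx₀ hk hN hc BCN.isInvPoly_sum_sq hp)) _
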